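/- **Setting.** Let $k$ be a field, $n\ge 0$, $I=\{1,\dots,n\}$, let $\alpha_1,\dots,\alpha_n$ be the standard basis of $\mathbb Z^n$, and let $\chi:\mathbb Z^n\times\mathbb Z^n\to k^\times$ be a bicharacter whose matrix $q_{ij}=\chi(\alpha_i,\alpha_j)$ is symmetric. For $\mu\in\mathbb N^n$ write $|\mu|=\sum_i\mu_i$. Let $T(V)=k\langle x_1,\dots,x_n\rangle$, graded by $\deg x_i=\alpha_i$, be the braided bialgebra with $\Delta(x_i)=x_i\otimes 1+1\otimes x_i$ as an algebra map into $T(V)\otimes T(V)$ with multiplication determined by $(1\otimes x_i)(x_j\otimes 1)=q_{ij}\,x_j\otimes x_i$. Let $\mathcal I_{\max}$ be the largest graded biideal of $T(V)$ contained in $\bigoplus_{m\ge 2}V^{\otimes m}$. Let $U=U(\chi)_{\max}$ be the Hopf algebra generated by $E_i,F_i$ $(i\in I)$ and $K_a$ $(a\in\mathbb Z^n)$ with relations $K_0=1$, $K_{a+b}=K_aK_b$, $K_aE_i=\chi(a,\alpha_i)E_iK_a$, $K_aF_i=\chi(a,\alpha_i)^{-1}F_iK_a$, $E_iF_j-F_jE_i=\delta_{ij}(K_i-K_i^{-1})$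 with $K_i=K_{\alpha_i}$, and $p(E_1,\dots,E_n)=0=p(F_1,\dots,F_n)$ for $p\in\mathcal I_{\max}$; its coproduct is $\Delta(E_i)=E_i\otimes 1+K_i\otimes E_i$, $\Delta(F_i)=F_i\otimes K_i^{-1}+1\otimes F_i$, $\Delta(K_a)=K_a\otimes K_a$, and its counit $\varepsilon$ satisfies $\varepsilon(E_i)=\varepsilon(F_i)=0$, $\varepsilon(K_a)=1$. Let $U^+,U^-,H$ be the subalgebras generated by the $E_i$, by the $F_i$, by the $K_a$, let $U^+_\mu$, $U^-_{-\mu}$ $(\mu\in\mathbb N^n)$ be the homogeneous components of $U^\pm$, and let $G^-$ be the subalgebra generated by the $F_iK_i$. Let $\tau$ be a permutation of $I$ with $\tau^2=\mathrm{id}$ and $q_{\tau(i)\tau(j)}=q_{ij}$ for all $i,j$; extend $\tau$ to $\mathbb Z^n$ by $\tau(\alpha_i)=\alpha_{\tau(i)}$, and let $\mathbb Z^n_\theta=\{\lambda\in\mathbb Z^n:-\tau(\lambda)=\lambda\}$. Let $\mathbf c=(c_1,\dots,c_n)\in k^n$, $B_i=F_i+c_iE_{\tau(i)}K_i^{-1}$,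 let $H_\theta$ be the subalgebra generated by all $K_iK_{\tau(i)}^{-1}$, let $B_{\mathbf c}$ be the subalgebra generated by $H_\theta$ and all $B_i$, let $H_\theta\ltimes U^-$ be the subalgebra generated by $H_\theta$ and $U^-$, and let $U^{\mathrm{poly}}$ be the subalgebra generated by all $F_i$, $E_iK_i^{-1}$, $K_i^{-1}$, $K_iK_{\tau(i)}^{-1}$. **Assumption on $\mathbf c$.** Let $P_\lambda$ and $\pi_{0,0}$ be the projections of $U$ onto $U^+K_\lambda G^-$ and onto $H=U^+_0HU^-_0$ with respect to the decompositions (1) below. Assume that $\mathcal I_{\max}$ is generated, as a two-sided ideal, by a family of homogeneous elements $p_j$, with $p_j$ of degree $\lambda_j\in\mathbb N^n$, such that $\pi_{0,0}\big(P_{-\lambda_j}(p_j(B_1,\dots,B_n))\big)=0$ for all $j$. **Claim.** First, the following objects are well defined. 1. $U=\bigoplus_{\lambda\in\mathbb Z^n}U^+K_\lambda G^-$ and $U=\bigoplus_{\mu,\nu\in\mathbb N^n}U^+_\mu HU^-_{-\nu}$. 2. There is exactly one bilinear form $\langle\,,\,\rangle:HU^-\times U^+H\to k$ with $\langle y,xx'\rangle=\langle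 y_{(1)},x'\rangle\langle y_{(2)},x\rangle$, $\langle yy',x\rangle=\langle y,x_{(1)}\rangle\langle y',x_{(2)}\rangle$, $\langle y,1\rangle=\varepsilon(y)$, $\langle 1,x\rangle=\varepsilon(x)$, $\langle F_i,E_j\rangle=\delta_{ij}$, $\langle K_i,K_j\rangle=q_{ij}^{-1}$, $\langle F_i,K_j\rangle=\langle K_i,E_j\rangle=0$. For each $\mu\in\mathbb N^n$ there are finite bases $(F_{\mu,r})_r$ of $U^-_{-\mu}$ and $(E_{\mu,r})_r$ of $U^+_\mu$ which are dual with respect to it. 3. There is an algebra homomorphism $\overline\sigma:U^-\to U$ with $\overline\sigma(F_i)=c_{\tau(i)}K_iE_{\tau(i)}$ for all $i$. 4. $U^{\mathrm{poly}}=(H_\theta\ltimes U^-)\oplus U^{\mathrm{poly}}\cdot\mathrm{span}_k\{E_iK_i^{-1},K_i^{-1}:i\in I\}$, and the projection $\psi$ onto the first summand restricts to a linear isomorphism $\psi:B_{\mathbf c}\to H_\theta\ltimes U^-$. For any choice of dual bases as in 2 write $F_\mu\otimes E_\mu=\sum_rF_{\mu,r}\otimes E_{\mu,r}$, and similarly for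 all expressions that are linear in $F_\mu$ and in $E_\mu$. Let $\Theta=\sum_\mu(-1)^{|\mu|}F_\mu\otimes E_\mu$, let the quasi $K$-matrix be the formal sum $$\Theta^\theta=\sum_{\mu\in\mathbb N^n}(-1)^{|\mu|}\psi^{-1}(F_\mu)\otimes E_\mu\in\prod_\mu B_{\mathbf c}\otimes U^+_\mu ,$$ and put $$\Theta^\theta_{12}=\Theta^\theta\otimes1,\qquad \Theta_{23}=1\otimes\Theta,\qquad \Theta^\theta_{1K3}=\sum_\mu(-1)^{|\mu|}\psi^{-1}(F_\mu)\otimes K_\mu\otimes E_\mu,\qquad \Theta^{\theta-}_{1K3}=\sum_\mu(-1)^{|\mu|}\psi^{-1}(F_\mu)\otimes K_\mu^{-1}\otimes E_\mu,$$ $$\Theta^{\overline\sigma}_{K23}=\sum_\mu(-1)^{|\mu|}K_{\mu-\tau(\mu)}\otimes\overline\sigma(F_\mu)\otimes E_\mu,\qquad \Theta^{\overline\sigma K}_{K32}=\sum_\mu(-1)^{|\mu|}K_{\mu-\tau(\mu)}\otimes E_\mu K_{\tau(\mu)}^{-1}\otimes K_\mu^{-1}\overline\sigma(F_\mu).$$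 Formal sums are multiplied degree by degree. Then $$(\mathrm{id}\otimes\Delta)(\Theta^\theta)=\Theta^\theta_{12}\cdot\Theta^{\overline\sigma}_{K23}\cdot\Theta^\theta_{1K3}\quad\text{in }\prod_{\mu,\nu}B_{\mathbf c}\otimes HU^+_\mu\otimes U^+_\nu,$$ $$(\Delta\otimes\mathrm{id})(\Theta^\theta)=\Theta_{23}\cdot\Theta^{\theta-}_{1K3}\cdot\Theta^{\overline\sigma K}_{K32}\quad\text{in }\prod_\mu B_{\mathbf c}\otimes U\otimes U^+_\mu .$$ Moreover, in the completion of $U\otimes U$ with respect to the degree of the second tensor factor ($\deg E_i=\alpha_i$, $\deg F_i=-\alpha_i$, $\deg K_a=0$), $$\Delta(B_i)\,\Theta^\theta=\Theta^\theta\Big(B_i\otimes K_i+c_{\tau(i)}q_{i\tau(i)}K_{\tau(i)}^{-1}K_i\otimes E_{\tau(i)}K_i+1\otimes F_i\Big)\quad\text{for all }i\in I,$$ $$\Delta(K_\lambda)\,\Theta^\theta=\Theta^\theta\,\Delta(K_\lambda)\quad\text{for all }\lambda\in\mathbb Z^n_\theta .$$ -/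

import Mathlib

set_option linter.unusedSectionVars false

open TensorProduct

noncomputable section

namespace SymPair

variable {k : Type*} [Field k] {ι : Type*} [Fintype ι] [DecidableEq ι]

/-! ### Lattice, bicharacter, noncommutative polynomials -/

/-- The standard basis vector `α_i` of `ℤ^ι`. -/
def α (i : ι) : ι → ℤ := Pi.single i 1

/-- The inclusion `ℕ^ι → ℤ^ι`. -/
def up (μ : ι → ℕ) : ι → ℤ := fun i => (μ i : ℤ)

/-- `|μ| = ∑ μ_i`. -/
def size (μ : ι → ℕ) : ℕ := ∑ i, μ i

/-- The action of an involution `τ` of the index set on `ℕ^ι` with `τ(α_i) = α_{τ(i)}`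
(recall that `τ = τ⁻¹`). -/
def tw (τ : Equiv.Perm ι) (μ : ι → ℕ) : ι → ℕ := fun i => μ (τ i)

/-- A bicharacter `χ : ℤ^ι × ℤ^ι → kˣ` with symmetric matrix `q_{ij} = χ(α_i, α_j)`. -/
structure SymBichar (k : Type*) [Field k] (ι : Type*) [DecidableEq ι] where
  toFun : (ι → ℤ) → (ι → ℤ) → kˣ
  map_add_left : ∀ a b c, toFun (a + b) c = toFun a c * toFun b c
  map_add_right : ∀ a b c, toFun a (b + c) = toFun a b * toFun a c
  symm : ∀ i j : ι, toFun (α i) (α j) = toFun (α j) (α i)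

/-- The value of the bicharacter as an element of the field. -/
def SymBichar.val (χ : SymBichar k ι) (a b : ι → ℤ) : k := (χ.toFun a b : kˣ)

/-- `q_{ij} = χ(α_i, α_j)`. -/
def SymBichar.q (χ : SymBichar k ι) (i j : ι) : k := χ.val (α i) (α j)

/-- The tensor algebra `T(V)` of the vector space with basis `ι`, i.e. noncommutative
polynomials in variables indexed by `ι`. -/
abbrev T (k : Type*) [Field k] (ι : Type*) := FreeAlgebra k ι

/-- The monomial of a word. -/
def word (k : Type*) [Field k] {ι : Type*} (l : List ι) : T k ι :=
  (l.map (FreeAlgebra.ι k)).prod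

/-- The homogeneous component of multidegree `μ ∈ ℕ^ι` of the tensor algebra. -/
def Twt (k : Type*) [Field k] {ι : Type*} [DecidableEq ι] (μ : ι → ℕ) : Submodule k (T k ι) :=
  Submodule.span k {p | ∃ l : List ι, (∀ i, l.count i = μ i) ∧ p = word k l}

/-- The sum of the homogeneous components of total degree at least two. -/
def Tge2 (k : Type*) [Field k] (ι : Type*) : Submodule k (T k ι) :=
  Submodule.span k {p | ∃ l : List ι, 2 ≤ l.length ∧ p = word k l}

/-! ### The Nichols ideal -/

/-- The action of `K_i` on the tensor algebra: `K_i · x_j = q_{ij} x_j`. -/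
def act (χ : SymBichar k ι) (i : ι) : T k ι →ₐ[k] T k ι :=
  FreeAlgebra.lift k fun j => χ.q i j • FreeAlgebra.ι k j

/-- Left multiplication by `x_i ⊗ 1 + 1 ⊗ x_i` in the braided tensor square of `T(V)`, where
`(1 ⊗ x_i)(u ⊗ v) = (K_i · u) ⊗ x_i v`. -/
def brLeft (χ : SymBichar k ι) (i : ι) : Module.End k (T k ι ⊗[k] T k ι) :=
  TensorProduct.map (LinearMap.mulLeft k (FreeAlgebra.ι k i)) LinearMap.id +
    TensorProduct.map (act χ i).toLinearMap (LinearMap.mulLeft k (FreeAlgebra.ι k i))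

/-- The braided coproduct of `T(V)`: the algebra homomorphism from `T(V)` to the braided tensor
square of `T(V)` with `x_i ↦ x_i ⊗ 1 + 1 ⊗ x_i`, obtained by letting `x_i` act on the
braided tensor square by left multiplication with `x_i ⊗ 1 + 1 ⊗ x_i` and evaluating
at `1 ⊗ 1`. -/
def brComul (χ : SymBichar k ι) (p : T k ι) : T k ι ⊗[k] T k ι :=
  (FreeAlgebra.lift k (brLeft χ) p : Module.End k (T k ι ⊗[k] T k ι)) (1 ⊗ₜ[k] 1)

/-- `J` is a `ℤ^ι`-graded biideal of the braided bialgebra `T(V)` which is contained in the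
part of degree at least two (the counit vanishes on `J` automatically). -/
structure IsGradedBiideal (χ : SymBichar k ι) (J : Submodule k (T k ι)) : Prop where
  mul_left : ∀ x, ∀ p ∈ J, x * p ∈ J
  mul_right : ∀ x, ∀ p ∈ J, p * x ∈ J
  graded : J ≤ ⨆ μ : ι → ℕ, J ⊓ Twt k μ
  coideal : ∀ p ∈ J, brComul χ p ∈
    LinearMap.range (TensorProduct.map J.subtype (LinearMap.id : T k ι →ₗ[k] T k ι)) ⊔
      LinearMap.range (TensorProduct.map (LinearMap.id : T k ι →ₗ[k] T k ι) J.subtype)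
  le_ge2 : J ≤ Tge2 k ι

/-- The maximal graded biideal `I_max` in degrees at least two: the sum of all of them. -/
def Imax (χ : SymBichar k ι) : Submodule k (T k ι) :=
  sSup {J | IsGradedBiideal χ J}

/-! ### The Drinfeld double `U(χ)_max` of the Nichols algebra -/

/-- Generators `E_i`, `F_i`, `K_a`, where `i ∈ ι` and `a ∈ ℤ^ι`. -/
inductive Gen (ι : Type*)
  | E (i : ι)
  | F (i : ι)
  | K (a : ι → ℤ)

/-- The generator `E_i` of the free algebra. -/
def gE (k : Type*) [Field k] {ι : Type*} (i : ι) : FreeAlgebra k (Gen ι) :=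
  FreeAlgebra.ι k (Gen.E i)

/-- The generator `F_i` of the free algebra. -/
def gF (k : Type*) [Field k] {ι : Type*} (i : ι) : FreeAlgebra k (Gen ι) :=
  FreeAlgebra.ι k (Gen.F i)

/-- The generator `K_a` of the free algebra. -/
def gK (k : Type*) [Field k] {ι : Type*} (a : ι → ℤ) : FreeAlgebra k (Gen ι) :=
  FreeAlgebra.ι k (Gen.K a)

/-- The defining relations: the `K_a` form the group algebra of `ℤ^ι`, the commutation relations
of the Drinfeld double of the tensor algebra, and `p(E) = 0 = p(F)` for `p ∈ I_max`. -/
inductive Rel (χ : SymBichar k ι) : FreeAlgebra k (Gen ι) → FreeAlgebra k (Gen ι) → Prop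
  | K_zero : Rel χ (gK k 0) 1
  | K_add (a b : ι → ℤ) : Rel χ (gK k (a + b)) (gK k a * gK k b)
  | K_E (a : ι → ℤ) (i : ι) : Rel χ (gK k a * gE k i) (χ.val a (α i) • (gE k i * gK k a))
  | K_F (a : ι → ℤ) (i : ι) : Rel χ (gK k a * gF k i) ((χ.val a (α i))⁻¹ • (gF k i * gK k a))
  | E_F (i j : ι) : Rel χ (gE k i * gF k j - gF k j * gE k i)
      (if i = j then gK k (α i) - gK k (-α i) else 0)
  | nichols_E (p : T k ι) (hp : p ∈ Imax χ) : Rel χ (FreeAlgebra.lift k (gE k) p) 0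
  | nichols_F (p : T k ι) (hp : p ∈ Imax χ) : Rel χ (FreeAlgebra.lift k (gF k) p) 0

/-- The Hopf algebra `U(χ)_max`. -/
def U (χ : SymBichar k ι) : Type _ := RingQuot (Rel χ)

instance (χ : SymBichar k ι) : Ring (U χ) := inferInstanceAs (Ring (RingQuot (Rel χ)))

instance (χ : SymBichar k ι) : Algebra k (U χ) := inferInstanceAs (Algebra k (RingQuot (Rel χ)))

/-- The quotient map onto `U(χ)_max`. -/
def mkU (χ : SymBichar k ι) : FreeAlgebra k (Gen ι) →ₐ[k] U χ := RingQuot.mkAlgHom k (Rel χ)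

/-- `E_i ∈ U(χ)_max`. -/
def E (χ : SymBichar k ι) (i : ι) : U χ := mkU χ (gE k i)

/-- `F_i ∈ U(χ)_max`. -/
def F (χ : SymBichar k ι) (i : ι) : U χ := mkU χ (gF k i)

/-- `K_a ∈ U(χ)_max`; here `K_i = K_{α_i}` and `K_i⁻¹ = K_{-α_i}`. -/
def K (χ : SymBichar k ι) (a : ι → ℤ) : U χ := mkU χ (gK k a)

/-- `p ↦ p(E)`. -/
def evE (χ : SymBichar k ι) : T k ι →ₐ[k] U χ := FreeAlgebra.lift k (E χ)

/-- `p ↦ p(F)`. -/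
def evF (χ : SymBichar k ι) : T k ι →ₐ[k] U χ := FreeAlgebra.lift k (F χ)

/-! #### Basic facts -/

theorem mkU_rel (χ : SymBichar k ι) {x y : FreeAlgebra k (Gen ι)} (h : Rel χ x y) :
    mkU χ x = mkU χ y := RingQuot.mkAlgHom_rel k h

theorem K_zero (χ : SymBichar k ι) : K χ 0 = 1 := by
  simpa [K] using mkU_rel χ (Rel.K_zero)

theorem K_add (χ : SymBichar k ι) (a b : ι → ℤ) : K χ (a + b) = K χ a * K χ b := by
  simpa [K] using mkU_rel χ (Rel.K_add a b)

theorem K_mul_E (χ : SymBichar k ι) (a : ι → ℤ) (i : ι) :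
    K χ a * E χ i = χ.val a (α i) • (E χ i * K χ a) := by
  simpa [K, E] using mkU_rel χ (Rel.K_E a i)

theorem K_mul_F (χ : SymBichar k ι) (a : ι → ℤ) (i : ι) :
    K χ a * F χ i = (χ.val a (α i))⁻¹ • (F χ i * K χ a) := by
  simpa [K, F] using mkU_rel χ (Rel.K_F a i)

theorem E_mul_F (χ : SymBichar k ι) (i j : ι) :
    E χ i * F χ j - F χ j * E χ i = if i = j then K χ (α i) - K χ (-α i) else 0 := by
  have h := mkU_rel χ (Rel.E_F i j)
  split_ifs with hij
  · simpa [K, E, F, hij] using h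
  · simpa [K, E, F, hij] using h

theorem K_comm (χ : SymBichar k ι) (a b : ι → ℤ) : K χ a * K χ b = K χ b * K χ a := by
  rw [← K_add, ← K_add, add_comm]

theorem mkU_lift_gE (χ : SymBichar k ι) (p : T k ι) :
    mkU χ (FreeAlgebra.lift k (gE k) p) = evE χ p := by
  have : (mkU χ).comp (FreeAlgebra.lift k (gE k)) = evE χ := by
    ext i; simp [evE, E]
  rw [← this]; rfl

theorem mkU_lift_gF (χ : SymBichar k ι) (p : T k ι) :
    mkU χ (FreeAlgebra.lift k (gF k) p) = evF χ p := by
  have : (mkU χ).comp (FreeAlgebra.lift k (gF k)) = evF χ := by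
    ext i; simp [evF, F]
  rw [← this]; rfl

theorem evE_Imax (χ : SymBichar k ι) {p : T k ι} (hp : p ∈ Imax χ) : evE χ p = 0 := by
  rw [← mkU_lift_gE, mkU_rel χ (Rel.nichols_E p hp), map_zero]

theorem evF_Imax (χ : SymBichar k ι) {p : T k ι} (hp : p ∈ Imax χ) : evF χ p = 0 := by
  rw [← mkU_lift_gF, mkU_rel χ (Rel.nichols_F p hp), map_zero]

theorem val_ne_zero (χ : SymBichar k ι) (a b : ι → ℤ) : χ.val a b ≠ 0 := Units.ne_zero _

theorem val_neg_left (χ : SymBichar k ι) (a b : ι → ℤ) : χ.val (-a) b = (χ.val a b)⁻¹ := by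
  have h0 : χ.val 0 b = 1 := by
    have h := χ.map_add_left 0 0 b
    rw [add_zero] at h
    have h1 : χ.toFun 0 b = 1 := by simpa using h
    simp [SymBichar.val, h1]
  have h := χ.map_add_left (-a) a b
  rw [neg_add_cancel] at h
  have h2 : χ.val (-a) b * χ.val a b = 1 := by
    rw [← h0]; simp [SymBichar.val, h]
  exact eq_inv_of_mul_eq_one_left h2

theorem q_symm (χ : SymBichar k ι) (i j : ι) : χ.q i j = χ.q j i := by
  simp [SymBichar.q, SymBichar.val, χ.symm i j]

/-- Elements `e_i`, `f_i`, `t_a` of an algebra which satisfy the relations of `U(χ)_max`. -/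
structure Rels (χ : SymBichar k ι) {A : Type*} [Ring A] [Algebra k A]
    (e f : ι → A) (t : (ι → ℤ) → A) : Prop where
  zero : t 0 = 1
  add : ∀ a b, t (a + b) = t a * t b
  tE : ∀ a i, t a * e i = χ.val a (α i) • (e i * t a)
  tF : ∀ a i, t a * f i = (χ.val a (α i))⁻¹ • (f i * t a)
  eF : ∀ i j, e i * f j - f j * e i = if i = j then t (α i) - t (-α i) else 0
  idE : ∀ p ∈ Imax χ, FreeAlgebra.lift k e p = 0
  idF : ∀ p ∈ Imax χ, FreeAlgebra.lift k f p = 0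

/-- The values on generators of the homomorphism `liftU`. -/
def genMap {A : Type*} (e f : ι → A) (t : (ι → ℤ) → A) : Gen ι → A
  | Gen.E i => e i
  | Gen.F i => f i
  | Gen.K a => t a

/-- The universal property of `U(χ)_max`: the algebra homomorphism with
`E_i ↦ e_i`, `F_i ↦ f_i`, `K_a ↦ t_a`. -/
def liftU (χ : SymBichar k ι) {A : Type*} [Ring A] [Algebra k A]
    {e f : ι → A} {t : (ι → ℤ) → A} (h : Rels χ e f t) : U χ →ₐ[k] A :=
  RingQuot.liftAlgHom k ⟨FreeAlgebra.lift k (genMap e f t), by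
    intro x y hxy
    induction hxy with
    | K_zero => simpa [gK, genMap] using h.zero
    | K_add a b => simpa [gK, genMap] using h.add a b
    | K_E a i => simpa [gK, gE, genMap] using h.tE a i
    | K_F a i => simpa [gK, gF, genMap] using h.tF a i
    | E_F i j =>
      have h := h.eF i j
      split_ifs at h ⊢ with hij
      · simpa [gK, gE, gF, genMap, hij] using h
      · simpa [gK, gE, gF, genMap, hij] using h
    | nichols_E p hp =>
      have := h.idE p hp
      rw [map_zero, ← this, ← AlgHom.comp_apply]
      congr 1
      ext i; simp [gE, genMap]
    | nichols_F p hp =>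
      have := h.idF p hp
      rw [map_zero, ← this, ← AlgHom.comp_apply]
      congr 1
      ext i; simp [gF, genMap]⟩

section liftU

variable (χ : SymBichar k ι) {A : Type*} [Ring A] [Algebra k A]
  {e f : ι → A} {t : (ι → ℤ) → A} (h : Rels χ e f t)

theorem liftU_mkU (x : FreeAlgebra k (Gen ι)) :
    liftU χ h (mkU χ x) = FreeAlgebra.lift k (genMap e f t) x := by
  simp only [liftU, mkU]
  exact RingQuot.liftAlgHom_mkAlgHom_apply ..

theorem liftU_E (i : ι) : liftU χ h (E χ i) = e i := by
  rw [E, liftU_mkU]; simp [gE, genMap]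

theorem liftU_F (i : ι) : liftU χ h (F χ i) = f i := by
  rw [F, liftU_mkU]; simp [gF, genMap]

theorem liftU_K (a : ι → ℤ) : liftU χ h (K χ a) = t a := by
  rw [K, liftU_mkU]; simp [gK, genMap]

end liftU

/-- Induction on generators of `U(χ)_max`. -/
theorem U_induction (χ : SymBichar k ι) {P : U χ → Prop}
    (hs : ∀ c : k, P (algebraMap k (U χ) c)) (hE : ∀ i, P (E χ i)) (hF : ∀ i, P (F χ i))
    (hK : ∀ a, P (K χ a)) (hm : ∀ x y, P x → P y → P (x * y))
    (ha : ∀ x y, P x → P y → P (x + y)) (x : U χ) : P x := by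
  obtain ⟨y, rfl⟩ : ∃ y, mkU χ y = x := RingQuot.mkAlgHom_surjective k (Rel χ) x
  induction y using FreeAlgebra.induction with
  | grade0 c => simpa using hs c
  | grade1 g =>
    cases g with
    | E i => exact hE i
    | F i => exact hF i
    | K a => exact hK a
  | mul a b iha ihb => simpa using hm _ _ iha ihb
  | add a b iha ihb => simpa using ha _ _ iha ihb

/-! #### Two facts on graded biideals -/

/-- If `f(x_i) = u_i g(x_i)` with `u_i` commuting with everything in sight, then `f` kills a
graded ideal which is killed by `g`. -/
theorem graded_kill {A : Type*} [Ring A] [Algebra k A] (f g : T k ι →ₐ[k] A) (u : ι → A)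
    (hfg : ∀ i, f (FreeAlgebra.ι k i) = u i * g (FreeAlgebra.ι k i))
    (huu : ∀ i j, u i * u j = u j * u i)
    (hug : ∀ i j, g (FreeAlgebra.ι k i) * u j = u j * g (FreeAlgebra.ι k i))
    (J : Submodule k (T k ι)) (hJ : J ≤ ⨆ μ : ι → ℕ, J ⊓ Twt k μ)
    (hg : ∀ p ∈ J, g p = 0) : ∀ p ∈ J, f p = 0 := by
  have hw : ∀ l : List ι, f (word k l) = (l.map u).prod * g (word k l) := by
    intro l
    have hc : ∀ i (l : List ι), g (FreeAlgebra.ι k i) * (l.map u).prod =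
        (l.map u).prod * g (FreeAlgebra.ι k i) := by
      intro i l
      induction l with
      | nil => simp
      | cons j l ih =>
        rw [List.map_cons, List.prod_cons, ← mul_assoc, hug, mul_assoc, ih, mul_assoc]
    induction l with
    | nil => simp [word]
    | cons i l ih =>
      have e : word k (i :: l) = FreeAlgebra.ι k i * word k l := by simp [word]
      rw [e, map_mul, map_mul, hfg, ih, List.map_cons, List.prod_cons]
      rw [mul_assoc, ← mul_assoc (g _), hc]
      simp only [mul_assoc]
  have key : J ≤ LinearMap.ker f.toLinearMap := by
    refine hJ.trans (iSup_le fun μ => ?_)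
    rintro p ⟨hpJ, hpμ⟩
    have hU : ∃ c : A, ∀ l : List ι, (∀ i, l.count i = μ i) → (l.map u).prod = c := by
      by_cases h : ∃ l₀ : List ι, ∀ i, l₀.count i = μ i
      · obtain ⟨l₀, hl₀⟩ := h
        refine ⟨(l₀.map u).prod, fun l hl => ?_⟩
        have hp : l.Perm l₀ := List.perm_iff_count.2 fun i => by rw [hl, hl₀]
        refine List.Perm.prod_eq' (hp.map u) ?_
        rw [List.pairwise_map]
        exact List.pairwise_of_forall fun i j => huu i j
      · exact ⟨0, fun l hl => (h ⟨l, hl⟩).elim⟩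
    obtain ⟨c, hc⟩ := hU
    have hfp : f p = c * g p := by
      refine Submodule.span_induction (p := fun p _ => f p = c * g p) ?_ ?_ ?_ ?_ hpμ
      · rintro _ ⟨l, hl, rfl⟩
        rw [hw, hc l hl]
      · simp
      · intro x y _ _ hx hy
        rw [map_add, map_add, hx, hy, mul_add]
      · intro a x _ hx
        rw [map_smul, map_smul, hx, mul_smul_comm]
    rw [LinearMap.mem_ker]
    simp [hfp, hg p hpJ]
  intro p hp
  exact key hp

/-- The coproduct of the bosonization kills a biideal. -/
theorem comul_kill (χ : SymBichar k ι) {A : Type*} [Ring A] [Algebra k A]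
    (c e κ : T k ι →ₐ[k] A)
    (hc : ∀ i, c (FreeAlgebra.ι k i) = e (FreeAlgebra.ι k i) + κ (FreeAlgebra.ι k i))
    (hκe : ∀ i j, κ (FreeAlgebra.ι k i) * e (FreeAlgebra.ι k j) =
      χ.q i j • (e (FreeAlgebra.ι k j) * κ (FreeAlgebra.ι k i)))
    (J : Submodule k (T k ι)) (hJ : IsGradedBiideal χ J)
    (he : ∀ p ∈ J, e p = 0) (hκ : ∀ p ∈ J, κ p = 0) : ∀ p ∈ J, c p = 0 := by
  have hact : ∀ i u, κ (FreeAlgebra.ι k i) * e u = e (act χ i u) * κ (FreeAlgebra.ι k i) := by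
    intro i u
    induction u using FreeAlgebra.induction with
    | grade0 r =>
      simp only [AlgHom.commutes]
      exact (Algebra.commutes r _).symm
    | grade1 j => simp [act, hκe]
    | mul a b ha hb =>
      rw [map_mul, map_mul, map_mul, ← mul_assoc, ha, mul_assoc, hb, mul_assoc]
    | add a b ha hb => rw [map_add, map_add, map_add, mul_add, add_mul, ha, hb]
  set j : T k ι ⊗[k] T k ι →ₗ[k] A :=
    LinearMap.mul' k A ∘ₗ TensorProduct.map e.toLinearMap κ.toLinearMap with hj
  have hL : ∀ i z, j (brLeft χ i z) = c (FreeAlgebra.ι k i) * j z := by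
    intro i z
    induction z with
    | zero => simp
    | tmul u v =>
      simp only [hj, brLeft, LinearMap.add_apply, TensorProduct.map_tmul, map_add,
        LinearMap.comp_apply, LinearMap.mulLeft_apply, LinearMap.id_apply,
        LinearMap.mul'_apply, AlgHom.toLinearMap_apply, map_mul, hc, add_mul]
      rw [← mul_assoc (κ _), hact]
      simp only [mul_assoc]
    | add x y hx hy => rw [map_add, map_add, hx, hy, map_add, mul_add]
  have hmul : ∀ p z, j ((FreeAlgebra.lift k (brLeft χ) p : Module.End k _) z) = c p * j z := by
    intro p
    induction p using FreeAlgebra.induction with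
    | grade0 r =>
      intro z
      simp [Algebra.smul_def]
    | grade1 i =>
      intro z
      simp [hL]
    | mul a b ha hb =>
      intro z
      rw [map_mul, Module.End.mul_apply, ha, hb, map_mul, mul_assoc]
    | add a b ha hb =>
      intro z
      rw [map_add, LinearMap.add_apply, map_add, ha, hb, map_add, add_mul]
  intro p hp
  have h1 : c p = j (brComul χ p) := by
    rw [brComul, hmul]; simp [hj]
  rw [h1]
  have hker : LinearMap.range (TensorProduct.map J.subtype (LinearMap.id : T k ι →ₗ[k] T k ι)) ⊔
      LinearMap.range (TensorProduct.map (LinearMap.id : T k ι →ₗ[k] T k ι) J.subtype) ≤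
      LinearMap.ker j := by
    refine sup_le ?_ ?_
    · rintro _ ⟨z, rfl⟩
      rw [LinearMap.mem_ker]
      induction z with
      | zero => simp
      | tmul u v => simp [hj, he _ u.2]
      | add x y hx hy => rw [map_add, map_add, hx, hy, add_zero]
    · rintro _ ⟨z, rfl⟩
      rw [LinearMap.mem_ker]
      induction z with
      | zero => simp
      | tmul u v => simp [hj, hκ _ v.2]
      | add x y hx hy => rw [map_add, map_add, hx, hy, add_zero]
  exact hker (hJ.coideal p hp)

/-- To kill `I_max` it suffices to kill every graded biideal. -/
theorem Imax_kill (χ : SymBichar k ι) {A : Type*} [Ring A] [Algebra k A] (f : T k ι →ₐ[k] A)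
    (h : ∀ J, IsGradedBiideal χ J → ∀ p ∈ J, f p = 0) : ∀ p ∈ Imax χ, f p = 0 := by
  have : Imax χ ≤ LinearMap.ker f.toLinearMap := sSup_le fun J hJ p hp => h J hJ p hp
  exact fun p hp => this hp

theorem le_Imax (χ : SymBichar k ι) {J : Submodule k (T k ι)} (hJ : IsGradedBiideal χ J) :
    J ≤ Imax χ := le_sSup hJ

/-! #### Coproduct and counit -/

theorem comul_rels (χ : SymBichar k ι) : Rels (A := U χ ⊗[k] U χ) χ
    (fun i => E χ i ⊗ₜ[k] 1 + K χ (α i) ⊗ₜ[k] E χ i)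
    (fun i => F χ i ⊗ₜ[k] K χ (-α i) + 1 ⊗ₜ[k] F χ i)
    (fun a => K χ a ⊗ₜ[k] K χ a) := by
  refine ⟨?_, ?_, ?_, ?_, ?_, ?_, ?_⟩
  · simp only [K_zero]; rfl
  · intro a b; simp [K_add]
  · intro a i
    simp only [mul_add, add_mul, Algebra.TensorProduct.tmul_mul_tmul, mul_one, one_mul,
      K_mul_E, smul_add, K_comm χ a (α i), TensorProduct.smul_tmul', TensorProduct.tmul_smul]
  · intro a i
    simp only [mul_add, add_mul, Algebra.TensorProduct.tmul_mul_tmul, mul_one, one_mul,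
      K_mul_F, smul_add, K_comm χ a (-α i), TensorProduct.smul_tmul', TensorProduct.tmul_smul]
  · intro i j
    have h1 : K χ (α i) * F χ j = (χ.q i j)⁻¹ • (F χ j * K χ (α i)) := K_mul_F χ _ _
    have h2 : K χ (-α j) * E χ i = (χ.q i j)⁻¹ • (E χ i * K χ (-α j)) := by
      rw [K_mul_E, val_neg_left, q_symm]; rfl
    have h3 := E_mul_F χ i j
    simp only [mul_add, add_mul, Algebra.TensorProduct.tmul_mul_tmul, mul_one, one_mul, h1, h2,
      TensorProduct.smul_tmul', TensorProduct.tmul_smul]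
    have h4 : (E χ i * F χ j) ⊗ₜ[k] K χ (-α j) - (F χ j * E χ i) ⊗ₜ[k] K χ (-α j) +
        (K χ (α i) ⊗ₜ[k] (E χ i * F χ j) - K χ (α i) ⊗ₜ[k] (F χ j * E χ i)) =
        if i = j then K χ (α i) ⊗ₜ[k] K χ (α i) - K χ (-α i) ⊗ₜ[k] K χ (-α i) else 0 := by
      rw [← TensorProduct.sub_tmul, ← TensorProduct.tmul_sub, h3]
      split_ifs with hij
      · subst hij
        rw [TensorProduct.sub_tmul, TensorProduct.tmul_sub]
        abel
      · simp
    rw [← h4]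
    abel
  · refine Imax_kill χ _ fun J hJ => ?_
    have hE : ∀ p ∈ J, evE χ p = 0 := fun p hp => evE_Imax χ (le_Imax χ hJ hp)
    refine comul_kill χ _
      ((Algebra.TensorProduct.includeLeft : U χ →ₐ[k] U χ ⊗[k] U χ).comp (evE χ))
      (FreeAlgebra.lift k fun i => K χ (α i) ⊗ₜ[k] E χ i) ?_ ?_ J hJ ?_ ?_
    · intro i; simp [evE]
    · intro i j
      simp [evE, K_mul_E, SymBichar.q, TensorProduct.smul_tmul']
    · intro p hp; simp [hE p hp]
    · refine graded_kill _
        ((Algebra.TensorProduct.includeRight : U χ →ₐ[k] U χ ⊗[k] U χ).comp (evE χ))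
        (fun i => K χ (α i) ⊗ₜ[k] 1) ?_ ?_ ?_ J hJ.graded ?_
      · intro i; simp [evE]
      · intro i j; simp [K_comm χ (α i)]
      · intro i j; simp [evE]
      · intro p hp; simp [hE p hp]
  · refine Imax_kill χ _ fun J hJ => ?_
    have hF : ∀ p ∈ J, evF χ p = 0 := fun p hp => evF_Imax χ (le_Imax χ hJ hp)
    refine comul_kill χ _
      ((Algebra.TensorProduct.includeRight : U χ →ₐ[k] U χ ⊗[k] U χ).comp (evF χ))
      (FreeAlgebra.lift k fun i => F χ i ⊗ₜ[k] K χ (-α i)) ?_ ?_ J hJ ?_ ?_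
    · intro i; simp [evF, add_comm]
    · intro i j
      simp [evF, K_mul_F, SymBichar.q, val_neg_left]
    · intro p hp; simp [hF p hp]
    · refine graded_kill _
        ((Algebra.TensorProduct.includeLeft : U χ →ₐ[k] U χ ⊗[k] U χ).comp (evF χ))
        (fun i => 1 ⊗ₜ[k] K χ (-α i)) ?_ ?_ ?_ J hJ.graded ?_
      · intro i; simp [evF]
      · intro i j; simp [K_comm χ (-α i)]
      · intro i j; simp [evF]
      · intro p hp; simp [hF p hp]

/-- The coproduct of `U(χ)_max`: `Δ(E_i) = E_i ⊗ 1 + K_i ⊗ E_i`,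
`Δ(F_i) = F_i ⊗ K_i⁻¹ + 1 ⊗ F_i`, `Δ(K_a) = K_a ⊗ K_a`. -/
def comul (χ : SymBichar k ι) : U χ →ₐ[k] U χ ⊗[k] U χ := liftU χ (comul_rels χ)

theorem comul_E (χ : SymBichar k ι) (i : ι) :
    comul χ (E χ i) = E χ i ⊗ₜ[k] 1 + K χ (α i) ⊗ₜ[k] E χ i := liftU_E _ _ _

theorem comul_F (χ : SymBichar k ι) (i : ι) :
    comul χ (F χ i) = F χ i ⊗ₜ[k] K χ (-α i) + 1 ⊗ₜ[k] F χ i := liftU_F _ _ _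

theorem comul_K (χ : SymBichar k ι) (a : ι → ℤ) :
    comul χ (K χ a) = K χ a ⊗ₜ[k] K χ a := liftU_K _ _ _

/-- An algebra map which sends all variables to zero kills `I_max`. -/
theorem Imax_kill_zero (χ : SymBichar k ι) {A : Type*} [Ring A] [Algebra k A] :
    ∀ p ∈ Imax χ, FreeAlgebra.lift k (fun _ : ι => (0 : A)) p = 0 := by
  refine Imax_kill χ _ fun J hJ p hp => ?_
  have : Tge2 k ι ≤ LinearMap.ker (FreeAlgebra.lift k (fun _ : ι => (0 : A))).toLinearMap := by
    refine Submodule.span_le.2 ?_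
    rintro _ ⟨l, hl, rfl⟩
    cases l with
    | nil => simp at hl
    | cons i l => simp [word]
  exact this (hJ.le_ge2 hp)

/-- The counit of `U(χ)_max`: `ε(E_i) = ε(F_i) = 0`, `ε(K_a) = 1`. -/
def counit (χ : SymBichar k ι) : U χ →ₐ[k] k :=
  liftU χ (e := fun _ => 0) (f := fun _ => 0) (t := fun _ => 1)
    ⟨rfl, by simp, by simp, by simp, by simp, Imax_kill_zero χ, Imax_kill_zero χ⟩

/-! ### Subalgebras and homogeneous components -/

/-- `U⁺`. -/
def Uplus (χ : SymBichar k ι) : Subalgebra k (U χ) := Algebra.adjoin k (Set.range (E χ))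

/-- `U⁻`. -/
def Uminus (χ : SymBichar k ι) : Subalgebra k (U χ) := Algebra.adjoin k (Set.range (F χ))

/-- `H`, the span of the `K_a`. -/
def H (χ : SymBichar k ι) : Subalgebra k (U χ) := Algebra.adjoin k (Set.range (K χ))

/-- `G⁻`, generated by the `F_i K_i`. -/
def Gminus (χ : SymBichar k ι) : Subalgebra k (U χ) :=
  Algebra.adjoin k (Set.range fun i => F χ i * K χ (α i))

/-- The homogeneous component `U⁺_μ`. -/
def UplusWt (χ : SymBichar k ι) (μ : ι → ℕ) : Submodule k (U χ) :=
  (Twt k μ).map (evE χ).toLinearMap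

/-- The homogeneous component `U⁻_{-μ}`. -/
def UminusWt (χ : SymBichar k ι) (μ : ι → ℕ) : Submodule k (U χ) :=
  (Twt k μ).map (evF χ).toLinearMap

/-- `U⁺ ⋊ H`. -/
def borelPlus (χ : SymBichar k ι) : Subalgebra k (U χ) :=
  Algebra.adjoin k (Set.range (E χ) ∪ Set.range (K χ))

/-- `H ⋉ U⁻ = (U⁻ ⋊ H)^cop`. -/
def borelMinus (χ : SymBichar k ι) : Subalgebra k (U χ) :=
  Algebra.adjoin k (Set.range (F χ) ∪ Set.range (K χ))

/-- The partial bosonization `H_θ ⋉ U⁻`, where `H_θ` is generated by the `K_i K_{τ(i)}⁻¹`. -/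
def partialBos (χ : SymBichar k ι) (τ : Equiv.Perm ι) : Subalgebra k (U χ) :=
  Algebra.adjoin k (Set.range (fun i => K χ (α i - α (τ i))) ∪ Set.range (F χ))

/-- `B_i = F_i + c_i E_{τ(i)} K_i⁻¹`. -/
def Bgen (χ : SymBichar k ι) (τ : Equiv.Perm ι) (c : ι → k) (i : ι) : U χ :=
  F χ i + c i • (E χ (τ i) * K χ (-α i))

/-- The coideal subalgebra `B_c`, generated by `H_θ` and the `B_i`. -/
def Bc (χ : SymBichar k ι) (τ : Equiv.Perm ι) (c : ι → k) : Subalgebra k (U χ) :=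
  Algebra.adjoin k (Set.range (fun i => K χ (α i - α (τ i))) ∪ Set.range (Bgen χ τ c))

/-- `U(χ)^poly`, generated by `F_i`, `E_i K_i⁻¹`, `K_i⁻¹`, `K_i K_{τ(i)}⁻¹`. -/
def Upoly (χ : SymBichar k ι) (τ : Equiv.Perm ι) : Subalgebra k (U χ) :=
  Algebra.adjoin k (Set.range (F χ) ∪ Set.range (fun i => E χ i * K χ (-α i)) ∪
    Set.range (fun i => K χ (-α i)) ∪ Set.range (fun i => K χ (α i - α (τ i))))

theorem evF_mem_Uminus (χ : SymBichar k ι) (p : T k ι) : evF χ p ∈ Uminus χ := by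
  induction p using FreeAlgebra.induction with
  | grade0 r => simp
  | grade1 i =>
    have h : F χ i ∈ Uminus χ := Algebra.subset_adjoin (Set.mem_range_self i)
    simpa [evF] using h
  | mul a b ha hb => simpa using mul_mem ha hb
  | add a b ha hb => simpa using add_mem ha hb

theorem evE_mem_Uplus (χ : SymBichar k ι) (p : T k ι) : evE χ p ∈ Uplus χ := by
  induction p using FreeAlgebra.induction with
  | grade0 r => simp
  | grade1 i =>
    have h : E χ i ∈ Uplus χ := Algebra.subset_adjoin (Set.mem_range_self i)
    simpa [evE] using h
  | mul a b ha hb => simpa using mul_mem ha hb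
  | add a b ha hb => simpa using add_mem ha hb

theorem UminusWt_le (χ : SymBichar k ι) {μ : ι → ℕ} {x : U χ} (hx : x ∈ UminusWt χ μ) :
    x ∈ Uminus χ := by
  obtain ⟨p, -, rfl⟩ := hx
  exact evF_mem_Uminus χ p

theorem UplusWt_le (χ : SymBichar k ι) {μ : ι → ℕ} {x : U χ} (hx : x ∈ UplusWt χ μ) :
    x ∈ Uplus χ := by
  obtain ⟨p, -, rfl⟩ := hx
  exact evE_mem_Uplus χ p

theorem Uminus_le_borelMinus (χ : SymBichar k ι) : Uminus χ ≤ borelMinus χ :=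
  Algebra.adjoin_mono Set.subset_union_left

theorem Uplus_le_borelPlus (χ : SymBichar k ι) : Uplus χ ≤ borelPlus χ :=
  Algebra.adjoin_mono Set.subset_union_left

theorem Uminus_le_partialBos (χ : SymBichar k ι) (τ : Equiv.Perm ι) :
    Uminus χ ≤ partialBos χ τ :=
  Algebra.adjoin_mono Set.subset_union_right

theorem partialBos_le_Upoly (χ : SymBichar k ι) (τ : Equiv.Perm ι) :
    partialBos χ τ ≤ Upoly χ τ := by
  refine Algebra.adjoin_mono ?_
  rintro x (hx | hx)
  · exact Or.inr hx
  · exact Or.inl (Or.inl (Or.inl hx))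

theorem Bc_le_Upoly (χ : SymBichar k ι) (τ : Equiv.Perm ι) (hτ : ∀ i, τ (τ i) = i) (c : ι → k) :
    Bc χ τ c ≤ Upoly χ τ := by
  refine Algebra.adjoin_le ?_
  rintro _ (⟨i, rfl⟩ | ⟨i, rfl⟩)
  · exact Algebra.subset_adjoin (Or.inr ⟨i, rfl⟩)
  · refine add_mem (Algebra.subset_adjoin (Or.inl (Or.inl (Or.inl ⟨i, rfl⟩)))) ?_
    refine Subalgebra.smul_mem _ ?_ _
    have h : E χ (τ i) * K χ (-α i) =
        (E χ (τ i) * K χ (-α (τ i))) * K χ (α (τ i) - α (τ (τ i))) := by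
      rw [mul_assoc, ← K_add, hτ]
      congr 2
      abel
    rw [h]
    exact mul_mem (Algebra.subset_adjoin (Or.inl (Or.inl (Or.inr ⟨τ i, rfl⟩))))
      (Algebra.subset_adjoin (Or.inr ⟨τ i, rfl⟩))

/-! ### The condition on the parameters -/

open Classical in
/-- The projection onto the `i`-th summand of a direct sum decomposition `V = ⨁ M_j`
(zero if the family `M` is not a direct sum decomposition). -/
def componentProj {V κ : Type*} [AddCommGroup V] [Module k V] (M : κ → Submodule k V) (i : κ) :
    V →ₗ[k] V :=
  if h : DirectSum.IsInternal M then
    (M i).subtype ∘ₗ DirectSum.component k κ (fun j => M j) i ∘ₗ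
      (LinearEquiv.ofBijective (DirectSum.coeLinearMap M) h).symm.toLinearMap
  else 0

/-- The subspace `U⁺ K_a G⁻`. -/
def UKG (χ : SymBichar k ι) (a : ι → ℤ) : Submodule k (U χ) :=
  (Uplus χ).toSubmodule * Submodule.span k {K χ a} * (Gminus χ).toSubmodule

/-- The subspace `U⁺_μ H U⁻_{-ν}`. -/
def UHU (χ : SymBichar k ι) (m : (ι → ℕ) × (ι → ℕ)) : Submodule k (U χ) :=
  UplusWt χ m.1 * (H χ).toSubmodule * UminusWt χ m.2

/-- The projection `P_a : U(χ) → U⁺ K_a G⁻` along `U(χ) = ⨁_b U⁺ K_b G⁻`. -/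
def projP (χ : SymBichar k ι) (a : ι → ℤ) : U χ →ₗ[k] U χ := componentProj (UKG χ) a

/-- The projection `π_{μ,ν} : U(χ) → U⁺_μ H U⁻_{-ν}` along
`U(χ) = ⨁_{μ,ν} U⁺_μ H U⁻_{-ν}`. -/
def projPi (χ : SymBichar k ι) (m : (ι → ℕ) × (ι → ℕ)) : U χ →ₗ[k] U χ :=
  componentProj (UHU χ) m

/-- The condition on the parameters: the ideal `I_max` is generated by homogeneous
noncommutative polynomials `p` (with degree `l ∈ ℕ^ι`) such that
`π_{0,0}(P_{-l}(p(B))) = 0`. -/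
def ParamCondition (χ : SymBichar k ι) (τ : Equiv.Perm ι) (c : ι → k) : Prop :=
  ∃ S : Set (T k ι),
    (∀ p ∈ S, ∃ l : ι → ℕ, p ∈ Twt k l ∧
      projPi χ (0, 0) (projP χ (-up l) (FreeAlgebra.lift k (Bgen χ τ c) p)) = 0) ∧
    ∀ x : T k ι, x ∈ TwoSidedIdeal.span S ↔ x ∈ Imax χ

/-! ### The skew Hopf pairing and dual bases -/

theorem comul_mem_of_adjoin (χ : SymBichar k ι) (S : Set (U χ))
    (h : ∀ s ∈ S, comul χ s ∈ (Algebra.TensorProduct.map (Algebra.adjoin k S).val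
      (Algebra.adjoin k S).val).range) (x : U χ) (hx : x ∈ Algebra.adjoin k S) :
    comul χ x ∈ (Algebra.TensorProduct.map (Algebra.adjoin k S).val
      (Algebra.adjoin k S).val).range := by
  have : Algebra.adjoin k S ≤ (Algebra.TensorProduct.map (Algebra.adjoin k S).val
      (Algebra.adjoin k S).val).range.comap (comul χ) := Algebra.adjoin_le h
  exact this hx

theorem map_val_injective (χ : SymBichar k ι) (A : Subalgebra k (U χ)) :
    Function.Injective (Algebra.TensorProduct.map A.val A.val) :=
  TensorProduct.map_injective_of_flat_flat A.val.toLinearMap A.val.toLinearMap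
    Subtype.val_injective Subtype.val_injective

/-- The restriction of the coproduct to a subalgebra `A` with `Δ(A) ⊆ A ⊗ A`. -/
def comulRestrict (χ : SymBichar k ι) (A : Subalgebra k (U χ))
    (h : ∀ x ∈ A, comul χ x ∈ (Algebra.TensorProduct.map A.val A.val).range) :
    A →ₐ[k] A ⊗[k] A :=
  (AlgEquiv.ofInjective (Algebra.TensorProduct.map A.val A.val)
      (map_val_injective χ A)).symm.toAlgHom.comp
    (((comul χ).comp A.val).codRestrict _ fun x => h x x.2)

theorem map_comulRestrict (χ : SymBichar k ι) (A : Subalgebra k (U χ))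
    (h : ∀ x ∈ A, comul χ x ∈ (Algebra.TensorProduct.map A.val A.val).range) (x : A) :
    Algebra.TensorProduct.map A.val A.val (comulRestrict χ A h x) = comul χ x := by
  have := congrArg Subtype.val ((AlgEquiv.ofInjective (Algebra.TensorProduct.map A.val A.val)
    (map_val_injective χ A)).apply_symm_apply
      ((((comul χ).comp A.val).codRestrict _ fun x => h x x.2) x))
  exact this

theorem borelMinus_comul (χ : SymBichar k ι) : ∀ x ∈ borelMinus χ, comul χ x ∈
    (Algebra.TensorProduct.map (borelMinus χ).val (borelMinus χ).val).range := by
  refine comul_mem_of_adjoin χ _ ?_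
  have hF : ∀ i, F χ i ∈ borelMinus χ := fun i => Algebra.subset_adjoin (Or.inl ⟨i, rfl⟩)
  have hK : ∀ a, K χ a ∈ borelMinus χ := fun a => Algebra.subset_adjoin (Or.inr ⟨a, rfl⟩)
  rintro _ (⟨i, rfl⟩ | ⟨a, rfl⟩)
  · refine ⟨(⟨_, hF i⟩ : borelMinus χ) ⊗ₜ[k] (⟨_, hK (-α i)⟩ : borelMinus χ) +
      1 ⊗ₜ[k] (⟨_, hF i⟩ : borelMinus χ), ?_⟩
    rw [comul_F]
    exact (map_add (Algebra.TensorProduct.map (borelMinus χ).val (borelMinus χ).val) _ _)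
  · refine ⟨(⟨_, hK a⟩ : borelMinus χ) ⊗ₜ[k] (⟨_, hK a⟩ : borelMinus χ), ?_⟩
    rw [comul_K]
    rfl

theorem borelPlus_comul (χ : SymBichar k ι) : ∀ x ∈ borelPlus χ, comul χ x ∈
    (Algebra.TensorProduct.map (borelPlus χ).val (borelPlus χ).val).range := by
  refine comul_mem_of_adjoin χ _ ?_
  have hE : ∀ i, E χ i ∈ borelPlus χ := fun i => Algebra.subset_adjoin (Or.inl ⟨i, rfl⟩)
  have hK : ∀ a, K χ a ∈ borelPlus χ := fun a => Algebra.subset_adjoin (Or.inr ⟨a, rfl⟩)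
  rintro _ (⟨i, rfl⟩ | ⟨a, rfl⟩)
  · refine ⟨(⟨_, hE i⟩ : borelPlus χ) ⊗ₜ[k] 1 +
      (⟨_, hK (α i)⟩ : borelPlus χ) ⊗ₜ[k] (⟨_, hE i⟩ : borelPlus χ), ?_⟩
    rw [comul_E]
    exact (map_add (Algebra.TensorProduct.map (borelPlus χ).val (borelPlus χ).val) _ _)
  · refine ⟨(⟨_, hK a⟩ : borelPlus χ) ⊗ₜ[k] (⟨_, hK a⟩ : borelPlus χ), ?_⟩
    rw [comul_K]
    rfl

/-- The coproduct of `(U⁻ ⋊ H)^cop`. -/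
def comulMinus (χ : SymBichar k ι) : borelMinus χ →ₐ[k] borelMinus χ ⊗[k] borelMinus χ :=
  comulRestrict χ _ (borelMinus_comul χ)

/-- The coproduct of `U⁺ ⋊ H`. -/
def comulPlus (χ : SymBichar k ι) : borelPlus χ →ₐ[k] borelPlus χ ⊗[k] borelPlus χ :=
  comulRestrict χ _ (borelPlus_comul χ)

/-- `F_i` as an element of `H ⋉ U⁻`. -/
def Fm (χ : SymBichar k ι) (i : ι) : borelMinus χ :=
  ⟨F χ i, Algebra.subset_adjoin (Or.inl ⟨i, rfl⟩)⟩

/-- `K_a` as an element of `H ⋉ U⁻`. -/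
def Km (χ : SymBichar k ι) (a : ι → ℤ) : borelMinus χ :=
  ⟨K χ a, Algebra.subset_adjoin (Or.inr ⟨a, rfl⟩)⟩

/-- `E_i` as an element of `U⁺ ⋊ H`. -/
def Ep (χ : SymBichar k ι) (i : ι) : borelPlus χ :=
  ⟨E χ i, Algebra.subset_adjoin (Or.inl ⟨i, rfl⟩)⟩

/-- `K_a` as an element of `U⁺ ⋊ H`. -/
def Kp (χ : SymBichar k ι) (a : ι → ℤ) : borelPlus χ :=
  ⟨K χ a, Algebra.subset_adjoin (Or.inr ⟨a, rfl⟩)⟩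

/-- Bilinear forms `(U⁻ ⋊ H)^cop × (U⁺ ⋊ H) → k`. -/
abbrev BorelForm (χ : SymBichar k ι) := borelMinus χ →ₗ[k] borelPlus χ →ₗ[k] k

/-- The skew Hopf pairing `⟨ , ⟩_max`:
`⟨y, x x'⟩ = ⟨y₍₁₎, x'⟩ ⟨y₍₂₎, x⟩`, `⟨y y', x⟩ = ⟨y, x₍₁₎⟩ ⟨y', x₍₂₎⟩`,
`⟨y, 1⟩ = ε(y)`, `⟨1, x⟩ = ε(x)`, with the prescribed values on generators. -/
structure IsSkewHopfPairing (χ : SymBichar k ι) (p : BorelForm χ) : Prop where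
  mul_right : ∀ y x x', p y (x * x') =
    LinearMap.mul' k k (TensorProduct.map (p.flip x') (p.flip x) (comulMinus χ y))
  mul_left : ∀ y y' x, p (y * y') x =
    LinearMap.mul' k k (TensorProduct.map (p y) (p y') (comulPlus χ x))
  one_right : ∀ y : borelMinus χ, p y 1 = counit χ (y : U χ)
  one_left : ∀ x : borelPlus χ, p 1 x = counit χ (x : U χ)
  F_E : ∀ i j, p (Fm χ i) (Ep χ j) = if i = j then 1 else 0
  K_K : ∀ i j, p (Km χ (α i)) (Kp χ (α j)) = (χ.q i j)⁻¹
  F_K : ∀ i j, p (Fm χ i) (Kp χ (α j)) = 0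
  K_E : ∀ i j, p (Km χ (α i)) (Ep χ j) = 0

/-- The restriction of a form to `U⁻_{-μ} × U⁺_μ`. -/
def wtPairing (χ : SymBichar k ι) (p : BorelForm χ) (μ : ι → ℕ)
    (f : UminusWt χ μ) (e : UplusWt χ μ) : k :=
  p ⟨f, Uminus_le_borelMinus χ (UminusWt_le χ f.2)⟩ ⟨e, Uplus_le_borelPlus χ (UplusWt_le χ e.2)⟩

/-- A pair of bases of `U⁻_{-μ}` and of `U⁺_μ` which are dual with respect to the form `p`. -/
structure DualBases (χ : SymBichar k ι) (p : BorelForm χ) (μ : ι → ℕ) where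
  n : ℕ
  Fb : Module.Basis (Fin n) k (UminusWt χ μ)
  Eb : Module.Basis (Fin n) k (UplusWt χ μ)
  dual : ∀ i j, wtPairing χ p μ (Fb i) (Eb j) = if i = j then 1 else 0

/-! ### The projection `ψ` -/

/-- `H_θ ⋉ U⁻` as a subspace of `U(χ)^poly`. -/
def psiRange (χ : SymBichar k ι) (τ : Equiv.Perm ι) : Submodule k (Upoly χ τ) :=
  (partialBos χ τ).toSubmodule.comap (Upoly χ τ).val.toLinearMap

/-- The subspace `U(χ)^poly · span {E_i K_i⁻¹, K_i⁻¹}` of `U(χ)^poly`. -/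
def psiKer (χ : SymBichar k ι) (τ : Equiv.Perm ι) : Submodule k (Upoly χ τ) :=
  (Ideal.span {x : Upoly χ τ | ∃ i, (x : U χ) = E χ i * K χ (-α i) ∨
    (x : U χ) = K χ (-α i)}).restrictScalars k

/-- The restriction to `B_c` of the projection `ψ : U(χ)^poly → H_θ ⋉ U⁻` along
`U(χ)^poly · span {E_i K_i⁻¹, K_i⁻¹}`. -/
def psiB (χ : SymBichar k ι) (τ : Equiv.Perm ι) (hτ : ∀ i, τ (τ i) = i) (c : ι → k)
    (h : IsCompl (psiRange χ τ) (psiKer χ τ)) : Bc χ τ c →ₗ[k] psiRange χ τ :=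
  Submodule.projectionOnto (psiRange χ τ) (psiKer χ τ) h ∘ₗ
    (Subalgebra.inclusion (Bc_le_Upoly χ τ hτ c)).toLinearMap

/-- The inverse `ψ⁻¹ : H_θ ⋉ U⁻ → B_c`, restricted to `U⁻_{-μ}` and viewed in `U(χ)`. -/
def psiInv (χ : SymBichar k ι) (τ : Equiv.Perm ι) (hτ : ∀ i, τ (τ i) = i) (c : ι → k)
    (h : IsCompl (psiRange χ τ) (psiKer χ τ)) (hb : Function.Bijective (psiB χ τ hτ c h))
    (μ : ι → ℕ) (f : UminusWt χ μ) : U χ :=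
  ((LinearEquiv.ofBijective (psiB χ τ hτ c h) hb).symm
    ⟨⟨(f : U χ), partialBos_le_Upoly χ τ (Uminus_le_partialBos χ τ (UminusWt_le χ f.2))⟩,
      Uminus_le_partialBos χ τ (UminusWt_le χ f.2)⟩ : Bc χ τ c)

/-! ### Completions -/

theorem isPWO_up (s : Set (ι → ℤ)) (hs : s ⊆ Set.range (up (ι := ι))) : s.IsPWO := by
  have h1 : (Set.univ : Set (ι → ℕ)).IsPWO := by
    have := Set.IsPWO.pi (s := fun _ : ι => (Set.univ : Set ℕ))
      (fun _ => Set.isPWO_univ_iff.2 inferInstance)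
    simpa [Set.pi_univ] using this
  have h2 : Monotone (up (ι := ι)) := fun a b hab i => by
    simpa [up] using hab i
  have h3 := h1.image_of_monotone h2
  rw [Set.image_univ] at h3
  exact h3.mono hs

/-- The formal infinite sum `∑_ρ X_ρ` over `ρ ∈ ℕ^ι` of elements of an algebra `A`, where `X_ρ`
is homogeneous of degree `d(ρ)`, recorded as the Hahn series `∑_ρ X_ρ t^{d(ρ)}`. All
degree maps `d` used below have finite fibres, so that each coefficient is a finite sum. The
product of Hahn series is the multiplication of formal infinite sums, degree by degree. -/
def formalSum {A : Type*} [Ring A] (d : (ι → ℕ) → (ι → ℕ)) (X : (ι → ℕ) → A) :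
    HahnSeries (ι → ℤ) A where
  coeff ν := ∑ᶠ (ρ : ι → ℕ) (_ : up (d ρ) = ν), X ρ
  isPWO_support' := isPWO_up _ fun ν hν => by
    by_contra hcon
    refine hν ?_
    have : ∀ ρ : ι → ℕ, (∑ᶠ (_ : up (d ρ) = ν), X ρ) = 0 := fun ρ => by
      have hf : ¬ (up (d ρ) = ν) := fun h => hcon ⟨d ρ, h⟩
      simp [hf]
    simp [this]

theorem single_smul' {A : Type*} [Ring A] [Algebra k A] (a : ι → ℤ) (r : k) (x : A) :
    (HahnSeries.single a) (r • x) = r • (HahnSeries.single a) x := by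
  ext ν
  by_cases h : ν = a
  · subst h; simp
  · simp [HahnSeries.coeff_single_of_ne h]

theorem rightSeries_rels (χ : SymBichar k ι) :
    Rels (A := HahnSeries (ι → ℤ) (U χ ⊗[k] U χ)) χ
      (fun i => HahnSeries.single (α i) (1 ⊗ₜ[k] E χ i))
      (fun i => HahnSeries.single (-α i) (1 ⊗ₜ[k] F χ i))
      (fun a => HahnSeries.single 0 (1 ⊗ₜ[k] K χ a)) := by
  refine ⟨?_, ?_, ?_, ?_, ?_, ?_, ?_⟩
  · rw [K_zero]; rfl
  · intro a b; simp [K_add, HahnSeries.single_mul_single]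
  · intro a i
    simp [K_mul_E, HahnSeries.single_mul_single]
    exact single_smul' _ _ _
  · intro a i
    simp [K_mul_F, HahnSeries.single_mul_single]
    exact single_smul' _ _ _
  · intro i j
    have h := E_mul_F χ i j
    rw [HahnSeries.single_mul_single, HahnSeries.single_mul_single, neg_add_eq_sub,
      ← sub_eq_add_neg, ← HahnSeries.single_sub]
    simp only [Algebra.TensorProduct.tmul_mul_tmul, mul_one, ← TensorProduct.tmul_sub, h]
    split_ifs with hij
    · subst hij
      simp [TensorProduct.tmul_sub]
    · simp
  · refine Imax_kill χ _ fun J hJ => ?_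
    refine graded_kill _ ((FreeAlgebra.lift k fun i =>
      (HahnSeries.single 0 (1 ⊗ₜ[k] E χ i) : HahnSeries (ι → ℤ) (U χ ⊗[k] U χ))))
      (fun i => HahnSeries.single (α i) 1) ?_ ?_ ?_ J hJ.graded ?_
    · intro i; simp [HahnSeries.single_mul_single]
    · intro i j; simp [HahnSeries.single_mul_single, add_comm]
    · intro i j; simp [HahnSeries.single_mul_single]
    · intro p hp
      have hz : ∀ p : T k ι, (FreeAlgebra.lift k fun i =>
          (HahnSeries.single 0 (1 ⊗ₜ[k] E χ i) : HahnSeries (ι → ℤ) (U χ ⊗[k] U χ))) p =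
          HahnSeries.single 0 (1 ⊗ₜ[k] evE χ p) := by
        intro p
        induction p using FreeAlgebra.induction with
        | grade0 r =>
          simp only [AlgHom.commutes, HahnSeries.algebraMap_apply, HahnSeries.C_apply]
          rw [← Algebra.TensorProduct.includeRight_apply, AlgHom.commutes]
        | grade1 i => simp [evE]
        | mul a b ha hb => simp [ha, hb, HahnSeries.single_mul_single]
        | add a b ha hb => simp [ha, hb, TensorProduct.tmul_add]
      rw [hz, evE_Imax χ (le_Imax χ hJ hp)]
      simp
  · refine Imax_kill χ _ fun J hJ => ?_
    refine graded_kill _ ((FreeAlgebra.lift k fun i =>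
      (HahnSeries.single 0 (1 ⊗ₜ[k] F χ i) : HahnSeries (ι → ℤ) (U χ ⊗[k] U χ))))
      (fun i => HahnSeries.single (-α i) 1) ?_ ?_ ?_ J hJ.graded ?_
    · intro i; simp [HahnSeries.single_mul_single]
    · intro i j; simp [HahnSeries.single_mul_single, add_comm]
    · intro i j; simp [HahnSeries.single_mul_single]
    · intro p hp
      have hz : ∀ p : T k ι, (FreeAlgebra.lift k fun i =>
          (HahnSeries.single 0 (1 ⊗ₜ[k] F χ i) : HahnSeries (ι → ℤ) (U χ ⊗[k] U χ))) p =
          HahnSeries.single 0 (1 ⊗ₜ[k] evF χ p) := by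
        intro p
        induction p using FreeAlgebra.induction with
        | grade0 r =>
          simp only [AlgHom.commutes, HahnSeries.algebraMap_apply, HahnSeries.C_apply]
          rw [← Algebra.TensorProduct.includeRight_apply, AlgHom.commutes]
        | grade1 i => simp [evF]
        | mul a b ha hb => simp [ha, hb, HahnSeries.single_mul_single]
        | add a b ha hb => simp [ha, hb, TensorProduct.tmul_add]
      rw [hz, evF_Imax χ (le_Imax χ hJ hp)]
      simp

/-- The `ℤ^ι`-grading of the second tensor leg, `deg E_i = α_i`, `deg F_i = -α_i`, `deg K_a = 0`:
the algebra homomorphism sending `y ∈ U(χ)` homogeneous of degree `ν` to `(1 ⊗ y) t^ν`. -/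
def rightSeries (χ : SymBichar k ι) : U χ →ₐ[k] HahnSeries (ι → ℤ) (U χ ⊗[k] U χ) := liftU χ (rightSeries_rels χ)

theorem rightSeries_E (χ : SymBichar k ι) (i : ι) :
    rightSeries χ (E χ i) = HahnSeries.single (α i) (1 ⊗ₜ[k] E χ i) := liftU_E _ _ _

theorem rightSeries_F (χ : SymBichar k ι) (i : ι) :
    rightSeries χ (F χ i) = HahnSeries.single (-α i) (1 ⊗ₜ[k] F χ i) := liftU_F _ _ _

theorem rightSeries_K (χ : SymBichar k ι) (a : ι → ℤ) :
    rightSeries χ (K χ a) = HahnSeries.single 0 (1 ⊗ₜ[k] K χ a) := liftU_K _ _ _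

/-- The algebra homomorphism `x ↦ (x ⊗ 1) t^0`. -/
def leftSeries (χ : SymBichar k ι) : U χ →ₐ[k] HahnSeries (ι → ℤ) (U χ ⊗[k] U χ) where
  toRingHom := (HahnSeries.C : (U χ ⊗[k] U χ) →+* HahnSeries (ι → ℤ) (U χ ⊗[k] U χ)).comp
    (Algebra.TensorProduct.includeLeft : U χ →ₐ[k] U χ ⊗[k] U χ).toRingHom
  commutes' r := by
    simp [HahnSeries.algebraMap_apply]

/-- The embedding of `U(χ) ⊗ U(χ)` into its completion: `x ⊗ y` with `y` homogeneous of degree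
`ν` is sent to `(x ⊗ y) t^ν`. -/
def toCompletion (χ : SymBichar k ι) :
    U χ ⊗[k] U χ →ₐ[k] HahnSeries (ι → ℤ) (U χ ⊗[k] U χ) :=
  Algebra.TensorProduct.lift (leftSeries χ) (rightSeries χ) fun x y => by
    have hl : leftSeries χ x = HahnSeries.single 0 (x ⊗ₜ[k] 1) := rfl
    refine U_induction χ (P := fun y => Commute (leftSeries χ x) (rightSeries χ y))
      ?_ ?_ ?_ ?_ ?_ ?_ y
    · intro c
      rw [AlgHom.commutes]
      exact (Algebra.commutes c _).symm
    · intro i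
      simp [Commute, SemiconjBy, hl, rightSeries_E, HahnSeries.single_mul_single]
    · intro i
      simp [Commute, SemiconjBy, hl, rightSeries_F, HahnSeries.single_mul_single]
    · intro a
      simp [Commute, SemiconjBy, hl, rightSeries_K, HahnSeries.single_mul_single]
    · intro y z hy hz
      rw [map_mul]
      exact hy.mul_right hz
    · intro y z hy hz
      rw [map_add]
      exact hy.add_right hz

/-! ### The quasi `R`-matrix, the quasi `K`-matrix and their legs

Below, `D` is a choice of dual bases `F_{μ,j}`, `E_{μ,j}`, the map `psi` stands for
`ψ⁻¹` on `U⁻_{-μ}`, and `s` for the algebra homomorphism `σ̄`. -/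

section Theta

variable (χ : SymBichar k ι) (τ : Equiv.Perm ι) {p : BorelForm χ} (D : ∀ μ, DualBases χ p μ)
  (psi : ∀ μ, UminusWt χ μ → U χ) (s : Uminus χ →ₐ[k] U χ)

/-- `σ̄` on `U⁻_{-μ}`. -/
def sigWt (μ : ι → ℕ) (f : UminusWt χ μ) : U χ := s ⟨f, UminusWt_le χ f.2⟩

/-- `(-1)^{|μ|}`. -/
def sgn (k : Type*) [Field k] (μ : ι → ℕ) : k := (-1) ^ size μ

/-- The component `Θ^θ_μ = (-1)^{|μ|} ∑_j ψ⁻¹(F_{μ,j}) ⊗ E_{μ,j}` of the quasi `K`-matrix. -/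
def thetaK (μ : ι → ℕ) : U χ ⊗[k] U χ :=
  sgn k μ • ∑ j, psi μ ((D μ).Fb j) ⊗ₜ[k] ((D μ).Eb j : U χ)

/-- The quasi `K`-matrix `Θ^θ = ∑_μ Θ^θ_μ`, graded by the degree of the second leg. -/
def ThetaK : HahnSeries (ι → ℤ) (U χ ⊗[k] U χ) := formalSum id (thetaK χ D psi)

/-- `(id ⊗ Δ)(Θ^θ)`, graded by the total degree of the second and third leg. -/
def idComulThetaK : HahnSeries (ι → ℤ) (U χ ⊗[k] (U χ ⊗[k] U χ)) :=
  formalSum id fun μ =>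
    Algebra.TensorProduct.map (AlgHom.id k (U χ)) (comul χ) (thetaK χ D psi μ)

/-- `(Δ ⊗ id)(Θ^θ)`, graded by the degree of the third leg. -/
def comulIdThetaK : HahnSeries (ι → ℤ) (U χ ⊗[k] (U χ ⊗[k] U χ)) :=
  formalSum id fun μ => Algebra.TensorProduct.assoc k k k (U χ) (U χ) (U χ)
    (Algebra.TensorProduct.map (comul χ) (AlgHom.id k (U χ)) (thetaK χ D psi μ))

/-- `Θ^θ_{12} = ∑_μ (-1)^{|μ|} ψ⁻¹(F_μ) ⊗ E_μ ⊗ 1`. -/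
def ThetaK12 : HahnSeries (ι → ℤ) (U χ ⊗[k] (U χ ⊗[k] U χ)) :=
  formalSum id fun μ =>
    sgn k μ • ∑ j, psi μ ((D μ).Fb j) ⊗ₜ[k] (((D μ).Eb j : U χ) ⊗ₜ[k] (1 : U χ))

/-- `Θ_{23} = ∑_μ (-1)^{|μ|} 1 ⊗ F_μ ⊗ E_μ`. -/
def Theta23 : HahnSeries (ι → ℤ) (U χ ⊗[k] (U χ ⊗[k] U χ)) :=
  formalSum id fun μ =>
    sgn k μ • ∑ j, (1 : U χ) ⊗ₜ[k] (((D μ).Fb j : U χ) ⊗ₜ[k] ((D μ).Eb j : U χ))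

/-- `Θ^θ_{1K3} = ∑_μ (-1)^{|μ|} ψ⁻¹(F_μ) ⊗ K_μ ⊗ E_μ`. -/
def ThetaK1K3 : HahnSeries (ι → ℤ) (U χ ⊗[k] (U χ ⊗[k] U χ)) :=
  formalSum id fun μ =>
    sgn k μ • ∑ j, psi μ ((D μ).Fb j) ⊗ₜ[k] (K χ (up μ) ⊗ₜ[k] ((D μ).Eb j : U χ))

/-- `Θ^{θ-}_{1K3} = ∑_μ (-1)^{|μ|} ψ⁻¹(F_μ) ⊗ K_μ⁻¹ ⊗ E_μ`. -/
def ThetaKm1K3 : HahnSeries (ι → ℤ) (U χ ⊗[k] (U χ ⊗[k] U χ)) :=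
  formalSum id fun μ =>
    sgn k μ • ∑ j, psi μ ((D μ).Fb j) ⊗ₜ[k] (K χ (-up μ) ⊗ₜ[k] ((D μ).Eb j : U χ))

/-- `Θ^{σ̄}_{K23} = ∑_μ (-1)^{|μ|} K_{μ-τ(μ)} ⊗ σ̄(F_μ) ⊗ E_μ`; the summand of `μ` has degree
`τ(μ)` in the second and degree `μ` in the third leg, hence total degree `τ(μ) + μ`. -/
def ThetaSigmaK23 : HahnSeries (ι → ℤ) (U χ ⊗[k] (U χ ⊗[k] U χ)) :=
  formalSum (fun μ => tw τ μ + μ) fun μ =>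
    sgn k μ • ∑ j, K χ (up μ - up (tw τ μ)) ⊗ₜ[k]
      (sigWt χ s μ ((D μ).Fb j) ⊗ₜ[k] ((D μ).Eb j : U χ))

/-- `Θ^{σ̄K}_{K32} = ∑_μ (-1)^{|μ|} K_{μ-τ(μ)} ⊗ E_μ K_{τ(μ)}⁻¹ ⊗ K_μ⁻¹ σ̄(F_μ)`; the summand
of `μ` has degree `τ(μ)` in the third leg. -/
def ThetaSigmaK32 : HahnSeries (ι → ℤ) (U χ ⊗[k] (U χ ⊗[k] U χ)) :=
  formalSum (tw τ) fun μ =>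
    sgn k μ • ∑ j, K χ (up μ - up (tw τ μ)) ⊗ₜ[k]
      ((((D μ).Eb j : U χ) * K χ (-up (tw τ μ))) ⊗ₜ[k]
        (K χ (-up μ) * sigWt χ s μ ((D μ).Fb j)))

end Theta

end SymPair

end

open SymPair TensorProduct

set_option linter.unusedSimpArgs false
set_option linter.unusedSectionVars false

open TensorProduct

noncomputable section

namespace SymPair

variable {k : Type*} [Field k] {ι : Type*} [Fintype ι] [DecidableEq ι]

/-! ### Skew derivations and the bilinear form of the tensor algebra -/

/-- Induction on words, letters being added on the left. -/
theorem T_induction {P : T k ι → Prop} (one : P 1)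
    (mul : ∀ i u, P u → P (FreeAlgebra.ι k i * u)) (add : ∀ u v, P u → P v → P (u + v))
    (smul : ∀ (c : k) u, P u → P (c • u)) (p : T k ι) : P p := by
  have key : ∀ u, P u → P (p * u) := by
    induction p using FreeAlgebra.induction with
    | grade0 c =>
      intro u hu
      rw [← Algebra.smul_def]
      exact smul c u hu
    | grade1 i => exact fun u hu => mul i u hu
    | mul a b ha hb =>
      intro u hu
      rw [mul_assoc]
      exact ha _ (hb u hu)
    | add a b ha hb =>
      intro u hu
      rw [add_mul]
      exact add _ _ (ha u hu) (hb u hu)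
  simpa using key 1 one

theorem T_hom_ext {M : Type*} [AddCommGroup M] [Module k M] {f g : T k ι →ₗ[k] M}
    (one : f 1 = g 1)
    (mul : ∀ i u, f u = g u → f (FreeAlgebra.ι k i * u) = g (FreeAlgebra.ι k i * u)) : f = g :=
  LinearMap.ext fun p => T_induction (P := fun p => f p = g p) one mul
    (fun u v hu hv => by rw [map_add, map_add, hu, hv])
    (fun c u hu => by rw [map_smul, map_smul, hu]) p

/-- The scaling automorphism `x_j ↦ χ(a, α_j) x_j`. -/
def scT (χ : SymBichar k ι) (a : ι → ℤ) : T k ι →ₐ[k] T k ι :=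
  FreeAlgebra.lift k fun j => χ.val a (α j) • FreeAlgebra.ι k j

@[simp] theorem scT_X (χ : SymBichar k ι) (a : ι → ℤ) (j : ι) :
    scT χ a (FreeAlgebra.ι k j) = χ.val a (α j) • FreeAlgebra.ι k j := by
  simp [scT]

/-- Left multiplication by `x_j` on pairs `(u, ∂_i u)`. -/
def dLop (χ : SymBichar k ι) (i j : ι) : Module.End k (T k ι × T k ι) :=
  ((LinearMap.mulLeft k (FreeAlgebra.ι k j)) ∘ₗ LinearMap.fst k _ _).prod
    ((if i = j then (1 : k) else 0) • LinearMap.fst k _ _ +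
      χ.q i j • ((LinearMap.mulLeft k (FreeAlgebra.ι k j)) ∘ₗ LinearMap.snd k _ _))

/-- The pair `(u, ∂_i u)`. -/
def dLpair (χ : SymBichar k ι) (i : ι) : T k ι →ₗ[k] T k ι × T k ι :=
  LinearMap.applyₗ (1, 0) ∘ₗ (FreeAlgebra.lift k (dLop χ i)).toLinearMap

/-- The left skew derivation of the tensor algebra with `∂_i(x_j) = δ_{ij}` and
`∂_i(uv) = ∂_i(u) v + (K_i · u) ∂_i(v)`. -/
def dLT (χ : SymBichar k ι) (i : ι) : T k ι →ₗ[k] T k ι := LinearMap.snd k _ _ ∘ₗ dLpair χ i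

theorem dLpair_X_mul (χ : SymBichar k ι) (i j : ι) (u : T k ι) :
    dLpair χ i (FreeAlgebra.ι k j * u) = dLop χ i j (dLpair χ i u) := by
  simp [dLpair]

theorem dLpair_fst (χ : SymBichar k ι) (i : ι) (u : T k ι) : (dLpair χ i u).1 = u := by
  have : LinearMap.fst k _ _ ∘ₗ dLpair χ i = LinearMap.id := by
    refine T_hom_ext (by simp [dLpair]) fun j u h => ?_
    have h' : (dLpair χ i u).1 = u := h
    simp [dLpair_X_mul, dLop, h']
  exact LinearMap.congr_fun this u

@[simp] theorem dLT_one (χ : SymBichar k ι) (i : ι) : dLT χ i 1 = 0 := by simp [dLT, dLpair]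

theorem dLT_X_mul (χ : SymBichar k ι) (i j : ι) (u : T k ι) :
    dLT χ i (FreeAlgebra.ι k j * u) =
      (if i = j then (1 : k) else 0) • u + χ.q i j • (FreeAlgebra.ι k j * dLT χ i u) := by
  simp only [dLT, LinearMap.comp_apply, dLpair_X_mul]
  change (if i = j then (1 : k) else 0) • (dLpair χ i u).1 +
    χ.q i j • (FreeAlgebra.ι k j * (dLpair χ i u).2) = _
  rw [dLpair_fst]
  rfl

@[simp] theorem dLT_X (χ : SymBichar k ι) (i j : ι) :
    dLT χ i (FreeAlgebra.ι k j) = if i = j then 1 else 0 := by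
  have := dLT_X_mul χ i j 1
  simpa using this

theorem dLT_mul (χ : SymBichar k ι) (i : ι) (u v : T k ι) :
    dLT χ i (u * v) = dLT χ i u * v + scT χ (α i) u * dLT χ i v := by
  refine T_induction (P := fun u => dLT χ i (u * v) = dLT χ i u * v + scT χ (α i) u * dLT χ i v)
    ?_ ?_ ?_ ?_ u
  · simp
  · intro j u h
    rw [mul_assoc, dLT_X_mul, h, dLT_X_mul, map_mul, scT_X]
    simp only [SymBichar.q, mul_add, smul_add, add_mul, smul_mul_assoc, mul_assoc, add_assoc]
  · intro u w hu hw
    simp only [add_mul, map_add, hu, hw]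
    abel
  · intro c u hu
    simp only [smul_mul_assoc, map_smul, hu, smul_add]

theorem dLT_scT (χ : SymBichar k ι) (i : ι) (a : ι → ℤ) (u : T k ι) :
    dLT χ i (scT χ a u) = χ.val a (α i) • scT χ a (dLT χ i u) := by
  have : dLT χ i ∘ₗ (scT χ a).toLinearMap = χ.val a (α i) • ((scT χ a).toLinearMap ∘ₗ dLT χ i) := by
    refine T_hom_ext (by simp) fun j u h => ?_
    have h' : dLT χ i (scT χ a u) = χ.val a (α i) • scT χ a (dLT χ i u) := h
    simp only [LinearMap.comp_apply, AlgHom.toLinearMap_apply, LinearMap.smul_apply, map_mul,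
      scT_X, smul_mul_assoc, map_smul, dLT_X_mul, h', map_add, smul_add, mul_smul_comm]
    congr 1
    · split_ifs with hij <;> simp [hij]
    · simp only [smul_smul]
      congr 1
      ring
  exact LinearMap.congr_fun this u

/-- Reversal of words. -/
def rev (k : Type*) [Field k] (ι : Type*) : T k ι →ₗ[k] T k ι :=
  (MulOpposite.opLinearEquiv k).symm.toLinearMap ∘ₗ
    (FreeAlgebra.lift k fun i => MulOpposite.op (FreeAlgebra.ι k i)).toLinearMap

@[simp] theorem rev_one : rev k ι 1 = 1 := by simp [rev]

@[simp] theorem rev_X (i : ι) : rev k ι (FreeAlgebra.ι k i) = FreeAlgebra.ι k i := by simp [rev]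

@[simp] theorem rev_mul (u v : T k ι) : rev k ι (u * v) = rev k ι v * rev k ι u := by simp [rev]

@[simp] theorem rev_rev (u : T k ι) : rev k ι (rev k ι u) = u := by
  have : rev k ι ∘ₗ rev k ι = LinearMap.id := by
    refine T_hom_ext (by simp) fun j u h => ?_
    have h' : rev k ι (rev k ι u) = u := h
    simp [h']
  exact LinearMap.congr_fun this u

theorem rev_scT (χ : SymBichar k ι) (a : ι → ℤ) (u : T k ι) :
    rev k ι (scT χ a u) = scT χ a (rev k ι u) := by
  have : rev k ι ∘ₗ (scT χ a).toLinearMap = (scT χ a).toLinearMap ∘ₗ rev k ι := by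
    refine T_hom_ext (by simp) fun j u h => ?_
    have h' : rev k ι (scT χ a u) = scT χ a (rev k ι u) := h
    simp [h']
  exact LinearMap.congr_fun this u

/-- The right skew derivation of the tensor algebra with `∂_i(x_j) = δ_{ij}` and
`∂_i(uv) = u ∂_i(v) + ∂_i(u) (K_i · v)`. -/
def dRT (χ : SymBichar k ι) (i : ι) : T k ι →ₗ[k] T k ι := rev k ι ∘ₗ dLT χ i ∘ₗ rev k ι

@[simp] theorem dRT_one (χ : SymBichar k ι) (i : ι) : dRT χ i 1 = 0 := by simp [dRT]

@[simp] theorem dRT_X (χ : SymBichar k ι) (i j : ι) :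
    dRT χ i (FreeAlgebra.ι k j) = if i = j then 1 else 0 := by
  simp only [dRT, LinearMap.comp_apply, rev_X, dLT_X]
  split_ifs <;> simp

theorem dRT_mul (χ : SymBichar k ι) (i : ι) (u v : T k ι) :
    dRT χ i (u * v) = u * dRT χ i v + dRT χ i u * scT χ (α i) v := by
  simp [dRT, dLT_mul, rev_scT]

theorem dLT_rev (χ : SymBichar k ι) (i : ι) (u : T k ι) :
    dLT χ i (rev k ι u) = rev k ι (dRT χ i u) := by simp [dRT]

theorem dRT_scT (χ : SymBichar k ι) (i : ι) (a : ι → ℤ) (u : T k ι) :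
    dRT χ i (scT χ a u) = χ.val a (α i) • scT χ a (dRT χ i u) := by
  simp [dRT, rev_scT, dLT_scT]

theorem dLT_dRT (χ : SymBichar k ι) (i j : ι) (u : T k ι) :
    dLT χ i (dRT χ j u) = dRT χ j (dLT χ i u) := by
  have : dLT χ i ∘ₗ dRT χ j = dRT χ j ∘ₗ dLT χ i := by
    refine T_hom_ext (by simp) fun l u h => ?_
    have h' : dLT χ i (dRT χ j u) = dRT χ j (dLT χ i u) := h
    have hd : dLT χ i (if j = l then (1 : T k ι) else 0) = 0 := by split_ifs <;> simp
    have hd' : dRT χ j (if i = l then (1 : T k ι) else 0) = 0 := by split_ifs <;> simp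
    have hs : scT χ (α i) (if j = l then (1 : T k ι) else 0) = if j = l then 1 else 0 := by
      split_ifs <;> simp
    simp only [LinearMap.comp_apply, dRT_mul, map_add, dLT_mul, dLT_X, dRT_X, h', hd, hd', hs,
      scT_X, zero_mul, zero_add, dLT_scT, map_smul, smul_mul_assoc, add_zero]
    split_ifs with h1 h2 h2 <;> simp [SymBichar.val, χ.symm]
    · subst h1
      subst h2
      abel
    · subst h2
      simp [χ.symm]
  exact LinearMap.congr_fun this u

/-- The counit of the tensor algebra. -/
def epsT (k : Type*) [Field k] (ι : Type*) : T k ι →ₐ[k] k := FreeAlgebra.lift k fun _ => 0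

@[simp] theorem epsT_X (i : ι) : epsT k ι (FreeAlgebra.ι k i) = 0 := by simp [epsT]

theorem epsT_scT (χ : SymBichar k ι) (a : ι → ℤ) (u : T k ι) :
    epsT k ι (scT χ a u) = epsT k ι u := by
  have : (epsT k ι).comp (scT χ a) = epsT k ι := by ext; simp
  exact AlgHom.congr_fun this u

theorem epsT_rev (u : T k ι) : epsT k ι (rev k ι u) = epsT k ι u := by
  have : (epsT k ι).toLinearMap ∘ₗ rev k ι = (epsT k ι).toLinearMap := by
    refine T_hom_ext (by simp) fun j u h => ?_
    simp
  exact LinearMap.congr_fun this u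

theorem epsT_dRT (χ : SymBichar k ι) (i : ι) (u : T k ι) :
    epsT k ι (dRT χ i u) = epsT k ι (dLT χ i u) := by
  have : (epsT k ι).toLinearMap ∘ₗ dRT χ i = (epsT k ι).toLinearMap ∘ₗ dLT χ i := by
    refine T_hom_ext (by simp) fun j u h => ?_
    simp only [LinearMap.comp_apply, AlgHom.toLinearMap_apply, dRT_mul, dLT_mul, map_add, map_mul,
      scT_X, epsT_X, dRT_X, dLT_X, map_smul, zero_mul, epsT_scT, zero_add, smul_zero, add_zero]
  exact LinearMap.congr_fun this u

/-- The bilinear form on the tensor algebra for which `∂_i` is adjoint to left multiplication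
by `x_i`. -/
def formT (χ : SymBichar k ι) : T k ι →ₗ[k] T k ι →ₗ[k] k :=
  LinearMap.applyₗ (epsT k ι).toLinearMap ∘ₗ
    (FreeAlgebra.lift k fun i => (Module.Dual.transpose (R := k) (dLT χ i) :
      Module.End k (Module.Dual k (T k ι)))).toLinearMap

@[simp] theorem formT_one (χ : SymBichar k ι) (p : T k ι) : formT χ 1 p = epsT k ι p := by
  simp [formT]

theorem formT_X_mul (χ : SymBichar k ι) (i : ι) (w p : T k ι) :
    formT χ (FreeAlgebra.ι k i * w) p = formT χ w (dLT χ i p) := by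
  simp [formT, Module.Dual.transpose_apply]

@[simp] theorem formT_one_right (χ : SymBichar k ι) (w : T k ι) :
    formT χ w 1 = epsT k ι w := by
  have : (formT χ).flip 1 = (epsT k ι).toLinearMap := by
    refine T_hom_ext (by simp) fun j u h => ?_
    simp [formT_X_mul]
  exact LinearMap.congr_fun this w

theorem formT_dLT (χ : SymBichar k ι) (i : ι) (p w : T k ι) :
    formT χ (dLT χ i p) w = formT χ p (FreeAlgebra.ι k i * w) := by
  refine T_induction (P := fun p => ∀ w, formT χ (dLT χ i p) w =
    formT χ p (FreeAlgebra.ι k i * w)) ?_ ?_ ?_ ?_ p w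
  · intro w; simp
  · intro j u h w
    rw [dLT_X_mul, map_add, LinearMap.add_apply, map_smul, map_smul, LinearMap.smul_apply,
      LinearMap.smul_apply, formT_X_mul, h, formT_X_mul, dLT_X_mul, map_add, map_smul, map_smul,
      q_symm χ j i]
    simp only [eq_comm]
  · intro u v hu hv w
    simp [hu, hv]
  · intro c u hu w
    simp [hu]

theorem formT_symm (χ : SymBichar k ι) (p w : T k ι) : formT χ p w = formT χ w p := by
  refine T_induction (P := fun w => ∀ p, formT χ p w = formT χ w p) ?_ ?_ ?_ ?_ w p
  · intro p; simp
  · intro j u h p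
    rw [← formT_dLT, h, formT_X_mul]
  · intro u v hu hv w
    simp [hu, hv]
  · intro c u hu w
    simp [hu]

theorem formT_mul_X (χ : SymBichar k ι) (i : ι) (w p : T k ι) :
    formT χ (w * FreeAlgebra.ι k i) p = formT χ w (dRT χ i p) := by
  refine T_induction (P := fun w => ∀ p, formT χ (w * FreeAlgebra.ι k i) p =
    formT χ w (dRT χ i p)) ?_ ?_ ?_ ?_ w p
  · intro p
    have := formT_X_mul χ i 1 p
    simp only [mul_one] at this
    simp [this, epsT_dRT]
  · intro j u h p
    rw [mul_assoc, formT_X_mul, h, formT_X_mul, dLT_dRT]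
  · intro u v hu hv w
    simp [add_mul, hu, hv]
  · intro c u hu w
    simp [hu]

/-- The radical of the form. -/
def radT (χ : SymBichar k ι) : Submodule k (T k ι) := LinearMap.ker (formT χ).flip

theorem mem_radT {χ : SymBichar k ι} {p : T k ι} : p ∈ radT χ ↔ ∀ w, formT χ w p = 0 := by
  simp [radT, LinearMap.ext_iff]

/-- A subspace on which the counit vanishes and which is stable under all `∂_i` is contained in
the radical. -/
theorem le_radT (χ : SymBichar k ι) (M : Submodule k (T k ι)) (h0 : ∀ p ∈ M, epsT k ι p = 0)
    (h1 : ∀ i, ∀ p ∈ M, dLT χ i p ∈ M) : M ≤ radT χ := by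
  intro p hp
  rw [mem_radT]
  intro w
  refine T_induction (P := fun w => ∀ p ∈ M, formT χ w p = 0) ?_ ?_ ?_ ?_ w p hp
  · intro p hp; simp [h0 p hp]
  · intro i u hu p hp
    rw [formT_X_mul]
    exact hu _ (h1 i p hp)
  · intro u v hu hv p hp
    simp [hu p hp, hv p hp]
  · intro c u hu p hp
    simp [hu p hp]

theorem epsT_radT {χ : SymBichar k ι} {p : T k ι} (hp : p ∈ radT χ) : epsT k ι p = 0 := by
  simpa using mem_radT.1 hp 1

theorem dLT_radT {χ : SymBichar k ι} (i : ι) {p : T k ι} (hp : p ∈ radT χ) :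
    dLT χ i p ∈ radT χ := by
  rw [mem_radT] at hp ⊢
  intro w
  rw [← formT_X_mul, hp]

theorem dRT_radT {χ : SymBichar k ι} (i : ι) {p : T k ι} (hp : p ∈ radT χ) :
    dRT χ i p ∈ radT χ := by
  rw [mem_radT] at hp ⊢
  intro w
  rw [← formT_mul_X, hp]

theorem map_radT_le (χ : SymBichar k ι) (f : T k ι →ₗ[k] T k ι)
    (h0 : ∀ p ∈ radT χ, epsT k ι (f p) = 0)
    (h1 : ∀ i, ∀ p ∈ radT χ, dLT χ i (f p) ∈ (radT χ).map f) {p : T k ι} (hp : p ∈ radT χ) :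
    f p ∈ radT χ := by
  refine le_radT χ ((radT χ).map f) ?_ ?_ ⟨p, hp, rfl⟩
  · rintro _ ⟨p, hp, rfl⟩
    exact h0 p hp
  · rintro i _ ⟨p, hp, rfl⟩
    exact h1 i p hp

theorem rev_radT {χ : SymBichar k ι} {p : T k ι} (hp : p ∈ radT χ) : rev k ι p ∈ radT χ := by
  refine map_radT_le χ (rev k ι) ?_ ?_ hp
  · intro p hp
    rw [epsT_rev, epsT_radT hp]
  · intro i p hp
    exact ⟨_, dRT_radT i hp, (dLT_rev χ i p).symm⟩

theorem scT_radT {χ : SymBichar k ι} (a : ι → ℤ) {p : T k ι} (hp : p ∈ radT χ) :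
    scT χ a p ∈ radT χ := by
  refine map_radT_le χ (scT χ a).toLinearMap ?_ ?_ hp
  · intro p hp
    simp [epsT_scT, epsT_radT hp]
  · intro i p hp
    refine ⟨_, (radT χ).smul_mem (χ.val a (α i)) (dLT_radT i hp), ?_⟩
    simp [dLT_scT]

/-- The action of a permutation of the index set on the tensor algebra. -/
def permT (k : Type*) [Field k] {ι : Type*} (τ : Equiv.Perm ι) : T k ι →ₐ[k] T k ι :=
  FreeAlgebra.lift k fun i => FreeAlgebra.ι k (τ i)

@[simp] theorem permT_X (τ : Equiv.Perm ι) (i : ι) :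
    permT k τ (FreeAlgebra.ι k i) = FreeAlgebra.ι k (τ i) := by
  simp [permT]

theorem permT_radT {χ : SymBichar k ι} {τ : Equiv.Perm ι}
    (hχτ : ∀ i j, χ.q (τ i) (τ j) = χ.q i j) {p : T k ι} (hp : p ∈ radT χ) :
    permT k τ p ∈ radT χ := by
  have hd : ∀ i, dLT χ (τ i) ∘ₗ (permT k τ).toLinearMap = (permT k τ).toLinearMap ∘ₗ dLT χ i := by
    intro i
    refine T_hom_ext (by simp) fun j u h => ?_
    have h' : dLT χ (τ i) (permT k τ u) = permT k τ (dLT χ i u) := h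
    simp only [LinearMap.comp_apply, AlgHom.toLinearMap_apply, map_mul, permT_X, dLT_X_mul, h',
      map_add, map_smul, hχτ, EmbeddingLike.apply_eq_iff_eq]
  refine map_radT_le χ (permT k τ).toLinearMap ?_ ?_ hp
  · intro p hp
    have : (epsT k ι).comp (permT k τ) = epsT k ι := by ext; simp [permT]
    have := AlgHom.congr_fun this p
    simp only [AlgHom.comp_apply] at this
    simp [this, epsT_radT hp]
  · intro i p hp
    refine ⟨dLT χ (τ.symm i) p, dLT_radT _ hp, ?_⟩
    have := LinearMap.congr_fun (hd (τ.symm i)) p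
    simpa using this.symm

theorem mul_radT {χ : SymBichar k ι} (u v : T k ι) {p : T k ι} (hp : p ∈ radT χ) :
    u * p * v ∈ radT χ := by
  refine le_radT χ (Submodule.span k {z | ∃ u v, ∃ p ∈ radT χ, z = u * p * v}) ?_ ?_
    (Submodule.subset_span ⟨u, v, p, hp, rfl⟩)
  · intro z hz
    induction hz using Submodule.span_induction with
    | mem z hz =>
      obtain ⟨u, v, p, hp, rfl⟩ := hz
      simp [epsT_radT hp]
    | zero => simp
    | add x y _ _ hx hy => simp [hx, hy]
    | smul c x _ hx => simp [hx]
  · intro i z hz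
    induction hz using Submodule.span_induction with
    | mem z hz =>
      obtain ⟨u, v, p, hp, rfl⟩ := hz
      rw [dLT_mul, dLT_mul, map_mul, add_mul]
      exact add_mem (add_mem (Submodule.subset_span ⟨_, _, p, hp, rfl⟩)
        (Submodule.subset_span ⟨_, _, _, dLT_radT i hp, rfl⟩))
        (Submodule.subset_span ⟨_, _, _, scT_radT _ hp, rfl⟩)
    | zero => simp
    | add x y _ _ hx hy => rw [map_add]; exact add_mem hx hy
    | smul c x _ hx => rw [map_smul]; exact Submodule.smul_mem _ _ hx

/-! ### The Nichols ideal is the radical of the form -/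

/-- The braided coproduct as a linear map. -/
def brComulₗ (χ : SymBichar k ι) : T k ι →ₗ[k] T k ι ⊗[k] T k ι :=
  LinearMap.applyₗ (1 ⊗ₜ[k] 1) ∘ₗ (FreeAlgebra.lift k (brLeft χ)).toLinearMap

@[simp] theorem brComulₗ_one (χ : SymBichar k ι) : brComulₗ χ 1 = 1 ⊗ₜ[k] 1 := by
  simp [brComulₗ]

theorem brComulₗ_X_mul (χ : SymBichar k ι) (i : ι) (p : T k ι) :
    brComulₗ χ (FreeAlgebra.ι k i * p) = brLeft χ i (brComulₗ χ p) := by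
  simp [brComulₗ]

theorem act_eq_scT (χ : SymBichar k ι) (i : ι) : act χ i = scT χ (α i) := rfl

/-- The counit applied to the left leg. -/
def epsLeft (k : Type*) [Field k] (ι : Type*) : T k ι ⊗[k] T k ι →ₗ[k] T k ι :=
  (TensorProduct.lid k _).toLinearMap ∘ₗ LinearMap.rTensor _ (epsT k ι).toLinearMap

@[simp] theorem epsLeft_tmul (u v : T k ι) : epsLeft k ι (u ⊗ₜ v) = epsT k ι u • v := by
  simp [epsLeft]

theorem epsLeft_brComul (χ : SymBichar k ι) (p : T k ι) : epsLeft k ι (brComulₗ χ p) = p := by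
  have h : ∀ j z, epsLeft k ι (brLeft χ j z) = FreeAlgebra.ι k j * epsLeft k ι z := by
    intro j z
    induction z with
    | zero => simp
    | tmul u v => simp [brLeft, act_eq_scT, epsT_scT]
    | add x y hx hy => simp only [map_add, hx, hy, mul_add]
  have : epsLeft k ι ∘ₗ brComulₗ χ = LinearMap.id := by
    refine T_hom_ext (by simp) fun j u hu => ?_
    have hu' : epsLeft k ι (brComulₗ χ u) = u := hu
    simp [brComulₗ_X_mul, h, hu']
  exact LinearMap.congr_fun this p

theorem dLT_rTensor_brComul (χ : SymBichar k ι) (i : ι) (p : T k ι) :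
    LinearMap.rTensor _ (dLT χ i) (brComulₗ χ p) = brComulₗ χ (dLT χ i p) := by
  have h : ∀ j z, LinearMap.rTensor _ (dLT χ i) (brLeft χ j z) =
      (if i = j then (1 : k) else 0) • z + χ.q i j • brLeft χ j (LinearMap.rTensor _ (dLT χ i) z) := by
    intro j z
    induction z with
    | zero => simp
    | tmul u v =>
      simp only [brLeft, LinearMap.add_apply, TensorProduct.map_tmul, LinearMap.mulLeft_apply,
        LinearMap.id_apply, map_add, LinearMap.rTensor_tmul, dLT_X_mul, act_eq_scT,
        AlgHom.toLinearMap_apply, dLT_scT, smul_add, TensorProduct.add_tmul,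
        TensorProduct.smul_tmul']
      rw [add_assoc]
      congr 3
      exact (congrArg (· • _) (q_symm χ j i))
    | add x y hx hy =>
      simp only [map_add, hx, hy, smul_add]
      abel
  have : LinearMap.rTensor _ (dLT χ i) ∘ₗ brComulₗ χ = brComulₗ χ ∘ₗ dLT χ i := by
    refine T_hom_ext (by simp) fun j u hu => ?_
    have hu' : LinearMap.rTensor _ (dLT χ i) (brComulₗ χ u) = brComulₗ χ (dLT χ i u) := hu
    simp only [LinearMap.comp_apply, brComulₗ_X_mul, h, hu', dLT_X_mul, map_add, map_smul]
  exact LinearMap.congr_fun this p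

/-- The product of two linear functionals. -/
def tf {V W : Type*} [AddCommGroup V] [Module k V] [AddCommGroup W] [Module k W]
    (f : V →ₗ[k] k) (g : W →ₗ[k] k) : V ⊗[k] W →ₗ[k] k :=
  LinearMap.mul' k k ∘ₗ TensorProduct.map f g

@[simp] theorem tf_tmul {V W : Type*} [AddCommGroup V] [Module k V] [AddCommGroup W] [Module k W]
    (f : V →ₗ[k] k) (g : W →ₗ[k] k) (v : V) (w : W) : tf f g (v ⊗ₜ[k] w) = f v * g w := by
  simp [tf]

theorem formT_mul (χ : SymBichar k ι) (w w' p : T k ι) :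
    formT χ (w * w') p = tf (formT χ w) (formT χ w') (brComulₗ χ p) := by
  refine T_induction (P := fun w => ∀ p, formT χ (w * w') p =
    tf (formT χ w) (formT χ w') (brComulₗ χ p)) ?_ ?_ ?_ ?_ w p
  · intro p
    have : tf (formT χ 1) (formT χ w') = formT χ w' ∘ₗ epsLeft k ι := by
      ext u v; simp
    rw [this, LinearMap.comp_apply, epsLeft_brComul, one_mul]
  · intro i u hu p
    have : tf (formT χ (FreeAlgebra.ι k i * u)) (formT χ w') =
        tf (formT χ u) (formT χ w') ∘ₗ LinearMap.rTensor _ (dLT χ i) := by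
      ext u v; simp [formT_X_mul]
    rw [mul_assoc, formT_X_mul, hu, this, LinearMap.comp_apply, dLT_rTensor_brComul]
  · intro u v hu hv p
    have : tf (formT χ (u + v)) (formT χ w') = tf (formT χ u) (formT χ w') +
        tf (formT χ v) (formT χ w') := by
      ext u v; simp [add_mul]
    rw [add_mul, map_add, LinearMap.add_apply, hu, hv, this, LinearMap.add_apply]
  · intro c u hu p
    have : tf (formT χ (c • u)) (formT χ w') = c • tf (formT χ u) (formT χ w') := by
      ext u v; simp [mul_assoc]
    rw [smul_mul_assoc, map_smul, LinearMap.smul_apply, hu, this, LinearMap.smul_apply]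

section TensorSeparation

variable {V W V' : Type*} [AddCommGroup V] [Module k V] [AddCommGroup W] [Module k W]

/-- Jointly injective families of linear maps stay jointly injective after tensoring. -/
theorem lTensor_separating {J : Type*} {M : J → Type*} [∀ j, AddCommGroup (M j)]
    [∀ j, Module k (M j)] (g : ∀ j, W →ₗ[k] M j) (hg : ∀ w, (∀ j, g j w = 0) → w = 0)
    (z : V ⊗[k] W) (hz : ∀ j, LinearMap.lTensor V (g j) z = 0) : z = 0 := by
  classical
  let B := Module.Basis.ofVectorSpace k V
  have key : ∀ j (z : V ⊗[k] W) r, TensorProduct.equivFinsuppOfBasisLeft B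
      (LinearMap.lTensor V (g j) z) r = g j (TensorProduct.equivFinsuppOfBasisLeft B z r) := by
    intro j z r
    induction z with
    | zero => simp
    | tmul v w => simp [TensorProduct.equivFinsuppOfBasisLeft_apply_tmul_apply]
    | add x y hx hy => simp only [map_add, Finsupp.add_apply, hx, hy]
  apply (TensorProduct.equivFinsuppOfBasisLeft B).injective
  rw [map_zero]
  ext r
  refine hg _ fun j => ?_
  rw [← key, hz, map_zero]
  rfl

theorem rTensor_separating {J : Type*} {M : J → Type*} [∀ j, AddCommGroup (M j)]
    [∀ j, Module k (M j)] (g : ∀ j, W →ₗ[k] M j) (hg : ∀ w, (∀ j, g j w = 0) → w = 0)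
    (z : W ⊗[k] V) (hz : ∀ j, LinearMap.rTensor V (g j) z = 0) : z = 0 := by
  apply (TensorProduct.comm k W V).injective
  rw [map_zero]
  refine lTensor_separating g hg _ fun j => ?_
  have : LinearMap.lTensor V (g j) ∘ₗ (TensorProduct.comm k W V).toLinearMap =
      (TensorProduct.comm k (M j) V).toLinearMap ∘ₗ LinearMap.rTensor V (g j) := by
    ext; simp
  have h := LinearMap.congr_fun this z
  simpa [hz] using h

theorem tf_separating {J L : Type*} (f : J → V →ₗ[k] k) (hf : ∀ v, (∀ j, f j v = 0) → v = 0)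
    (g : L → W →ₗ[k] k) (hg : ∀ w, (∀ l, g l w = 0) → w = 0) (z : V ⊗[k] W)
    (hz : ∀ j l, tf (f j) (g l) z = 0) : z = 0 := by
  refine lTensor_separating g hg z fun l => ?_
  refine rTensor_separating f hf _ fun j => ?_
  apply (TensorProduct.lid k k).injective
  rw [map_zero, ← hz j l]
  simp only [LinearMap.rTensor, LinearMap.lTensor]
  rw [← LinearMap.comp_apply, ← TensorProduct.map_comp]
  simp only [tf, LinearMap.comp_apply, LinearMap.id_comp, LinearMap.comp_id]
  induction TensorProduct.map (f j) (g l) z with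
  | zero => simp
  | tmul a b => simp
  | add x y hx hy => simp only [map_add, hx, hy]

end TensorSeparation

theorem brComul_radT (χ : SymBichar k ι) {p : T k ι} (hp : p ∈ radT χ) : brComulₗ χ p ∈
    LinearMap.range (TensorProduct.map (radT χ).subtype (LinearMap.id : T k ι →ₗ[k] T k ι)) ⊔
      LinearMap.range (TensorProduct.map (LinearMap.id : T k ι →ₗ[k] T k ι) (radT χ).subtype) := by
  have hex : Function.Exact (radT χ).subtype (radT χ).mkQ :=
    LinearMap.exact_iff.2 (by simp)
  have hker := TensorProduct.map_ker (g := (radT χ).mkQ) (f := (radT χ).subtype)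
    (g' := (radT χ).mkQ) (f' := (radT χ).subtype) hex (Submodule.mkQ_surjective _) hex
    (Submodule.mkQ_surjective _)
  have hmem : brComulₗ χ p ∈ LinearMap.ker (TensorProduct.map (radT χ).mkQ (radT χ).mkQ) := by
    rw [LinearMap.mem_ker]
    have hle : ∀ w, radT χ ≤ LinearMap.ker (formT χ w) := fun w p hp => mem_radT.1 hp w
    refine tf_separating (fun w => (radT χ).liftQ (formT χ w) (hle w)) ?_
      (fun w => (radT χ).liftQ (formT χ w) (hle w)) ?_ _ ?_
    · intro v hv
      obtain ⟨v, rfl⟩ := Submodule.mkQ_surjective _ v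
      rw [Submodule.mkQ_apply, Submodule.Quotient.mk_eq_zero, mem_radT]
      exact fun w => by simpa using hv w
    · intro v hv
      obtain ⟨v, rfl⟩ := Submodule.mkQ_surjective _ v
      rw [Submodule.mkQ_apply, Submodule.Quotient.mk_eq_zero, mem_radT]
      exact fun w => by simpa using hv w
    · intro w w'
      have : tf ((radT χ).liftQ (formT χ w) (hle w)) ((radT χ).liftQ (formT χ w') (hle w')) ∘ₗ
          TensorProduct.map (radT χ).mkQ (radT χ).mkQ = tf (formT χ w) (formT χ w') := by
        ext; simp
      rw [← LinearMap.comp_apply, this, ← formT_mul]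
      exact mem_radT.1 hp _
  rw [hker] at hmem
  rw [sup_comm]
  exact hmem

/-- The algebra homomorphism recording the weight of words. -/
def grT (k : Type*) [Field k] (ι : Type*) [DecidableEq ι] :
    T k ι →ₐ[k] AddMonoidAlgebra (T k ι) (ι → ℕ) :=
  FreeAlgebra.lift k fun i => AddMonoidAlgebra.single (Pi.single i 1) (FreeAlgebra.ι k i)

theorem word_cons (i : ι) (l : List ι) : word k (i :: l) = FreeAlgebra.ι k i * word k l := by
  simp [word]

/-- The weight of a word. -/
def cnt (l : List ι) : ι → ℕ := fun i => l.count i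

theorem cnt_cons (i : ι) (l : List ι) : cnt (i :: l) = Pi.single i 1 + cnt l := by
  ext j
  by_cases h : j = i
  · subst h; simp [cnt, add_comm]
  · have h' : i ≠ j := fun e => h e.symm
    simp [cnt, List.count_cons, h, h']

theorem grT_word (l : List ι) :
    grT k ι (word k l) = AddMonoidAlgebra.single (cnt l) (word k l) := by
  induction l with
  | nil =>
    have : cnt ([] : List ι) = 0 := by ext; simp [cnt]
    simp [word, this, AddMonoidAlgebra.one_def]
  | cons i l ih =>
    rw [word_cons, map_mul, ih, cnt_cons]
    simp [grT, AddMonoidAlgebra.single_mul_single]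

theorem word_induction {P : T k ι → Prop} (hw : ∀ l, P (word k l))
    (add : ∀ u v, P u → P v → P (u + v)) (smul : ∀ (c : k) u, P u → P (c • u)) (p : T k ι) :
    P p := by
  have key : p ∈ Submodule.span k (Set.range (word k (ι := ι))) := by
    refine T_induction (P := fun p => p ∈ Submodule.span k (Set.range (word k (ι := ι))))
      (Submodule.subset_span ⟨[], by simp [word]⟩) ?_ (fun u v => add_mem)
      (fun c u => Submodule.smul_mem _ c) p
    intro i u hu
    induction hu using Submodule.span_induction with
    | mem x hx =>
      obtain ⟨l, rfl⟩ := hx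
      exact Submodule.subset_span ⟨i :: l, word_cons i l⟩
    | zero => simp
    | add x y _ _ hx hy => rw [mul_add]; exact add_mem hx hy
    | smul c x _ hx => rw [mul_smul_comm]; exact Submodule.smul_mem _ c hx
  have h0 : P 0 := by simpa using smul 0 _ (hw [])
  exact Submodule.span_induction (p := fun p _ => P p) (by rintro _ ⟨l, rfl⟩; exact hw l) h0
    (fun u v _ _ => add u v) (fun c u _ => smul c u) key

/-- The homogeneous component of weight `μ`. -/
def prT (k : Type*) [Field k] {ι : Type*} [DecidableEq ι] (μ : ι → ℕ) : T k ι →ₗ[k] T k ι where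
  toFun p := (grT k ι p).coeff μ
  map_add' := by simp
  map_smul' := by simp

theorem prT_word (μ : ι → ℕ) (l : List ι) :
    prT k μ (word k l) = if cnt l = μ then word k l else 0 := by
  simp [prT, grT_word, Finsupp.single_apply]

theorem word_mem_Twt (l : List ι) : word k l ∈ Twt k (cnt l) :=
  Submodule.subset_span ⟨l, fun _ => rfl, rfl⟩

theorem prT_mem (μ : ι → ℕ) (p : T k ι) : prT k μ p ∈ Twt k μ := by
  refine word_induction (P := fun p => prT k μ p ∈ Twt k μ) ?_ ?_ ?_ p
  · intro l
    rw [prT_word]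
    split_ifs with h
    · rw [← h]
      exact word_mem_Twt l
    · exact zero_mem _
  · intro u v hu hv
    rw [map_add]; exact add_mem hu hv
  · intro c u hu
    rw [map_smul]; exact Submodule.smul_mem _ c hu

theorem prT_of_mem {μ : ι → ℕ} {p : T k ι} (hp : p ∈ Twt k μ) (ν : ι → ℕ) :
    prT k ν p = if μ = ν then p else 0 := by
  refine Submodule.span_induction (p := fun p _ => prT k ν p = if μ = ν then p else 0)
    ?_ ?_ ?_ ?_ hp
  · rintro _ ⟨l, hl, rfl⟩
    have : cnt l = μ := funext hl
    rw [prT_word, this]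
  · simp
  · intro u v _ _ hu hv
    rw [map_add, hu, hv]
    split_ifs <;> simp
  · intro c u _ hu
    rw [map_smul, hu]
    split_ifs <;> simp

theorem sum_prT (p : T k ι) : ∃ s : Finset (ι → ℕ), p = ∑ μ ∈ s, prT k μ p ∧
    ∀ μ ∉ s, prT k μ p = 0 := by
  classical
  have key : ((grT k ι p).coeff.sum fun _ x => x) = p := by
    refine word_induction (P := fun p => ((grT k ι p).coeff.sum fun _ x => x) = p) ?_ ?_ ?_ p
    · intro l
      simp [grT_word]
    · intro u v hu hv
      rw [map_add, AddMonoidAlgebra.coeff_add, Finsupp.sum_add_index' (by simp) (by simp), hu, hv]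
    · intro c u hu
      rw [map_smul, AddMonoidAlgebra.coeff_smul, Finsupp.sum_smul_index' (by simp),
        ← Finsupp.smul_sum, hu]
  refine ⟨(grT k ι p).coeff.support, key.symm, fun μ hμ => ?_⟩
  simpa [prT] using hμ

theorem dLT_prT (χ : SymBichar k ι) (i : ι) (μ : ι → ℕ) (p : T k ι) :
    dLT χ i (prT k (Pi.single i 1 + μ) p) = prT k μ (dLT χ i p) := by
  have hw : ∀ l : List ι, dLT χ i (word k l) ∈
      Submodule.span k {z | ∃ l', Pi.single i 1 + cnt l' = cnt l ∧ z = word k l'} := by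
    intro l
    induction l with
    | nil => simp [word]
    | cons j l ih =>
      rw [word_cons, dLT_X_mul]
      refine add_mem ?_ (Submodule.smul_mem _ _ ?_)
      · split_ifs with h
        · subst h
          rw [one_smul]
          exact Submodule.subset_span ⟨l, (cnt_cons _ _).symm, rfl⟩
        · simp
      · generalize dLT χ i (word k l) = z at ih
        induction ih using Submodule.span_induction with
        | mem x hx =>
          obtain ⟨l', h, rfl⟩ := hx
          refine Submodule.subset_span ⟨j :: l', ?_, (word_cons _ _).symm⟩
          rw [cnt_cons, cnt_cons, ← h]
          abel
        | zero => simp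
        | add x y _ _ hx hy => rw [mul_add]; exact add_mem hx hy
        | smul c x _ hx => rw [mul_smul_comm]; exact Submodule.smul_mem _ c hx
  refine word_induction (P := fun p => dLT χ i (prT k (Pi.single i 1 + μ) p) =
    prT k μ (dLT χ i p)) ?_ ?_ ?_ p
  · intro l
    have : ∀ z ∈ Submodule.span k {z : T k ι | ∃ l', Pi.single i 1 + cnt l' = cnt l ∧
        z = word k l'}, prT k μ z = if cnt l = Pi.single i 1 + μ then z else 0 := by
      intro z hz
      induction hz using Submodule.span_induction with
      | mem x hx =>
        obtain ⟨l', h, rfl⟩ := hx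
        rw [prT_word, ← h]
        simp
      | zero => simp
      | add x y _ _ hx hy => rw [map_add, hx, hy]; split_ifs <;> simp
      | smul c x _ hx => rw [map_smul, hx]; split_ifs <;> simp
    rw [this _ (hw l), prT_word]
    split_ifs <;> simp
  · intro u v hu hv
    simp only [map_add, hu, hv]
  · intro c u hu
    simp only [map_smul, hu]

theorem epsT_word_cons (i : ι) (l : List ι) : epsT k ι (word k (i :: l)) = 0 := by
  simp [word_cons]

theorem prT_radT {χ : SymBichar k ι} (μ : ι → ℕ) {p : T k ι} (hp : p ∈ radT χ) :
    prT k μ p ∈ radT χ := by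
  refine le_radT χ (⨆ μ, (radT χ).map (prT k μ)) ?_ ?_ ((le_iSup (fun μ => (radT χ).map (prT k μ))
    μ) ⟨p, hp, rfl⟩)
  · have : (⨆ μ, (radT χ).map (prT k μ)) ≤ LinearMap.ker (epsT k ι).toLinearMap := by
      refine iSup_le fun μ => ?_
      rintro _ ⟨p, hp, rfl⟩
      rw [LinearMap.mem_ker]
      have h : ∀ p, epsT k ι (prT k μ p) = if μ = 0 then epsT k ι p else 0 := by
        intro p
        refine word_induction (P := fun p => epsT k ι (prT k μ p) =
          if μ = 0 then epsT k ι p else 0) ?_ ?_ ?_ p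
        · intro l
          cases l with
          | nil =>
            have : cnt ([] : List ι) = 0 := by ext; simp [cnt]
            rw [prT_word, this]
            by_cases h : μ = 0
            · simp [h]
            · simp [h, Ne.symm h]
          | cons i l =>
            rw [prT_word]
            split_ifs <;> simp [epsT_word_cons]
        · intro u v hu hv
          rw [map_add, map_add, hu, hv]
          split_ifs <;> simp
        · intro c u hu
          rw [map_smul, map_smul, hu]
          split_ifs <;> simp
      have := h p
      rw [epsT_radT hp] at this
      simpa using this
    exact fun p hp => this hp
  · intro i
    have : (⨆ μ, (radT χ).map (prT k μ)) ≤ (⨆ μ, (radT χ).map (prT k μ)).comap (dLT χ i) := by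
      refine iSup_le fun μ => ?_
      rintro _ ⟨p, hp, rfl⟩
      rw [Submodule.mem_comap]
      by_cases hμ : μ i = 0
      · have h0 : ∀ q ∈ Twt k μ, dLT χ i q = 0 := by
          intro q hq
          refine Submodule.span_induction (p := fun q _ => dLT χ i q = 0) ?_ ?_ ?_ ?_ hq
          · rintro _ ⟨l, hl, rfl⟩
            have hil : i ∉ l := by
              rw [← List.count_eq_zero, hl, hμ]
            clear hl
            induction l with
            | nil => simp [word]
            | cons j l ih =>
              rw [word_cons, dLT_X_mul, ih (fun h => hil (List.mem_cons_of_mem _ h))]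
              have : i ≠ j := fun h => hil (h ▸ List.mem_cons_self)
              simp [this]
          · simp
          · intro u v _ _ hu hv
            rw [map_add, hu, hv, add_zero]
          · intro c u _ hu
            rw [map_smul, hu, smul_zero]
        rw [h0 _ (prT_mem μ p)]
        exact zero_mem _
      · have : μ = Pi.single i 1 + (μ - Pi.single i 1) := by
          rw [add_tsub_cancel_of_le]
          intro j
          by_cases h : j = i
          · subst h
            simp
            omega
          · simp [h]
        rw [this, dLT_prT]
        exact (le_iSup (fun μ => (radT χ).map (prT k μ)) (μ - Pi.single i 1))
          ⟨_, dLT_radT i hp, rfl⟩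
    exact fun p hp => this hp

theorem radT_isGradedBiideal (χ : SymBichar k ι) : IsGradedBiideal χ (radT χ) where
  mul_left x p hp := by simpa using mul_radT x 1 hp
  mul_right x p hp := by simpa using mul_radT 1 x hp
  graded p hp := by
    obtain ⟨s, hs, -⟩ := sum_prT p
    rw [hs]
    exact Submodule.sum_mem _ fun μ _ =>
      (le_iSup (fun μ => radT χ ⊓ Twt k μ) μ) ⟨prT_radT μ hp, prT_mem μ p⟩
  coideal p hp := brComul_radT χ hp
  le_ge2 p hp := by
    have key : ∀ p : T k ι, p - algebraMap k _ (epsT k ι p) -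
        ∑ i, epsT k ι (dLT χ i p) • FreeAlgebra.ι k i ∈ Tge2 k ι := by
      intro p
      refine word_induction (P := fun p => p - algebraMap k _ (epsT k ι p) -
        ∑ i, epsT k ι (dLT χ i p) • FreeAlgebra.ι k i ∈ Tge2 k ι) ?_ ?_ ?_ p
      · intro l
        match l with
        | [] => simp [word]
        | [i] =>
          have h : ∀ j, epsT k ι (dLT χ j (FreeAlgebra.ι k i)) = if j = i then 1 else 0 := by
            intro j
            rw [dLT_X]
            split_ifs <;> simp
          simp [word, h]
        | i :: j :: l =>
          have h : ∀ a, epsT k ι (dLT χ a (word k (i :: j :: l))) = 0 := by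
            intro a
            rw [word_cons, dLT_X_mul, map_add, map_smul, map_smul, epsT_word_cons]
            simp
          simp only [h, epsT_word_cons]
          simp only [map_zero, sub_zero, zero_smul, Finset.sum_const_zero]
          exact Submodule.subset_span ⟨_, by simp, rfl⟩
      · intro u v hu hv
        have := add_mem hu hv
        simp only [map_add, add_smul, Finset.sum_add_distrib]
        convert this using 1
        abel
      · intro c u hu
        have := Submodule.smul_mem _ c hu
        simp only [map_smul, smul_assoc, ← Finset.smul_sum]
        convert this using 1
        rw [smul_sub, smul_sub, Algebra.algebraMap_eq_smul_one, Algebra.algebraMap_eq_smul_one,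
          smul_assoc]
    have h := key p
    rw [epsT_radT hp] at h
    simpa [epsT_radT (dLT_radT _ hp)] using h

theorem epsT_Tge2 {p : T k ι} (hp : p ∈ Tge2 k ι) : epsT k ι p = 0 := by
  refine Submodule.span_induction (p := fun p _ => epsT k ι p = 0) ?_ ?_ ?_ ?_ hp
  · rintro _ ⟨l, hl, rfl⟩
    cases l with
    | nil => simp at hl
    | cons i l => exact epsT_word_cons i l
  · simp
  · intro u v _ _ hu hv
    rw [map_add, hu, hv, add_zero]
  · intro c u _ hu
    rw [map_smul, hu, smul_zero]

theorem epsT_dLT_Tge2 (χ : SymBichar k ι) (i : ι) {p : T k ι} (hp : p ∈ Tge2 k ι) :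
    epsT k ι (dLT χ i p) = 0 := by
  refine Submodule.span_induction (p := fun p _ => epsT k ι (dLT χ i p) = 0) ?_ ?_ ?_ ?_ hp
  · rintro _ ⟨l, hl, rfl⟩
    match l with
    | [] => simp at hl
    | [j] => simp at hl
    | j :: m :: l =>
      rw [word_cons, dLT_X_mul, map_add, map_smul, map_smul, epsT_word_cons]
      simp
  · simp
  · intro u v _ _ hu hv
    rw [map_add, map_add, hu, hv, add_zero]
  · intro c u _ hu
    rw [map_smul, map_smul, hu, smul_zero]

theorem dLT_eq_coproduct (χ : SymBichar k ι) (i : ι) (p : T k ι) : dLT χ i p =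
    epsLeft k ι (LinearMap.rTensor _ (dLT χ i) (brComulₗ χ p)) := by
  rw [dLT_rTensor_brComul, epsLeft_brComul]

theorem IsGradedBiideal.le_radT {χ : SymBichar k ι} {J : Submodule k (T k ι)}
    (hJ : IsGradedBiideal χ J) : J ≤ radT χ := by
  refine SymPair.le_radT χ J (fun p hp => epsT_Tge2 (hJ.le_ge2 hp)) fun i p hp => ?_
  have hle : LinearMap.range (TensorProduct.map J.subtype (LinearMap.id : T k ι →ₗ[k] T k ι)) ⊔
      LinearMap.range (TensorProduct.map (LinearMap.id : T k ι →ₗ[k] T k ι) J.subtype) ≤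
      J.comap (epsLeft k ι ∘ₗ LinearMap.rTensor _ (dLT χ i)) := by
    refine sup_le ?_ ?_
    · rintro _ ⟨z, rfl⟩
      rw [Submodule.mem_comap]
      induction z with
      | zero => simp
      | tmul u v => simp [epsT_dLT_Tge2 χ i (hJ.le_ge2 u.2)]
      | add x y hx hy => rw [map_add, map_add]; exact add_mem hx hy
    · rintro _ ⟨z, rfl⟩
      rw [Submodule.mem_comap]
      induction z with
      | zero => simp
      | tmul u v => simpa using Submodule.smul_mem _ _ v.2
      | add x y hx hy => rw [map_add, map_add]; exact add_mem hx hy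
  rw [dLT_eq_coproduct]
  exact hle (hJ.coideal p hp)

theorem Imax_eq_radT (χ : SymBichar k ι) : Imax χ = radT χ :=
  le_antisymm (sSup_le fun _ hJ => IsGradedBiideal.le_radT hJ)
    (le_Imax χ (radT_isGradedBiideal χ))

theorem Imax_isGradedBiideal (χ : SymBichar k ι) : IsGradedBiideal χ (Imax χ) :=
  Imax_eq_radT χ ▸ radT_isGradedBiideal χ

/-! ### Bicharacter identities -/

theorem val_add_left (χ : SymBichar k ι) (a b c : ι → ℤ) :
    χ.val (a + b) c = χ.val a c * χ.val b c := by
  simp [SymBichar.val, χ.map_add_left]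

theorem val_add_right (χ : SymBichar k ι) (a b c : ι → ℤ) :
    χ.val a (b + c) = χ.val a b * χ.val a c := by
  simp [SymBichar.val, χ.map_add_right]

/-- A bicharacter is determined by its values on the standard basis. -/
theorem bichar_ext (f g : (ι → ℤ) → (ι → ℤ) → kˣ)
    (fl : ∀ a b c, f (a + b) c = f a c * f b c) (fr : ∀ a b c, f a (b + c) = f a b * f a c)
    (gl : ∀ a b c, g (a + b) c = g a c * g b c) (gr : ∀ a b c, g a (b + c) = g a b * g a c)
    (h : ∀ i j, f (α i) (α j) = g (α i) (α j)) (a b : ι → ℤ) : f a b = g a b := by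
  have aux : ∀ (f g : (ι → ℤ) → kˣ), (∀ a b, f (a + b) = f a * f b) →
      (∀ a b, g (a + b) = g a * g b) → (∀ i, f (α i) = g (α i)) → ∀ a, f a = g a := by
    intro f g hf hg h a
    let F : (ι → ℤ) →+ Additive kˣ := AddMonoidHom.mk' (fun a => Additive.ofMul (f a)) hf
    let G : (ι → ℤ) →+ Additive kˣ := AddMonoidHom.mk' (fun a => Additive.ofMul (g a)) hg
    have : F = G := by
      refine AddMonoidHom.functions_ext' _ _ _ fun i => ?_
      refine AddMonoidHom.ext_int ?_
      exact congrArg Additive.ofMul (h i)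
    exact congrArg Additive.toMul (DFunLike.congr_fun this a)
  exact aux (fun a => f a b) (fun a => g a b) (fun a c => fl a c b) (fun a c => gl a c b)
    (fun i => aux (f (α i)) (g (α i)) (fr _) (gr _) (h i) b) a

theorem val_symm (χ : SymBichar k ι) (a b : ι → ℤ) : χ.val a b = χ.val b a :=
  congrArg Units.val (bichar_ext χ.toFun (fun a b => χ.toFun b a) χ.map_add_left χ.map_add_right
    (fun a b c => χ.map_add_right c a b) (fun a b c => χ.map_add_left b c a) χ.symm a b)

@[simp] theorem val_zero_left (χ : SymBichar k ι) (a : ι → ℤ) : χ.val 0 a = 1 := by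
  have h := val_add_left χ 0 0 a
  rw [add_zero] at h
  exact (mul_eq_left₀ (val_ne_zero χ 0 a)).1 h.symm

@[simp] theorem val_zero_right (χ : SymBichar k ι) (a : ι → ℤ) : χ.val a 0 = 1 := by
  rw [val_symm, val_zero_left]

theorem val_sub_left (χ : SymBichar k ι) (a b c : ι → ℤ) :
    χ.val (a - b) c = χ.val a c * (χ.val b c)⁻¹ := by
  rw [sub_eq_add_neg, val_add_left, val_neg_left]

theorem val_comp_perm (χ : SymBichar k ι) {τ : Equiv.Perm ι}
    (hχτ : ∀ i j, χ.q (τ i) (τ j) = χ.q i j) (a b : ι → ℤ) :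
    χ.val (a ∘ τ) (b ∘ τ) = χ.val a b := by
  have hα : ∀ i, α i ∘ τ = α (τ.symm i) := by
    intro i
    ext j
    simp [α, Pi.single_apply, Equiv.eq_symm_apply]
  refine congrArg Units.val (bichar_ext (fun a b => χ.toFun (a ∘ τ) (b ∘ τ)) χ.toFun
    (fun a b c => χ.map_add_left _ _ _) (fun a b c => χ.map_add_right _ _ _) χ.map_add_left
    χ.map_add_right (fun i j => Units.ext ?_) a b)
  have := hχτ (τ.symm i) (τ.symm j)
  simp only [Equiv.apply_symm_apply] at this
  simp only [hα]
  exact this.symm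

theorem q_eq (χ : SymBichar k ι) (i j : ι) : χ.q i j = χ.val (α i) (α j) := rfl

theorem up_single (i : ι) : up (Pi.single i 1 : ι → ℕ) = α i := by
  ext j
  by_cases h : j = i
  · subst h; simp [up, α]
  · simp [up, α, h]

theorem up_add (μ ν : ι → ℕ) : up (μ + ν) = up μ + up ν := by
  ext; simp [up]

@[simp] theorem up_zero : up (0 : ι → ℕ) = 0 := by
  ext; simp [up]

/-! ### Twisted multiples of algebra homomorphisms -/

/-- The product of `s i j` over all pairs of letters of a word. -/
def pairProd (s : ι → ι → k) : List ι → k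
  | [] => 1
  | i :: l => (l.map (s i)).prod * pairProd s l

theorem pairProd_perm (s : ι → ι → k) (hs : ∀ i j, s i j = s j i) {l l' : List ι}
    (h : l.Perm l') : pairProd s l = pairProd s l' := by
  induction h with
  | nil => rfl
  | cons i h ih => simp only [pairProd, ih, (h.map (s i)).prod_eq]
  | swap i j l =>
    simp only [pairProd, List.map_cons, List.prod_cons, hs i j]
    ring
  | trans _ _ h1 h2 => exact h1.trans h2

/-- If `f(x_i) = u_i g(x_i)`, where the `u_i` commute with each other and commute with the
`g(x_j)` up to a symmetric matrix of scalars, then `f` kills a graded ideal killed by `g`. -/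
theorem graded_kill_twisted {A : Type*} [Ring A] [Algebra k A] (f g : T k ι →ₐ[k] A) (u : ι → A)
    (s : ι → ι → k) (hs : ∀ i j, s i j = s j i)
    (hfg : ∀ i, f (FreeAlgebra.ι k i) = u i * g (FreeAlgebra.ι k i))
    (huu : ∀ i j, u i * u j = u j * u i)
    (hug : ∀ i j, g (FreeAlgebra.ι k i) * u j = s i j • (u j * g (FreeAlgebra.ι k i)))
    (J : Submodule k (T k ι)) (hJ : J ≤ ⨆ μ : ι → ℕ, J ⊓ Twt k μ)
    (hg : ∀ p ∈ J, g p = 0) : ∀ p ∈ J, f p = 0 := by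
  have hw : ∀ l : List ι, f (word k l) = pairProd s l • ((l.map u).prod * g (word k l)) := by
    intro l
    have hc : ∀ i (l : List ι), g (FreeAlgebra.ι k i) * (l.map u).prod =
        (l.map (s i)).prod • ((l.map u).prod * g (FreeAlgebra.ι k i)) := by
      intro i l
      induction l with
      | nil => simp
      | cons j l ih =>
        rw [List.map_cons, List.prod_cons, ← mul_assoc, hug, smul_mul_assoc, mul_assoc, ih,
          mul_smul_comm, smul_smul, mul_assoc, List.map_cons, List.prod_cons]
    induction l with
    | nil => simp [word, pairProd]
    | cons i l ih =>
      rw [word_cons, map_mul, map_mul, hfg, ih, List.map_cons, List.prod_cons, mul_smul_comm,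
        mul_assoc, ← mul_assoc (g _), hc, smul_mul_assoc, mul_smul_comm, smul_smul, pairProd,
        mul_comm (pairProd s l)]
      simp only [mul_assoc]
  have key : J ≤ LinearMap.ker f.toLinearMap := by
    refine hJ.trans (iSup_le fun μ => ?_)
    rintro p ⟨hpJ, hpμ⟩
    have hU : ∃ (r : k) (c : A), ∀ l : List ι, (∀ i, l.count i = μ i) →
        pairProd s l = r ∧ (l.map u).prod = c := by
      by_cases h : ∃ l₀ : List ι, ∀ i, l₀.count i = μ i
      · obtain ⟨l₀, hl₀⟩ := h
        refine ⟨pairProd s l₀, (l₀.map u).prod, fun l hl => ?_⟩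
        have hp : l.Perm l₀ := List.perm_iff_count.2 fun i => by rw [hl, hl₀]
        refine ⟨pairProd_perm s hs hp, List.Perm.prod_eq' (hp.map u) ?_⟩
        rw [List.pairwise_map]
        exact List.pairwise_of_forall fun i j => huu i j
      · exact ⟨0, 0, fun l hl => (h ⟨l, hl⟩).elim⟩
    obtain ⟨r, c, hc⟩ := hU
    have hfp : f p = r • (c * g p) := by
      refine Submodule.span_induction (p := fun p _ => f p = r • (c * g p)) ?_ ?_ ?_ ?_ hpμ
      · rintro _ ⟨l, hl, rfl⟩
        rw [hw, (hc l hl).1, (hc l hl).2]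
      · simp
      · intro x y _ _ hx hy
        rw [map_add, map_add, hx, hy, mul_add, smul_add]
      · intro a x _ hx
        rw [map_smul, map_smul, hx, mul_smul_comm, smul_comm]
    rw [LinearMap.mem_ker]
    simp [hfp, hg p hpJ]
  intro p hp
  exact key hp

/-! ### The Nichols algebra -/

/-- `I_max` as an ideal. -/
def NicIdeal (χ : SymBichar k ι) : Ideal (T k ι) where
  carrier := Imax χ
  add_mem' := add_mem
  zero_mem' := zero_mem _
  smul_mem' x p hp := (Imax_isGradedBiideal χ).mul_left x p hp

instance (χ : SymBichar k ι) : (NicIdeal χ).IsTwoSided :=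
  ⟨fun x hp => (Imax_isGradedBiideal χ).mul_right x _ hp⟩

/-- The Nichols algebra `T(V) / I_max`. -/
def Nic (χ : SymBichar k ι) : Type _ := T k ι ⧸ NicIdeal χ

instance (χ : SymBichar k ι) : Ring (Nic χ) := inferInstanceAs (Ring (T k ι ⧸ NicIdeal χ))

instance (χ : SymBichar k ι) : Algebra k (Nic χ) :=
  inferInstanceAs (Algebra k (T k ι ⧸ NicIdeal χ))

/-- The quotient map. -/
def mkN (χ : SymBichar k ι) : T k ι →ₐ[k] Nic χ := Ideal.Quotient.mkₐ k (NicIdeal χ)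

theorem mkN_surjective (χ : SymBichar k ι) : Function.Surjective (mkN χ) :=
  Ideal.Quotient.mkₐ_surjective k (NicIdeal χ)

theorem mkN_eq_zero {χ : SymBichar k ι} {p : T k ι} : mkN χ p = 0 ↔ p ∈ Imax χ :=
  Ideal.Quotient.eq_zero_iff_mem (I := NicIdeal χ)

/-- Algebra homomorphisms out of the Nichols algebra. -/
def liftN (χ : SymBichar k ι) {A : Type*} [Ring A] [Algebra k A] (f : T k ι →ₐ[k] A)
    (hf : ∀ p ∈ Imax χ, f p = 0) : Nic χ →ₐ[k] A :=
  Ideal.Quotient.liftₐ (NicIdeal χ) f hf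

@[simp] theorem liftN_mk (χ : SymBichar k ι) {A : Type*} [Ring A] [Algebra k A]
    (f : T k ι →ₐ[k] A) (hf : ∀ p ∈ Imax χ, f p = 0) (p : T k ι) :
    liftN χ f hf (mkN χ p) = f p := rfl

/-- The generators of the Nichols algebra. -/
def nx (χ : SymBichar k ι) (i : ι) : Nic χ := mkN χ (FreeAlgebra.ι k i)

theorem mkN_X (χ : SymBichar k ι) (i : ι) : mkN χ (FreeAlgebra.ι k i) = nx χ i := rfl

theorem Nic_induction {χ : SymBichar k ι} {P : Nic χ → Prop} (one : P 1)
    (mul : ∀ i u, P u → P (nx χ i * u)) (add : ∀ u v, P u → P v → P (u + v))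
    (smul : ∀ (c : k) u, P u → P (c • u)) (u : Nic χ) : P u := by
  obtain ⟨p, rfl⟩ := mkN_surjective χ u
  refine T_induction (P := fun p => P (mkN χ p)) (by simpa using one) ?_ ?_ ?_ p
  · intro i u hu
    rw [map_mul]
    exact mul _ _ hu
  · intro u v hu hv
    rw [map_add]
    exact add _ _ hu hv
  · intro c u hu
    rw [map_smul]
    exact smul _ _ hu

theorem Nic_hom_ext {χ : SymBichar k ι} {M : Type*} [AddCommGroup M] [Module k M]
    {f g : Nic χ →ₗ[k] M} (one : f 1 = g 1)
    (mul : ∀ i u, f u = g u → f (nx χ i * u) = g (nx χ i * u)) : f = g :=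
  LinearMap.ext fun p => Nic_induction (P := fun p => f p = g p) one mul
    (fun u v hu hv => by rw [map_add, map_add, hu, hv])
    (fun c u hu => by rw [map_smul, map_smul, hu]) p

theorem Nic_algHom_ext {χ : SymBichar k ι} {A : Type*} [Ring A] [Algebra k A]
    {f g : Nic χ →ₐ[k] A} (h : ∀ i, f (nx χ i) = g (nx χ i)) : f = g := by
  have : f.toLinearMap = g.toLinearMap := Nic_hom_ext (by simp) fun i u hu => by
    have hu' : f u = g u := hu
    simp [h, hu']
  exact AlgHom.toLinearMap_injective this

/-- Linear maps out of the Nichols algebra. -/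
def descend (χ : SymBichar k ι) {M : Type*} [AddCommGroup M] [Module k M] (f : T k ι →ₗ[k] M)
    (hf : ∀ p ∈ radT χ, f p = 0) : Nic χ →ₗ[k] M :=
  (LinearMap.ker (mkN χ).toLinearMap).liftQ f (by
    intro p hp
    refine hf p ?_
    rw [← Imax_eq_radT, ← mkN_eq_zero]
    exact hp) ∘ₗ
    ((mkN χ).toLinearMap.quotKerEquivOfSurjective (mkN_surjective χ)).symm.toLinearMap

@[simp] theorem descend_mk (χ : SymBichar k ι) {M : Type*} [AddCommGroup M] [Module k M]
    (f : T k ι →ₗ[k] M) (hf : ∀ p ∈ radT χ, f p = 0) (p : T k ι) :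
    descend χ f hf (mkN χ p) = f p := by
  have : ((mkN χ).toLinearMap.quotKerEquivOfSurjective (mkN_surjective χ)).symm (mkN χ p) =
      Submodule.Quotient.mk p := by
    rw [LinearEquiv.symm_apply_eq]
    rfl
  rw [descend, LinearMap.comp_apply, LinearEquiv.coe_coe, this]
  rfl

theorem mkN_radT {χ : SymBichar k ι} {p : T k ι} (hp : p ∈ radT χ) : mkN χ p = 0 := by
  rwa [mkN_eq_zero, Imax_eq_radT]

/-- The scaling automorphism of the Nichols algebra. -/
def S (χ : SymBichar k ι) (a : ι → ℤ) : Nic χ →ₐ[k] Nic χ :=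
  liftN χ ((mkN χ).comp (scT χ a)) (by
    intro p hp
    exact mkN_radT (scT_radT a (Imax_eq_radT χ ▸ hp)))

@[simp] theorem S_x (χ : SymBichar k ι) (a : ι → ℤ) (i : ι) :
    S χ a (nx χ i) = χ.val a (α i) • nx χ i := by
  refine (liftN_mk χ _ _ (FreeAlgebra.ι k i)).trans ?_
  simp [← mkN_X]

theorem S_mk (χ : SymBichar k ι) (a : ι → ℤ) (p : T k ι) :
    S χ a (mkN χ p) = mkN χ (scT χ a p) := rfl

theorem S_add (χ : SymBichar k ι) (a b : ι → ℤ) (u : Nic χ) :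
    S χ (a + b) u = S χ a (S χ b u) := by
  have : S χ (a + b) = (S χ a).comp (S χ b) := Nic_algHom_ext fun i => by
    simp [val_add_left, smul_smul, mul_comm]
  exact AlgHom.congr_fun this u

@[simp] theorem S_zero (χ : SymBichar k ι) (u : Nic χ) : S χ 0 u = u := by
  have : S χ 0 = AlgHom.id k _ := Nic_algHom_ext fun i => by simp
  exact AlgHom.congr_fun this u

/-- The left skew derivation of the Nichols algebra. -/
def dL (χ : SymBichar k ι) (i : ι) : Nic χ →ₗ[k] Nic χ :=
  descend χ ((mkN χ).toLinearMap ∘ₗ dLT χ i) (by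
    intro p hp
    exact mkN_radT (dLT_radT i hp))

theorem dL_mk (χ : SymBichar k ι) (i : ι) (p : T k ι) :
    dL χ i (mkN χ p) = mkN χ (dLT χ i p) := descend_mk χ _ _ p

/-- The right skew derivation of the Nichols algebra. -/
def dR (χ : SymBichar k ι) (i : ι) : Nic χ →ₗ[k] Nic χ :=
  descend χ ((mkN χ).toLinearMap ∘ₗ dRT χ i) (by
    intro p hp
    exact mkN_radT (dRT_radT i hp))

theorem dR_mk (χ : SymBichar k ι) (i : ι) (p : T k ι) :
    dR χ i (mkN χ p) = mkN χ (dRT χ i p) := descend_mk χ _ _ p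

@[simp] theorem dL_one (χ : SymBichar k ι) (i : ι) : dL χ i 1 = 0 := by
  rw [← map_one (mkN χ), dL_mk]; simp

@[simp] theorem dR_one (χ : SymBichar k ι) (i : ι) : dR χ i 1 = 0 := by
  rw [← map_one (mkN χ), dR_mk]; simp

@[simp] theorem dL_x (χ : SymBichar k ι) (i j : ι) :
    dL χ i (nx χ j) = if i = j then 1 else 0 := by
  rw [← mkN_X, dL_mk, dLT_X]
  split_ifs <;> simp

@[simp] theorem dR_x (χ : SymBichar k ι) (i j : ι) :
    dR χ i (nx χ j) = if i = j then 1 else 0 := by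
  rw [← mkN_X, dR_mk, dRT_X]
  split_ifs <;> simp

theorem dL_mul (χ : SymBichar k ι) (i : ι) (u v : Nic χ) :
    dL χ i (u * v) = dL χ i u * v + S χ (α i) u * dL χ i v := by
  obtain ⟨u, rfl⟩ := mkN_surjective χ u
  obtain ⟨v, rfl⟩ := mkN_surjective χ v
  simp only [← map_mul, dL_mk, S_mk, dLT_mul, map_add]

theorem dR_mul (χ : SymBichar k ι) (i : ι) (u v : Nic χ) :
    dR χ i (u * v) = u * dR χ i v + dR χ i u * S χ (α i) v := by
  obtain ⟨u, rfl⟩ := mkN_surjective χ u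
  obtain ⟨v, rfl⟩ := mkN_surjective χ v
  simp only [← map_mul, dR_mk, S_mk, dRT_mul, map_add]

theorem dL_x_mul (χ : SymBichar k ι) (i j : ι) (u : Nic χ) :
    dL χ i (nx χ j * u) = (if i = j then u else 0) + χ.q i j • (nx χ j * dL χ i u) := by
  rw [dL_mul, dL_x, S_x, ite_mul, one_mul, zero_mul, smul_mul_assoc, q_eq]

theorem dR_mul_x (χ : SymBichar k ι) (i j : ι) (u : Nic χ) :
    dR χ i (u * nx χ j) = (if i = j then u else 0) + χ.q i j • (dR χ i u * nx χ j) := by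
  rw [dR_mul, dR_x, S_x, mul_ite, mul_one, mul_zero, mul_smul_comm, q_eq]

theorem dL_S (χ : SymBichar k ι) (i : ι) (a : ι → ℤ) (u : Nic χ) :
    dL χ i (S χ a u) = χ.val a (α i) • S χ a (dL χ i u) := by
  obtain ⟨u, rfl⟩ := mkN_surjective χ u
  simp only [dL_mk, S_mk, dLT_scT, map_smul]

theorem dR_S (χ : SymBichar k ι) (i : ι) (a : ι → ℤ) (u : Nic χ) :
    dR χ i (S χ a u) = χ.val a (α i) • S χ a (dR χ i u) := by
  obtain ⟨u, rfl⟩ := mkN_surjective χ u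
  simp only [dR_mk, S_mk, dRT_scT, map_smul]

theorem dL_dR (χ : SymBichar k ι) (i j : ι) (u : Nic χ) :
    dL χ i (dR χ j u) = dR χ j (dL χ i u) := by
  obtain ⟨u, rfl⟩ := mkN_surjective χ u
  simp only [dL_mk, dR_mk, dLT_dRT]

/-- The counit of the Nichols algebra. -/
def epsN (χ : SymBichar k ι) : Nic χ →ₐ[k] k :=
  liftN χ (epsT k ι) (by
    intro p hp
    exact epsT_radT (χ := χ) (Imax_eq_radT χ ▸ hp))

@[simp] theorem epsN_x (χ : SymBichar k ι) (i : ι) : epsN χ (nx χ i) = 0 := by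
  simp [epsN, ← mkN_X]

theorem epsN_mk (χ : SymBichar k ι) (p : T k ι) : epsN χ (mkN χ p) = epsT k ι p := rfl

@[simp] theorem epsN_S (χ : SymBichar k ι) (a : ι → ℤ) (u : Nic χ) :
    epsN χ (S χ a u) = epsN χ u := by
  obtain ⟨u, rfl⟩ := mkN_surjective χ u
  simp only [S_mk, epsN_mk, epsT_scT]

/-- The bilinear form of the Nichols algebra. -/
def formN (χ : SymBichar k ι) : Nic χ →ₗ[k] Nic χ →ₗ[k] k :=
  descend χ (M := Nic χ →ₗ[k] k) (LinearMap.flip (descend χ (formT χ).flip (by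
    intro p hp
    ext w
    exact mem_radT.1 hp w))) (by
    intro p hp
    ext u
    obtain ⟨u, rfl⟩ := mkN_surjective χ u
    simp only [LinearMap.flip_apply, descend_mk, LinearMap.zero_apply]
    rw [formT_symm]
    exact mem_radT.1 hp u)

theorem formN_mk (χ : SymBichar k ι) (p w : T k ι) :
    formN χ (mkN χ p) (mkN χ w) = formT χ p w := by
  simp [formN]

@[simp] theorem formN_one (χ : SymBichar k ι) (u : Nic χ) : formN χ 1 u = epsN χ u := by
  obtain ⟨u, rfl⟩ := mkN_surjective χ u
  rw [← map_one (mkN χ), formN_mk, formT_one, epsN_mk]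

theorem formN_symm (χ : SymBichar k ι) (u v : Nic χ) : formN χ u v = formN χ v u := by
  obtain ⟨u, rfl⟩ := mkN_surjective χ u
  obtain ⟨v, rfl⟩ := mkN_surjective χ v
  rw [formN_mk, formN_mk, formT_symm]

theorem formN_x_mul (χ : SymBichar k ι) (i : ι) (u v : Nic χ) :
    formN χ (nx χ i * u) v = formN χ u (dL χ i v) := by
  obtain ⟨u, rfl⟩ := mkN_surjective χ u
  obtain ⟨v, rfl⟩ := mkN_surjective χ v
  rw [← mkN_X, ← map_mul, formN_mk, dL_mk, formN_mk, formT_X_mul]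

theorem formN_mul_x (χ : SymBichar k ι) (i : ι) (u v : Nic χ) :
    formN χ (u * nx χ i) v = formN χ u (dR χ i v) := by
  obtain ⟨u, rfl⟩ := mkN_surjective χ u
  obtain ⟨v, rfl⟩ := mkN_surjective χ v
  rw [← mkN_X, ← map_mul, formN_mk, dR_mk, formN_mk, formT_mul_X]

theorem formN_S (χ : SymBichar k ι) (a : ι → ℤ) (u v : Nic χ) :
    formN χ (S χ a u) v = formN χ u (S χ a v) := by
  refine Nic_induction (P := fun u => ∀ v, formN χ (S χ a u) v = formN χ u (S χ a v))
    ?_ ?_ ?_ ?_ u v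
  · intro v; simp
  · intro i u hu v
    rw [map_mul, S_x, smul_mul_assoc, map_smul, LinearMap.smul_apply, formN_x_mul, hu,
      formN_x_mul, dL_S, map_smul]
  · intro u v hu hv w
    simp [hu, hv]
  · intro c u hu w
    simp [hu]

theorem formN_nondeg (χ : SymBichar k ι) {u : Nic χ} (h : ∀ w, formN χ w u = 0) : u = 0 := by
  obtain ⟨u, rfl⟩ := mkN_surjective χ u
  refine mkN_radT (mem_radT.2 fun w => ?_)
  rw [← formN_mk, h]

theorem eq_zero_of_dL (χ : SymBichar k ι) {u : Nic χ} (h0 : epsN χ u = 0)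
    (h : ∀ i, dL χ i u = 0) : u = 0 := by
  refine formN_nondeg χ fun w => ?_
  refine Nic_induction (P := fun w => formN χ w u = 0) (by simpa using h0) ?_ ?_ ?_ w
  · intro i w _
    rw [formN_x_mul, h, map_zero]
  · intro v w hv hw
    simp [hv, hw]
  · intro c w hw
    simp [hw]

/-- Induction on words, letters being added on the right. -/
theorem Nic_induction_right {χ : SymBichar k ι} {P : Nic χ → Prop} (one : P 1)
    (mul : ∀ i u, P u → P (u * nx χ i)) (add : ∀ u v, P u → P v → P (u + v))
    (smul : ∀ (c : k) u, P u → P (c • u)) (u : Nic χ) : P u := by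
  obtain ⟨p, rfl⟩ := mkN_surjective χ u
  rw [← rev_rev p]
  refine T_induction (P := fun p => P (mkN χ (rev k ι p))) (by simpa using one) ?_ ?_ ?_
    (rev k ι p)
  · intro i u hu
    simp only [rev_mul, rev_X, map_mul]
    exact mul _ _ hu
  · intro u v hu hv
    rw [map_add, map_add]
    exact add _ _ hu hv
  · intro c u hu
    rw [map_smul, map_smul]
    exact smul _ _ hu

theorem eq_zero_of_dR (χ : SymBichar k ι) {u : Nic χ} (h0 : epsN χ u = 0)
    (h : ∀ i, dR χ i u = 0) : u = 0 := by
  refine formN_nondeg χ fun w => ?_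
  refine Nic_induction_right (P := fun w => formN χ w u = 0) (by simpa using h0) ?_ ?_ ?_ w
  · intro i w _
    rw [formN_mul_x, h, map_zero]
  · intro v w hv hw
    simp [hv, hw]
  · intro c w hw
    simp [hw]

theorem lift_dR_formN (χ : SymBichar k ι) (p : T k ι) (v w : Nic χ) :
    formN χ w ((FreeAlgebra.lift k (dR χ) p : Module.End k (Nic χ)) v) =
      formN χ (w * mkN χ p) v := by
  refine T_induction (P := fun p => ∀ w, formN χ w ((FreeAlgebra.lift k (dR χ) p :
    Module.End k (Nic χ)) v) = formN χ (w * mkN χ p) v) ?_ ?_ ?_ ?_ p w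
  · intro w; simp
  · intro i u hu w
    rw [map_mul, FreeAlgebra.lift_ι_apply, Module.End.mul_apply, ← formN_mul_x, hu,
      map_mul (mkN χ), mkN_X, mul_assoc]
  · intro u u' hu hu' w
    simp [hu, hu', mul_add]
  · intro c u hu w
    simp [hu]

theorem lift_dR_Imax (χ : SymBichar k ι) (p : T k ι) (hp : p ∈ Imax χ) :
    (FreeAlgebra.lift k (dR χ) p : Module.End k (Nic χ)) = 0 := by
  ext v
  refine formN_nondeg χ fun w => ?_
  rw [lift_dR_formN, mkN_eq_zero.2 hp]
  simp

theorem lift_dL_formN (χ : SymBichar k ι) (p : T k ι) (v w : Nic χ) :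
    formN χ w ((FreeAlgebra.lift k (dL χ) p : Module.End k (Nic χ)) v) =
      formN χ (mkN χ (rev k ι p) * w) v := by
  refine T_induction (P := fun p => ∀ w, formN χ w ((FreeAlgebra.lift k (dL χ) p :
    Module.End k (Nic χ)) v) = formN χ (mkN χ (rev k ι p) * w) v) ?_ ?_ ?_ ?_ p w
  · intro w; simp
  · intro i u hu w
    rw [map_mul, FreeAlgebra.lift_ι_apply, Module.End.mul_apply, ← formN_x_mul, hu, rev_mul,
      rev_X, map_mul (mkN χ), mkN_X, mul_assoc]
  · intro u u' hu hu' w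
    simp [hu, hu', add_mul]
  · intro c u hu w
    simp [hu]

theorem lift_dL_Imax (χ : SymBichar k ι) (p : T k ι) (hp : p ∈ Imax χ) :
    (FreeAlgebra.lift k (dL χ) p : Module.End k (Nic χ)) = 0 := by
  ext v
  refine formN_nondeg χ fun w => ?_
  rw [Imax_eq_radT] at hp
  rw [lift_dL_formN, mkN_radT (rev_radT hp)]
  simp

/-! ### Weights in the Nichols algebra -/

/-- The homogeneous component of weight `μ` of the Nichols algebra. -/
def Nwt (χ : SymBichar k ι) (μ : ι → ℕ) : Submodule k (Nic χ) := (Twt k μ).map (mkN χ).toLinearMap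

/-- The projection of the Nichols algebra onto the component of weight `μ`. -/
def prN (χ : SymBichar k ι) (μ : ι → ℕ) : Nic χ →ₗ[k] Nic χ :=
  descend χ ((mkN χ).toLinearMap ∘ₗ prT k μ) (by
    intro p hp
    exact mkN_radT (prT_radT μ hp))

theorem prN_mk (χ : SymBichar k ι) (μ : ι → ℕ) (p : T k ι) :
    prN χ μ (mkN χ p) = mkN χ (prT k μ p) := descend_mk χ _ _ p

theorem prN_mem (χ : SymBichar k ι) (μ : ι → ℕ) (u : Nic χ) : prN χ μ u ∈ Nwt χ μ := by
  obtain ⟨p, rfl⟩ := mkN_surjective χ u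
  rw [prN_mk]
  exact ⟨_, prT_mem μ p, rfl⟩

theorem prN_of_mem {χ : SymBichar k ι} {μ : ι → ℕ} {u : Nic χ} (hu : u ∈ Nwt χ μ)
    (ν : ι → ℕ) : prN χ ν u = if μ = ν then u else 0 := by
  obtain ⟨p, hp, rfl⟩ := hu
  simp only [AlgHom.toLinearMap_apply, prN_mk, prT_of_mem hp]
  split_ifs <;> simp

theorem sum_prN {χ : SymBichar k ι} (u : Nic χ) : ∃ s : Finset (ι → ℕ), u = ∑ μ ∈ s, prN χ μ u ∧
    ∀ μ ∉ s, prN χ μ u = 0 := by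
  obtain ⟨p, rfl⟩ := mkN_surjective χ u
  obtain ⟨s, hs, h0⟩ := sum_prT p
  refine ⟨s, ?_, fun μ hμ => by rw [prN_mk, h0 μ hμ, map_zero]⟩
  simp only [prN_mk]
  rw [← map_sum, ← hs]

theorem Nwt_induction {χ : SymBichar k ι} {P : Nic χ → Prop}
    (hw : ∀ μ, ∀ u ∈ Nwt χ μ, P u) (add : ∀ u v, P u → P v → P (u + v)) (u : Nic χ) : P u := by
  obtain ⟨s, hs, -⟩ := sum_prN u
  rw [hs]
  exact Finset.sum_induction _ _ add (hw 0 0 (zero_mem _)) fun μ _ => hw μ _ (prN_mem χ μ u)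

theorem one_mem_Nwt (χ : SymBichar k ι) : (1 : Nic χ) ∈ Nwt χ 0 :=
  ⟨1, Submodule.subset_span ⟨[], by simp [word]⟩, by simp⟩

theorem x_mul_mem_Nwt {χ : SymBichar k ι} {μ : ι → ℕ} {u : Nic χ} (hu : u ∈ Nwt χ μ) (i : ι) :
    nx χ i * u ∈ Nwt χ (Pi.single i 1 + μ) := by
  obtain ⟨p, hp, rfl⟩ := hu
  refine ⟨FreeAlgebra.ι k i * p, ?_, by simp [mkN_X]⟩
  refine Submodule.span_induction (p := fun p _ => FreeAlgebra.ι k i * p ∈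
    (Twt k (Pi.single i 1 + μ) : Set (T k ι))) ?_ ?_ ?_ ?_ hp
  · rintro _ ⟨l, hl, rfl⟩
    rw [← word_cons]
    have : cnt l = μ := funext hl
    rw [← this, ← cnt_cons]
    exact word_mem_Twt _
  · simp
  · intro x y _ _ hx hy
    rw [mul_add]; exact add_mem hx hy
  · intro c x _ hx
    rw [mul_smul_comm]; exact Submodule.smul_mem _ c hx

/-- Induction on homogeneous elements. -/
theorem Nwt_word_induction {χ : SymBichar k ι} {P : (ι → ℕ) → Nic χ → Prop} (one : P 0 1)
    (mul : ∀ i μ u, u ∈ Nwt χ μ → P μ u → P (Pi.single i 1 + μ) (nx χ i * u))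
    (zero : ∀ μ, P μ 0) (add : ∀ μ u v, P μ u → P μ v → P μ (u + v))
    (smul : ∀ μ (c : k) u, P μ u → P μ (c • u)) {μ : ι → ℕ} {u : Nic χ} (hu : u ∈ Nwt χ μ) :
    P μ u := by
  have hword : ∀ l, P (cnt l) (mkN χ (word k l)) := by
    intro l
    induction l with
    | nil =>
      have : cnt ([] : List ι) = 0 := by ext; simp [cnt]
      simpa [this, word] using one
    | cons i l ih =>
      rw [cnt_cons, word_cons, map_mul]
      exact mul i _ _ ⟨_, word_mem_Twt l, rfl⟩ ih
  obtain ⟨p, hp, rfl⟩ := hu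
  refine Submodule.span_induction (p := fun p _ => P μ (mkN χ p)) ?_ ?_ ?_ ?_ hp
  · rintro _ ⟨l, hl, rfl⟩
    have : cnt l = μ := funext hl
    rw [← this]
    exact hword l
  · simpa using zero μ
  · intro x y _ _ hx hy
    rw [map_add]; exact add _ _ _ hx hy
  · intro c x _ hx
    rw [map_smul]; exact smul _ _ _ hx

theorem S_of_mem {χ : SymBichar k ι} {μ : ι → ℕ} {u : Nic χ} (hu : u ∈ Nwt χ μ) (a : ι → ℤ) :
    S χ a u = χ.val a (up μ) • u := by
  refine Nwt_word_induction (P := fun μ u => S χ a u = χ.val a (up μ) • u) ?_ ?_ ?_ ?_ ?_ hu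
  · simp
  · intro i μ u _ h
    rw [map_mul, h, S_x, up_add, up_single, val_add_right, smul_mul_assoc, mul_smul_comm,
      smul_smul]
  · simp
  · intro μ u v hu hv
    rw [map_add, hu, hv, smul_add]
  · intro μ c u hu
    rw [map_smul, hu, smul_comm]

theorem prN_dL {χ : SymBichar k ι} (i : ι) (μ : ι → ℕ) (u : Nic χ) :
    prN χ μ (dL χ i u) = dL χ i (prN χ (Pi.single i 1 + μ) u) := by
  obtain ⟨p, rfl⟩ := mkN_surjective χ u
  rw [dL_mk, prN_mk, prN_mk, dL_mk, dLT_prT]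

/-! ### The regular representation and the triangular decomposition -/

/-- The space underlying the regular representation: `E K_a F` is written `om a E F`. -/
abbrev Om (χ : SymBichar k ι) := (ι → ℤ) →₀ (Nic χ ⊗[k] Nic χ)

/-- The element of `Om` corresponding to `u K_a v`. -/
def om (χ : SymBichar k ι) (a : ι → ℤ) : Nic χ →ₗ[k] Nic χ →ₗ[k] Om χ :=
  (TensorProduct.mk k (Nic χ) (Nic χ)).compr₂ (Finsupp.lsingle a)

theorem om_apply (χ : SymBichar k ι) (a : ι → ℤ) (u v : Nic χ) :
    om χ a u v = Finsupp.single a (u ⊗ₜ[k] v) := rfl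

theorem Om_hom_ext {χ : SymBichar k ι} {M : Type*} [AddCommGroup M] [Module k M]
    {f g : Om χ →ₗ[k] M} (h : ∀ a u v, f (om χ a u v) = g (om χ a u v)) : f = g := by
  refine Finsupp.lhom_ext' fun a => TensorProduct.ext' fun u v => ?_
  exact h a u v

theorem Om_induction {χ : SymBichar k ι} {P : Om χ → Prop} (zero : P 0)
    (h : ∀ a u v, P (om χ a u v)) (add : ∀ x y, P x → P y → P (x + y)) (x : Om χ) : P x := by
  induction x using Finsupp.induction_linear with
  | zero => exact zero
  | add x y hx hy => exact add x y hx hy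
  | single a z =>
    induction z with
    | zero => simpa using zero
    | tmul u v => exact h a u v
    | add x y hx hy =>
      rw [Finsupp.single_add]
      exact add _ _ hx hy

/-- The operator `u K_a v ↦ s(a) f(u) K_{a+b} g(v)`. -/
def opG (χ : SymBichar k ι) (s : (ι → ℤ) → k) (b : ι → ℤ) (f g : Nic χ →ₗ[k] Nic χ) :
    Module.End k (Om χ) :=
  Finsupp.lsum k fun a => s a • (Finsupp.lsingle (a + b) ∘ₗ TensorProduct.map f g)

@[simp] theorem opG_om (χ : SymBichar k ι) (s : (ι → ℤ) → k) (b : ι → ℤ)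
    (f g : Nic χ →ₗ[k] Nic χ) (a : ι → ℤ) (u v : Nic χ) :
    opG χ s b f g (om χ a u v) = s a • om χ (a + b) (f u) (g v) := by
  simp [opG, om_apply]

/-- Left multiplication by `E_i`. -/
def opE (χ : SymBichar k ι) (i : ι) : Module.End k (Om χ) :=
  opG χ (fun _ => 1) 0 (LinearMap.mulLeft k (nx χ i)) LinearMap.id

/-- Left multiplication by `K_b`. -/
def opK (χ : SymBichar k ι) (b : ι → ℤ) : Module.End k (Om χ) :=
  opG χ (fun _ => 1) b (S χ b).toLinearMap LinearMap.id

/-- The part of left multiplication by `F_i` which raises the degree. -/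
def opA (χ : SymBichar k ι) (i : ι) : Module.End k (Om χ) :=
  opG χ (fun a => χ.val a (α i)) 0 LinearMap.id (LinearMap.mulLeft k (nx χ i))

/-- The part of left multiplication by `F_i` which involves `K_i`. -/
def opP (χ : SymBichar k ι) (i : ι) : Module.End k (Om χ) :=
  opG χ (fun _ => -1) (α i) (dR χ i) LinearMap.id

/-- The part of left multiplication by `F_i` which involves `K_i⁻¹`. -/
def opM (χ : SymBichar k ι) (i : ι) : Module.End k (Om χ) :=
  opG χ (fun _ => 1) (-α i) ((S χ (-α i)).toLinearMap ∘ₗ dL χ i) LinearMap.id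

/-- Left multiplication by `F_i`. -/
def opF (χ : SymBichar k ι) (i : ι) : Module.End k (Om χ) := (opP χ i + opA χ i) + opM χ i

section opApply

variable (χ : SymBichar k ι) (i : ι) (a : ι → ℤ) (u v : Nic χ)

@[simp] theorem opE_om : opE χ i (om χ a u v) = om χ a (nx χ i * u) v := by
  simp [opE]

@[simp] theorem opK_om (b : ι → ℤ) : opK χ b (om χ a u v) = om χ (a + b) (S χ b u) v := by
  simp [opK]

@[simp] theorem opA_om : opA χ i (om χ a u v) = χ.val a (α i) • om χ a u (nx χ i * v) := by
  simp [opA]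

@[simp] theorem opP_om : opP χ i (om χ a u v) = - om χ (a + α i) (dR χ i u) v := by
  simp [opP]

@[simp] theorem opM_om :
    opM χ i (om χ a u v) = om χ (a - α i) (S χ (-α i) (dL χ i u)) v := by
  simp [opM, sub_eq_add_neg]

theorem opF_om : opF χ i (om χ a u v) = - om χ (a + α i) (dR χ i u) v +
    χ.val a (α i) • om χ a u (nx χ i * v) + om χ (a - α i) (S χ (-α i) (dL χ i u)) v := by
  simp [opF]

end opApply

/-- Operators on the left factor. -/
def endLeft (χ : SymBichar k ι) : Module.End k (Nic χ) →ₐ[k] Module.End k (Om χ) :=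
  AlgHom.ofLinearMap
    { toFun := fun f => opG χ (fun _ => 1) 0 f LinearMap.id
      map_add' := fun f g => Om_hom_ext fun a u v => by simp
      map_smul' := fun c f => Om_hom_ext fun a u v => by simp }
    (Om_hom_ext fun a u v => by simp) (fun f g => Om_hom_ext fun a u v => by simp)

/-- Operators on the right factor. -/
def endRight (χ : SymBichar k ι) : Module.End k (Nic χ) →ₐ[k] Module.End k (Om χ) :=
  AlgHom.ofLinearMap
    { toFun := fun f => opG χ (fun _ => 1) 0 LinearMap.id f
      map_add' := fun f g => Om_hom_ext fun a u v => by simp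
      map_smul' := fun c f => Om_hom_ext fun a u v => by simp }
    (Om_hom_ext fun a u v => by simp) (fun f g => Om_hom_ext fun a u v => by simp)

@[simp] theorem endLeft_om (χ : SymBichar k ι) (f : Module.End k (Nic χ)) (a : ι → ℤ)
    (u v : Nic χ) : endLeft χ f (om χ a u v) = om χ a (f u) v := by
  change opG χ (fun _ => 1) 0 f LinearMap.id (om χ a u v) = _
  simp

@[simp] theorem endRight_om (χ : SymBichar k ι) (f : Module.End k (Nic χ)) (a : ι → ℤ)
    (u v : Nic χ) : endRight χ f (om χ a u v) = om χ a u (f v) := by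
  change opG χ (fun _ => 1) 0 LinearMap.id f (om χ a u v) = _
  simp

theorem lift_mulLeft (χ : SymBichar k ι) (p : T k ι) :
    FreeAlgebra.lift k (fun i => (LinearMap.mulLeft k (nx χ i) : Module.End k (Nic χ))) p =
      LinearMap.mulLeft k (mkN χ p) := by
  have : FreeAlgebra.lift k (fun i => (LinearMap.mulLeft k (nx χ i) : Module.End k (Nic χ))) =
      (Algebra.lmul k (Nic χ)).comp (mkN χ) := by
    refine FreeAlgebra.hom_ext (funext fun i => LinearMap.ext fun u => ?_)
    simp [mkN_X]
  rw [this]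
  rfl

/-- If `h` is obtained from `f_i` by an algebra homomorphism, then it kills what `f` kills. -/
theorem lift_kill_of_comp {A B : Type*} [Semiring A] [Algebra k A] [Semiring B] [Algebra k B]
    (f : ι → A) (φ : A →ₐ[k] B) {p : T k ι} (h : FreeAlgebra.lift k f p = 0) :
    FreeAlgebra.lift k (fun i => φ (f i)) p = 0 := by
  have : FreeAlgebra.lift k (fun i => φ (f i)) = φ.comp (FreeAlgebra.lift k f) := by
    ext i; simp
  rw [this, AlgHom.comp_apply, h, map_zero]

theorem mulLeft_kill (χ : SymBichar k ι) (p : T k ι) (hp : p ∈ Imax χ) :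
    FreeAlgebra.lift k (fun i => (LinearMap.mulLeft k (nx χ i) : Module.End k (Nic χ))) p = 0 := by
  rw [lift_mulLeft, mkN_eq_zero.2 hp]
  ext u
  simp

theorem opA_kill (χ : SymBichar k ι) (p : T k ι) (hp : p ∈ Imax χ) :
    FreeAlgebra.lift k (opA χ) p = 0 := by
  refine graded_kill _ (FreeAlgebra.lift k fun i => endRight χ (LinearMap.mulLeft k (nx χ i)))
    (fun i => opG χ (fun a => χ.val a (α i)) 0 LinearMap.id LinearMap.id) ?_ ?_ ?_ (Imax χ)
    (Imax_isGradedBiideal χ).graded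
    (fun p hp => lift_kill_of_comp (fun i => LinearMap.mulLeft k (nx χ i)) (endRight χ)
      (mulLeft_kill χ p hp)) p hp
  · intro i
    rw [FreeAlgebra.lift_ι_apply, FreeAlgebra.lift_ι_apply]
    refine Om_hom_ext fun a u v => ?_
    simp only [Module.End.mul_apply, opA_om, endRight_om, opG_om, LinearMap.id_apply, add_zero,
      LinearMap.mulLeft_apply]
  · intro i j
    refine Om_hom_ext fun a u v => ?_
    simp only [Module.End.mul_apply, opG_om, LinearMap.id_apply, add_zero, map_smul, smul_smul,
      mul_comm]
  · intro i j
    rw [FreeAlgebra.lift_ι_apply]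
    refine Om_hom_ext fun a u v => ?_
    simp only [Module.End.mul_apply, endRight_om, opG_om, LinearMap.id_apply, add_zero, map_smul]

theorem opP_kill (χ : SymBichar k ι) (p : T k ι) (hp : p ∈ Imax χ) :
    FreeAlgebra.lift k (opP χ) p = 0 := by
  refine graded_kill _ (FreeAlgebra.lift k fun i => endLeft χ (dR χ i))
    (fun i => opG χ (fun _ => -1) (α i) LinearMap.id LinearMap.id) ?_ ?_ ?_ (Imax χ)
    (Imax_isGradedBiideal χ).graded
    (fun p hp => lift_kill_of_comp (dR χ) (endLeft χ) (lift_dR_Imax χ p hp)) p hp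
  · intro i
    rw [FreeAlgebra.lift_ι_apply, FreeAlgebra.lift_ι_apply]
    refine Om_hom_ext fun a u v => ?_
    simp only [Module.End.mul_apply, opP_om, endLeft_om, opG_om, LinearMap.id_apply, neg_smul,
      one_smul]
  · intro i j
    refine Om_hom_ext fun a u v => ?_
    simp only [Module.End.mul_apply, opG_om, LinearMap.id_apply, map_smul, add_right_comm]
  · intro i j
    rw [FreeAlgebra.lift_ι_apply]
    refine Om_hom_ext fun a u v => ?_
    simp only [Module.End.mul_apply, endLeft_om, opG_om, LinearMap.id_apply, map_smul]

theorem opM_kill (χ : SymBichar k ι) (p : T k ι) (hp : p ∈ Imax χ) :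
    FreeAlgebra.lift k (opM χ) p = 0 := by
  refine graded_kill_twisted _ (FreeAlgebra.lift k fun i => endLeft χ (dL χ i))
    (fun i => opG χ (fun _ => 1) (-α i) (S χ (-α i)).toLinearMap LinearMap.id)
    (fun i j => χ.val (-α j) (α i)) ?_ ?_ ?_ ?_ (Imax χ)
    (Imax_isGradedBiideal χ).graded
    (fun p hp => lift_kill_of_comp (dL χ) (endLeft χ) (lift_dL_Imax χ p hp)) p hp
  · intro i j
    rw [val_neg_left, val_neg_left, val_symm]
  · intro i
    rw [FreeAlgebra.lift_ι_apply, FreeAlgebra.lift_ι_apply]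
    refine Om_hom_ext fun a u v => ?_
    simp only [Module.End.mul_apply, opM_om, endLeft_om, opG_om, LinearMap.id_apply, one_smul,
      sub_eq_add_neg, AlgHom.toLinearMap_apply]
  · intro i j
    refine Om_hom_ext fun a u v => ?_
    simp only [Module.End.mul_apply, opG_om, LinearMap.id_apply, one_smul,
      AlgHom.toLinearMap_apply, ← S_add, add_right_comm a, add_comm (-α i) (-α j)]
  · intro i j
    rw [FreeAlgebra.lift_ι_apply]
    refine Om_hom_ext fun a u v => ?_
    simp only [Module.End.mul_apply, endLeft_om, opG_om, LinearMap.id_apply, one_smul,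
      AlgHom.toLinearMap_apply, dL_S, LinearMap.smul_apply, map_smul]

theorem opF_kill (χ : SymBichar k ι) (p : T k ι) (hp : p ∈ Imax χ) :
    FreeAlgebra.lift k (opF χ) p = 0 := by
  refine comul_kill χ _ (FreeAlgebra.lift k fun i => opP χ i + opA χ i)
    (FreeAlgebra.lift k (opM χ)) ?_ ?_ (Imax χ) (Imax_isGradedBiideal χ) ?_ (opM_kill χ) p hp
  · intro i
    simp [opF]
  · intro i j
    refine Om_hom_ext fun a u v => ?_
    simp only [FreeAlgebra.lift_ι_apply, Module.End.mul_apply, LinearMap.add_apply, opP_om, opA_om,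
      map_add, map_neg, map_smul, opM_om, LinearMap.smul_apply, smul_add, dR_S, val_neg_left,
      val_sub_left, q_eq, val_symm χ (α i) (α j), smul_neg, smul_smul, dL_dR]
    rw [add_sub_right_comm, mul_inv_cancel₀ (val_ne_zero _ _ _), one_smul,
      mul_comm (χ.val a (α j)), mul_inv_cancel_left₀ (val_ne_zero _ _ _)]
  · refine comul_kill χ _ (FreeAlgebra.lift k (opP χ)) (FreeAlgebra.lift k (opA χ)) ?_ ?_ (Imax χ)
      (Imax_isGradedBiideal χ) (opP_kill χ) (opA_kill χ)
    · intro i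
      simp
    · intro i j
      refine Om_hom_ext fun a u v => ?_
      simp only [FreeAlgebra.lift_ι_apply, Module.End.mul_apply, opP_om, opA_om,
        map_neg, map_smul, LinearMap.smul_apply, val_add_left, q_eq, val_symm χ (α i) (α j),
        smul_neg, smul_smul]
      rw [mul_comm]

theorem op_rels (χ : SymBichar k ι) : Rels χ (opE χ) (opF χ) (opK χ) := by
  refine ⟨?_, ?_, ?_, ?_, ?_, ?_, opF_kill χ⟩
  · exact Om_hom_ext fun a u v => by simp
  · intro a b
    exact Om_hom_ext fun c u v => by
      simp only [Module.End.mul_apply, opK_om, ← S_add, add_comm a b, add_assoc]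
  · intro b i
    exact Om_hom_ext fun a u v => by simp
  · intro b i
    refine Om_hom_ext fun a u v => ?_
    have h := val_ne_zero χ b (α i)
    simp only [Module.End.mul_apply, opF_om, opK_om, map_add, map_neg, map_smul,
      LinearMap.smul_apply, dR_S, dL_S, smul_add, smul_neg, smul_smul, val_add_left,
      inv_mul_cancel₀ h, one_smul, LinearMap.add_apply, LinearMap.neg_apply]
    rw [mul_comm (χ.val a (α i)), inv_mul_cancel_left₀ h, add_right_comm a b, ← S_add, ← S_add,
      add_comm b (-α i), sub_add_eq_add_sub]
  · intro i j
    refine Om_hom_ext fun a u v => ?_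
    have h := val_ne_zero χ (α j) (α i)
    simp only [LinearMap.sub_apply, Module.End.mul_apply, opF_om, opE_om, map_add, map_neg,
      map_smul, LinearMap.smul_apply, dR_mul, dL_x_mul, dR_x, map_mul, S_x, smul_mul_assoc, q_eq,
      LinearMap.add_apply, LinearMap.neg_apply, val_neg_left, smul_smul]
    rw [val_symm χ (α j) (α i)] at h ⊢
    rw [mul_inv_cancel₀ h, one_smul]
    by_cases hij : i = j
    · subst hij
      simp [sub_eq_add_neg]
      abel
    · have hji : j ≠ i := fun h => hij h.symm
      simp [hij, hji]
  · intro p hp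
    have : opE χ = fun i => endLeft χ (LinearMap.mulLeft k (nx χ i)) := by
      ext1 i
      exact Om_hom_ext fun a u v => by simp
    rw [this]
    exact lift_kill_of_comp (fun i => LinearMap.mulLeft k (nx χ i)) (endLeft χ)
      (mulLeft_kill χ p hp)

/-- The regular representation. -/
def actOm (χ : SymBichar k ι) : U χ →ₐ[k] Module.End k (Om χ) := liftU χ (op_rels χ)

/-- `p ↦ p(E)` on the Nichols algebra. -/
def nE (χ : SymBichar k ι) : Nic χ →ₐ[k] U χ := liftN χ (evE χ) fun _ => evE_Imax χ

/-- `p ↦ p(F)` on the Nichols algebra. -/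
def nF (χ : SymBichar k ι) : Nic χ →ₐ[k] U χ := liftN χ (evF χ) fun _ => evF_Imax χ

theorem nE_mk (χ : SymBichar k ι) (p : T k ι) : nE χ (mkN χ p) = evE χ p := rfl

theorem nF_mk (χ : SymBichar k ι) (p : T k ι) : nF χ (mkN χ p) = evF χ p := rfl

@[simp] theorem nE_x (χ : SymBichar k ι) (i : ι) : nE χ (nx χ i) = E χ i := by
  rw [← mkN_X, nE_mk]; simp [evE]

@[simp] theorem nF_x (χ : SymBichar k ι) (i : ι) : nF χ (nx χ i) = F χ i := by
  rw [← mkN_X, nF_mk]; simp [evF]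

theorem K_mul_nE (χ : SymBichar k ι) (a : ι → ℤ) (u : Nic χ) :
    K χ a * nE χ u = nE χ (S χ a u) * K χ a := by
  refine Nic_induction (P := fun u => K χ a * nE χ u = nE χ (S χ a u) * K χ a) (by simp) ?_ ?_ ?_ u
  · intro i u hu
    rw [map_mul, nE_x, ← mul_assoc, K_mul_E, smul_mul_assoc, mul_assoc, hu, map_mul, S_x,
      smul_mul_assoc, map_smul, map_mul, nE_x, smul_mul_assoc, mul_assoc]
  · intro u v hu hv
    simp only [map_add, mul_add, add_mul, hu, hv]
  · intro c u hu
    simp only [map_smul, mul_smul_comm, smul_mul_assoc, hu]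

theorem K_mul_nF (χ : SymBichar k ι) (a : ι → ℤ) (u : Nic χ) :
    K χ a * nF χ u = nF χ (S χ (-a) u) * K χ a := by
  refine Nic_induction (P := fun u => K χ a * nF χ u = nF χ (S χ (-a) u) * K χ a) (by simp)
    ?_ ?_ ?_ u
  · intro i u hu
    rw [map_mul, nF_x, ← mul_assoc, K_mul_F, smul_mul_assoc, mul_assoc, hu, map_mul, S_x,
      smul_mul_assoc, map_smul, map_mul, nF_x, smul_mul_assoc, mul_assoc, val_neg_left]
  · intro u v hu hv
    simp only [map_add, mul_add, add_mul, hu, hv]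
  · intro c u hu
    simp only [map_smul, mul_smul_comm, smul_mul_assoc, hu]

theorem nE_mul_K (χ : SymBichar k ι) (a : ι → ℤ) (u : Nic χ) :
    nE χ u * K χ a = K χ a * nE χ (S χ (-a) u) := by
  rw [K_mul_nE, ← S_add, add_neg_cancel, S_zero]

theorem nF_mul_K (χ : SymBichar k ι) (a : ι → ℤ) (u : Nic χ) :
    nF χ u * K χ a = K χ a * nF χ (S χ a u) := by
  rw [K_mul_nF, ← S_add, neg_add_cancel, S_zero]

theorem E_mul_F' (χ : SymBichar k ι) (i j : ι) : E χ i * F χ j =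
    F χ j * E χ i + if i = j then K χ (α i) - K χ (-α i) else 0 := by
  rw [← E_mul_F]; abel

theorem F_mul_nE (χ : SymBichar k ι) (i : ι) (u : Nic χ) : F χ i * nE χ u =
    nE χ u * F χ i - nE χ (dR χ i u) * K χ (α i) + K χ (-α i) * nE χ (dL χ i u) := by
  refine Nic_induction (P := fun u => F χ i * nE χ u =
    nE χ u * F χ i - nE χ (dR χ i u) * K χ (α i) + K χ (-α i) * nE χ (dL χ i u))
    (by simp) ?_ ?_ ?_ u
  · intro j u hu
    have h1 : F χ i * E χ j = E χ j * F χ i - if i = j then K χ (α i) - K χ (-α i) else 0 := by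
      rw [E_mul_F']
      by_cases hij : i = j
      · subst hij; simp
      · have hji : j ≠ i := fun h => hij h.symm
        simp [hij, hji]
    have h2 : E χ j * K χ (-α i) = χ.q i j • (K χ (-α i) * E χ j) := by
      rw [K_mul_E, smul_smul, val_neg_left, q_eq, mul_inv_cancel₀ (val_ne_zero _ _ _), one_smul]
    rw [map_mul, nE_x, ← mul_assoc, h1, sub_mul, mul_assoc, hu, dL_x_mul, dR_mul, dR_x, mul_add,
      mul_sub, ← mul_assoc (E χ j) (K χ (-α i)), h2]
    by_cases hij : i = j
    · subst hij
      simp only [if_true, one_mul, map_add, map_mul, nE_x, map_smul, add_mul, mul_add,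
        mul_smul_comm, smul_mul_assoc, mul_assoc, sub_mul, ← K_mul_nE]
      abel
    · simp only [if_neg hij, zero_mul, map_add, map_mul, nE_x, map_smul, add_mul, mul_add,
        mul_smul_comm, smul_mul_assoc, mul_assoc, map_zero, sub_zero, zero_add, add_zero]
  · intro u v hu hv
    simp only [map_add, mul_add, add_mul, hu, hv]
    abel
  · intro c u hu
    simp only [map_smul, mul_smul_comm, smul_mul_assoc, hu, smul_add, smul_sub]

theorem E_mul_nF (χ : SymBichar k ι) (i : ι) (u : Nic χ) : E χ i * nF χ u =
    nF χ u * E χ i + K χ (α i) * nF χ (dL χ i u) - nF χ (dR χ i u) * K χ (-α i) := by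
  refine Nic_induction (P := fun u => E χ i * nF χ u =
    nF χ u * E χ i + K χ (α i) * nF χ (dL χ i u) - nF χ (dR χ i u) * K χ (-α i))
    (by simp) ?_ ?_ ?_ u
  · intro j u hu
    have h2 : F χ j * K χ (α i) = χ.q i j • (K χ (α i) * F χ j) := by
      rw [K_mul_F, smul_smul, q_eq, mul_inv_cancel₀ (val_ne_zero _ _ _), one_smul]
    rw [map_mul, nF_x, ← mul_assoc, E_mul_F', add_mul, mul_assoc, hu, dL_x_mul, dR_mul, dR_x,
      mul_sub, mul_add, ← mul_assoc (F χ j) (K χ (α i)), h2]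
    have h3 : K χ (-α i) * nF χ u = nF χ (S χ (α i) u) * K χ (-α i) := by
      rw [K_mul_nF, neg_neg]
    by_cases hij : i = j
    · subst hij
      simp only [if_true, one_mul, map_add, map_mul, nF_x, map_smul, add_mul, mul_add,
        mul_smul_comm, smul_mul_assoc, mul_assoc, sub_mul, h3]
      abel
    · simp only [if_neg hij, zero_mul, map_add, map_mul, nF_x, map_smul, add_mul, mul_add,
        mul_smul_comm, smul_mul_assoc, mul_assoc, map_zero, sub_zero, zero_add, add_zero]
  · intro u v hu hv
    simp only [map_add, mul_add, add_mul, hu, hv]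
    abel
  · intro c u hu
    simp only [map_smul, mul_smul_comm, smul_mul_assoc, hu, smul_add, smul_sub]

/-- The multiplication map `u K_a v ↦ u(E) K_a v(F)`. -/
def pbw (χ : SymBichar k ι) : Om χ →ₗ[k] U χ :=
  Finsupp.lsum k fun a => TensorProduct.lift
    ((LinearMap.mul k (U χ)).compl₁₂ ((LinearMap.mulRight k (K χ a)) ∘ₗ (nE χ).toLinearMap)
      (nF χ).toLinearMap)

@[simp] theorem pbw_om (χ : SymBichar k ι) (a : ι → ℤ) (u v : Nic χ) :
    pbw χ (om χ a u v) = nE χ u * K χ a * nF χ v := by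
  simp [pbw, om_apply]

theorem actOm_E (χ : SymBichar k ι) (i : ι) : actOm χ (E χ i) = opE χ i := liftU_E _ _ _

theorem actOm_F (χ : SymBichar k ι) (i : ι) : actOm χ (F χ i) = opF χ i := liftU_F _ _ _

theorem actOm_K (χ : SymBichar k ι) (a : ι → ℤ) : actOm χ (K χ a) = opK χ a := liftU_K _ _ _

theorem pbw_act (χ : SymBichar k ι) (x : U χ) (w : Om χ) : pbw χ (actOm χ x w) = x * pbw χ w := by
  refine U_induction χ (P := fun x => ∀ w, pbw χ (actOm χ x w) = x * pbw χ w)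
    ?_ ?_ ?_ ?_ ?_ ?_ x w
  · intro c w
    rw [AlgHom.commutes, Module.algebraMap_end_apply, map_smul, Algebra.smul_def]
  · intro i w
    rw [actOm_E]
    refine Om_induction (P := fun w => pbw χ (opE χ i w) = E χ i * pbw χ w) (by simp) ?_ ?_ w
    · intro a u v
      simp [mul_assoc]
    · intro x y hx hy
      simp only [map_add, hx, hy, mul_add]
  · intro i w
    rw [actOm_F]
    refine Om_induction (P := fun w => pbw χ (opF χ i w) = F χ i * pbw χ w) (by simp) ?_ ?_ w
    · intro a u v
      have h : F χ i * K χ a = χ.val a (α i) • (K χ a * F χ i) := by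
        rw [K_mul_F, smul_smul, mul_inv_cancel₀ (val_ne_zero _ _ _), one_smul]
      simp only [opF_om, map_add, map_neg, map_smul, pbw_om, map_mul, nF_x]
      rw [← mul_assoc (F χ i) (nE χ u * K χ a), ← mul_assoc (F χ i) (nE χ u), F_mul_nE, K_mul_nE, add_mul, sub_mul, add_mul, sub_mul,
        mul_assoc (nE χ u) (F χ i), h, mul_assoc _ (K χ (α i)), ← K_add,
        mul_assoc _ (K χ (-α i)), ← K_add, add_comm (α i), neg_add_eq_sub]
      simp only [mul_smul_comm, smul_mul_assoc, mul_assoc]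
      abel_nf
    · intro x y hx hy
      simp only [map_add, hx, hy, mul_add]
  · intro b w
    rw [actOm_K]
    refine Om_induction (P := fun w => pbw χ (opK χ b w) = K χ b * pbw χ w) (by simp) ?_ ?_ w
    · intro a u v
      rw [opK_om, pbw_om, pbw_om, ← mul_assoc, ← mul_assoc, K_mul_nE, add_comm, K_add]
      simp only [mul_assoc]
    · intro x y hx hy
      simp only [map_add, hx, hy, mul_add]
  · intro x y hx hy w
    rw [map_mul, Module.End.mul_apply, hx, hy, mul_assoc]
  · intro x y hx hy w
    rw [map_add, LinearMap.add_apply, map_add, hx, hy, add_mul]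

theorem actOm_nF (χ : SymBichar k ι) (v : Nic χ) :
    actOm χ (nF χ v) (om χ 0 1 1) = om χ 0 1 v := by
  refine Nic_induction (P := fun v => actOm χ (nF χ v) (om χ 0 1 1) = om χ 0 1 v) (by simp)
    ?_ ?_ ?_ v
  · intro i v hv
    rw [map_mul, map_mul, Module.End.mul_apply, hv, nF_x, actOm_F, opF_om]
    simp
  · intro u v hu hv
    simp only [map_add, LinearMap.add_apply, hu, hv]
  · intro c u hu
    simp only [map_smul, LinearMap.smul_apply, hu]

theorem actOm_nE (χ : SymBichar k ι) (a : ι → ℤ) (u v : Nic χ) :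
    actOm χ (nE χ u) (om χ a 1 v) = om χ a u v := by
  refine Nic_induction (P := fun u => actOm χ (nE χ u) (om χ a 1 v) = om χ a u v) (by simp)
    ?_ ?_ ?_ u
  · intro i v hv
    rw [map_mul, map_mul, Module.End.mul_apply, hv, nE_x, actOm_E, opE_om]
  · intro u v hu hv
    simp only [map_add, LinearMap.add_apply, hu, hv]
  · intro c u hu
    simp only [map_smul, LinearMap.smul_apply, hu]

theorem actOm_pbw (χ : SymBichar k ι) (w : Om χ) : actOm χ (pbw χ w) (om χ 0 1 1) = w := by
  refine Om_induction (P := fun w => actOm χ (pbw χ w) (om χ 0 1 1) = w) (by simp) ?_ ?_ w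
  · intro a u v
    rw [pbw_om, map_mul, map_mul, Module.End.mul_apply, Module.End.mul_apply, actOm_nF, actOm_K,
      opK_om, map_one, zero_add, actOm_nE]
  · intro x y hx hy
    simp only [map_add, LinearMap.add_apply, hx, hy]

/-- The triangular decomposition of `U(χ)_max`. -/
def pbwEquiv (χ : SymBichar k ι) : Om χ ≃ₗ[k] U χ :=
  LinearEquiv.ofLinearMap (pbw χ) ((LinearMap.applyₗ (om χ 0 1 1)) ∘ₗ (actOm χ).toLinearMap)
    (LinearMap.ext fun x => by
      have := pbw_act χ x (om χ 0 1 1)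
      simpa [om_apply, pbw, K_zero] using this)
    (LinearMap.ext fun w => actOm_pbw χ w)

@[simp] theorem pbwEquiv_om (χ : SymBichar k ι) (a : ι → ℤ) (u v : Nic χ) :
    pbwEquiv χ (om χ a u v) = nE χ u * K χ a * nF χ v := pbw_om χ a u v

@[simp] theorem pbwEquiv_symm_mul (χ : SymBichar k ι) (a : ι → ℤ) (u v : Nic χ) :
    (pbwEquiv χ).symm (nE χ u * K χ a * nF χ v) = om χ a u v := by
  rw [LinearEquiv.symm_apply_eq, pbwEquiv_om]

/-- Induction on products `u(E) K_a v(F)`. -/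
theorem EKF_induction {χ : SymBichar k ι} {P : U χ → Prop} (zero : P 0)
    (h : ∀ a u v, P (nE χ u * K χ a * nF χ v)) (add : ∀ x y, P x → P y → P (x + y)) (x : U χ) :
    P x := by
  rw [← (pbwEquiv χ).apply_symm_apply x]
  refine Om_induction (P := fun w => P (pbwEquiv χ w)) (by simpa using zero) ?_ ?_ _
  · intro a u v
    rw [pbwEquiv_om]
    exact h a u v
  · intro x y hx hy
    rw [map_add]
    exact add _ _ hx hy

theorem EKF_hom_ext {χ : SymBichar k ι} {M : Type*} [AddCommGroup M] [Module k M]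
    {f g : U χ →ₗ[k] M} (h : ∀ a u v, f (nE χ u * K χ a * nF χ v) = g (nE χ u * K χ a * nF χ v)) :
    f = g :=
  LinearMap.ext fun x => EKF_induction (P := fun x => f x = g x) (by simp) h
    (fun x y hx hy => by rw [map_add, map_add, hx, hy]) x

/-! ### The Chevalley involution -/

theorem omega_rels (χ : SymBichar k ι) :
    Rels χ (F χ) (E χ) (fun a => K χ (-a)) := by
  refine ⟨?_, ?_, ?_, ?_, ?_, ?_, ?_⟩
  · simp [K_zero]
  · intro a b
    rw [neg_add, K_add]
  · intro a i
    rw [K_mul_F, val_neg_left, inv_inv]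
  · intro a i
    rw [K_mul_E, val_neg_left]
  · intro i j
    rw [E_mul_F' χ j i]
    by_cases hij : i = j
    · subst hij; simp
    · have hji : j ≠ i := fun h => hij h.symm
      simp [hij, hji]
  · intro p hp
    exact evF_Imax χ hp
  · intro p hp
    exact evE_Imax χ hp

/-- The involution with `E_i ↦ F_i`, `F_i ↦ E_i`, `K_a ↦ K_{-a}`. -/
def omega (χ : SymBichar k ι) : U χ →ₐ[k] U χ := liftU χ (omega_rels χ)

@[simp] theorem omega_E (χ : SymBichar k ι) (i : ι) : omega χ (E χ i) = F χ i := liftU_E _ _ _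

@[simp] theorem omega_F (χ : SymBichar k ι) (i : ι) : omega χ (F χ i) = E χ i := liftU_F _ _ _

@[simp] theorem omega_K (χ : SymBichar k ι) (a : ι → ℤ) : omega χ (K χ a) = K χ (-a) :=
  liftU_K _ _ _

@[simp] theorem omega_omega (χ : SymBichar k ι) (x : U χ) : omega χ (omega χ x) = x := by
  refine U_induction χ (P := fun x => omega χ (omega χ x) = x) ?_ ?_ ?_ ?_ ?_ ?_ x
  · intro c; simp
  · intro i; simp
  · intro i; simp
  · intro a; simp
  · intro x y hx hy; simp [hx, hy]
  · intro x y hx hy; simp [hx, hy]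

@[simp] theorem omega_nE (χ : SymBichar k ι) (u : Nic χ) : omega χ (nE χ u) = nF χ u := by
  have : (omega χ).comp (nE χ) = nF χ := Nic_algHom_ext fun i => by simp
  exact AlgHom.congr_fun this u

@[simp] theorem omega_nF (χ : SymBichar k ι) (u : Nic χ) : omega χ (nF χ u) = nE χ u := by
  rw [← omega_nE, omega_omega]

/-- Induction on products `u(F) K_a v(E)`. -/
theorem FKE_induction {χ : SymBichar k ι} {P : U χ → Prop} (zero : P 0)
    (h : ∀ a u v, P (nF χ u * K χ a * nE χ v)) (add : ∀ x y, P x → P y → P (x + y)) (x : U χ) :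
    P x := by
  rw [← omega_omega χ x]
  refine EKF_induction (P := fun x => P (omega χ x)) (by simpa using zero) ?_ ?_ (omega χ x)
  · intro a u v
    simp only [map_mul, omega_nE, omega_K, omega_nF]
    exact h _ _ _
  · intro x y hx hy
    rw [map_add]
    exact add _ _ hx hy

/-! ### Direct sum decompositions -/

section Internal

variable {V κ : Type*} [AddCommGroup V] [Module k V] {M : κ → Submodule k V} {π : κ → V →ₗ[k] V}

theorem isInternal_of_proj [DecidableEq κ] (h1 : ∀ i, ∀ v ∈ M i, π i v = v)
    (h0 : ∀ i j, i ≠ j → ∀ v ∈ M j, π i v = 0) (htop : ⨆ i, M i = ⊤) :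
    DirectSum.IsInternal M := by
  refine DirectSum.isInternal_submodule_of_iSupIndep_of_iSup_eq_top (fun i => ?_) htop
  rw [Submodule.disjoint_def]
  intro v hv hv'
  rw [← h1 i v hv]
  have hle : ⨆ (j) (_ : j ≠ i), M j ≤ LinearMap.ker (π i) :=
    iSup₂_le fun j hj w hw => h0 i j (Ne.symm hj) w hw
  exact hle hv'

open Classical in
theorem componentProj_of_mem (h : DirectSum.IsInternal M) {i : κ} {v : V} (hv : v ∈ M i) :
    componentProj M i v = v := by
  rw [componentProj, dif_pos h]
  have hs : (LinearEquiv.ofBijective (DirectSum.coeLinearMap M) h).symm v =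
      DirectSum.lof k κ (fun j => M j) i ⟨v, hv⟩ := by
    rw [LinearEquiv.symm_apply_eq]
    exact (DirectSum.coeLinearMap_lof M i ⟨v, hv⟩).symm
  simp only [LinearMap.comp_apply, LinearEquiv.coe_coe, hs, DirectSum.component.lof_self,
    Submodule.subtype_apply]

open Classical in
theorem componentProj_of_mem_ne (h : DirectSum.IsInternal M) {i j : κ} (hij : i ≠ j) {v : V}
    (hv : v ∈ M j) : componentProj M i v = 0 := by
  rw [componentProj, dif_pos h]
  have hs : (LinearEquiv.ofBijective (DirectSum.coeLinearMap M) h).symm v =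
      DirectSum.lof k κ (fun j => M j) j ⟨v, hv⟩ := by
    rw [LinearEquiv.symm_apply_eq]
    exact (DirectSum.coeLinearMap_lof M j ⟨v, hv⟩).symm
  simp only [LinearMap.comp_apply, LinearEquiv.coe_coe, hs, DirectSum.component.of,
    dif_neg (Ne.symm hij), map_zero]

theorem componentProj_eq (h1 : ∀ i, ∀ v ∈ M i, π i v = v)
    (h0 : ∀ i j, i ≠ j → ∀ v ∈ M j, π i v = 0) (htop : ⨆ i, M i = ⊤) (i : κ) :
    componentProj M i = π i := by
  classical
  have h := isInternal_of_proj h1 h0 htop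
  ext v
  have hv : v ∈ ⨆ i, M i := htop ▸ Submodule.mem_top
  induction hv using Submodule.iSup_induction' with
  | mem j v hv =>
    by_cases hij : i = j
    · subst hij
      rw [componentProj_of_mem h hv, h1 _ _ hv]
    · rw [componentProj_of_mem_ne h hij hv, h0 _ _ hij _ hv]
  | zero => simp
  | add x y _ _ hx hy => rw [map_add, map_add, hx, hy]

end Internal

/-! ### Contractions with functionals -/

/-- `v ⊗ w ↦ φ(w) v`. -/
def coeffR {V W : Type*} [AddCommGroup V] [Module k V] [AddCommGroup W] [Module k W]
    (φ : W →ₗ[k] k) : V ⊗[k] W →ₗ[k] V :=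
  (TensorProduct.rid k V).toLinearMap ∘ₗ LinearMap.lTensor V φ

@[simp] theorem coeffR_tmul {V W : Type*} [AddCommGroup V] [Module k V] [AddCommGroup W]
    [Module k W] (φ : W →ₗ[k] k) (v : V) (w : W) : coeffR φ (v ⊗ₜ[k] w) = φ w • v := by
  simp [coeffR]

theorem coeffR_mul {A B : Type*} [Ring A] [Algebra k A] [Ring B] [Algebra k B]
    (φ ψ : B →ₗ[k] k) (a a' : A) (b b' : B) (h : ∀ x, φ (b * x * b') = ψ x) (w : A ⊗[k] B) :
    coeffR φ ((a ⊗ₜ[k] b) * w * (a' ⊗ₜ[k] b')) = a * coeffR ψ w * a' := by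
  induction w with
  | zero => simp
  | tmul x y => simp [h]
  | add x y hx hy => simp only [mul_add, add_mul, map_add, hx, hy]

/-- The functional `E K_b F ↦ δ_{a,b} ε(E) ε(F)`. -/
def epsU (χ : SymBichar k ι) (a : ι → ℤ) : U χ →ₗ[k] k :=
  tf (epsN χ).toLinearMap (epsN χ).toLinearMap ∘ₗ Finsupp.lapply a ∘ₗ
    (pbwEquiv χ).symm.toLinearMap

theorem epsU_pbw (χ : SymBichar k ι) (a b : ι → ℤ) (u v : Nic χ) :
    epsU χ a (nE χ u * K χ b * nF χ v) = if b = a then epsN χ u * epsN χ v else 0 := by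
  simp only [epsU, LinearMap.comp_apply, LinearEquiv.coe_coe, pbwEquiv_symm_mul, om_apply,
    Finsupp.lapply_apply, Finsupp.single_apply]
  split_ifs <;> simp

theorem epsU_K (χ : SymBichar k ι) (a b : ι → ℤ) :
    epsU χ a (K χ b) = if b = a then 1 else 0 := by
  have := epsU_pbw χ a b 1 1
  simpa using this

theorem epsU_E_mul (χ : SymBichar k ι) (a : ι → ℤ) (i : ι) (x : U χ) :
    epsU χ a (E χ i * x) = 0 := by
  refine EKF_induction (P := fun x => epsU χ a (E χ i * x) = 0) (by simp) ?_ ?_ x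
  · intro b u v
    rw [← mul_assoc, ← mul_assoc, ← nE_x, ← map_mul, epsU_pbw, map_mul, epsN_x]
    simp
  · intro x y hx hy
    rw [mul_add, map_add, hx, hy, add_zero]

theorem epsU_mul_F (χ : SymBichar k ι) (a : ι → ℤ) (i : ι) (x : U χ) :
    epsU χ a (x * F χ i) = 0 := by
  refine EKF_induction (P := fun x => epsU χ a (x * F χ i) = 0) (by simp) ?_ ?_ x
  · intro b u v
    rw [mul_assoc, ← nF_x, ← map_mul, epsU_pbw, map_mul, epsN_x]
    simp
  · intro x y hx hy
    rw [add_mul, map_add, hx, hy, add_zero]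

theorem epsU_mul_K (χ : SymBichar k ι) (a b : ι → ℤ) (x : U χ) :
    epsU χ a (x * K χ b) = epsU χ (a - b) x := by
  refine EKF_induction (P := fun x => epsU χ a (x * K χ b) = epsU χ (a - b) x) (by simp) ?_ ?_ x
  · intro c u v
    rw [mul_assoc, nF_mul_K, ← mul_assoc, mul_assoc (nE χ u), ← K_add, epsU_pbw, epsU_pbw, epsN_S]
    simp only [eq_sub_iff_add_eq]
  · intro x y hx hy
    rw [add_mul, map_add, map_add, hx, hy]

/-- The projection `P_a`, expressed through the coproduct. -/
def projW (χ : SymBichar k ι) (a : ι → ℤ) : U χ →ₗ[k] U χ :=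
  coeffR (epsU χ a) ∘ₗ (comul χ).toLinearMap

theorem projW_apply (χ : SymBichar k ι) (a : ι → ℤ) (x : U χ) :
    projW χ a x = coeffR (epsU χ a) (comul χ x) := rfl

theorem projW_K (χ : SymBichar k ι) (a b : ι → ℤ) :
    projW χ a (K χ b) = if b = a then K χ b else 0 := by
  rw [projW_apply, comul_K, coeffR_tmul, epsU_K]
  split_ifs <;> simp

theorem projW_E_mul (χ : SymBichar k ι) (a : ι → ℤ) (i : ι) (z : U χ) :
    projW χ a (E χ i * z) = E χ i * projW χ a z := by
  rw [projW_apply, map_mul, comul_E, add_mul, map_add]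
  have h1 := coeffR_mul (epsU χ a) (epsU χ a) (E χ i) 1 1 1 (fun x => by simp) (comul χ z)
  have h2 := coeffR_mul (epsU χ a) 0 (K χ (α i)) 1 (E χ i) 1 (fun x => by simp [epsU_E_mul])
    (comul χ z)
  have h3 : coeffR (V := U χ) (0 : U χ →ₗ[k] k) (comul χ z) = 0 := by simp [coeffR]
  rw [← Algebra.TensorProduct.one_def, mul_one, mul_one] at h1 h2
  rw [h1, h2, h3, mul_zero, add_zero]
  rfl

theorem projW_mul_FK (χ : SymBichar k ι) (a : ι → ℤ) (i : ι) (z : U χ) :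
    projW χ a (z * (F χ i * K χ (α i))) = projW χ a z * (F χ i * K χ (α i)) := by
  have hc : comul χ (F χ i * K χ (α i)) =
      (F χ i * K χ (α i)) ⊗ₜ[k] 1 + K χ (α i) ⊗ₜ[k] (F χ i * K χ (α i)) := by
    rw [map_mul, comul_F, comul_K, add_mul, Algebra.TensorProduct.tmul_mul_tmul,
      Algebra.TensorProduct.tmul_mul_tmul, ← K_add, neg_add_cancel, K_zero, one_mul]
  rw [projW_apply, map_mul, hc, mul_add, map_add]
  have h1 := coeffR_mul (epsU χ a) (epsU χ a) 1 (F χ i * K χ (α i)) 1 1 (fun x => by simp)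
    (comul χ z)
  have h2 := coeffR_mul (epsU χ a) 0 1 (K χ (α i)) 1 (F χ i * K χ (α i))
    (fun x => by rw [one_mul, ← mul_assoc, epsU_mul_K, epsU_mul_F, LinearMap.zero_apply])
    (comul χ z)
  have h3 : coeffR (V := U χ) (0 : U χ →ₗ[k] k) (comul χ z) = 0 := by simp [coeffR]
  rw [← Algebra.TensorProduct.one_def, one_mul, one_mul] at h1 h2
  rw [h1, h2, h3, zero_mul, add_zero]
  rfl

theorem projW_Uplus_mul (χ : SymBichar k ι) (a : ι → ℤ) {x : U χ} (hx : x ∈ Uplus χ) (z : U χ) :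
    projW χ a (x * z) = x * projW χ a z := by
  induction hx using Algebra.adjoin_induction generalizing z with
  | mem x hx =>
    obtain ⟨i, rfl⟩ := hx
    exact projW_E_mul χ a i z
  | algebraMap r => simp [← Algebra.smul_def]
  | add x y _ _ hx hy => rw [add_mul, map_add, hx, hy, add_mul]
  | mul x y _ _ hx hy => rw [mul_assoc, hx, hy, mul_assoc]

theorem projW_mul_Gminus (χ : SymBichar k ι) (a : ι → ℤ) {x : U χ} (hx : x ∈ Gminus χ) (z : U χ) :
    projW χ a (z * x) = projW χ a z * x := by
  induction hx using Algebra.adjoin_induction generalizing z with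
  | mem x hx =>
    obtain ⟨i, rfl⟩ := hx
    exact projW_mul_FK χ a i z
  | algebraMap r => rw [← Algebra.commutes, ← Algebra.commutes, ← Algebra.smul_def,
      ← Algebra.smul_def, map_smul]
  | add x y _ _ hx hy => rw [mul_add, map_add, hx, hy, mul_add]
  | mul x y _ _ hx hy => rw [← mul_assoc, hy, hx, mul_assoc]

theorem projW_UKG (χ : SymBichar k ι) (a b : ι → ℤ) {z : U χ} (hz : z ∈ UKG χ b) :
    projW χ a z = if b = a then z else 0 := by
  refine Submodule.mul_induction_on hz ?_ ?_
  · intro y hy g hg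
    rw [projW_mul_Gminus χ a hg]
    have : projW χ a y = if b = a then y else 0 := by
      refine Submodule.mul_induction_on hy ?_ ?_
      · intro x hx t ht
        obtain ⟨c, rfl⟩ := Submodule.mem_span_singleton.1 ht
        rw [projW_Uplus_mul χ a hx, map_smul, projW_K]
        split_ifs <;> simp
      · intro x y hx hy
        rw [map_add, hx, hy]
        split_ifs <;> simp
    rw [this]
    split_ifs <;> simp
  · intro x y hx hy
    rw [map_add, hx, hy]
    split_ifs <;> simp

theorem nE_mem_Uplus (χ : SymBichar k ι) (u : Nic χ) : nE χ u ∈ Uplus χ := by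
  obtain ⟨p, rfl⟩ := mkN_surjective χ u
  exact evE_mem_Uplus χ p

theorem nF_mem_Uminus (χ : SymBichar k ι) (u : Nic χ) : nF χ u ∈ Uminus χ := by
  obtain ⟨p, rfl⟩ := mkN_surjective χ u
  exact evF_mem_Uminus χ p

theorem K_mul_nF_mem_Gminus (χ : SymBichar k ι) {μ : ι → ℕ} {u : Nic χ} (hu : u ∈ Nwt χ μ) :
    K χ (up μ) * nF χ u ∈ Gminus χ := by
  refine Nwt_word_induction (P := fun μ u => K χ (up μ) * nF χ u ∈ Gminus χ) ?_ ?_ ?_ ?_ ?_ hu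
  · simp [K_zero]
  · intro i μ u hu ih
    have : K χ (up (Pi.single i 1 + μ)) * nF χ (nx χ i * u) =
        ((χ.val (α i) (α i))⁻¹ * (χ.val (up μ) (α i))⁻¹) •
          ((F χ i * K χ (α i)) * (K χ (up μ) * nF χ u)) := by
      rw [up_add, up_single, map_mul, nF_x, ← mul_assoc, K_add, mul_assoc (K χ (α i)), K_mul_F,
        mul_smul_comm, ← mul_assoc (K χ (α i)), K_mul_F, smul_mul_assoc, smul_mul_assoc,
        smul_mul_assoc, smul_smul, mul_comm (χ.val (up μ) (α i))⁻¹]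
      simp only [mul_assoc]
    rw [this]
    exact Subalgebra.smul_mem _ (mul_mem (Algebra.subset_adjoin (Set.mem_range_self i)) ih) _
  · intro μ
    simp
  · intro μ u v hu hv
    rw [map_add, mul_add]
    exact add_mem hu hv
  · intro μ c u hu
    rw [map_smul, mul_smul_comm]
    exact Subalgebra.smul_mem _ hu _

theorem iSup_UKG (χ : SymBichar k ι) : ⨆ a, UKG χ a = ⊤ := by
  refine eq_top_iff.2 fun x _ => ?_
  refine EKF_induction (P := fun x => x ∈ ⨆ a, UKG χ a) (zero_mem _) ?_ (fun x y => add_mem) x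
  intro a u v
  refine Nwt_induction (P := fun v => nE χ u * K χ a * nF χ v ∈ ⨆ a, UKG χ a) ?_ ?_ v
  · intro ν v hv
    have : nE χ u * K χ a * nF χ v = nE χ u * K χ (a - up ν) * (K χ (up ν) * nF χ v) := by
      rw [← mul_assoc, mul_assoc (nE χ u) (K χ (a - up ν)), ← K_add, sub_add_cancel]
    rw [this]
    exact Submodule.mem_iSup_of_mem (a - up ν) (Submodule.mul_mem_mul
      (Submodule.mul_mem_mul (nE_mem_Uplus χ u) (Submodule.mem_span_singleton_self _))
      (K_mul_nF_mem_Gminus χ hv))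
  · intro v w hv hw
    rw [map_add, mul_add]
    exact add_mem hv hw

theorem UKG_isInternal (χ : SymBichar k ι) : DirectSum.IsInternal (UKG χ) :=
  isInternal_of_proj (π := projW χ) (fun a v hv => by rw [projW_UKG χ a a hv, if_pos rfl])
    (fun a b hab v hv => by rw [projW_UKG χ a b hv, if_neg (Ne.symm hab)]) (iSup_UKG χ)

theorem projP_eq (χ : SymBichar k ι) (a : ι → ℤ) : projP χ a = projW χ a :=
  componentProj_eq (π := projW χ) (fun a v hv => by rw [projW_UKG χ a a hv, if_pos rfl])
    (fun a b hab v hv => by rw [projW_UKG χ a b hv, if_neg (Ne.symm hab)]) (iSup_UKG χ) a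

theorem mem_UplusWt {χ : SymBichar k ι} {μ : ι → ℕ} {x : U χ} :
    x ∈ UplusWt χ μ ↔ ∃ u ∈ Nwt χ μ, nE χ u = x := by
  constructor
  · rintro ⟨p, hp, rfl⟩
    exact ⟨mkN χ p, ⟨p, hp, rfl⟩, rfl⟩
  · rintro ⟨_, ⟨p, hp, rfl⟩, rfl⟩
    exact ⟨p, hp, rfl⟩

theorem mem_UminusWt {χ : SymBichar k ι} {μ : ι → ℕ} {x : U χ} :
    x ∈ UminusWt χ μ ↔ ∃ u ∈ Nwt χ μ, nF χ u = x := by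
  constructor
  · rintro ⟨p, hp, rfl⟩
    exact ⟨mkN χ p, ⟨p, hp, rfl⟩, rfl⟩
  · rintro ⟨_, ⟨p, hp, rfl⟩, rfl⟩
    exact ⟨p, hp, rfl⟩

theorem H_eq_span (χ : SymBichar k ι) : (H χ).toSubmodule = Submodule.span k (Set.range (K χ)) := by
  rw [H, Algebra.adjoin_eq_span]
  congr 1
  refine Set.Subset.antisymm ?_ Submonoid.subset_closure
  intro x hx
  induction hx using Submonoid.closure_induction with
  | mem x hx => exact hx
  | one => exact ⟨0, K_zero χ⟩
  | mul x y _ _ hx hy =>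
    obtain ⟨a, rfl⟩ := hx
    obtain ⟨b, rfl⟩ := hy
    exact ⟨a + b, K_add χ a b⟩

/-- The projection `π_{μ,ν}`. -/
def projUHU (χ : SymBichar k ι) (m : (ι → ℕ) × (ι → ℕ)) : U χ →ₗ[k] U χ :=
  (pbwEquiv χ).toLinearMap ∘ₗ Finsupp.mapRange.linearMap
    (TensorProduct.map (prN χ m.1) (prN χ m.2)) ∘ₗ (pbwEquiv χ).symm.toLinearMap

theorem projUHU_pbw (χ : SymBichar k ι) (m : (ι → ℕ) × (ι → ℕ)) (a : ι → ℤ) (u v : Nic χ) :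
    projUHU χ m (nE χ u * K χ a * nF χ v) =
      nE χ (prN χ m.1 u) * K χ a * nF χ (prN χ m.2 v) := by
  rw [← pbwEquiv_om χ a (prN χ m.1 u)]
  simp only [projUHU, LinearMap.comp_apply, LinearEquiv.coe_coe, pbwEquiv_symm_mul, om_apply,
    Finsupp.mapRange.linearMap_apply, Finsupp.mapRange_single, TensorProduct.map_tmul]

theorem projUHU_of_mem (χ : SymBichar k ι) (m n : (ι → ℕ) × (ι → ℕ)) {z : U χ}
    (hz : z ∈ UHU χ n) : projUHU χ m z = if n = m then z else 0 := by
  refine Submodule.mul_induction_on hz ?_ ?_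
  · intro y hy f hf
    obtain ⟨v, hv, rfl⟩ := mem_UminusWt.1 hf
    refine Submodule.mul_induction_on hy ?_ ?_
    · intro x hx h hh
      obtain ⟨u, hu, rfl⟩ := mem_UplusWt.1 hx
      rw [H_eq_span] at hh
      induction hh using Submodule.span_induction with
      | mem h hh =>
        obtain ⟨a, rfl⟩ := hh
        rw [projUHU_pbw, prN_of_mem hu, prN_of_mem hv]
        by_cases h1 : n.1 = m.1
        · by_cases h2 : n.2 = m.2
          · simp [h1, h2, Prod.ext_iff]
          · simp [h2, Prod.ext_iff]
        · simp [h1, Prod.ext_iff]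
      | zero => simp
      | add a b _ _ ha hb =>
        rw [mul_add, add_mul, map_add, ha, hb]
        split_ifs <;> simp
      | smul c a _ ha =>
        rw [mul_smul_comm, smul_mul_assoc, map_smul, ha]
        split_ifs <;> simp
    · intro x y hx hy
      rw [add_mul, map_add, hx, hy]
      split_ifs <;> simp
  · intro x y hx hy
    rw [map_add, hx, hy]
    split_ifs <;> simp

theorem iSup_UHU (χ : SymBichar k ι) : ⨆ m, UHU χ m = ⊤ := by
  refine eq_top_iff.2 fun x _ => ?_
  refine EKF_induction (P := fun x => x ∈ ⨆ m, UHU χ m) (zero_mem _) ?_ (fun x y => add_mem) x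
  intro a u v
  refine Nwt_induction (P := fun u => nE χ u * K χ a * nF χ v ∈ ⨆ m, UHU χ m) ?_ ?_ u
  · intro μ u hu
    refine Nwt_induction (P := fun v => nE χ u * K χ a * nF χ v ∈ ⨆ m, UHU χ m) ?_ ?_ v
    · intro ν v hv
      exact Submodule.mem_iSup_of_mem (μ, ν) (Submodule.mul_mem_mul
        (Submodule.mul_mem_mul (mem_UplusWt.2 ⟨u, hu, rfl⟩) (Algebra.subset_adjoin ⟨a, rfl⟩))
        (mem_UminusWt.2 ⟨v, hv, rfl⟩))
    · intro v w hv hw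
      rw [map_add, mul_add]
      exact add_mem hv hw
  · intro v w hv hw
    rw [map_add, add_mul, add_mul]
    exact add_mem hv hw

theorem UHU_isInternal (χ : SymBichar k ι) : DirectSum.IsInternal (UHU χ) :=
  isInternal_of_proj (π := projUHU χ) (fun a v hv => by rw [projUHU_of_mem χ a a hv, if_pos rfl])
    (fun a b hab v hv => by rw [projUHU_of_mem χ a b hv, if_neg (Ne.symm hab)]) (iSup_UHU χ)

theorem projPi_of_mem_H (χ : SymBichar k ι) {x : U χ} (hx : x ∈ H χ) :
    projPi χ (0, 0) x = x := by
  suffices h : x ∈ UHU χ (0, 0) by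
    rw [projPi, componentProj_eq (π := projUHU χ)
      (fun a v hv => by rw [projUHU_of_mem χ a a hv, if_pos rfl])
      (fun a b hab v hv => by rw [projUHU_of_mem χ a b hv, if_neg (Ne.symm hab)]) (iSup_UHU χ),
      projUHU_of_mem χ _ _ h, if_pos rfl]
  have h1 : (1 : U χ) ∈ UplusWt χ 0 := mem_UplusWt.2 ⟨1, one_mem_Nwt χ, map_one _⟩
  have h2 : (1 : U χ) ∈ UminusWt χ 0 := mem_UminusWt.2 ⟨1, one_mem_Nwt χ, map_one _⟩
  have := Submodule.mul_mem_mul (Submodule.mul_mem_mul h1 (show x ∈ (H χ).toSubmodule from hx)) h2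
  rwa [one_mul, mul_one] at this

/-! ### The skew Hopf pairing -/

/-- `φ ⊗ id`: `v ⊗ w ↦ φ(v) w`. -/
def coeffL {V W : Type*} [AddCommGroup V] [Module k V] [AddCommGroup W] [Module k W]
    (φ : V →ₗ[k] k) : V ⊗[k] W →ₗ[k] W :=
  (TensorProduct.lid k W).toLinearMap ∘ₗ LinearMap.rTensor W φ

@[simp] theorem coeffL_tmul {V W : Type*} [AddCommGroup V] [Module k V] [AddCommGroup W]
    [Module k W] (φ : V →ₗ[k] k) (v : V) (w : W) : coeffL φ (v ⊗ₜ[k] w) = φ v • w := by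
  simp [coeffL]

theorem coeffL_zero {V W : Type*} [AddCommGroup V] [Module k V] [AddCommGroup W]
    [Module k W] (w : V ⊗[k] W) : coeffL (0 : V →ₗ[k] k) w = 0 := by
  simp [coeffL]

theorem coeffR_zero {V W : Type*} [AddCommGroup V] [Module k V] [AddCommGroup W]
    [Module k W] (w : V ⊗[k] W) : coeffR (0 : W →ₗ[k] k) w = 0 := by
  simp [coeffR]

theorem coeffL_smul {V W : Type*} [AddCommGroup V] [Module k V] [AddCommGroup W]
    [Module k W] (c : k) (φ : V →ₗ[k] k) (w : V ⊗[k] W) : coeffL (c • φ) w = c • coeffL φ w := by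
  simp [coeffL, LinearMap.rTensor_smul]

theorem coeffR_smul {V W : Type*} [AddCommGroup V] [Module k V] [AddCommGroup W]
    [Module k W] (c : k) (φ : W →ₗ[k] k) (w : V ⊗[k] W) : coeffR (c • φ) w = c • coeffR φ w := by
  simp [coeffR, LinearMap.lTensor_smul]

theorem coeffL_mul {A B : Type*} [Ring A] [Algebra k A] [Ring B] [Algebra k B]
    (φ ψ : A →ₗ[k] k) (a a' : A) (b b' : B) (h : ∀ x, φ (a * x * a') = ψ x) (w : A ⊗[k] B) :
    coeffL φ ((a ⊗ₜ[k] b) * w * (a' ⊗ₜ[k] b')) = b * coeffL ψ w * b' := by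
  induction w with
  | zero => simp
  | tmul x y => simp [h]
  | add x y hx hy => simp only [mul_add, add_mul, map_add, hx, hy]

theorem coeffL_mul_left {A B : Type*} [Ring A] [Algebra k A] [Ring B] [Algebra k B]
    (φ ψ : A →ₗ[k] k) (a : A) (b : B) (h : ∀ x, φ (a * x) = ψ x) (w : A ⊗[k] B) :
    coeffL φ ((a ⊗ₜ[k] b) * w) = b * coeffL ψ w := by
  have := coeffL_mul φ ψ a 1 b 1 (fun x => by simp [h]) w
  rwa [← Algebra.TensorProduct.one_def, mul_one, mul_one] at this

theorem coeffL_mul_right {A B : Type*} [Ring A] [Algebra k A] [Ring B] [Algebra k B]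
    (φ ψ : A →ₗ[k] k) (a : A) (b : B) (h : ∀ x, φ (x * a) = ψ x) (w : A ⊗[k] B) :
    coeffL φ (w * (a ⊗ₜ[k] b)) = coeffL ψ w * b := by
  have := coeffL_mul φ ψ 1 a 1 b (fun x => by simp [h]) w
  rwa [← Algebra.TensorProduct.one_def, one_mul, one_mul] at this

theorem coeffR_mul_left {A B : Type*} [Ring A] [Algebra k A] [Ring B] [Algebra k B]
    (φ ψ : B →ₗ[k] k) (a : A) (b : B) (h : ∀ x, φ (b * x) = ψ x) (w : A ⊗[k] B) :
    coeffR φ ((a ⊗ₜ[k] b) * w) = a * coeffR ψ w := by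
  have := coeffR_mul φ ψ a 1 b 1 (fun x => by simp [h]) w
  rwa [← Algebra.TensorProduct.one_def, mul_one, mul_one] at this

theorem coeffR_mul_right {A B : Type*} [Ring A] [Algebra k A] [Ring B] [Algebra k B]
    (φ ψ : B →ₗ[k] k) (a : A) (b : B) (h : ∀ x, φ (x * b) = ψ x) (w : A ⊗[k] B) :
    coeffR φ (w * (a ⊗ₜ[k] b)) = coeffR ψ w * a := by
  have := coeffR_mul φ ψ 1 a 1 b (fun x => by simp [h]) w
  rwa [← Algebra.TensorProduct.one_def, one_mul, one_mul] at this

theorem tf_eq_coeffL {V W : Type*} [AddCommGroup V] [Module k V] [AddCommGroup W]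
    [Module k W] (φ : V →ₗ[k] k) (ψ : W →ₗ[k] k) (w : V ⊗[k] W) :
    tf φ ψ w = ψ (coeffL φ w) := by
  induction w with
  | zero => simp
  | tmul x y => simp
  | add x y hx hy => simp only [map_add, hx, hy]

theorem tf_eq_coeffR {V W : Type*} [AddCommGroup V] [Module k V] [AddCommGroup W]
    [Module k W] (φ : V →ₗ[k] k) (ψ : W →ₗ[k] k) (w : V ⊗[k] W) :
    tf φ ψ w = φ (coeffR ψ w) := by
  induction w with
  | zero => simp
  | tmul x y => simp [mul_comm]
  | add x y hx hy => simp only [map_add, hx, hy]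

@[simp] theorem counit_E (χ : SymBichar k ι) (i : ι) : counit χ (E χ i) = 0 := liftU_E _ _ _
@[simp] theorem counit_F (χ : SymBichar k ι) (i : ι) : counit χ (F χ i) = 0 := liftU_F _ _ _
@[simp] theorem counit_K (χ : SymBichar k ι) (a : ι → ℤ) : counit χ (K χ a) = 1 := liftU_K _ _ _

@[simp] theorem counit_nE (χ : SymBichar k ι) (u : Nic χ) : counit χ (nE χ u) = epsN χ u := by
  have : (counit χ).comp (nE χ) = epsN χ := Nic_algHom_ext fun i => by simp
  exact AlgHom.congr_fun this u

@[simp] theorem counit_nF (χ : SymBichar k ι) (u : Nic χ) : counit χ (nF χ u) = epsN χ u := by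
  have : (counit χ).comp (nF χ) = epsN χ := Nic_algHom_ext fun i => by simp
  exact AlgHom.congr_fun this u

theorem U_algHom_ext {χ : SymBichar k ι} {A : Type*} [Ring A] [Algebra k A]
    {f g : U χ →ₐ[k] A} (hE : ∀ i, f (E χ i) = g (E χ i)) (hF : ∀ i, f (F χ i) = g (F χ i))
    (hK : ∀ a, f (K χ a) = g (K χ a)) : f = g := by
  refine AlgHom.ext fun x => ?_
  refine U_induction χ (P := fun x => f x = g x) ?_ hE hF hK ?_ ?_ x
  · intro c; simp
  · intro x y hx hy; simp [hx, hy]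
  · intro x y hx hy; simp [hx, hy]

theorem comul_coassoc (χ : SymBichar k ι) (x : U χ) :
    Algebra.TensorProduct.assoc k k k (U χ) (U χ) (U χ)
      (Algebra.TensorProduct.map (comul χ) (AlgHom.id k (U χ)) (comul χ x)) =
    Algebra.TensorProduct.map (AlgHom.id k (U χ)) (comul χ) (comul χ x) := by
  have : ((Algebra.TensorProduct.assoc k k k (U χ) (U χ) (U χ)).toAlgHom.comp
      (Algebra.TensorProduct.map (comul χ) (AlgHom.id k (U χ)))).comp (comul χ) =
      (Algebra.TensorProduct.map (AlgHom.id k (U χ)) (comul χ)).comp (comul χ) := by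
    refine U_algHom_ext (fun i => ?_) (fun i => ?_) (fun a => ?_)
    · simp [comul_E, comul_K, TensorProduct.add_tmul, TensorProduct.tmul_add, add_assoc,
        Algebra.TensorProduct.one_def]
    · simp [comul_F, comul_K, TensorProduct.add_tmul, TensorProduct.tmul_add, add_assoc,
        Algebra.TensorProduct.one_def]
    · simp [comul_K]
  exact AlgHom.congr_fun this x

theorem coeffL_counit_comul (χ : SymBichar k ι) (x : U χ) :
    coeffL (counit χ).toLinearMap (comul χ x) = x := by
  have : ((Algebra.TensorProduct.lid k (U χ)).toAlgHom.comp
      (Algebra.TensorProduct.map (counit χ) (AlgHom.id k (U χ)))).comp (comul χ) =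
      AlgHom.id k (U χ) := by
    refine U_algHom_ext (fun i => ?_) (fun i => ?_) (fun a => ?_)
    · simp [comul_E]
    · simp [comul_F]
    · simp [comul_K]
  exact AlgHom.congr_fun this x

theorem coeffR_counit_comul (χ : SymBichar k ι) (x : U χ) :
    coeffR (counit χ).toLinearMap (comul χ x) = x := by
  have : ((Algebra.TensorProduct.rid k k (U χ)).toAlgHom.comp
      (Algebra.TensorProduct.map (AlgHom.id k (U χ)) (counit χ))).comp (comul χ) =
      AlgHom.id k (U χ) := by
    refine U_algHom_ext (fun i => ?_) (fun i => ?_) (fun a => ?_)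
    · simp [comul_E]
    · simp [comul_F]
    · simp [comul_K]
  exact AlgHom.congr_fun this x

theorem comul_coeffL (χ : SymBichar k ι) (φ : U χ →ₗ[k] k) (x : U χ) :
    comul χ (coeffL φ (comul χ x)) =
      LinearMap.rTensor (U χ) (coeffL φ ∘ₗ (comul χ).toLinearMap) (comul χ x) := by
  have h1 : ∀ w : U χ ⊗[k] U χ, comul χ (coeffL φ w) =
      coeffL φ (Algebra.TensorProduct.map (AlgHom.id k (U χ)) (comul χ) w) := by
    intro w
    induction w with
    | zero => simp
    | tmul x y => simp
    | add x y hx hy => simp only [map_add, hx, hy]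
  have h2 : ∀ w : U χ ⊗[k] U χ, coeffL φ (Algebra.TensorProduct.assoc k k k (U χ) (U χ) (U χ)
      (Algebra.TensorProduct.map (comul χ) (AlgHom.id k (U χ)) w)) =
      LinearMap.rTensor (U χ) (coeffL φ ∘ₗ (comul χ).toLinearMap) w := by
    intro w
    induction w with
    | zero => simp
    | tmul x y =>
      simp only [Algebra.TensorProduct.map_tmul, AlgHom.id_apply, LinearMap.rTensor_tmul,
        LinearMap.comp_apply, AlgHom.toLinearMap_apply]
      induction comul χ x with
      | zero => simp
      | tmul a b => simp [TensorProduct.smul_tmul']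
      | add a b ha hb => simp only [TensorProduct.add_tmul, map_add, ha, hb]
    | add x y hx hy => simp only [map_add, hx, hy]
  rw [h1, ← h2, comul_coassoc]

theorem comul_coeffR (χ : SymBichar k ι) (φ : U χ →ₗ[k] k) (x : U χ) :
    comul χ (coeffR φ (comul χ x)) =
      LinearMap.lTensor (U χ) (coeffR φ ∘ₗ (comul χ).toLinearMap) (comul χ x) := by
  have h1 : ∀ w : U χ ⊗[k] U χ, (comul χ (coeffR φ w)) =
      coeffR φ (Algebra.TensorProduct.map (comul χ) (AlgHom.id k (U χ)) w) := by
    intro w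
    induction w with
    | zero => simp
    | tmul x y => simp
    | add x y hx hy => simp only [map_add, hx, hy]
  have h2 : ∀ w : (U χ ⊗[k] U χ) ⊗[k] U χ, coeffR φ w =
      LinearMap.lTensor (U χ) (coeffR φ)
        (Algebra.TensorProduct.assoc k k k (U χ) (U χ) (U χ) w) := by
    intro w
    induction w with
    | zero => simp
    | tmul x y =>
      induction x with
      | zero => simp
      | tmul a b => simp
      | add a b ha hb => simp only [TensorProduct.add_tmul, map_add, ha, hb]
    | add x y hx hy => simp only [map_add, hx, hy]
  have h3 : ∀ w : U χ ⊗[k] U χ, LinearMap.lTensor (U χ) (coeffR φ)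
      (Algebra.TensorProduct.map (AlgHom.id k (U χ)) (comul χ) w) =
      LinearMap.lTensor (U χ) (coeffR φ ∘ₗ (comul χ).toLinearMap) w := by
    intro w
    induction w with
    | zero => simp
    | tmul x y => simp
    | add x y hx hy => simp only [map_add, hx, hy]
  rw [h1, h2, comul_coassoc, h3]

/-- `E K_a F ↦ ε(E) K_a F`. -/
def coordM (χ : SymBichar k ι) : U χ →ₗ[k] ((ι → ℤ) →₀ Nic χ) :=
  Finsupp.mapRange.linearMap (coeffL (epsN χ).toLinearMap) ∘ₗ (pbwEquiv χ).symm.toLinearMap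

/-- `E K_a F ↦ ε(F) E K_a`. -/
def coordP (χ : SymBichar k ι) : U χ →ₗ[k] ((ι → ℤ) →₀ Nic χ) :=
  Finsupp.mapRange.linearMap (coeffR (epsN χ).toLinearMap) ∘ₗ (pbwEquiv χ).symm.toLinearMap

theorem coordM_pbw (χ : SymBichar k ι) (a : ι → ℤ) (u v : Nic χ) :
    coordM χ (nE χ u * K χ a * nF χ v) = epsN χ u • Finsupp.single a v := by
  simp only [coordM, LinearMap.comp_apply, LinearEquiv.coe_coe, pbwEquiv_symm_mul, om_apply,
    Finsupp.mapRange.linearMap_apply, Finsupp.mapRange_single, coeffL_tmul,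
    AlgHom.toLinearMap_apply, Finsupp.smul_single]

theorem coordP_pbw (χ : SymBichar k ι) (a : ι → ℤ) (u v : Nic χ) :
    coordP χ (nE χ u * K χ a * nF χ v) = epsN χ v • Finsupp.single a u := by
  simp only [coordP, LinearMap.comp_apply, LinearEquiv.coe_coe, pbwEquiv_symm_mul, om_apply,
    Finsupp.mapRange.linearMap_apply, Finsupp.mapRange_single, coeffR_tmul,
    AlgHom.toLinearMap_apply, Finsupp.smul_single]

/-- `(K_a f, e K_b) ↦ χ(a,b)⁻¹ ⟨S_{-a} f, e⟩`. -/
def coordForm (χ : SymBichar k ι) : ((ι → ℤ) →₀ Nic χ) →ₗ[k] ((ι → ℤ) →₀ Nic χ) →ₗ[k] k :=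
  Finsupp.lsum k fun a => LinearMap.flip (Finsupp.lsum k fun b =>
    (χ.val a b)⁻¹ • (formN χ ∘ₗ (S χ (-a)).toLinearMap).flip)

theorem coordForm_single (χ : SymBichar k ι) (a b : ι → ℤ) (f e : Nic χ) :
    coordForm χ (Finsupp.single a f) (Finsupp.single b e) =
      (χ.val a b)⁻¹ * formN χ (S χ (-a) f) e := by
  simp [coordForm]

/-- The pairing, extended by zero to all of `U`. -/
def pairU (χ : SymBichar k ι) : U χ →ₗ[k] U χ →ₗ[k] k :=
  (coordForm χ).compl₁₂ (coordM χ) (coordP χ)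

theorem pairU_pbw (χ : SymBichar k ι) (a b : ι → ℤ) (u f e v : Nic χ) :
    pairU χ (nE χ u * K χ a * nF χ f) (nE χ e * K χ b * nF χ v) =
      epsN χ u * epsN χ v * ((χ.val a b)⁻¹ * formN χ (S χ (-a) f) e) := by
  simp only [pairU, LinearMap.compl₁₂_apply, coordM_pbw, coordP_pbw, map_smul,
    LinearMap.smul_apply, smul_eq_mul, coordForm_single]
  ring

theorem pairU_K_nF (χ : SymBichar k ι) (a b : ι → ℤ) (f e v : Nic χ) :
    pairU χ (K χ a * nF χ f) (nE χ e * K χ b * nF χ v) =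
      epsN χ v * ((χ.val a b)⁻¹ * formN χ (S χ (-a) f) e) := by
  have := pairU_pbw χ a b 1 f e v
  simpa using this

theorem pairU_nE_K (χ : SymBichar k ι) (a b : ι → ℤ) (u f e : Nic χ) :
    pairU χ (nE χ u * K χ a * nF χ f) (nE χ e * K χ b) =
      epsN χ u * ((χ.val a b)⁻¹ * formN χ (S χ (-a) f) e) := by
  have := pairU_pbw χ a b u f e 1
  simpa using this

theorem pairU_K_left (χ : SymBichar k ι) (a b : ι → ℤ) (e v : Nic χ) :
    pairU χ (K χ a) (nE χ e * K χ b * nF χ v) = epsN χ v * ((χ.val a b)⁻¹ * epsN χ e) := by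
  have := pairU_K_nF χ a b 1 e v
  simpa using this

theorem formN_x (χ : SymBichar k ι) (i : ι) (u : Nic χ) :
    formN χ (nx χ i) u = epsN χ (dL χ i u) := by
  rw [← mul_one (nx χ i), formN_x_mul, formN_one]

theorem pairU_F_left (χ : SymBichar k ι) (i : ι) (b : ι → ℤ) (e v : Nic χ) :
    pairU χ (F χ i) (nE χ e * K χ b * nF χ v) = epsN χ v * epsN χ (dL χ i e) := by
  have := pairU_K_nF χ 0 b (nx χ i) e v
  simpa [K_zero, formN_x] using this

theorem pairU_K_right (χ : SymBichar k ι) (a b : ι → ℤ) (u f : Nic χ) :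
    pairU χ (nE χ u * K χ a * nF χ f) (K χ b) = epsN χ u * ((χ.val a b)⁻¹ * epsN χ f) := by
  have := pairU_nE_K χ a b u f 1
  rw [formN_symm, formN_one, epsN_S, map_one, one_mul] at this
  exact this

theorem pairU_E_right (χ : SymBichar k ι) (i : ι) (a : ι → ℤ) (u f : Nic χ) :
    pairU χ (nE χ u * K χ a * nF χ f) (E χ i) =
      epsN χ u * ((χ.val a (α i))⁻¹ * epsN χ (dL χ i f)) := by
  have := pairU_nE_K χ a 0 u f (nx χ i)
  rw [formN_symm, formN_x, dL_S, map_smul, epsN_S, K_zero, nE_x, mul_one, val_zero_right, inv_one,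
    one_mul, val_neg_left, smul_eq_mul] at this
  exact this

/-- Contraction of the first tensor factor of the coproduct. -/
def lamL (χ : SymBichar k ι) (φ : U χ →ₗ[k] k) : U χ →ₗ[k] U χ := coeffL φ ∘ₗ (comul χ).toLinearMap

/-- Contraction of the second tensor factor of the coproduct. -/
def lamR (χ : SymBichar k ι) (φ : U χ →ₗ[k] k) : U χ →ₗ[k] U χ := coeffR φ ∘ₗ (comul χ).toLinearMap

theorem lamL_apply (χ : SymBichar k ι) (φ : U χ →ₗ[k] k) (x : U χ) :
    lamL χ φ x = coeffL φ (comul χ x) := rfl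

theorem lamR_apply (χ : SymBichar k ι) (φ : U χ →ₗ[k] k) (x : U χ) :
    lamR χ φ x = coeffR φ (comul χ x) := rfl

theorem pairU_mul_F (χ : SymBichar k ι) (y x : U χ) (i : ι) : pairU χ y (x * F χ i) = 0 := by
  refine EKF_induction (P := fun x => pairU χ y (x * F χ i) = 0) (by simp) ?_ ?_ x
  · intro b e v
    rw [mul_assoc, ← nF_x, ← map_mul, pairU, LinearMap.compl₁₂_apply, coordP_pbw, map_mul, epsN_x,
      mul_zero, zero_smul, map_zero]
  · intro x x' hx hx'
    rw [add_mul, map_add, hx, hx', add_zero]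

theorem pairU_E_mul (χ : SymBichar k ι) (y x : U χ) (i : ι) : pairU χ (E χ i * y) x = 0 := by
  refine EKF_induction (P := fun y => pairU χ (E χ i * y) x = 0) (by simp) ?_ ?_ y
  · intro b e v
    rw [← mul_assoc, ← mul_assoc, ← nE_x, ← map_mul, pairU, LinearMap.compl₁₂_apply, coordM_pbw,
      map_mul, epsN_x, zero_mul, zero_smul, map_zero, LinearMap.zero_apply]
  · intro x x' hx hx'
    rw [mul_add, map_add, LinearMap.add_apply, hx, hx', add_zero]

theorem lamL_mul_nF (χ : SymBichar k ι) (y x : U χ) (v : Nic χ) :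
    lamL χ (pairU χ y) (x * nF χ v) = lamL χ (pairU χ y) x * nF χ v := by
  refine Nic_induction (P := fun v => ∀ x, lamL χ (pairU χ y) (x * nF χ v) =
    lamL χ (pairU χ y) x * nF χ v) (by simp) ?_ ?_ ?_ v x
  · intro i v hv x
    rw [map_mul (nF χ), ← mul_assoc, hv, nF_x, lamL_apply, map_mul (comul χ), comul_F, mul_add, map_add,
      coeffL_mul_right (pairU χ y) 0 _ _ (fun x => pairU_mul_F χ y x i),
      coeffL_mul_right (pairU χ y) (pairU χ y) _ _ (fun x => by rw [mul_one]), coeffL_zero,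
      zero_mul, zero_add, ← lamL_apply, mul_assoc]
  · intro u v hu hv x
    simp only [map_add, mul_add, hu, hv]
  · intro c u hu x
    simp only [map_smul, mul_smul_comm, hu]

theorem lamR_nE_mul (χ : SymBichar k ι) (y x : U χ) (u : Nic χ) :
    lamR χ ((pairU χ).flip x) (nE χ u * y) = nE χ u * lamR χ ((pairU χ).flip x) y := by
  refine Nic_induction (P := fun u => ∀ y, lamR χ ((pairU χ).flip x) (nE χ u * y) =
    nE χ u * lamR χ ((pairU χ).flip x) y) (by simp) ?_ ?_ ?_ u y
  · intro i u hu y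
    rw [map_mul (nE χ), mul_assoc, mul_assoc, ← hu, nE_x, lamR_apply, map_mul (comul χ), comul_E, add_mul, map_add,
      coeffR_mul_left ((pairU χ).flip x) ((pairU χ).flip x) _ _ (fun x => by rw [one_mul]),
      coeffR_mul_left ((pairU χ).flip x) 0 _ _ (fun y => pairU_E_mul χ y x i), coeffR_zero,
      mul_zero, add_zero, ← lamR_apply]
  · intro u v hu hv x
    simp only [map_add, add_mul, hu, hv]
  · intro c u hu x
    simp only [map_smul, smul_mul_assoc, hu]

theorem pairU_one (χ : SymBichar k ι) : pairU χ 1 = (counit χ).toLinearMap := by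
  refine EKF_hom_ext fun b e v => ?_
  rw [← K_zero, pairU_K_left]
  simp [mul_comm]

theorem pairU_flip_one (χ : SymBichar k ι) (y : U χ) : pairU χ y 1 = counit χ y := by
  have : (pairU χ).flip 1 = (counit χ).toLinearMap := by
    refine EKF_hom_ext fun b e v => ?_
    rw [← K_zero, LinearMap.flip_apply, pairU_K_right]
    simp
  rw [← LinearMap.flip_apply, this]
  rfl

theorem lamL_K (χ : SymBichar k ι) (a b : ι → ℤ) (e v : Nic χ) :
    lamL χ (pairU χ (K χ a)) (nE χ e * K χ b * nF χ v) =
      (χ.val a b)⁻¹ • (nE χ (S χ (-a) e) * K χ b * nF χ v) := by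
  rw [lamL_mul_nF, ← smul_mul_assoc]
  congr 1
  refine Nic_induction (P := fun e => lamL χ (pairU χ (K χ a)) (nE χ e * K χ b) =
    (χ.val a b)⁻¹ • (nE χ (S χ (-a) e) * K χ b)) ?_ ?_ ?_ ?_ e
  · have := pairU_K_left χ a b 1 1
    simp only [map_one, one_mul, mul_one] at this
    rw [map_one, map_one, map_one, one_mul, lamL_apply, comul_K, coeffL_tmul, this]
  · intro j e he
    have h1 : ∀ x, pairU χ (K χ a) (E χ j * x) = (0 : U χ →ₗ[k] k) x := by
      refine LinearMap.congr_fun (f := pairU χ (K χ a) ∘ₗ LinearMap.mulLeft k (E χ j))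
        (EKF_hom_ext fun c u v => ?_)
      rw [LinearMap.comp_apply, LinearMap.mulLeft_apply, ← mul_assoc, ← mul_assoc, ← nE_x,
        ← map_mul, pairU_K_left]
      simp
    have h2 : ∀ x, pairU χ (K χ a) (K χ (α j) * x) =
        ((χ.val a (α j))⁻¹ • pairU χ (K χ a)) x := by
      refine LinearMap.congr_fun (f := pairU χ (K χ a) ∘ₗ LinearMap.mulLeft k (K χ (α j)))
        (EKF_hom_ext fun c u v => ?_)
      rw [LinearMap.comp_apply, LinearMap.mulLeft_apply, ← mul_assoc, ← mul_assoc, K_mul_nE,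
        mul_assoc (nE χ _), ← K_add, pairU_K_left, LinearMap.smul_apply, pairU_K_left, epsN_S,
        val_add_right, mul_inv, smul_eq_mul]
      ring
    rw [map_mul (nE χ), mul_assoc, nE_x, lamL_apply, map_mul (comul χ), comul_E, add_mul, map_add,
      coeffL_mul_left _ _ _ _ h1, coeffL_mul_left _ _ _ _ h2, coeffL_zero, mul_zero, zero_add,
      coeffL_smul, ← lamL_apply, he, map_mul (S χ (-a)), S_x, smul_mul_assoc, map_smul, map_mul (nE χ), nE_x,
      val_neg_left, smul_mul_assoc, mul_smul_comm, mul_smul_comm, smul_comm, mul_assoc]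
  · intro u v hu hv
    simp only [map_add, add_mul, smul_add, hu, hv]
  · intro c u hu
    simp only [map_smul, smul_mul_assoc, hu, smul_comm c]

theorem lamL_F (χ : SymBichar k ι) (i : ι) (b : ι → ℤ) (e v : Nic χ) :
    lamL χ (pairU χ (F χ i)) (nE χ e * K χ b * nF χ v) = nE χ (dL χ i e) * K χ b * nF χ v := by
  rw [lamL_mul_nF]
  congr 1
  refine Nic_induction (P := fun e => lamL χ (pairU χ (F χ i)) (nE χ e * K χ b) =
    nE χ (dL χ i e) * K χ b) ?_ ?_ ?_ ?_ e
  · have := pairU_F_left χ i b 1 1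
    simp only [map_one, one_mul, mul_one, dL_one, map_zero] at this
    rw [map_one, dL_one, map_zero, one_mul, lamL_apply, comul_K, coeffL_tmul, this, zero_smul,
      zero_mul]
  · intro j e he
    have h1 : ∀ x, pairU χ (F χ i) (E χ j * x) =
        ((if i = j then (1 : k) else 0) • (counit χ).toLinearMap) x := by
      refine LinearMap.congr_fun (f := pairU χ (F χ i) ∘ₗ LinearMap.mulLeft k (E χ j))
        (EKF_hom_ext fun c u v => ?_)
      rw [LinearMap.comp_apply, LinearMap.mulLeft_apply, ← mul_assoc, ← mul_assoc, ← nE_x,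
        ← map_mul, pairU_F_left, dL_x_mul]
      split_ifs <;> simp [mul_comm]
    have h2 : ∀ x, pairU χ (F χ i) (K χ (α j) * x) = (χ.q i j • pairU χ (F χ i)) x := by
      refine LinearMap.congr_fun (f := pairU χ (F χ i) ∘ₗ LinearMap.mulLeft k (K χ (α j)))
        (EKF_hom_ext fun c u v => ?_)
      rw [LinearMap.comp_apply, LinearMap.mulLeft_apply, ← mul_assoc, ← mul_assoc, K_mul_nE,
        mul_assoc (nE χ _), ← K_add, pairU_F_left, LinearMap.smul_apply, pairU_F_left, dL_S,
        map_smul, epsN_S, q_symm, q_eq, smul_eq_mul, smul_eq_mul]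
      ring
    rw [map_mul (nE χ), mul_assoc, nE_x, lamL_apply, map_mul (comul χ), comul_E, add_mul, map_add,
      coeffL_mul_left _ _ _ _ h1, coeffL_mul_left _ _ _ _ h2, coeffL_smul, coeffL_smul,
      coeffL_counit_comul, one_mul, ← lamL_apply, he, dL_x_mul, map_add, map_smul, map_mul (nE χ), nE_x,
      add_mul, smul_mul_assoc, mul_smul_comm, mul_assoc]
    split_ifs <;> simp
  · intro u v hu hv
    simp only [map_add, add_mul, hu, hv]
  · intro c u hu
    simp only [map_smul, smul_mul_assoc, hu]

theorem lamR_K (χ : SymBichar k ι) (a b : ι → ℤ) (u f : Nic χ) :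
    lamR χ ((pairU χ).flip (K χ b)) (nE χ u * K χ a * nF χ f) =
      (χ.val a b)⁻¹ • (nE χ u * K χ a * nF χ (S χ b f)) := by
  rw [mul_assoc, lamR_nE_mul, mul_assoc, ← mul_smul_comm]
  congr 1
  refine Nic_induction_right (P := fun f => lamR χ ((pairU χ).flip (K χ b)) (K χ a * nF χ f) =
    (χ.val a b)⁻¹ • (K χ a * nF χ (S χ b f))) ?_ ?_ ?_ ?_ f
  · have := pairU_K_right χ a b 1 1
    simp only [map_one, one_mul, mul_one] at this
    rw [map_one, map_one, map_one, mul_one, lamR_apply, comul_K, coeffR_tmul,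
      LinearMap.flip_apply, this]
  · intro j f hf
    have h1 : ∀ y, (pairU χ).flip (K χ b) (y * F χ j) = (0 : U χ →ₗ[k] k) y := by
      refine LinearMap.congr_fun (f := (pairU χ).flip (K χ b) ∘ₗ LinearMap.mulRight k (F χ j))
        (EKF_hom_ext fun c u v => ?_)
      rw [LinearMap.comp_apply, LinearMap.mulRight_apply, mul_assoc, ← nF_x, ← map_mul,
        LinearMap.flip_apply, pairU_K_right]
      simp
    have h2 : ∀ y, (pairU χ).flip (K χ b) (y * K χ (-α j)) =
        (χ.val b (α j) • (pairU χ).flip (K χ b)) y := by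
      refine LinearMap.congr_fun (f := (pairU χ).flip (K χ b) ∘ₗ LinearMap.mulRight k (K χ (-α j)))
        (EKF_hom_ext fun c u v => ?_)
      rw [LinearMap.comp_apply, LinearMap.mulRight_apply, mul_assoc, nF_mul_K, ← mul_assoc,
        mul_assoc (nE χ u), ← K_add, LinearMap.flip_apply, pairU_K_right, LinearMap.smul_apply,
        LinearMap.flip_apply, pairU_K_right, epsN_S, val_add_left, val_neg_left, mul_inv, inv_inv,
        val_symm χ b (α j), smul_eq_mul]
      ring
    rw [map_mul (nF χ), ← mul_assoc, nF_x, lamR_apply, map_mul (comul χ), comul_F, mul_add, map_add,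
      coeffR_mul_right _ _ _ _ h1, coeffR_mul_right _ _ _ _ h2, coeffR_zero, zero_mul, add_zero,
      coeffR_smul, ← lamR_apply, hf, map_mul (S χ b), S_x, mul_smul_comm, map_smul, map_mul (nF χ), nF_x,
      smul_mul_assoc, smul_mul_assoc, mul_smul_comm, smul_comm, mul_assoc]
  · intro u v hu hv
    simp only [map_add, mul_add, smul_add, hu, hv]
  · intro c u hu
    simp only [map_smul, mul_smul_comm, hu, smul_comm c]

theorem lamR_E (χ : SymBichar k ι) (i : ι) (a : ι → ℤ) (u f : Nic χ) :
    lamR χ ((pairU χ).flip (E χ i)) (nE χ u * K χ a * nF χ f) =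
      (χ.val a (α i))⁻¹ • (nE χ u * K χ a * nF χ (dL χ i f)) := by
  rw [mul_assoc, lamR_nE_mul, mul_assoc, ← mul_smul_comm]
  congr 1
  refine Nic_induction_right (P := fun f => lamR χ ((pairU χ).flip (E χ i)) (K χ a * nF χ f) =
    (χ.val a (α i))⁻¹ • (K χ a * nF χ (dL χ i f))) ?_ ?_ ?_ ?_ f
  · have := pairU_E_right χ i a 1 1
    simp only [map_one, one_mul, mul_one, dL_one, map_zero, mul_zero] at this
    rw [map_one, dL_one, map_zero, mul_one, lamR_apply, comul_K, coeffR_tmul,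
      LinearMap.flip_apply, this, zero_smul, mul_zero, smul_zero]
  · intro j f hf
    have h1 : ∀ y, (pairU χ).flip (E χ i) (y * F χ j) =
        ((if i = j then (1 : k) else 0) • (pairU χ).flip (K χ (α i))) y := by
      refine LinearMap.congr_fun (f := (pairU χ).flip (E χ i) ∘ₗ LinearMap.mulRight k (F χ j))
        (EKF_hom_ext fun c u v => ?_)
      rw [LinearMap.comp_apply, LinearMap.mulRight_apply, mul_assoc, ← nF_x, ← map_mul,
        LinearMap.flip_apply, pairU_E_right, LinearMap.smul_apply, LinearMap.flip_apply,
        pairU_K_right, dL_mul, map_add, map_mul, map_mul, epsN_x, epsN_S, dL_x]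
      split_ifs <;> simp
    have h2 : ∀ y, (pairU χ).flip (E χ i) (y * K χ (-α j)) = (pairU χ).flip (E χ i) y := by
      refine LinearMap.congr_fun (f := (pairU χ).flip (E χ i) ∘ₗ LinearMap.mulRight k (K χ (-α j)))
        (EKF_hom_ext fun c u v => ?_)
      rw [LinearMap.comp_apply, LinearMap.mulRight_apply, mul_assoc, nF_mul_K, ← mul_assoc,
        mul_assoc (nE χ u), ← K_add, LinearMap.flip_apply, pairU_E_right,
        LinearMap.flip_apply, pairU_E_right, dL_S, map_smul, epsN_S, val_add_left, mul_inv,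
        smul_eq_mul, mul_assoc (χ.val c (α i))⁻¹, inv_mul_cancel_left₀ (val_ne_zero _ _ _)]
    have h3 : lamR χ ((pairU χ).flip (K χ (α i))) (K χ a * nF χ f) =
        (χ.val a (α i))⁻¹ • (K χ a * nF χ (S χ (α i) f)) := by
      have := lamR_K χ a (α i) 1 f
      simpa using this
    rw [map_mul (nF χ), ← mul_assoc, nF_x, lamR_apply, map_mul (comul χ), comul_F, mul_add, map_add,
      coeffR_mul_right _ _ _ _ h1, coeffR_mul_right _ _ _ _ h2, mul_one, coeffR_smul,
      ← lamR_apply, ← lamR_apply, hf, h3, dL_mul, dL_x, map_add, map_mul (nF χ), nF_x, mul_add, smul_add,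
      smul_mul_assoc, mul_assoc]
    split_ifs <;> simp [add_comm]
  · intro u v hu hv
    simp only [map_add, mul_add, smul_add, hu, hv]
  · intro c u hu
    simp only [map_smul, mul_smul_comm, hu, smul_comm c]

/-- A subspace which contains `1` and is stable under left multiplication by generators contains
the subalgebra. -/
theorem adjoin_le_of_mul_mem {A : Type*} [Ring A] [Algebra k A] (s : Set A) (M : Submodule k A)
    (h1 : (1 : A) ∈ M) (hs : ∀ x ∈ s, ∀ m ∈ M, x * m ∈ M) {x : A} (hx : x ∈ Algebra.adjoin k s) :
    x ∈ M := by
  suffices h : ∀ m ∈ M, x * m ∈ M by simpa using h 1 h1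
  induction hx using Algebra.adjoin_induction with
  | mem x hx => exact hs x hx
  | algebraMap r => intro m hm; rw [← Algebra.smul_def]; exact M.smul_mem r hm
  | add x y _ _ hx hy => intro m hm; rw [add_mul]; exact M.add_mem (hx m hm) (hy m hm)
  | mul x y _ _ hx hy => intro m hm; rw [mul_assoc]; exact hx _ (hy _ hm)

/-- A subspace `M` spanned by elements `g a u`, with `g` linear in `u`. -/
theorem mul_mem_range_lsum {A L N : Type*} [Ring A] [Algebra k A] [AddCommGroup N] [Module k N]
    (g : L → N →ₗ[k] A) (y : A) (h : ∀ a u, y * g a u ∈ LinearMap.range (Finsupp.lsum k g)) :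
    ∀ m ∈ LinearMap.range (Finsupp.lsum k g), y * m ∈ LinearMap.range (Finsupp.lsum k g) := by
  rintro _ ⟨w, rfl⟩
  induction w using Finsupp.induction_linear with
  | zero => simp
  | add x y hx hy => rw [map_add, mul_add]; exact add_mem hx hy
  | single a u => simpa using h a u

theorem mem_range_lsum {A L N : Type*} [Ring A] [Algebra k A] [AddCommGroup N] [Module k N]
    (g : L → N →ₗ[k] A) (a : L) (u : N) : g a u ∈ LinearMap.range (Finsupp.lsum k g) :=
  ⟨Finsupp.single a u, by simp⟩

theorem range_lsum_induction {A L N : Type*} [Ring A] [Algebra k A] [AddCommGroup N] [Module k N]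
    (g : L → N →ₗ[k] A) {P : A → Prop} (zero : P 0) (h : ∀ a u, P (g a u))
    (add : ∀ x y, P x → P y → P (x + y)) {x : A} (hx : x ∈ LinearMap.range (Finsupp.lsum k g)) :
    P x := by
  obtain ⟨w, rfl⟩ := hx
  induction w using Finsupp.induction_linear with
  | zero => simpa using zero
  | add x y hx hy => rw [map_add]; exact add _ _ hx hy
  | single a u => simpa using h a u

theorem borelPlus_induction {χ : SymBichar k ι} {P : U χ → Prop} (zero : P 0)
    (h : ∀ u a, P (nE χ u * K χ a)) (add : ∀ x y, P x → P y → P (x + y))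
    {x : U χ} (hx : x ∈ borelPlus χ) : P x := by
  let g : (ι → ℤ) → Nic χ →ₗ[k] U χ := fun a => LinearMap.mulRight k (K χ a) ∘ₗ (nE χ).toLinearMap
  have hg : ∀ a u, g a u = nE χ u * K χ a := fun a u => rfl
  refine range_lsum_induction g zero (fun a u => h u a) add
    (adjoin_le_of_mul_mem _ _ ?_ ?_ hx)
  · have := mem_range_lsum g 0 1
    rwa [hg, K_zero, map_one, mul_one] at this
  · intro y hy
    refine mul_mem_range_lsum g y fun a u => ?_
    rcases hy with ⟨i, rfl⟩ | ⟨b, rfl⟩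
    · have := mem_range_lsum g a (nx χ i * u)
      rwa [hg, map_mul, nE_x, mul_assoc] at this
    · have := mem_range_lsum g (b + a) (S χ b u)
      rwa [hg, K_add, ← mul_assoc, ← K_mul_nE, mul_assoc] at this

theorem borelMinus_induction {χ : SymBichar k ι} {P : U χ → Prop} (zero : P 0)
    (h : ∀ u a, P (K χ a * nF χ u)) (add : ∀ x y, P x → P y → P (x + y))
    {x : U χ} (hx : x ∈ borelMinus χ) : P x := by
  let g : (ι → ℤ) → Nic χ →ₗ[k] U χ := fun a => LinearMap.mulLeft k (K χ a) ∘ₗ (nF χ).toLinearMap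
  have hg : ∀ a u, g a u = K χ a * nF χ u := fun a u => rfl
  refine range_lsum_induction g zero (fun a u => h u a) add
    (adjoin_le_of_mul_mem _ _ ?_ ?_ hx)
  · have := mem_range_lsum g 0 1
    rwa [hg, K_zero, map_one, mul_one] at this
  · intro y hy
    refine mul_mem_range_lsum g y fun a u => ?_
    rcases hy with ⟨i, rfl⟩ | ⟨b, rfl⟩
    · have := mem_range_lsum g a (χ.val a (α i) • (nx χ i * u))
      rw [map_smul, hg, map_mul, nF_x, ← mul_assoc, K_mul_F, smul_mul_assoc, smul_smul,
        mul_inv_cancel₀ (val_ne_zero _ _ _), one_smul, mul_assoc] at this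
      exact this
    · have := mem_range_lsum g (b + a) u
      rwa [hg, K_add, mul_assoc] at this

theorem pairU_mul_of_K (χ : SymBichar k ι) (c : ι → ℤ) {y : U χ} (hy : y ∈ borelMinus χ) (x : U χ) :
    pairU χ (K χ c * y) x = pairU χ y (lamL χ (pairU χ (K χ c)) x) := by
  refine borelMinus_induction (P := fun y => pairU χ (K χ c * y) x =
    pairU χ y (lamL χ (pairU χ (K χ c)) x)) (by simp) ?_ ?_ hy
  · intro f a
    rw [← mul_assoc, ← K_add]
    refine LinearMap.congr_fun (g := pairU χ (K χ a * nF χ f) ∘ₗ lamL χ (pairU χ (K χ c)))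
      (EKF_hom_ext fun b e v => ?_) x
    rw [LinearMap.comp_apply, lamL_K, map_smul, pairU_K_nF, pairU_K_nF, neg_add, S_add,
      formN_S, val_add_left, mul_inv, smul_eq_mul]
    ring
  · intro y z hy hz
    rw [mul_add, map_add, LinearMap.add_apply, hy, hz, map_add, LinearMap.add_apply]

theorem pairU_mul_of_F (χ : SymBichar k ι) (i : ι) {y : U χ} (hy : y ∈ borelMinus χ) (x : U χ) :
    pairU χ (F χ i * y) x = pairU χ y (lamL χ (pairU χ (F χ i)) x) := by
  refine borelMinus_induction (P := fun y => pairU χ (F χ i * y) x =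
    pairU χ y (lamL χ (pairU χ (F χ i)) x)) (by simp) ?_ ?_ hy
  · intro f a
    have : F χ i * (K χ a * nF χ f) = χ.val a (α i) • (K χ a * nF χ (nx χ i * f)) := by
      rw [map_mul, nF_x, ← mul_assoc (K χ a), K_mul_F, smul_mul_assoc, smul_smul,
        mul_inv_cancel₀ (val_ne_zero _ _ _), one_smul, mul_assoc]
    rw [this, map_smul]
    refine LinearMap.congr_fun (g := pairU χ (K χ a * nF χ f) ∘ₗ lamL χ (pairU χ (F χ i)))
      (EKF_hom_ext fun b e v => ?_) x
    rw [LinearMap.comp_apply, lamL_F, LinearMap.smul_apply, pairU_K_nF, pairU_K_nF, map_mul, S_x,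
      smul_mul_assoc, map_smul, LinearMap.smul_apply, formN_x_mul, val_neg_left, smul_eq_mul,
      smul_eq_mul]
    have := val_ne_zero χ a (α i)
    field_simp
  · intro y z hy hz
    rw [mul_add, map_add, LinearMap.add_apply, hy, hz, map_add, LinearMap.add_apply]

theorem pairU_of_K_mul (χ : SymBichar k ι) (c : ι → ℤ) {x : U χ} (hx : x ∈ borelPlus χ) (y : U χ) :
    pairU χ y (K χ c * x) = pairU χ (lamR χ ((pairU χ).flip (K χ c)) y) x := by
  refine borelPlus_induction (P := fun x => pairU χ y (K χ c * x) =
    pairU χ (lamR χ ((pairU χ).flip (K χ c)) y) x) (by simp) ?_ ?_ hx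
  · intro e b
    rw [← mul_assoc, K_mul_nE, mul_assoc, ← K_add]
    refine LinearMap.congr_fun (f := (pairU χ).flip (nE χ (S χ c e) * K χ (c + b)))
      (g := (pairU χ).flip (nE χ e * K χ b) ∘ₗ lamR χ ((pairU χ).flip (K χ c)))
      (EKF_hom_ext fun a u f => ?_) y
    rw [LinearMap.comp_apply, lamR_K, map_smul, LinearMap.flip_apply, LinearMap.flip_apply,
      pairU_nE_K, pairU_nE_K, ← S_add, add_comm (-a) c, S_add, formN_S χ c, val_add_right, mul_inv, smul_eq_mul]
    ring
  · intro y z hy hz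
    rw [mul_add, map_add, hy, hz, map_add]

theorem pairU_of_E_mul (χ : SymBichar k ι) (i : ι) {x : U χ} (hx : x ∈ borelPlus χ) (y : U χ) :
    pairU χ y (E χ i * x) = pairU χ (lamR χ ((pairU χ).flip (E χ i)) y) x := by
  refine borelPlus_induction (P := fun x => pairU χ y (E χ i * x) =
    pairU χ (lamR χ ((pairU χ).flip (E χ i)) y) x) (by simp) ?_ ?_ hx
  · intro e b
    rw [← mul_assoc, ← nE_x, ← map_mul]
    refine LinearMap.congr_fun (f := (pairU χ).flip (nE χ (nx χ i * e) * K χ b))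
      (g := (pairU χ).flip (nE χ e * K χ b) ∘ₗ lamR χ ((pairU χ).flip (nE χ (nx χ i))))
      (EKF_hom_ext fun a u f => ?_) y
    rw [nE_x, LinearMap.comp_apply, lamR_E, map_smul, LinearMap.flip_apply, LinearMap.flip_apply,
      pairU_nE_K, pairU_nE_K, formN_symm, formN_x_mul, formN_symm, dL_S, map_smul,
      LinearMap.smul_apply, val_neg_left, smul_eq_mul, smul_eq_mul]
    ring
  · intro y z hy hz
    rw [mul_add, map_add, hy, hz, map_add]

theorem pairU_mul_left (χ : SymBichar k ι) {y y' : U χ} (hy : y ∈ borelMinus χ)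
    (hy' : y' ∈ borelMinus χ) (x : U χ) :
    pairU χ (y * y') x = tf (pairU χ y) (pairU χ y') (comul χ x) := by
  induction hy using Algebra.adjoin_induction generalizing y' x with
  | mem y hy =>
    rw [tf_eq_coeffL]
    rcases hy with ⟨i, rfl⟩ | ⟨a, rfl⟩
    · exact pairU_mul_of_F χ i hy' x
    · exact pairU_mul_of_K χ a hy' x
  | algebraMap r =>
    rw [← Algebra.smul_def, tf_eq_coeffL, Algebra.algebraMap_eq_smul_one, map_smul, map_smul,
      pairU_one, coeffL_smul, coeffL_counit_comul, map_smul, LinearMap.smul_apply]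
  | add y z _ _ hy hz =>
    rw [add_mul, map_add, LinearMap.add_apply, hy hy', hz hy', map_add, tf_eq_coeffR, tf_eq_coeffR,
      tf_eq_coeffR, LinearMap.add_apply]
  | mul y z hy1 hz1 hy hz =>
    have h : pairU χ (y * z) = pairU χ z ∘ₗ lamL χ (pairU χ y) :=
      LinearMap.ext fun w => by rw [hy hz1, tf_eq_coeffL]; rfl
    rw [mul_assoc, hy (mul_mem hz1 hy'), tf_eq_coeffL, hz hy', h, ← lamL_apply, lamL_apply,
      comul_coeffL]
    induction comul χ x with
    | zero => simp
    | tmul a b => simp [lamL]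
    | add a b ha hb => simp only [map_add, ha, hb]

theorem pairU_mul_right (χ : SymBichar k ι) {x x' : U χ} (hx : x ∈ borelPlus χ)
    (hx' : x' ∈ borelPlus χ) (y : U χ) :
    pairU χ y (x * x') = tf ((pairU χ).flip x') ((pairU χ).flip x) (comul χ y) := by
  induction hx using Algebra.adjoin_induction generalizing x' y with
  | mem x hx =>
    rw [tf_eq_coeffR]
    rcases hx with ⟨i, rfl⟩ | ⟨a, rfl⟩
    · exact pairU_of_E_mul χ i hx' y
    · exact pairU_of_K_mul χ a hx' y
  | algebraMap r =>
    have : (pairU χ).flip 1 = (counit χ).toLinearMap := LinearMap.ext (pairU_flip_one χ)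
    rw [← Algebra.smul_def, tf_eq_coeffR, Algebra.algebraMap_eq_smul_one, map_smul, map_smul,
      this, coeffR_smul, coeffR_counit_comul, map_smul, LinearMap.flip_apply]
  | add y z _ _ hy hz =>
    rw [add_mul, map_add, hy hx', hz hx', map_add, tf_eq_coeffL, tf_eq_coeffL,
      tf_eq_coeffL, LinearMap.add_apply]
  | mul x z hx1 hz1 hx hz =>
    have h : (pairU χ).flip (x * z) = (pairU χ).flip z ∘ₗ lamR χ ((pairU χ).flip x) :=
      LinearMap.ext fun w => by rw [LinearMap.flip_apply, hx hz1, tf_eq_coeffR]; rfl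
    rw [mul_assoc, hx (mul_mem hz1 hx'), tf_eq_coeffR, LinearMap.flip_apply, hz hx', h,
      comul_coeffR]
    induction comul χ y with
    | zero => simp
    | tmul a b => simp [lamR]
    | add a b ha hb => simp only [map_add, ha, hb]

theorem pairU_F_E (χ : SymBichar k ι) (i j : ι) :
    pairU χ (F χ i) (E χ j) = if i = j then 1 else 0 := by
  have := pairU_F_left χ i 0 (nx χ j) 1
  simp only [K_zero, map_one, mul_one, nE_x, dL_x, one_mul] at this
  rw [this]
  split_ifs <;> simp

theorem pairU_K_K (χ : SymBichar k ι) (a b : ι → ℤ) :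
    pairU χ (K χ a) (K χ b) = (χ.val a b)⁻¹ := by
  simpa using pairU_K_left χ a b 1 1

theorem pairU_F_K (χ : SymBichar k ι) (i : ι) (b : ι → ℤ) : pairU χ (F χ i) (K χ b) = 0 := by
  simpa using pairU_F_left χ i b 1 1

theorem pairU_K_E (χ : SymBichar k ι) (a : ι → ℤ) (j : ι) : pairU χ (K χ a) (E χ j) = 0 := by
  simpa [K_zero] using pairU_K_left χ a 0 (nx χ j) 1

/-- The skew Hopf pairing of `(U⁻ ⋊ H)^cop` and `U⁺ ⋊ H`. -/
def borelPairing (χ : SymBichar k ι) : BorelForm χ :=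
  (pairU χ).compl₁₂ (borelMinus χ).val.toLinearMap (borelPlus χ).val.toLinearMap

theorem mul'_map_eq_tf {V W : Type*} [AddCommGroup V] [Module k V] [AddCommGroup W] [Module k W]
    (f : V →ₗ[k] k) (g : W →ₗ[k] k) (z : V ⊗[k] W) :
    LinearMap.mul' k k (TensorProduct.map f g z) = tf f g z := by
  induction z with
  | zero => simp
  | tmul x y => simp
  | add x y hx hy => simp only [map_add, hx, hy]

theorem tf_map {A : Type*} [Ring A] [Algebra k A] (B : Subalgebra k A) (f g : A →ₗ[k] k)
    (f' g' : B →ₗ[k] k) (hf : ∀ x : B, f' x = f x) (hg : ∀ x : B, g' x = g x) (z : B ⊗[k] B) :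
    tf f' g' z = tf f g (Algebra.TensorProduct.map B.val B.val z) := by
  induction z with
  | zero => simp
  | tmul x y => simp [hf, hg]
  | add x y hx hy => simp only [map_add, hx, hy]

theorem borelPairing_isSkewHopfPairing (χ : SymBichar k ι) :
    IsSkewHopfPairing χ (borelPairing χ) where
  mul_right y x x' := by
    rw [mul'_map_eq_tf, tf_map (borelMinus χ) ((pairU χ).flip x') ((pairU χ).flip x) _ _
      (fun _ => rfl) (fun _ => rfl)]
    refine (pairU_mul_right χ x.2 x'.2 y).trans ?_
    rw [comulMinus, map_comulRestrict]
  mul_left y y' x := by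
    rw [mul'_map_eq_tf, tf_map (borelPlus χ) (pairU χ y) (pairU χ y') _ _
      (fun _ => rfl) (fun _ => rfl)]
    refine (pairU_mul_left χ y.2 y'.2 x).trans ?_
    rw [comulPlus, map_comulRestrict]
  one_right y := pairU_flip_one χ y
  one_left x := LinearMap.congr_fun (pairU_one χ) x
  F_E i j := by
    refine (pairU_F_E χ i j).trans ?_
    rfl
  K_K i j := pairU_K_K χ _ _
  F_K i j := pairU_F_K χ _ _
  K_E i j := pairU_K_E χ _ _

/-! ### Uniqueness of the pairing -/

theorem lattice_induction {P : (ι → ℤ) → Prop} (zero : P 0) (single : ∀ i, P (α i))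
    (add : ∀ a b, P a → P b → P (a + b)) (neg : ∀ a, P a → P (-a)) (a : ι → ℤ) : P a := by
  let S : AddSubgroup (ι → ℤ) :=
    { carrier := {a | P a}
      zero_mem' := zero
      add_mem' := fun {a b} ha hb => add a b ha hb
      neg_mem' := fun {a} ha => neg a ha }
  have h : a = ∑ i, a i • α i := by
    ext j
    simp [α, Finset.sum_apply, Pi.single_apply]
  have : a ∈ S := by
    rw [h]
    exact sum_mem fun i _ => S.zsmul_mem (single i) _
  exact this

theorem comulMinus_F (χ : SymBichar k ι) (i : ι) :
    comulMinus χ (Fm χ i) = Fm χ i ⊗ₜ[k] Km χ (-α i) + 1 ⊗ₜ[k] Fm χ i := by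
  refine map_val_injective χ (borelMinus χ) ?_
  rw [comulMinus, map_comulRestrict, map_add]
  exact comul_F χ i

theorem comulMinus_K (χ : SymBichar k ι) (a : ι → ℤ) :
    comulMinus χ (Km χ a) = Km χ a ⊗ₜ[k] Km χ a := by
  refine map_val_injective χ (borelMinus χ) ?_
  rw [comulMinus, map_comulRestrict]
  exact comul_K χ a

theorem comulPlus_E (χ : SymBichar k ι) (i : ι) :
    comulPlus χ (Ep χ i) = Ep χ i ⊗ₜ[k] 1 + Kp χ (α i) ⊗ₜ[k] Ep χ i := by
  refine map_val_injective χ (borelPlus χ) ?_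
  rw [comulPlus, map_comulRestrict, map_add]
  exact comul_E χ i

theorem comulPlus_K (χ : SymBichar k ι) (a : ι → ℤ) :
    comulPlus χ (Kp χ a) = Kp χ a ⊗ₜ[k] Kp χ a := by
  refine map_val_injective χ (borelPlus χ) ?_
  rw [comulPlus, map_comulRestrict]
  exact comul_K χ a

theorem Km_add (χ : SymBichar k ι) (a b : ι → ℤ) : Km χ (a + b) = Km χ a * Km χ b :=
  Subtype.ext (K_add χ a b)

theorem Kp_add (χ : SymBichar k ι) (a b : ι → ℤ) : Kp χ (a + b) = Kp χ a * Kp χ b :=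
  Subtype.ext (K_add χ a b)

theorem Km_zero (χ : SymBichar k ι) : Km χ 0 = 1 := Subtype.ext (K_zero χ)

theorem Kp_zero (χ : SymBichar k ι) : Kp χ 0 = 1 := Subtype.ext (K_zero χ)

namespace IsSkewHopfPairing

variable {χ : SymBichar k ι} {p : BorelForm χ}


theorem Km_Kp_add_left (hp : IsSkewHopfPairing χ p) (a b c : ι → ℤ) :
    p (Km χ (a + b)) (Kp χ c) = p (Km χ a) (Kp χ c) * p (Km χ b) (Kp χ c) := by
  rw [Km_add, hp.mul_left, comulPlus_K]
  simp

theorem Km_Kp_add_right (hp : IsSkewHopfPairing χ p) (a b c : ι → ℤ) :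
    p (Km χ a) (Kp χ (b + c)) = p (Km χ a) (Kp χ b) * p (Km χ a) (Kp χ c) := by
  rw [Kp_add, hp.mul_right, comulMinus_K]
  simp [mul_comm]

theorem Km_Kp_zero (hp : IsSkewHopfPairing χ p) (a : ι → ℤ) : p (Km χ a) (Kp χ 0) = 1 := by
  rw [Kp_zero, hp.one_right]
  exact counit_K χ a

theorem Km_Kp_neg (hp : IsSkewHopfPairing χ p) (a b : ι → ℤ) : p (Km χ a) (Kp χ b) * p (Km χ a) (Kp χ (-b)) = 1 := by
  rw [← hp.Km_Kp_add_right, add_neg_cancel, hp.Km_Kp_zero]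

theorem Km_Kp (hp : IsSkewHopfPairing χ p) (a b : ι → ℤ) : p (Km χ a) (Kp χ b) = (χ.val a b)⁻¹ := by
  let f : (ι → ℤ) → (ι → ℤ) → kˣ := fun a b =>
    ⟨p (Km χ a) (Kp χ b), p (Km χ a) (Kp χ (-b)), hp.Km_Kp_neg a b, by
      rw [mul_comm, hp.Km_Kp_neg]⟩
  have h := bichar_ext f (fun a b => (χ.toFun a b)⁻¹)
    (fun a b c => Units.ext (hp.Km_Kp_add_left a b c))
    (fun a b c => Units.ext (hp.Km_Kp_add_right a b c))
    (fun a b c => by rw [χ.map_add_left, mul_inv]) (fun a b c => by rw [χ.map_add_right, mul_inv])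
    (fun i j => Units.ext (by
      rw [Units.val_inv_eq_inv_val]
      exact hp.K_K i j)) a b
  have h2 := congrArg Units.val h
  rwa [Units.val_inv_eq_inv_val] at h2

theorem Fm_Kp (hp : IsSkewHopfPairing χ p) (i : ι) (b : ι → ℤ) : p (Fm χ i) (Kp χ b) = 0 := by
  have hadd : ∀ b c, p (Fm χ i) (Kp χ (b + c)) =
      p (Fm χ i) (Kp χ c) * (χ.val (-α i) b)⁻¹ + p (Fm χ i) (Kp χ b) := by
    intro b c
    have h1 : counit χ (Kp χ c : U χ) = 1 := counit_K χ c
    rw [Kp_add, hp.mul_right, comulMinus_F]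
    simp [hp.Km_Kp, hp.one_left, h1]
  have h0 : p (Fm χ i) (Kp χ 0) = 0 := by
    rw [Kp_zero, hp.one_right]
    exact counit_F χ i
  refine lattice_induction (P := fun b => p (Fm χ i) (Kp χ b) = 0) h0 (hp.F_K i) ?_ ?_ b
  · intro a b ha hb
    rw [hadd, ha, hb, zero_mul, zero_add]
  · intro a ha
    have h := hadd a (-a)
    rw [add_neg_cancel, h0, ha, add_zero] at h
    exact (mul_eq_zero.1 h.symm).resolve_right (inv_ne_zero (val_ne_zero _ _ _))

theorem Km_Ep (hp : IsSkewHopfPairing χ p) (a : ι → ℤ) (j : ι) : p (Km χ a) (Ep χ j) = 0 := by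
  have hadd : ∀ a b, p (Km χ (a + b)) (Ep χ j) =
      p (Km χ a) (Ep χ j) + (χ.val a (α j))⁻¹ * p (Km χ b) (Ep χ j) := by
    intro a b
    have h1 : counit χ (Km χ b : U χ) = 1 := counit_K χ b
    rw [Km_add, hp.mul_left, comulPlus_E]
    simp [hp.Km_Kp, hp.one_right, h1]
  have h0 : p (Km χ 0) (Ep χ j) = 0 := by
    rw [Km_zero, hp.one_left]
    exact counit_E χ j
  refine lattice_induction (P := fun a => p (Km χ a) (Ep χ j) = 0) h0 (fun i => hp.K_E i j) ?_ ?_ a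
  · intro a b ha hb
    rw [hadd, ha, hb, zero_add, mul_zero]
  · intro a ha
    have h := hadd a (-a)
    rw [add_neg_cancel, h0, ha, zero_add] at h
    exact (mul_eq_zero.1 h.symm).resolve_left (inv_ne_zero (val_ne_zero _ _ _))

end IsSkewHopfPairing

theorem borelMinus_hom_ext {χ : SymBichar k ι} {P : borelMinus χ → Prop}
    (hs : ∀ c : k, P (algebraMap k _ c)) (hF : ∀ i, P (Fm χ i)) (hK : ∀ a, P (Km χ a))
    (add : ∀ x y, P x → P y → P (x + y)) (mul : ∀ x y, P x → P y → P (x * y))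
    (x : borelMinus χ) : P x := by
  obtain ⟨x, hx⟩ := x
  induction hx using Algebra.adjoin_induction with
  | mem x hx =>
    rcases hx with ⟨i, rfl⟩ | ⟨a, rfl⟩
    · exact hF i
    · exact hK a
  | algebraMap r => exact hs r
  | add x y hx' hy' hx hy => exact add _ _ hx hy
  | mul x y hx' hy' hx hy => exact mul _ _ hx hy

theorem borelPlus_hom_ext {χ : SymBichar k ι} {P : borelPlus χ → Prop}
    (hs : ∀ c : k, P (algebraMap k _ c)) (hE : ∀ i, P (Ep χ i)) (hK : ∀ a, P (Kp χ a))
    (add : ∀ x y, P x → P y → P (x + y)) (mul : ∀ x y, P x → P y → P (x * y))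
    (x : borelPlus χ) : P x := by
  obtain ⟨x, hx⟩ := x
  induction hx using Algebra.adjoin_induction with
  | mem x hx =>
    rcases hx with ⟨i, rfl⟩ | ⟨a, rfl⟩
    · exact hE i
    · exact hK a
  | algebraMap r => exact hs r
  | add x y hx' hy' hx hy => exact add _ _ hx hy
  | mul x y hx' hy' hx hy => exact mul _ _ hx hy

theorem IsSkewHopfPairing.unique {χ : SymBichar k ι} {p p' : BorelForm χ}
    (hp : IsSkewHopfPairing χ p) (hp' : IsSkewHopfPairing χ p') : p = p' := by
  have hKp : ∀ y b, p y (Kp χ b) = p' y (Kp χ b) := by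
    intro y b
    refine borelMinus_hom_ext (P := fun y => p y (Kp χ b) = p' y (Kp χ b)) ?_ ?_ ?_ ?_ ?_ y
    · intro c
      rw [Algebra.algebraMap_eq_smul_one, map_smul, map_smul, LinearMap.smul_apply,
        LinearMap.smul_apply, hp.one_left, hp'.one_left]
    · intro i
      rw [hp.Fm_Kp, hp'.Fm_Kp]
    · intro a
      rw [hp.Km_Kp, hp'.Km_Kp]
    · intro x y hx hy
      rw [map_add, map_add, LinearMap.add_apply, LinearMap.add_apply, hx, hy]
    · intro x y hx hy
      rw [hp.mul_left, hp'.mul_left, comulPlus_K]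
      simp [hx, hy]
  have hEp : ∀ y j, p y (Ep χ j) = p' y (Ep χ j) := by
    intro y j
    refine borelMinus_hom_ext (P := fun y => p y (Ep χ j) = p' y (Ep χ j)) ?_ ?_ ?_ ?_ ?_ y
    · intro c
      rw [Algebra.algebraMap_eq_smul_one, map_smul, map_smul, LinearMap.smul_apply,
        LinearMap.smul_apply, hp.one_left, hp'.one_left]
    · intro i
      rw [hp.F_E, hp'.F_E]
    · intro a
      rw [hp.Km_Ep, hp'.Km_Ep]
    · intro x y hx hy
      rw [map_add, map_add, LinearMap.add_apply, LinearMap.add_apply, hx, hy]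
    · intro x y hx hy
      rw [hp.mul_left, hp'.mul_left, comulPlus_E]
      simp [hx, hy, hKp, hp.one_right, hp'.one_right]
  have key : ∀ x y, p y x = p' y x := by
    intro x
    refine borelPlus_hom_ext (P := fun x => ∀ y, p y x = p' y x) ?_ ?_ ?_ ?_ ?_ x
    · intro c y
      rw [Algebra.algebraMap_eq_smul_one, map_smul, map_smul, hp.one_right, hp'.one_right]
    · exact fun j y => hEp y j
    · exact fun b y => hKp y b
    · intro x x' hx hx' y
      rw [map_add, map_add, hx, hx']
    · intro x x' hx hx' y
      have h1 : p.flip x = p'.flip x := LinearMap.ext hx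
      have h2 : p.flip x' = p'.flip x' := LinearMap.ext hx'
      rw [hp.mul_right, hp'.mul_right, h1, h2]
  exact LinearMap.ext fun y => LinearMap.ext fun x => key x y

/-! ### Dual bases -/

theorem pairU_nF_nE (χ : SymBichar k ι) (f e : Nic χ) :
    pairU χ (nF χ f) (nE χ e) = formN χ f e := by
  have := pairU_K_nF χ 0 0 f e 1
  simpa [K_zero] using this

theorem nF_injective (χ : SymBichar k ι) : Function.Injective (nF χ) := by
  intro u v h
  have h1 := congrArg (coordM χ) (show nE χ 1 * K χ 0 * nF χ u = nE χ 1 * K χ 0 * nF χ v by rw [h])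
  rw [coordM_pbw, coordM_pbw, map_one, one_smul, one_smul] at h1
  exact Finsupp.single_injective 0 h1

theorem nE_injective (χ : SymBichar k ι) : Function.Injective (nE χ) := by
  intro u v h
  refine nF_injective χ ?_
  rw [← omega_nE, ← omega_nE, h]

theorem epsN_of_mem {χ : SymBichar k ι} {μ : ι → ℕ} {u : Nic χ} (hu : u ∈ Nwt χ μ) (hμ : μ ≠ 0) :
    epsN χ u = 0 := by
  refine Nwt_word_induction (P := fun μ u => μ ≠ 0 → epsN χ u = 0) ?_ ?_ ?_ ?_ ?_ hu hμ
  · exact fun h => (h rfl).elim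
  · intro i μ u _ _ _
    rw [map_mul, epsN_x, zero_mul]
  · intro μ _
    exact map_zero _
  · intro μ u v hu hv h
    rw [map_add, hu h, hv h, add_zero]
  · intro μ c u hu h
    rw [map_smul, hu h, smul_zero]

theorem epsN_prN (χ : SymBichar k ι) (u : Nic χ) : epsN χ (prN χ 0 u) = epsN χ u := by
  refine Nwt_induction (P := fun u => epsN χ (prN χ 0 u) = epsN χ u) ?_ ?_ u
  · intro μ u hu
    rw [prN_of_mem hu]
    split_ifs with h
    · rfl
    · rw [map_zero, epsN_of_mem hu h]
  · intro u v hu hv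
    rw [map_add, map_add, map_add, hu, hv]

theorem formN_prN {χ : SymBichar k ι} {μ : ι → ℕ} {w : Nic χ} (hw : w ∈ Nwt χ μ) (u : Nic χ) :
    formN χ w (prN χ μ u) = formN χ w u := by
  refine Nwt_word_induction (P := fun μ w => ∀ u, formN χ w (prN χ μ u) = formN χ w u)
    ?_ ?_ ?_ ?_ ?_ hw u
  · intro u
    rw [formN_one, formN_one, epsN_prN]
  · intro i μ w _ ih u
    rw [formN_x_mul, formN_x_mul, ← prN_dL, ih]
  · intro μ u
    simp
  · intro μ v w hv hw u
    rw [map_add, LinearMap.add_apply, LinearMap.add_apply, hv, hw]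
  · intro μ c w hw u
    rw [map_smul, LinearMap.smul_apply, LinearMap.smul_apply, hw]

theorem formN_of_mem_ne {χ : SymBichar k ι} {μ ν : ι → ℕ} {w u : Nic χ} (hw : w ∈ Nwt χ μ)
    (hu : u ∈ Nwt χ ν) (h : ν ≠ μ) : formN χ w u = 0 := by
  rw [← formN_prN hw, prN_of_mem hu, if_neg h, map_zero]

/-- The form restricted to a weight space. -/
def formWt (χ : SymBichar k ι) (μ : ι → ℕ) : LinearMap.BilinForm k (Nwt χ μ) :=
  (formN χ).compl₁₂ (Nwt χ μ).subtype (Nwt χ μ).subtype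

theorem formWt_apply (χ : SymBichar k ι) (μ : ι → ℕ) (u v : Nwt χ μ) :
    formWt χ μ u v = formN χ u v := rfl

theorem formWt_symm (χ : SymBichar k ι) (μ : ι → ℕ) (u v : Nwt χ μ) :
    formWt χ μ u v = formWt χ μ v u := formN_symm χ _ _

theorem formWt_separating (χ : SymBichar k ι) (μ : ι → ℕ) (u : Nwt χ μ)
    (h : ∀ w, formWt χ μ w u = 0) : u = 0 := by
  refine Subtype.ext (formN_nondeg χ fun w => ?_)
  refine Nwt_induction (P := fun w => formN χ w u = 0) ?_ ?_ w
  · intro ν w hw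
    by_cases hν : μ = ν
    · subst hν
      exact h ⟨w, hw⟩
    · exact formN_of_mem_ne hw u.2 hν
  · intro v w hv hw
    rw [map_add, LinearMap.add_apply, hv, hw, add_zero]

theorem formWt_nondegenerate (χ : SymBichar k ι) (μ : ι → ℕ) : (formWt χ μ).Nondegenerate :=
  ⟨fun u h => formWt_separating χ μ u fun w => by rw [formWt_symm]; exact h w,
    formWt_separating χ μ⟩

instance Nwt_finite (χ : SymBichar k ι) (μ : ι → ℕ) : Module.Finite k (Nwt χ μ) := by
  have hfin : {l : List ι | ∀ i, l.count i = μ i}.Finite := by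
    refine (List.finite_length_eq ι (size μ)).subset fun l hl => ?_
    have : ∑ i, l.count i = l.length := by
      rw [← List.sum_toFinset_count_eq_length]
      refine (Finset.sum_subset (Finset.subset_univ _) fun i _ hi => ?_).symm
      simpa [List.count_eq_zero] using hi
    simp only [Set.mem_ofPred_eq, size, ← this]
    exact Finset.sum_congr rfl fun i _ => hl i
  have h1 : (Twt k μ).FG := by
    refine ⟨(hfin.image (word k)).toFinset, ?_⟩
    rw [Set.Finite.coe_toFinset, Twt]
    congr 1
    ext p
    simp only [Set.mem_image, Set.mem_ofPred_eq, eq_comm]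
  exact Module.Finite.iff_fg.2 (h1.map _)

/-- `U⁺_μ` is isomorphic to the weight space of the Nichols algebra. -/
def UplusWtEquiv (χ : SymBichar k ι) (μ : ι → ℕ) : Nwt χ μ ≃ₗ[k] UplusWt χ μ :=
  LinearEquiv.ofBijective
    ((nE χ).toLinearMap.restrict (p := Nwt χ μ) (q := UplusWt χ μ)
      fun u hu => mem_UplusWt.2 ⟨u, hu, rfl⟩)
    ⟨fun u v h => Subtype.ext (nE_injective χ (congrArg Subtype.val h)), fun x => by
      obtain ⟨u, hu, h⟩ := mem_UplusWt.1 x.2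
      exact ⟨⟨u, hu⟩, Subtype.ext h⟩⟩

/-- `U⁻_{-μ}` is isomorphic to the weight space of the Nichols algebra. -/
def UminusWtEquiv (χ : SymBichar k ι) (μ : ι → ℕ) : Nwt χ μ ≃ₗ[k] UminusWt χ μ :=
  LinearEquiv.ofBijective
    ((nF χ).toLinearMap.restrict (p := Nwt χ μ) (q := UminusWt χ μ)
      fun u hu => mem_UminusWt.2 ⟨u, hu, rfl⟩)
    ⟨fun u v h => Subtype.ext (nF_injective χ (congrArg Subtype.val h)), fun x => by
      obtain ⟨u, hu, h⟩ := mem_UminusWt.1 x.2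
      exact ⟨⟨u, hu⟩, Subtype.ext h⟩⟩

theorem UplusWtEquiv_coe (χ : SymBichar k ι) (μ : ι → ℕ) (u : Nwt χ μ) :
    (UplusWtEquiv χ μ u : U χ) = nE χ u := rfl

theorem UminusWtEquiv_coe (χ : SymBichar k ι) (μ : ι → ℕ) (u : Nwt χ μ) :
    (UminusWtEquiv χ μ u : U χ) = nF χ u := rfl

theorem wtPairing_equiv (χ : SymBichar k ι) (μ : ι → ℕ) (u v : Nwt χ μ) :
    wtPairing χ (borelPairing χ) μ (UminusWtEquiv χ μ u) (UplusWtEquiv χ μ v) = formN χ u v :=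
  pairU_nF_nE χ u v

theorem dualBases_nonempty (χ : SymBichar k ι) (μ : ι → ℕ) :
    Nonempty (DualBases χ (borelPairing χ) μ) := by
  classical
  let b := Module.finBasis k (Nwt χ μ)
  let b' := (formWt χ μ).dualBasis (formWt_nondegenerate χ μ) b
  refine ⟨⟨_, b'.map (UminusWtEquiv χ μ), b.map (UplusWtEquiv χ μ), fun i j => ?_⟩⟩
  rw [Module.Basis.map_apply, Module.Basis.map_apply, wtPairing_equiv]
  have := (formWt χ μ).apply_dualBasis_left (formWt_nondegenerate χ μ) b i j
  rw [formWt_apply] at this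
  rw [this]
  simp [eq_comm]

/-! ### The projection `ψ` -/

/-- The sum of the coordinates. -/
def hgt (a : ι → ℤ) : ℤ := ∑ i, a i

@[simp] theorem hgt_zero : hgt (0 : ι → ℤ) = 0 := by simp [hgt]

@[simp] theorem hgt_add (a b : ι → ℤ) : hgt (a + b) = hgt a + hgt b := by
  simp [hgt, Finset.sum_add_distrib]

@[simp] theorem hgt_neg (a : ι → ℤ) : hgt (-a) = - hgt a := by simp [hgt]

@[simp] theorem hgt_sub (a b : ι → ℤ) : hgt (a - b) = hgt a - hgt b := by
  simp [sub_eq_add_neg]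

@[simp] theorem hgt_α (i : ι) : hgt (α i) = 1 := by simp [hgt, α]

theorem hgt_up (μ : ι → ℕ) : hgt (up μ) = size μ := by simp [hgt, up, size]

theorem KFE_induction {χ : SymBichar k ι} {P : U χ → Prop} (zero : P 0)
    (h : ∀ a u v, P (K χ a * nF χ u * nE χ v)) (add : ∀ x y, P x → P y → P (x + y)) (x : U χ) :
    P x := by
  refine FKE_induction zero (fun a u v => ?_) add x
  rw [nF_mul_K]
  exact h _ _ _

theorem KFE_hom_ext {χ : SymBichar k ι} {M : Type*} [AddCommGroup M] [Module k M]
    {f g : U χ →ₗ[k] M} (h : ∀ a u v, f (K χ a * nF χ u * nE χ v) = g (K χ a * nF χ u * nE χ v)) :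
    f = g :=
  LinearMap.ext fun x => KFE_induction (P := fun x => f x = g x) (by simp) h
    (fun x y hx hy => by rw [map_add, map_add, hx, hy]) x

/-- The part of `K_a F E ↦ ε(E) K_a F` with `a` of height zero. -/
def vz (χ : SymBichar k ι) : U χ →ₗ[k] ((ι → ℤ) →₀ Nic χ) :=
  (Finsupp.lsum k fun b : ι → ℤ => if hgt b = 0 then
    Finsupp.lsingle (-b) ∘ₗ (S χ (-b)).toLinearMap else 0) ∘ₗ coordP χ ∘ₗ (omega χ).toLinearMap

theorem vz_KFE (χ : SymBichar k ι) (a : ι → ℤ) (f e : Nic χ) :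
    vz χ (K χ a * nF χ f * nE χ e) = if hgt a = 0 then epsN χ e • Finsupp.single a f else 0 := by
  have h : omega χ (K χ a * nF χ f * nE χ e) = nE χ (S χ (-a) f) * K χ (-a) * nF χ e := by
    rw [map_mul, map_mul, omega_K, omega_nF, omega_nE, K_mul_nE]
  rw [vz, LinearMap.comp_apply, LinearMap.comp_apply, AlgHom.toLinearMap_apply, h, coordP_pbw,
    map_smul, Finsupp.lsum_single]
  by_cases ha : hgt a = 0
  · simp [ha, ← S_add]
  · simp [ha]

/-- The operator on the Borel part induced by left multiplication by `F_i`. -/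
def fOp (χ : SymBichar k ι) (i : ι) : Module.End k ((ι → ℤ) →₀ Nic χ) :=
  Finsupp.lsum k fun a => χ.val a (α i) • (Finsupp.lsingle a ∘ₗ LinearMap.mulLeft k (nx χ i))

/-- The operator on the Borel part induced by left multiplication by `K_b`. -/
def kOp (χ : SymBichar k ι) (b : ι → ℤ) : Module.End k ((ι → ℤ) →₀ Nic χ) :=
  Finsupp.lsum k fun a => Finsupp.lsingle (b + a)

/-- The operator on the Borel part induced by left multiplication by `E_j K_b`. -/
def eOp (χ : SymBichar k ι) (j : ι) (b : ι → ℤ) : Module.End k ((ι → ℤ) →₀ Nic χ) :=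
  Finsupp.lsum k fun a => (χ.val (b + a) (α j))⁻¹ • (Finsupp.lsingle (b + a + α j) ∘ₗ dL χ j)

@[simp] theorem fOp_single (χ : SymBichar k ι) (i : ι) (a : ι → ℤ) (f : Nic χ) :
    fOp χ i (Finsupp.single a f) = χ.val a (α i) • Finsupp.single a (nx χ i * f) := by
  simp [fOp]

@[simp] theorem kOp_single (χ : SymBichar k ι) (b a : ι → ℤ) (f : Nic χ) :
    kOp χ b (Finsupp.single a f) = Finsupp.single (b + a) f := by
  simp [kOp]

@[simp] theorem eOp_single (χ : SymBichar k ι) (j : ι) (b a : ι → ℤ) (f : Nic χ) :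
    eOp χ j b (Finsupp.single a f) =
      (χ.val (b + a) (α j))⁻¹ • Finsupp.single (b + a + α j) (dL χ j f) := by
  simp [eOp]

theorem F_mul_KFE (χ : SymBichar k ι) (i : ι) (a : ι → ℤ) (f e : Nic χ) :
    F χ i * (K χ a * nF χ f * nE χ e) = χ.val a (α i) • (K χ a * nF χ (nx χ i * f) * nE χ e) := by
  have h : F χ i * K χ a = χ.val a (α i) • (K χ a * F χ i) := by
    rw [K_mul_F, smul_smul, mul_inv_cancel₀ (val_ne_zero _ _ _), one_smul]
  rw [map_mul, nF_x, ← mul_assoc, ← mul_assoc, h]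
  simp only [smul_mul_assoc, mul_assoc]

theorem E_mul_KFE (χ : SymBichar k ι) (j : ι) (a : ι → ℤ) (f e : Nic χ) :
    E χ j * (K χ a * nF χ f * nE χ e) = (χ.val a (α j))⁻¹ •
      (K χ a * nF χ f * nE χ (nx χ j * e) + K χ (a + α j) * nF χ (dL χ j f) * nE χ e -
        K χ (a - α j) * nF χ (S χ (-α j) (dR χ j f)) * nE χ e) := by
  have h : E χ j * K χ a = (χ.val a (α j))⁻¹ • (K χ a * E χ j) := by
    rw [K_mul_E, smul_smul, inv_mul_cancel₀ (val_ne_zero _ _ _), one_smul]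
  rw [← mul_assoc, ← mul_assoc, h, smul_mul_assoc, mul_assoc (K χ a), E_mul_nF, nF_mul_K,
    map_mul (nE χ), nE_x, K_add, sub_eq_add_neg a, K_add, smul_mul_assoc]
  simp only [mul_add, mul_sub, add_mul, sub_mul, mul_assoc]

theorem vz_F_mul (χ : SymBichar k ι) (i : ι) (x : U χ) :
    vz χ (F χ i * x) = fOp χ i (vz χ x) := by
  refine LinearMap.congr_fun (f := vz χ ∘ₗ LinearMap.mulLeft k (F χ i)) (g := fOp χ i ∘ₗ vz χ)
    (KFE_hom_ext fun a f e => ?_) x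
  rw [LinearMap.comp_apply, LinearMap.comp_apply, LinearMap.mulLeft_apply, F_mul_KFE, map_smul,
    vz_KFE, vz_KFE]
  split_ifs
  · rw [map_smul, fOp_single, smul_comm]
  · simp

theorem vz_K_mul (χ : SymBichar k ι) {b : ι → ℤ} (hb : hgt b = 0) (x : U χ) :
    vz χ (K χ b * x) = kOp χ b (vz χ x) := by
  refine LinearMap.congr_fun (f := vz χ ∘ₗ LinearMap.mulLeft k (K χ b)) (g := kOp χ b ∘ₗ vz χ)
    (KFE_hom_ext fun a f e => ?_) x
  rw [LinearMap.comp_apply, LinearMap.comp_apply, LinearMap.mulLeft_apply, ← mul_assoc,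
    ← mul_assoc, ← K_add, vz_KFE, vz_KFE, hgt_add, hb, zero_add]
  split_ifs <;> simp

theorem vz_mul_E (χ : SymBichar k ι) (j : ι) (x : U χ) : vz χ (x * E χ j) = 0 := by
  refine LinearMap.congr_fun (f := vz χ ∘ₗ LinearMap.mulRight k (E χ j)) (g := 0)
    (KFE_hom_ext fun a f e => ?_) x
  rw [LinearMap.comp_apply, LinearMap.mulRight_apply, mul_assoc, ← nE_x, ← map_mul, vz_KFE,
    map_mul, epsN_x]
  simp

/-- The span of the `K_a F E` with `a` of height at most zero. -/
def Mle (χ : SymBichar k ι) : Submodule k (U χ) :=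
  Submodule.span k {x | ∃ a f e, hgt a ≤ 0 ∧ x = K χ a * nF χ f * nE χ e}

theorem KFE_mem_Mle {χ : SymBichar k ι} {a : ι → ℤ} (ha : hgt a ≤ 0) (f e : Nic χ) :
    K χ a * nF χ f * nE χ e ∈ Mle χ := Submodule.subset_span ⟨a, f, e, ha, rfl⟩

theorem one_mem_Mle (χ : SymBichar k ι) : (1 : U χ) ∈ Mle χ := by
  simpa [K_zero] using KFE_mem_Mle (χ := χ) (a := 0) (by simp) 1 1

theorem mul_mem_Mle {χ : SymBichar k ι} (y : U χ)
    (h : ∀ a f e, hgt a ≤ 0 → y * (K χ a * nF χ f * nE χ e) ∈ Mle χ) {x : U χ} (hx : x ∈ Mle χ) :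
    y * x ∈ Mle χ := by
  have : Mle χ ≤ (Mle χ).comap (LinearMap.mulLeft k y) := Submodule.span_le.2 (by
    rintro _ ⟨a, f, e, ha, rfl⟩
    exact h a f e ha)
  exact this hx

theorem K_mul_mem_Mle {χ : SymBichar k ι} {b : ι → ℤ} (hb : hgt b ≤ 0) {x : U χ}
    (hx : x ∈ Mle χ) : K χ b * x ∈ Mle χ := by
  refine mul_mem_Mle _ (fun a f e ha => ?_) hx
  rw [← mul_assoc, ← mul_assoc, ← K_add]
  exact KFE_mem_Mle (by rw [hgt_add]; linarith) f e

theorem F_mul_mem_Mle {χ : SymBichar k ι} (i : ι) {x : U χ}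
    (hx : x ∈ Mle χ) : F χ i * x ∈ Mle χ := by
  refine mul_mem_Mle _ (fun a f e ha => ?_) hx
  rw [F_mul_KFE]
  exact Submodule.smul_mem _ _ (KFE_mem_Mle ha _ _)

theorem EK_mul_mem_Mle {χ : SymBichar k ι} (j : ι) {b : ι → ℤ} (hb : hgt b < 0) {x : U χ}
    (hx : x ∈ Mle χ) : E χ j * K χ b * x ∈ Mle χ := by
  refine mul_mem_Mle _ (fun a f e ha => ?_) hx
  rw [mul_assoc, ← mul_assoc (K χ b), ← mul_assoc (K χ b), ← K_add, E_mul_KFE]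
  refine Submodule.smul_mem _ _ (sub_mem (add_mem (KFE_mem_Mle ?_ _ _) (KFE_mem_Mle ?_ _ _))
    (KFE_mem_Mle ?_ _ _))
  all_goals
    simp only [hgt_add, hgt_sub, hgt_α]
    omega

theorem vz_EK_mul (χ : SymBichar k ι) (j : ι) {b : ι → ℤ} (hb : hgt b = -1) {x : U χ}
    (hx : x ∈ Mle χ) : vz χ (E χ j * K χ b * x) = eOp χ j b (vz χ x) := by
  have : Mle χ ≤ LinearMap.eqLocus (vz χ ∘ₗ LinearMap.mulLeft k (E χ j * K χ b))
      (eOp χ j b ∘ₗ vz χ) := Submodule.span_le.2 (by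
    rintro _ ⟨a, f, e, ha, rfl⟩
    change vz χ (E χ j * K χ b * (K χ a * nF χ f * nE χ e)) = eOp χ j b (vz χ _)
    rw [mul_assoc, ← mul_assoc (K χ b), ← mul_assoc (K χ b), ← K_add, E_mul_KFE, map_smul,
      map_sub, map_add, vz_KFE, vz_KFE, vz_KFE, vz_KFE, map_mul, epsN_x, zero_mul, zero_smul,
      ite_self, zero_add, if_neg (c := hgt (b + a - α j) = 0), sub_zero]
    · have h1 : hgt (b + a + α j) = hgt a := by
        rw [hgt_add, hgt_add, hb, hgt_α]; ring
      rw [h1]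
      split_ifs
      · rw [map_smul, eOp_single, smul_comm]
      · simp
    · rw [hgt_sub, hgt_add, hb, hgt_α]
      omega)
  exact this hx

theorem vz_mul_K (χ : SymBichar k ι) {b : ι → ℤ} (hb : hgt b < 0) {x : U χ}
    (hx : x ∈ Mle χ) : vz χ (x * K χ b) = 0 := by
  have : Mle χ ≤ LinearMap.ker (vz χ ∘ₗ LinearMap.mulRight k (K χ b)) := Submodule.span_le.2 (by
    rintro _ ⟨a, f, e, ha, rfl⟩
    change vz χ (K χ a * nF χ f * nE χ e * K χ b) = 0
    rw [mul_assoc, nE_mul_K, ← mul_assoc, mul_assoc (K χ a), nF_mul_K, ← mul_assoc, ← K_add,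
      vz_KFE, if_neg]
    rw [hgt_add]
    omega)
  exact this hx

section Psi

variable (χ : SymBichar k ι) (τ : Equiv.Perm ι)

theorem Upoly_le_Mle {x : U χ} (hx : x ∈ Upoly χ τ) : x ∈ Mle χ := by
  refine adjoin_le_of_mul_mem _ (Mle χ) (one_mem_Mle χ) ?_ hx
  rintro _ (((⟨i, rfl⟩ | ⟨i, rfl⟩) | ⟨i, rfl⟩) | ⟨i, rfl⟩) m hm
  · exact F_mul_mem_Mle i hm
  · exact EK_mul_mem_Mle i (by simp) hm
  · exact K_mul_mem_Mle (by simp) hm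
  · exact K_mul_mem_Mle (by simp) hm

/-- The lattice generated by the `α_i - α_{τ(i)}`. -/
def Qθ : AddSubgroup (ι → ℤ) := AddSubgroup.closure (Set.range fun i => α i - α (τ i))

theorem sub_mem_Qθ (i : ι) : α i - α (τ i) ∈ Qθ τ := AddSubgroup.subset_closure ⟨i, rfl⟩

theorem sub_mem_Qθ' (i : ι) : -α i + α (τ i) ∈ Qθ τ := by
  have := neg_mem (sub_mem_Qθ τ i)
  rwa [neg_sub, sub_eq_neg_add] at this

variable {τ}

theorem hgt_of_mem_Qθ {a : ι → ℤ} (ha : a ∈ Qθ τ) : hgt a = 0 := by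
  induction ha using AddSubgroup.closure_induction with
  | mem a ha => obtain ⟨i, rfl⟩ := ha; simp
  | zero => simp
  | add a b _ _ ha hb => rw [hgt_add, ha, hb, add_zero]
  | neg a _ ha => rw [hgt_neg, ha, neg_zero]

theorem comp_of_mem_Qθ (hτ : ∀ i, τ (τ i) = i) {a : ι → ℤ} (ha : a ∈ Qθ τ) : a ∘ τ = -a := by
  induction ha using AddSubgroup.closure_induction with
  | mem a ha =>
    obtain ⟨i, rfl⟩ := ha
    ext j
    simp only [Function.comp_apply, Pi.sub_apply, Pi.neg_apply, α, Pi.single_apply]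
    have h1 : (τ j = i) = (j = τ i) := by
      apply propext
      constructor
      · rintro rfl; rw [hτ]
      · rintro rfl; rw [hτ]
    have h2 : (τ j = τ i) = (j = i) := by simp
    simp only [h1, h2, neg_sub]
  | zero => rfl
  | add a b _ _ ha hb => 
    ext j
    have h1 := congrFun ha j
    have h2 := congrFun hb j
    simp only [Function.comp_apply, Pi.neg_apply, Pi.add_apply] at h1 h2 ⊢
    omega
  | neg a _ ha => 
    ext j
    have h1 := congrFun ha j
    simp only [Function.comp_apply, Pi.neg_apply] at h1 ⊢
    omega

theorem K_mem_of_Qθ (hτ : ∀ i, τ (τ i) = i) {A : Subalgebra k (U χ)}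
    (hA : ∀ i, K χ (α i - α (τ i)) ∈ A) {a : ι → ℤ} (ha : a ∈ Qθ τ) : K χ a ∈ A := by
  have h : ∀ a ∈ Qθ τ, K χ a ∈ A ∧ K χ (-a) ∈ A := by
    intro a ha
    induction ha using AddSubgroup.closure_induction with
    | mem a ha =>
      obtain ⟨i, rfl⟩ := ha
      refine ⟨hA i, ?_⟩
      have := hA (τ i)
      rwa [hτ, ← neg_sub] at this
    | zero => simp [K_zero]
    | add a b _ _ ha hb =>
      rw [neg_add, K_add, K_add]
      exact ⟨mul_mem ha.1 hb.1, mul_mem ha.2 hb.2⟩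
    | neg a _ ha => rw [neg_neg]; exact ha.symm
  exact (h a ha).1

theorem partialBos_induction {P : U χ → Prop} (zero : P 0)
    (h : ∀ a ∈ Qθ τ, ∀ u, P (K χ a * nF χ u)) (add : ∀ x y, P x → P y → P (x + y))
    {x : U χ} (hx : x ∈ partialBos χ τ) : P x := by
  let g : Qθ τ → Nic χ →ₗ[k] U χ := fun a => LinearMap.mulLeft k (K χ a) ∘ₗ (nF χ).toLinearMap
  have hg : ∀ a u, g a u = K χ a * nF χ u := fun a u => rfl
  refine range_lsum_induction g zero (fun a u => h a a.2 u) add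
    (adjoin_le_of_mul_mem _ _ ?_ ?_ hx)
  · have := mem_range_lsum g 0 1
    rwa [hg, ZeroMemClass.coe_zero, K_zero, map_one, mul_one] at this
  · intro y hy
    refine mul_mem_range_lsum g y fun a u => ?_
    rcases hy with ⟨i, rfl⟩ | ⟨i, rfl⟩
    · have := mem_range_lsum g (⟨_, sub_mem_Qθ τ i⟩ + a) u
      rwa [hg, AddMemClass.coe_add, K_add, mul_assoc] at this
    · have := mem_range_lsum g a (χ.val a (α i) • (nx χ i * u))
      rw [map_smul, hg, map_mul, nF_x, ← mul_assoc, K_mul_F, smul_mul_assoc, smul_smul,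
        mul_inv_cancel₀ (val_ne_zero _ _ _), one_smul, mul_assoc] at this
      exact this

theorem vz_K_nF {a : ι → ℤ} (ha : a ∈ Qθ τ) (f : Nic χ) :
    vz χ (K χ a * nF χ f) = Finsupp.single a f := by
  have := vz_KFE χ a f 1
  rwa [map_one, mul_one, if_pos (hgt_of_mem_Qθ ha), map_one, one_smul] at this

theorem vz_injective_partialBos {x : U χ} (hx : x ∈ partialBos χ τ) (h : vz χ x = 0) : x = 0 := by
  let g : (ι → ℤ) → Nic χ →ₗ[k] U χ := fun a => LinearMap.mulLeft k (K χ a) ∘ₗ (nF χ).toLinearMap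
  have key : Finsupp.lsum k g (vz χ x) = x := by
    refine partialBos_induction (P := fun x => Finsupp.lsum k g (vz χ x) = x) χ (by simp) ?_ ?_ hx
    · intro a ha u
      rw [vz_K_nF χ ha]
      simp [g]
    · intro x y hx hy
      rw [map_add, map_add, hx, hy]
  rw [← key, h, map_zero]

theorem vz_psiKer {x : Upoly χ τ} (hx : x ∈ psiKer χ τ) : vz χ x = 0 := by
  have hx' : x ∈ Ideal.span {x : Upoly χ τ | ∃ i, (x : U χ) = E χ i * K χ (-α i) ∨
    (x : U χ) = K χ (-α i)} := hx
  suffices h : ∀ a : Upoly χ τ, vz χ (a * x) = 0 by simpa using h 1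
  clear hx
  induction hx' using Submodule.span_induction with
  | mem x hx =>
    intro a
    obtain ⟨i, hx | hx⟩ := hx
    · have h : E χ i * K χ (-α i) = (χ.val (-α i) (α i))⁻¹ • (K χ (-α i) * E χ i) := by
        rw [K_mul_E, smul_smul, inv_mul_cancel₀ (val_ne_zero _ _ _), one_smul]
      rw [hx, h, mul_smul_comm, map_smul, ← mul_assoc, vz_mul_E, smul_zero]
    · rw [hx]
      exact vz_mul_K χ (by simp) (Upoly_le_Mle χ τ a.2)
  | zero => simp
  | add x y _ _ hx hy =>
    intro a
    rw [AddMemClass.coe_add, mul_add, map_add, hx, hy, add_zero]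
  | smul b x _ hx =>
    intro a
    have := hx (a * b)
    rwa [MulMemClass.coe_mul, mul_assoc] at this

/-- `U^poly span {E_i K_i⁻¹, K_i⁻¹}` as a subspace of `U`. -/
def psiKerU (τ : Equiv.Perm ι) : Submodule k (U χ) :=
  (psiKer χ τ).map (Upoly χ τ).val.toLinearMap

theorem mul_mem_psiKerU {y x : U χ} (hy : y ∈ Upoly χ τ) (hx : x ∈ psiKerU χ τ) :
    y * x ∈ psiKerU χ τ := by
  obtain ⟨l, hl, rfl⟩ := hx
  exact ⟨⟨y, hy⟩ * l, Ideal.mul_mem_left _ _ hl, rfl⟩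

theorem EK_mem_Upoly (i : ι) : E χ i * K χ (-α i) ∈ Upoly χ τ :=
  Algebra.subset_adjoin (Or.inl (Or.inl (Or.inr ⟨i, rfl⟩)))

theorem Kneg_mem_Upoly (i : ι) : K χ (-α i) ∈ Upoly χ τ :=
  Algebra.subset_adjoin (Or.inl (Or.inr ⟨i, rfl⟩))

theorem EK_mem_psiKerU (i : ι) : E χ i * K χ (-α i) ∈ psiKerU χ τ :=
  ⟨⟨_, EK_mem_Upoly χ i⟩, Ideal.subset_span ⟨i, Or.inl rfl⟩, rfl⟩

theorem Kneg_mem_psiKerU (i : ι) : K χ (-α i) ∈ psiKerU χ τ :=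
  ⟨⟨_, Kneg_mem_Upoly χ i⟩, Ideal.subset_span ⟨i, Or.inr rfl⟩, rfl⟩

theorem nF_mem_partialBos (u : Nic χ) : nF χ u ∈ partialBos χ τ :=
  Uminus_le_partialBos χ τ (nF_mem_Uminus χ u)

theorem K_mem_partialBos (hτ : ∀ i, τ (τ i) = i) {a : ι → ℤ} (ha : a ∈ Qθ τ) :
    K χ a ∈ partialBos χ τ :=
  K_mem_of_Qθ χ hτ (fun i => Algebra.subset_adjoin (Or.inl ⟨i, rfl⟩)) ha

theorem Upoly_le_sup (hτ : ∀ i, τ (τ i) = i) {x : U χ} (hx : x ∈ Upoly χ τ) :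
    x ∈ (partialBos χ τ).toSubmodule ⊔ psiKerU χ τ := by
  refine adjoin_le_of_mul_mem _ _ (Submodule.mem_sup_left (one_mem (partialBos χ τ))) ?_ hx
  intro y hy m hm
  have hy' : y ∈ Upoly χ τ := Algebra.subset_adjoin hy
  obtain ⟨p, hp, l, hl, rfl⟩ := Submodule.mem_sup.1 hm
  rw [mul_add]
  refine add_mem ?_ (Submodule.mem_sup_right (mul_mem_psiKerU χ hy' hl))
  rcases hy with ((⟨i, rfl⟩ | ⟨i, rfl⟩) | ⟨i, rfl⟩) | ⟨i, rfl⟩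
  · exact Submodule.mem_sup_left ((partialBos χ τ).mul_mem
      (Algebra.subset_adjoin (Or.inr ⟨i, rfl⟩)) hp)
  · refine partialBos_induction (P := fun p => E χ i * K χ (-α i) * p ∈
      (partialBos χ τ).toSubmodule ⊔ psiKerU χ τ) χ (by simp) ?_ ?_ hp
    · intro a ha u
      have hKa := K_mem_partialBos χ hτ ha
      have h := E_mul_KFE χ i (-α i + a) u 1
      have h1 : K χ (-α i + a) * nF χ u * E χ i = (χ.val (-α i) (α i)) •
          ((K χ a * nF χ (S χ (α i) u)) * (E χ i * K χ (-α i))) := by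
        rw [add_comm, K_add, mul_assoc (K χ a), K_mul_nF, neg_neg, mul_assoc (K χ a), mul_assoc,
          mul_assoc, K_mul_E, mul_smul_comm, mul_smul_comm]
      have h2 : ∀ g, K χ (-α i + a - α i) * nF χ g =
          (K χ a * K χ (-α i) * nF χ (S χ (α i) g)) * K χ (-α i) := by
        intro g
        rw [add_comm, sub_eq_add_neg, K_add, K_add, mul_assoc _ (K χ (-α i)) (nF χ g), K_mul_nF,
          neg_neg, mul_assoc _ (nF χ _)]
      rw [mul_one, nE_x, map_one, mul_one, mul_one, mul_one, h1, h2, neg_add_cancel_comm] at h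
      rw [mul_assoc, ← mul_assoc (K χ (-α i)), ← K_add, h]
      have hp1 : ∀ v, K χ a * nF χ v ∈ partialBos χ τ := fun v =>
        mul_mem hKa (nF_mem_partialBos χ v)
      refine Submodule.smul_mem _ _ (sub_mem (add_mem ?_ ?_) ?_)
      · exact Submodule.mem_sup_right (Submodule.smul_mem _ _
          (mul_mem_psiKerU χ (partialBos_le_Upoly χ τ (hp1 _)) (EK_mem_psiKerU χ i)))
      · exact Submodule.mem_sup_left (hp1 _)
      · exact Submodule.mem_sup_right (mul_mem_psiKerU χ
          (mul_mem (mul_mem (partialBos_le_Upoly χ τ hKa) (Kneg_mem_Upoly χ i))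
            (partialBos_le_Upoly χ τ (nF_mem_partialBos χ _))) (Kneg_mem_psiKerU χ i))
    · intro x y hx hy
      rw [mul_add]
      exact add_mem hx hy
  · refine partialBos_induction (P := fun p => K χ (-α i) * p ∈
      (partialBos χ τ).toSubmodule ⊔ psiKerU χ τ) χ (by simp) ?_ ?_ hp
    · intro a ha u
      rw [← mul_assoc, ← K_add, add_comm, K_add, mul_assoc, K_mul_nF, ← mul_assoc]
      exact Submodule.mem_sup_right (mul_mem_psiKerU χ (partialBos_le_Upoly χ τ
        (mul_mem (K_mem_partialBos χ hτ ha) (nF_mem_partialBos χ _))) (Kneg_mem_psiKerU χ i))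
    · intro x y hx hy
      rw [mul_add]
      exact add_mem hx hy
  · exact Submodule.mem_sup_left ((partialBos χ τ).mul_mem
      (Algebra.subset_adjoin (Or.inl ⟨i, rfl⟩)) hp)

theorem psi_isCompl (hτ : ∀ i, τ (τ i) = i) : IsCompl (psiRange χ τ) (psiKer χ τ) := by
  refine ⟨Submodule.disjoint_def.2 fun x hx hx' => ?_, codisjoint_iff.2 (eq_top_iff.2 ?_)⟩
  · exact Subtype.ext (vz_injective_partialBos χ hx (vz_psiKer χ hx'))
  · rintro ⟨x, hx⟩ -
    obtain ⟨p, hp, l, ⟨l', hl, rfl⟩, rfl⟩ := Submodule.mem_sup.1 (Upoly_le_sup χ hτ hx)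
    refine Submodule.mem_sup.2 ⟨⟨p, partialBos_le_Upoly χ τ hp⟩, hp, l', hl, rfl⟩

theorem vz_projection (h : IsCompl (psiRange χ τ) (psiKer χ τ)) (x : Upoly χ τ) :
    vz χ (Submodule.projectionOnto (psiRange χ τ) (psiKer χ τ) h x : Upoly χ τ) = vz χ x := by
  have h1 : x - (Submodule.projectionOnto (psiRange χ τ) (psiKer χ τ) h x : Upoly χ τ) ∈
      psiKer χ τ := by
    rw [← Submodule.projectionOnto_apply_eq_zero_iff h, map_sub,
      Submodule.projectionOnto_apply_left, sub_self]
  have h2 := vz_psiKer χ h1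
  rw [AddSubgroupClass.coe_sub, map_sub, sub_eq_zero] at h2
  exact h2.symm

end Psi

/-! ### Filtrations by length -/

theorem span_le_of_word {V : Type*} [AddCommGroup V] [Module k V] {s : Set V}
    (M : Submodule k V) (h : ∀ x ∈ s, x ∈ M) {x : V} (hx : x ∈ Submodule.span k s) : x ∈ M :=
  Submodule.span_le.2 h hx

/-- The monomial of a word in the Nichols algebra. -/
def wN (χ : SymBichar k ι) (l : List ι) : Nic χ := mkN χ (word k l)

@[simp] theorem wN_nil (χ : SymBichar k ι) : wN χ [] = 1 := map_one _

@[simp] theorem wN_cons (χ : SymBichar k ι) (i : ι) (l : List ι) :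
    wN χ (i :: l) = nx χ i * wN χ l := by
  rw [wN, word_cons, map_mul, mkN_X]; rfl

@[simp] theorem wN_append (χ : SymBichar k ι) (l l' : List ι) :
    wN χ (l ++ l') = wN χ l * wN χ l' := by
  induction l with
  | nil => simp
  | cons i l ih => rw [List.cons_append, wN_cons, ih, wN_cons, mul_assoc]

theorem wN_mem_Nwt (χ : SymBichar k ι) (l : List ι) : wN χ l ∈ Nwt χ (cnt l) :=
  ⟨_, word_mem_Twt l, rfl⟩

theorem S_wN (χ : SymBichar k ι) (a : ι → ℤ) (l : List ι) :
    S χ a (wN χ l) = χ.val a (up (cnt l)) • wN χ l := S_of_mem (wN_mem_Nwt χ l) a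

theorem size_add (μ ν : ι → ℕ) : size (μ + ν) = size μ + size ν := by
  simp [size, Finset.sum_add_distrib]

@[simp] theorem size_single (i : ι) : size (Pi.single i 1 : ι → ℕ) = 1 := by
  simp [size]

theorem cnt_nil : cnt ([] : List ι) = 0 := by
  ext i; simp [cnt]

theorem size_cnt (l : List ι) : size (cnt l) = l.length := by
  induction l with
  | nil => simp [cnt_nil, size]
  | cons i l ih => rw [cnt_cons, size_add, size_single, ih, List.length_cons, add_comm]

theorem up_cnt_cons (i : ι) (l : List ι) : up (cnt (i :: l)) = α i + up (cnt l) := by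
  rw [cnt_cons, up_add, up_single]

/-- Noncommutative polynomials of degree less than `m`. -/
def Tlt (k : Type*) [Field k] (ι : Type*) (m : ℕ) : Submodule k (T k ι) :=
  Submodule.span k {p | ∃ l : List ι, l.length < m ∧ p = word k l}

/-- Elements of the Nichols algebra of degree less than `m`. -/
def Nlt (χ : SymBichar k ι) (m : ℕ) : Submodule k (Nic χ) :=
  Submodule.span k {p | ∃ l : List ι, l.length < m ∧ p = wN χ l}

theorem word_mem_Tlt {l : List ι} {m : ℕ} (h : l.length < m) : word k l ∈ Tlt k ι m :=
  Submodule.subset_span ⟨l, h, rfl⟩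

theorem wN_mem_Nlt (χ : SymBichar k ι) {l : List ι} {m : ℕ} (h : l.length < m) :
    wN χ l ∈ Nlt χ m := Submodule.subset_span ⟨l, h, rfl⟩

theorem Nlt_mono (χ : SymBichar k ι) {m n : ℕ} (h : m ≤ n) : Nlt χ m ≤ Nlt χ n :=
  Submodule.span_mono fun _ ⟨l, hl, hp⟩ => ⟨l, by omega, hp⟩

theorem exists_Tlt_of_Nlt {χ : SymBichar k ι} {m : ℕ} {u : Nic χ} (hu : u ∈ Nlt χ m) :
    ∃ t ∈ Tlt k ι m, mkN χ t = u := by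
  have : Nlt χ m ≤ (Tlt k ι m).map (mkN χ).toLinearMap := Submodule.span_le.2 (by
    rintro _ ⟨l, hl, rfl⟩
    exact ⟨word k l, word_mem_Tlt hl, rfl⟩)
  obtain ⟨t, ht, h⟩ := this hu
  exact ⟨t, ht, h⟩

theorem exists_mem_Nlt (χ : SymBichar k ι) (u : Nic χ) : ∃ m, u ∈ Nlt χ m := by
  obtain ⟨p, rfl⟩ := mkN_surjective χ u
  refine word_induction (P := fun p => ∃ m, mkN χ p ∈ Nlt χ m) ?_ ?_ ?_ p
  · intro l
    exact ⟨l.length + 1, wN_mem_Nlt χ (Nat.lt_succ_self _)⟩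
  · rintro u v ⟨m, hm⟩ ⟨n, hn⟩
    refine ⟨max m n, ?_⟩
    rw [map_add]
    exact add_mem (Nlt_mono χ (le_max_left _ _) hm) (Nlt_mono χ (le_max_right _ _) hn)
  · rintro c u ⟨m, hm⟩
    refine ⟨m, ?_⟩
    rw [map_smul]
    exact Submodule.smul_mem _ _ hm

theorem x_mul_mem_Nlt {χ : SymBichar k ι} (i : ι) {m : ℕ} {u : Nic χ} (hu : u ∈ Nlt χ m) :
    nx χ i * u ∈ Nlt χ (m + 1) :=
  span_le_of_word ((Nlt χ (m + 1)).comap (LinearMap.mulLeft k (nx χ i))) (by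
    rintro _ ⟨l, hl, rfl⟩
    have := wN_mem_Nlt χ (l := i :: l) (m := m + 1) (by simpa using hl)
    rwa [wN_cons] at this) hu

theorem S_mem_Nlt {χ : SymBichar k ι} (a : ι → ℤ) {m : ℕ} {u : Nic χ} (hu : u ∈ Nlt χ m) :
    S χ a u ∈ Nlt χ m :=
  span_le_of_word ((Nlt χ m).comap (S χ a).toLinearMap) (by
    rintro _ ⟨l, hl, rfl⟩
    change S χ a (wN χ l) ∈ Nlt χ m
    rw [S_wN]
    exact Submodule.smul_mem _ _ (wN_mem_Nlt χ hl)) hu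

theorem dL_wN_mem_Nlt (χ : SymBichar k ι) (i : ι) (l : List ι) :
    dL χ i (wN χ l) ∈ Nlt χ l.length := by
  induction l with
  | nil => simp
  | cons j l ih =>
    rw [wN_cons, dL_x_mul, List.length_cons]
    refine add_mem ?_ (Submodule.smul_mem _ _ (x_mul_mem_Nlt j ih))
    split_ifs
    · exact wN_mem_Nlt χ (Nat.lt_succ_self _)
    · exact zero_mem _

theorem dR_wN_mem_Nlt (χ : SymBichar k ι) (i : ι) (l : List ι) :
    dR χ i (wN χ l) ∈ Nlt χ l.length := by
  induction l with
  | nil => simp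
  | cons j l ih =>
    rw [wN_cons, dR_mul, List.length_cons, dR_x]
    refine add_mem (x_mul_mem_Nlt j ih) ?_
    split_ifs
    · rw [one_mul, S_wN]
      exact Submodule.smul_mem _ _ (wN_mem_Nlt χ (Nat.lt_succ_self _))
    · rw [zero_mul]
      exact zero_mem _

theorem dL_mem_Nlt {χ : SymBichar k ι} (i : ι) {m : ℕ} {u : Nic χ} (hu : u ∈ Nlt χ m) :
    dL χ i u ∈ Nlt χ m :=
  span_le_of_word ((Nlt χ m).comap (dL χ i)) (by
    rintro _ ⟨l, hl, rfl⟩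
    exact Nlt_mono χ hl.le (dL_wN_mem_Nlt χ i l)) hu

/-- Elements of the Borel part of degree less than `m`. -/
def Vlt (χ : SymBichar k ι) (m : ℕ) : Submodule k ((ι → ℤ) →₀ Nic χ) :=
  Submodule.span k {g | ∃ (a : ι → ℤ) (l : List ι), l.length < m ∧ g = Finsupp.single a (wN χ l)}

theorem Vlt_mono (χ : SymBichar k ι) {m n : ℕ} (h : m ≤ n) : Vlt χ m ≤ Vlt χ n :=
  Submodule.span_mono fun _ ⟨a, l, hl, hp⟩ => ⟨a, l, by omega, hp⟩

theorem single_mem_Vlt {χ : SymBichar k ι} (a : ι → ℤ) {m : ℕ} {u : Nic χ} (hu : u ∈ Nlt χ m) :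
    Finsupp.single a u ∈ Vlt χ m :=
  span_le_of_word ((Vlt χ m).comap (Finsupp.lsingle a)) (by
    rintro _ ⟨l, hl, rfl⟩
    exact Submodule.subset_span ⟨a, l, hl, rfl⟩) hu

theorem apply_mem_Nlt {χ : SymBichar k ι} {m : ℕ} {g : (ι → ℤ) →₀ Nic χ} (hg : g ∈ Vlt χ m)
    (a : ι → ℤ) : g a ∈ Nlt χ m :=
  span_le_of_word ((Nlt χ m).comap (Finsupp.lapply (R := k) (M := Nic χ) a)) (by
    rintro _ ⟨b, l, hl, rfl⟩
    rw [Submodule.mem_comap, Finsupp.lapply_apply, Finsupp.single_apply]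
    split_ifs
    · exact wN_mem_Nlt χ hl
    · exact zero_mem _) hg

theorem kOp_mem_Vlt {χ : SymBichar k ι} (b : ι → ℤ) {m : ℕ} {g : (ι → ℤ) →₀ Nic χ}
    (hg : g ∈ Vlt χ m) : kOp χ b g ∈ Vlt χ m :=
  span_le_of_word ((Vlt χ m).comap (kOp χ b)) (by
    rintro _ ⟨a, l, hl, rfl⟩
    rw [Submodule.mem_comap, kOp_single]
    exact single_mem_Vlt _ (wN_mem_Nlt χ hl)) hg

section Filtration

variable (χ : SymBichar k ι) (τ : Equiv.Perm ι) (c : ι → k)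

/-- The operator on the Borel part induced by left multiplication by `B_i`. -/
def bOp (i : ι) : Module.End k ((ι → ℤ) →₀ Nic χ) := fOp χ i + c i • eOp χ (τ i) (-α i)

theorem vz_B_mul (i : ι) {x : U χ} (hx : x ∈ Mle χ) :
    vz χ (Bgen χ τ c i * x) = bOp χ τ c i (vz χ x) := by
  rw [Bgen, add_mul, smul_mul_assoc, map_add, map_smul, vz_F_mul, vz_EK_mul χ _ (by simp) hx]
  rfl

theorem bOp_single (i : ι) (a : ι → ℤ) (f : Nic χ) : bOp χ τ c i (Finsupp.single a f) =
    χ.val a (α i) • Finsupp.single a (nx χ i * f) + (c i * (χ.val (-α i + a) (α (τ i)))⁻¹) •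
      Finsupp.single (-α i + a + α (τ i)) (dL χ (τ i) f) := by
  rw [bOp, LinearMap.add_apply, LinearMap.smul_apply, fOp_single, eOp_single, smul_smul]

variable {χ} in
theorem bOp_mem_Vlt (i : ι) {m : ℕ} {g : (ι → ℤ) →₀ Nic χ} (hg : g ∈ Vlt χ m) :
    bOp χ τ c i g ∈ Vlt χ (m + 1) :=
  span_le_of_word ((Vlt χ (m + 1)).comap (bOp χ τ c i)) (by
    rintro _ ⟨a, l, hl, rfl⟩
    rw [Submodule.mem_comap, bOp_single]
    refine add_mem (Submodule.smul_mem _ _ (single_mem_Vlt _ (x_mul_mem_Nlt i (wN_mem_Nlt χ hl))))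
      (Submodule.smul_mem _ _ (single_mem_Vlt _ (Nlt_mono χ (Nat.le_succ _)
        (dL_mem_Nlt _ (wN_mem_Nlt χ hl)))))) hg

/-- `p ↦ p(B)`. -/
def evB : T k ι →ₐ[k] U χ := FreeAlgebra.lift k (Bgen χ τ c)

@[simp] theorem evB_nil : evB χ τ c (word k []) = 1 := map_one _

theorem evB_cons (i : ι) (l : List ι) :
    evB χ τ c (word k (i :: l)) = Bgen χ τ c i * evB χ τ c (word k l) := by
  rw [word_cons, map_mul, evB, FreeAlgebra.lift_ι_apply]

theorem word_append (l l' : List ι) : word k (l ++ l') = word k l * word k l' := by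
  simp [word]

variable {τ} in
theorem Bc_le_Mle (hτ : ∀ i, τ (τ i) = i) {x : U χ} (hx : x ∈ Bc χ τ c) : x ∈ Mle χ :=
  Upoly_le_Mle χ τ (Bc_le_Upoly χ τ hτ c hx)

theorem B_mem_Bc (i : ι) : Bgen χ τ c i ∈ Bc χ τ c := Algebra.subset_adjoin (Or.inr ⟨i, rfl⟩)

variable {τ} in
theorem K_mem_Bc (hτ : ∀ i, τ (τ i) = i) {a : ι → ℤ} (ha : a ∈ Qθ τ) : K χ a ∈ Bc χ τ c :=
  K_mem_of_Qθ χ hτ (fun i => Algebra.subset_adjoin (Or.inl ⟨i, rfl⟩)) ha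

theorem evB_mem_Bc (l : List ι) : evB χ τ c (word k l) ∈ Bc χ τ c := by
  induction l with
  | nil => rw [evB_nil]; exact one_mem _
  | cons i l ih => rw [evB_cons]; exact mul_mem (B_mem_Bc χ τ c i) ih

theorem vz_one : vz χ 1 = Finsupp.single 0 1 := by
  simpa [K_zero] using vz_KFE χ 0 1 1

variable {τ}

theorem vz_evB (hτ : ∀ i, τ (τ i) = i) (l : List ι) :
    vz χ (evB χ τ c (word k l)) - Finsupp.single 0 (wN χ l) ∈ Vlt χ l.length := by
  induction l with
  | nil => simp [vz_one]
  | cons i l ih =>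
    have h1 := bOp_mem_Vlt τ c i ih
    rw [map_sub, bOp_single, ← vz_B_mul χ τ c i (Bc_le_Mle χ c hτ (evB_mem_Bc χ τ c l)),
      ← evB_cons, val_zero_left, one_smul, ← wN_cons] at h1
    have h2 : (c i * (χ.val (-α i + 0) (α (τ i)))⁻¹) •
      Finsupp.single (-α i + 0 + α (τ i)) (dL χ (τ i) (wN χ l)) ∈ Vlt χ (l.length + 1) :=
      Submodule.smul_mem _ _ (single_mem_Vlt _ (Nlt_mono χ (Nat.le_succ _) (dL_wN_mem_Nlt χ _ _)))
    have h3 := add_mem h1 h2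
    rwa [← sub_sub, sub_add_cancel] at h3

theorem exists_Bc_vz (hτ : ∀ i, τ (τ i) = i) (m : ℕ) :
    ∀ f ∈ Nlt χ m, ∃ x ∈ Bc χ τ c, vz χ x = Finsupp.single 0 f := by
  let M : Submodule k (Nic χ) := ((Bc χ τ c).toSubmodule.map (vz χ)).comap (Finsupp.lsingle 0)
  suffices h : ∀ m, Nlt χ m ≤ M from fun f hf => by
    obtain ⟨x, hx, h⟩ := h m hf
    exact ⟨x, hx, h⟩
  intro m
  induction m with
  | zero => exact Submodule.span_le.2 (by rintro _ ⟨l, hl, rfl⟩; omega)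
  | succ m ih =>
    refine Submodule.span_le.2 ?_
    rintro _ ⟨l, hl, rfl⟩
    cases l with
    | nil => exact ⟨1, one_mem (Bc χ τ c), by rw [vz_one, wN_nil]; rfl⟩
    | cons i l =>
      have hl' : l.length < m := by simpa using hl
      obtain ⟨x, hx, h1⟩ := ih (wN_mem_Nlt χ hl')
      obtain ⟨y, hy, h2⟩ := ih (Nlt_mono χ hl'.le (dL_wN_mem_Nlt χ (τ i) l))
      have hx' : x ∈ Bc χ τ c := hx
      have hy' : y ∈ Bc χ τ c := hy
      refine ⟨Bgen χ τ c i * x - (c i * (χ.val (-α i + 0) (α (τ i)))⁻¹) •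
        (K χ (-α i + α (τ i)) * y), ?_, ?_⟩
      · exact (Bc χ τ c).sub_mem (mul_mem (B_mem_Bc χ τ c i) hx') (Subalgebra.smul_mem _
          (mul_mem (K_mem_Bc χ c hτ (sub_mem_Qθ' τ i)) hy') _)
      · rw [map_sub, map_smul, vz_B_mul χ τ c i (Bc_le_Mle χ c hτ hx'), h1,
          vz_K_mul χ (by simp), h2, Finsupp.lsingle_apply, Finsupp.lsingle_apply, bOp_single,
          kOp_single, val_zero_left, one_smul, ← wN_cons, add_zero, add_zero, add_sub_cancel_right]
        rfl

theorem α_comp (i : ι) : α (τ i) ∘ τ = α i := by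
  ext j
  simp [α, Pi.single_apply]

theorem val_Qθ (hχτ : ∀ i j, χ.q (τ i) (τ j) = χ.q i j) {a : ι → ℤ}
    (ha : a ∘ τ = -a) (i : ι) : χ.val a (α (τ i)) = (χ.val a (α i))⁻¹ := by
  rw [← val_comp_perm χ hχτ, ha, α_comp, val_neg_left]

theorem K_mul_B (hχτ : ∀ i j, χ.q (τ i) (τ j) = χ.q i j) {a : ι → ℤ}
    (ha : a ∘ τ = -a) (i : ι) :
    K χ a * Bgen χ τ c i = (χ.val a (α i))⁻¹ • (Bgen χ τ c i * K χ a) := by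
  rw [Bgen, mul_add, mul_smul_comm, ← mul_assoc, K_mul_E, K_mul_F, val_Qθ χ hχτ ha, add_mul,
    smul_add, smul_mul_assoc, smul_mul_assoc, smul_comm, mul_assoc, mul_assoc, K_comm]

variable (τ) in
/-- The span of the `K_a B_w` for words `w` of length less than `m`. -/
def Flt (m : ℕ) : Submodule k (U χ) :=
  Submodule.span k {x | ∃ a ∈ Qθ τ, ∃ l : List ι, l.length < m ∧
    x = K χ a * evB χ τ c (word k l)}

theorem K_evB_mem_Flt {a : ι → ℤ} (ha : a ∈ Qθ τ) {l : List ι} {m : ℕ} (hl : l.length < m) :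
    K χ a * evB χ τ c (word k l) ∈ Flt χ τ c m := Submodule.subset_span ⟨a, ha, l, hl, rfl⟩

theorem evB_mem_Flt {l : List ι} {m : ℕ} (hl : l.length < m) :
    evB χ τ c (word k l) ∈ Flt χ τ c m := by
  have := K_evB_mem_Flt χ c (zero_mem (Qθ τ)) hl
  rwa [K_zero, one_mul] at this

theorem Flt_mono {m n : ℕ} (h : m ≤ n) : Flt χ τ c m ≤ Flt χ τ c n :=
  Submodule.span_mono fun _ ⟨a, ha, l, hl, hp⟩ => ⟨a, ha, l, by omega, hp⟩

variable {χ} {c}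

theorem K_mul_mem_Flt {a : ι → ℤ} (ha : a ∈ Qθ τ) {m : ℕ} {x : U χ} (hx : x ∈ Flt χ τ c m) :
    K χ a * x ∈ Flt χ τ c m :=
  span_le_of_word ((Flt χ τ c m).comap (LinearMap.mulLeft k (K χ a))) (by
    rintro _ ⟨b, hb, l, hl, rfl⟩
    rw [Submodule.mem_comap, LinearMap.mulLeft_apply, ← mul_assoc, ← K_add]
    exact K_evB_mem_Flt χ c (add_mem ha hb) hl) hx

theorem B_mul_mem_Flt (hτ : ∀ i, τ (τ i) = i) (hχτ : ∀ i j, χ.q (τ i) (τ j) = χ.q i j) (i : ι)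
    {m : ℕ} {x : U χ} (hx : x ∈ Flt χ τ c m) : Bgen χ τ c i * x ∈ Flt χ τ c (m + 1) :=
  span_le_of_word ((Flt χ τ c (m + 1)).comap (LinearMap.mulLeft k (Bgen χ τ c i))) (by
    rintro _ ⟨b, hb, l, hl, rfl⟩
    have h : Bgen χ τ c i * K χ b = χ.val b (α i) • (K χ b * Bgen χ τ c i) := by
      rw [K_mul_B χ c hχτ (comp_of_mem_Qθ hτ hb), smul_smul, mul_inv_cancel₀ (val_ne_zero _ _ _),
        one_smul]
    rw [Submodule.mem_comap, LinearMap.mulLeft_apply, ← mul_assoc, h,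
      smul_mul_assoc, mul_assoc, ← evB_cons]
    exact Submodule.smul_mem _ _ (K_evB_mem_Flt χ c hb (by simpa using hl))) hx

theorem evB_mul_mem_Flt (hτ : ∀ i, τ (τ i) = i) (hχτ : ∀ i j, χ.q (τ i) (τ j) = χ.q i j)
    (l : List ι) {m : ℕ} {x : U χ} (hx : x ∈ Flt χ τ c m) :
    evB χ τ c (word k l) * x ∈ Flt χ τ c (m + l.length) := by
  induction l with
  | nil => simpa using hx
  | cons i l ih =>
    rw [evB_cons, mul_assoc]
    exact B_mul_mem_Flt hτ hχτ i ih

theorem mul_evB_mem_Flt (l : List ι) {m : ℕ} {x : U χ} (hx : x ∈ Flt χ τ c m) :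
    x * evB χ τ c (word k l) ∈ Flt χ τ c (m + l.length) :=
  span_le_of_word ((Flt χ τ c (m + l.length)).comap (LinearMap.mulRight k (evB χ τ c (word k l)))) (by
    rintro _ ⟨b, hb, l', hl, rfl⟩
    rw [Submodule.mem_comap, LinearMap.mulRight_apply, mul_assoc, ← map_mul,
      ← word_append]
    exact K_evB_mem_Flt χ c hb (by simpa using hl)) hx

theorem exists_mem_Flt (hτ : ∀ i, τ (τ i) = i) (hχτ : ∀ i j, χ.q (τ i) (τ j) = χ.q i j)
    {x : U χ} (hx : x ∈ Bc χ τ c) : ∃ m, x ∈ Flt χ τ c m := by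
  have hdir : Directed (· ≤ ·) (Flt χ τ c) := fun m n =>
    ⟨max m n, Flt_mono χ c (le_max_left _ _), Flt_mono χ c (le_max_right _ _)⟩
  rw [← Submodule.mem_iSup_of_directed _ hdir]
  refine adjoin_le_of_mul_mem _ _ ?_ ?_ hx
  · rw [Submodule.mem_iSup_of_directed _ hdir]
    exact ⟨1, by simpa using evB_mem_Flt χ c (τ := τ) (l := []) (m := 1) (by simp)⟩
  · intro y hy m hm
    rw [Submodule.mem_iSup_of_directed _ hdir] at hm ⊢
    obtain ⟨n, hn⟩ := hm
    rcases hy with ⟨i, rfl⟩ | ⟨i, rfl⟩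
    · exact ⟨n, K_mul_mem_Flt (sub_mem_Qθ τ i) hn⟩
    · exact ⟨n + 1, B_mul_mem_Flt hτ hχτ i hn⟩

variable (χ) (c) in
theorem comul_B (i : ι) : comul χ (Bgen χ τ c i) = Bgen χ τ c i ⊗ₜ[k] K χ (-α i) +
    1 ⊗ₜ[k] F χ i + c i • (K χ (-α i + α (τ i)) ⊗ₜ[k] (E χ (τ i) * K χ (-α i))) := by
  rw [Bgen, map_add, map_smul, map_mul, comul_F, comul_E, comul_K, add_mul,
    Algebra.TensorProduct.tmul_mul_tmul, Algebra.TensorProduct.tmul_mul_tmul, one_mul, ← K_add,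
    TensorProduct.add_tmul, smul_add, TensorProduct.smul_tmul', add_comm (α (τ i))]
  abel

theorem lamR_B_mul (φ : U χ →ₗ[k] k) (i : ι) (z : U χ) : lamR χ φ (Bgen χ τ c i * z) =
    Bgen χ τ c i * lamR χ (φ ∘ₗ LinearMap.mulLeft k (K χ (-α i))) z +
      lamR χ (φ ∘ₗ LinearMap.mulLeft k (F χ i)) z + c i • (K χ (-α i + α (τ i)) *
        lamR χ (φ ∘ₗ LinearMap.mulLeft k (E χ (τ i) * K χ (-α i))) z) := by
  rw [lamR_apply, map_mul, comul_B, add_mul, add_mul, map_add, map_add, smul_mul_assoc, map_smul,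
    coeffR_mul_left φ (φ ∘ₗ LinearMap.mulLeft k (K χ (-α i))) _ _ (fun _ => rfl),
    coeffR_mul_left φ (φ ∘ₗ LinearMap.mulLeft k (F χ i)) _ _ (fun _ => rfl),
    coeffR_mul_left φ (φ ∘ₗ LinearMap.mulLeft k (E χ (τ i) * K χ (-α i))) _ _ (fun _ => rfl),
    one_mul]
  rfl

theorem lamR_K_mul (φ : U χ →ₗ[k] k) (a : ι → ℤ) (z : U χ) : lamR χ φ (K χ a * z) =
    K χ a * lamR χ (φ ∘ₗ LinearMap.mulLeft k (K χ a)) z := by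
  rw [lamR_apply, map_mul, comul_K,
    coeffR_mul_left φ (φ ∘ₗ LinearMap.mulLeft k (K χ a)) _ _ (fun _ => rfl)]
  rfl

theorem lamR_evB (hτ : ∀ i, τ (τ i) = i) (hχτ : ∀ i j, χ.q (τ i) (τ j) = χ.q i j)
    (l : List ι) (φ : U χ →ₗ[k] k) : lamR χ φ (evB χ τ c (word k l)) -
      φ (K χ (-up (cnt l))) • evB χ τ c (word k l) ∈ Flt χ τ c l.length := by
  induction l generalizing φ with
  | nil =>
    rw [evB_nil, cnt_nil, up_zero, neg_zero, K_zero, lamR_apply, map_one,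
      Algebra.TensorProduct.one_def, coeffR_tmul, sub_self]
    exact zero_mem _
  | cons i l ih =>
    have hmem : ∀ φ, lamR χ φ (evB χ τ c (word k l)) ∈ Flt χ τ c (l.length + 1) := by
      intro φ
      have := add_mem (Flt_mono χ c (Nat.le_succ _) (ih φ)) (Submodule.smul_mem _
        (φ (K χ (-up (cnt l)))) (evB_mem_Flt χ c (τ := τ) (Nat.lt_succ_self l.length)))
      rwa [sub_add_cancel] at this
    rw [evB_cons, lamR_B_mul, up_cnt_cons, neg_add, K_add χ (-α i) (-up (cnt l)), List.length_cons]
    have h1 := B_mul_mem_Flt hτ hχτ i (ih (φ ∘ₗ LinearMap.mulLeft k (K χ (-α i))))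
    rw [mul_sub, mul_smul_comm] at h1
    have h2 := add_mem (add_mem h1 (hmem (φ ∘ₗ LinearMap.mulLeft k (F χ i))))
      (Submodule.smul_mem _ (c i) (K_mul_mem_Flt (sub_mem_Qθ' τ i)
        (hmem (φ ∘ₗ LinearMap.mulLeft k (E χ (τ i) * K χ (-α i))))))
    convert h2 using 1
    rw [LinearMap.comp_apply, LinearMap.mulLeft_apply]
    abel

theorem lamR_mem_Flt (hτ : ∀ i, τ (τ i) = i) (hχτ : ∀ i j, χ.q (τ i) (τ j) = χ.q i j)
    (φ : U χ →ₗ[k] k) {m : ℕ} {x : U χ} (hx : x ∈ Flt χ τ c m) : lamR χ φ x ∈ Flt χ τ c m :=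
  span_le_of_word ((Flt χ τ c m).comap (lamR χ φ)) (by
    rintro _ ⟨b, hb, l, hl, rfl⟩
    rw [Submodule.mem_comap, lamR_K_mul]
    refine K_mul_mem_Flt hb ?_
    have := add_mem (Flt_mono χ c hl.le (lamR_evB hτ hχτ l (φ ∘ₗ LinearMap.mulLeft k (K χ b))))
      (Submodule.smul_mem _ ((φ ∘ₗ LinearMap.mulLeft k (K χ b)) (K χ (-up (cnt l))))
        (evB_mem_Flt χ c (τ := τ) hl))
    rwa [sub_add_cancel] at this) hx

end Filtration

/-! ### The degree filtration of `U(χ)_max` -/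

/-- The span of the `u K_b v` with `|u| + |v| < M`. -/
def Omlt (χ : SymBichar k ι) (M : ℕ) : Submodule k (Om χ) :=
  Submodule.span k {x | ∃ (b : ι → ℤ) (l l' : List ι), l.length + l'.length < M ∧
    x = om χ b (wN χ l) (wN χ l')}

theorem om_wN_mem_Omlt (χ : SymBichar k ι) (b : ι → ℤ) {l l' : List ι} {M : ℕ}
    (h : l.length + l'.length < M) : om χ b (wN χ l) (wN χ l') ∈ Omlt χ M :=
  Submodule.subset_span ⟨b, l, l', h, rfl⟩

theorem Omlt_mono (χ : SymBichar k ι) {m n : ℕ} (h : m ≤ n) : Omlt χ m ≤ Omlt χ n :=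
  Submodule.span_mono fun _ ⟨a, l, l', hl, hp⟩ => ⟨a, l, l', by omega, hp⟩

theorem om_mem_Omlt {χ : SymBichar k ι} (b : ι → ℤ) {p q M : ℕ} {u v : Nic χ} (hu : u ∈ Nlt χ p)
    (hv : v ∈ Nlt χ q) (h : p + q ≤ M + 1) : om χ b u v ∈ Omlt χ M :=
  span_le_of_word ((Omlt χ M).comap ((om χ b).flip v)) (by
    rintro _ ⟨l, hl, rfl⟩
    exact span_le_of_word ((Omlt χ M).comap (om χ b (wN χ l))) (by
      rintro _ ⟨l', hl', rfl⟩
      exact om_wN_mem_Omlt χ b (by omega)) hv) hu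

theorem mem_Omlt_of_word {χ : SymBichar k ι} {m n : ℕ} (f : Module.End k (Om χ))
    (h : ∀ b l l', l.length + l'.length < m → f (om χ b (wN χ l) (wN χ l')) ∈ Omlt χ n)
    {w : Om χ} (hw : w ∈ Omlt χ m) : f w ∈ Omlt χ n :=
  span_le_of_word ((Omlt χ n).comap f) (by
    rintro _ ⟨b, l, l', hl, rfl⟩
    exact h b l l' hl) hw

section Filtration

variable (χ : SymBichar k ι) (τ : Equiv.Perm ι) (c : ι → k)

/-- The leading part of left multiplication by `B_i`. -/
def opT (i : ι) : Module.End k (Om χ) := opA χ i + c i • (opE χ (τ i) * opK χ (-α i))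

theorem opT_om (i : ι) (a : ι → ℤ) (u v : Nic χ) : opT χ τ c i (om χ a u v) =
    χ.val a (α i) • om χ a u (nx χ i * v) + c i • om χ (a + -α i) (nx χ (τ i) * S χ (-α i) u) v := by
  simp [opT]

theorem opT_mem_Omlt (i : ι) {M : ℕ} {w : Om χ} (hw : w ∈ Omlt χ M) :
    opT χ τ c i w ∈ Omlt χ (M + 1) := by
  refine mem_Omlt_of_word _ (fun b l l' h => ?_) hw
  rw [opT_om, S_wN, mul_smul_comm, map_smul, LinearMap.smul_apply, ← wN_cons, ← wN_cons]
  exact add_mem (Submodule.smul_mem _ _ (om_wN_mem_Omlt χ _ (by simp; omega)))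
    (Submodule.smul_mem _ _ (Submodule.smul_mem _ _ (om_wN_mem_Omlt χ _ (by simp; omega))))

theorem opP_mem_Omlt (i : ι) {M : ℕ} {w : Om χ} (hw : w ∈ Omlt χ (M + 1)) :
    opP χ i w ∈ Omlt χ M := by
  refine mem_Omlt_of_word _ (fun b l l' h => ?_) hw
  rw [opP_om]
  exact neg_mem (om_mem_Omlt _ (dR_wN_mem_Nlt χ i l) (wN_mem_Nlt χ (Nat.lt_succ_self _))
    (by omega))

theorem opM_mem_Omlt (i : ι) {M : ℕ} {w : Om χ} (hw : w ∈ Omlt χ (M + 1)) :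
    opM χ i w ∈ Omlt χ M := by
  refine mem_Omlt_of_word _ (fun b l l' h => ?_) hw
  rw [opM_om]
  exact om_mem_Omlt _ (S_mem_Nlt _ (dL_wN_mem_Nlt χ i l)) (wN_mem_Nlt χ (Nat.lt_succ_self _))
    (by omega)

theorem actOm_B (i : ι) (w : Om χ) :
    actOm χ (Bgen χ τ c i) w = opT χ τ c i w + opP χ i w + opM χ i w := by
  rw [Bgen, map_add, map_smul, map_mul, actOm_E, actOm_F, actOm_K, opF, opT]
  simp only [LinearMap.add_apply]
  abel

theorem lift_opT_word (l : List ι) :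
    FreeAlgebra.lift k (opT χ τ c) (word k l) (om χ 0 1 1) ∈ Omlt χ (l.length + 1) ∧
    actOm χ (evB χ τ c (word k l)) (om χ 0 1 1) -
      FreeAlgebra.lift k (opT χ τ c) (word k l) (om χ 0 1 1) ∈ Omlt χ l.length := by
  induction l with
  | nil =>
    have h := om_wN_mem_Omlt χ 0 (l := []) (l' := []) (M := 1) (by simp)
    have h1 : word k ([] : List ι) = 1 := rfl
    rw [wN_nil] at h
    rw [evB_nil, h1, map_one (actOm χ), map_one (FreeAlgebra.lift k (opT χ τ c)), sub_self]
    exact ⟨h, zero_mem _⟩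
  | cons i l ih =>
    rw [evB_cons, map_mul, word_cons, map_mul, FreeAlgebra.lift_ι_apply, Module.End.mul_apply,
      Module.End.mul_apply, actOm_B, List.length_cons]
    have h1 := opT_mem_Omlt χ τ c i ih.1
    have h2 := opT_mem_Omlt χ τ c i ih.2
    have h3 := add_mem ih.1 (Omlt_mono χ (Nat.le_succ _) ih.2)
    rw [add_sub_cancel] at h3
    have h4 := opP_mem_Omlt χ i (M := l.length) h3
    have h5 := opM_mem_Omlt χ i (M := l.length) h3
    refine ⟨h1, ?_⟩
    rw [map_sub] at h2
    have h6 := add_mem (add_mem h2 (Omlt_mono χ (Nat.le_succ _) h4))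
      (Omlt_mono χ (Nat.le_succ _) h5)
    convert h6 using 1
    abel

variable {τ}

theorem lift_mulLeft_perm_kill (hχτ : ∀ i j, χ.q (τ i) (τ j) = χ.q i j) (p : T k ι)
    (hp : p ∈ Imax χ) : FreeAlgebra.lift k
      (fun i => (LinearMap.mulLeft k (nx χ (τ i)) : Module.End k (Nic χ))) p = 0 := by
  have h : FreeAlgebra.lift k (fun i => (LinearMap.mulLeft k (nx χ (τ i)) : Module.End k (Nic χ))) =
      (FreeAlgebra.lift k (fun i => (LinearMap.mulLeft k (nx χ i) : Module.End k (Nic χ)))).comp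
        (permT k τ) := by
    ext i : 2
    simp
  rw [Imax_eq_radT] at hp
  rw [h, AlgHom.comp_apply, mulLeft_kill χ _ (Imax_eq_radT χ ▸ permT_radT hχτ hp)]

theorem q_perm_symm (hτ : ∀ i, τ (τ i) = i) (hχτ : ∀ i j, χ.q (τ i) (τ j) = χ.q i j) (i j : ι) :
    χ.val (α j) (α (τ i)) = χ.val (α i) (α (τ j)) := by
  have := hχτ j (τ i)
  rw [hτ, q_symm] at this
  exact this.symm

theorem opT_kill (hτ : ∀ i, τ (τ i) = i) (hχτ : ∀ i j, χ.q (τ i) (τ j) = χ.q i j) (p : T k ι)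
    (hp : p ∈ Imax χ) : FreeAlgebra.lift k (opT χ τ c) p = 0 := by
  refine comul_kill χ _ (FreeAlgebra.lift k (opA χ))
    (FreeAlgebra.lift k fun i => c i • (opE χ (τ i) * opK χ (-α i)))
    ?_ ?_ (Imax χ) (Imax_isGradedBiideal χ) (opA_kill χ) ?_ p hp
  · intro i
    simp [opT]
  · intro i j
    refine Om_hom_ext fun a u v => ?_
    simp only [FreeAlgebra.lift_ι_apply, Module.End.mul_apply, LinearMap.smul_apply, opA_om,
      map_smul, opK_om, opE_om, smul_smul, val_add_left, val_neg_left, q_eq]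
    congr 1
    have := val_ne_zero χ (α i) (α j)
    field_simp
  · refine graded_kill_twisted _
      (FreeAlgebra.lift k fun i => endLeft χ (LinearMap.mulLeft k (nx χ (τ i))))
      (fun i => (c i * χ.val (α i) (α (τ i))) • opK χ (-α i))
      (fun i j => χ.val (α j) (α (τ i))) (fun i j => q_perm_symm χ hτ hχτ i j) ?_ ?_ ?_ (Imax χ)
      (Imax_isGradedBiideal χ).graded
      (fun p hp => lift_kill_of_comp (fun i => LinearMap.mulLeft k (nx χ (τ i))) (endLeft χ)
        (lift_mulLeft_perm_kill χ hχτ p hp))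
    · intro i
      refine Om_hom_ext fun a u v => ?_
      simp only [FreeAlgebra.lift_ι_apply, Module.End.mul_apply, LinearMap.smul_apply, opK_om,
        opE_om, endLeft_om, LinearMap.mulLeft_apply, map_mul, S_x, smul_mul_assoc, map_smul,
        smul_smul, val_neg_left, mul_assoc, mul_inv_cancel₀ (val_ne_zero χ (α i) (α (τ i))), mul_one]
    · intro i j
      refine Om_hom_ext fun a u v => ?_
      simp only [Module.End.mul_apply, LinearMap.smul_apply, opK_om, map_smul, smul_smul, ← S_add]
      rw [mul_comm, add_assoc, add_assoc, add_comm (-α i)]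
    · intro i j
      refine Om_hom_ext fun a u v => ?_
      simp only [FreeAlgebra.lift_ι_apply, Module.End.mul_apply, LinearMap.smul_apply, opK_om,
        endLeft_om, LinearMap.mulLeft_apply, map_mul, S_x, smul_mul_assoc, map_smul,
        smul_smul, val_neg_left]
      congr 1
      have := val_ne_zero χ (α j) (α (τ i))
      field_simp

/-- The span of the `u K_b v` with `|u| + |v| < M`. -/
def Ult (M : ℕ) : Submodule k (U χ) := (Omlt χ M).map (pbw χ)

theorem evB_mem_Ult (hτ : ∀ i, τ (τ i) = i) (hχτ : ∀ i j, χ.q (τ i) (τ j) = χ.q i j) {μ : ι → ℕ}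
    {s : T k ι} (hs : s ∈ Twt k μ) (hs' : s ∈ Imax χ) : evB χ τ c s ∈ Ult χ (size μ) := by
  have h : s ∈ (Omlt χ (size μ)).comap
      (((LinearMap.applyₗ (om χ 0 1 1)) ∘ₗ ((actOm χ).comp (evB χ τ c)).toLinearMap) -
        (LinearMap.applyₗ (om χ 0 1 1)) ∘ₗ (FreeAlgebra.lift k (opT χ τ c)).toLinearMap) := by
    refine span_le_of_word _ ?_ hs
    rintro _ ⟨l, hl, rfl⟩
    have := (lift_opT_word χ τ c l).2
    have hμ : cnt l = μ := funext hl
    rwa [← size_cnt, hμ] at this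
  have h2 : actOm χ (evB χ τ c s) (om χ 0 1 1) - FreeAlgebra.lift k (opT χ τ c) s (om χ 0 1 1) ∈
    Omlt χ (size μ) := h
  rw [opT_kill χ c hτ hχτ s hs', LinearMap.zero_apply, sub_zero] at h2
  refine ⟨_, h2, ?_⟩
  rw [pbw_act, pbw_om]
  simp [K_zero]

/-- The PBW monomial `E_l K_b F_{l'}`. -/
def mon (l : List ι) (b : ι → ℤ) (l' : List ι) : U χ := nE χ (wN χ l) * K χ b * nF χ (wN χ l')

theorem Ult_eq_span (M : ℕ) : Ult χ M = Submodule.span k {x | ∃ (b : ι → ℤ) (l l' : List ι),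
    l.length + l'.length < M ∧ x = mon χ l b l'} := by
  rw [Ult, Omlt, Submodule.map_span]
  congr 1
  ext x
  constructor
  · rintro ⟨_, ⟨b, l, l', h, rfl⟩, rfl⟩
    exact ⟨b, l, l', h, pbw_om χ _ _ _⟩
  · rintro ⟨b, l, l', h, rfl⟩
    exact ⟨_, ⟨b, l, l', h, rfl⟩, pbw_om χ _ _ _⟩

theorem mon_mem_Ult {l : List ι} (b : ι → ℤ) {l' : List ι} {M : ℕ}
    (h : l.length + l'.length < M) : mon χ l b l' ∈ Ult χ M := by
  rw [Ult_eq_span]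
  exact Submodule.subset_span ⟨b, l, l', h, rfl⟩

/-- The part of `Ult` in the component `U⁺ K_a G⁻`. -/
def Uwt (a : ι → ℤ) (M : ℕ) : Submodule k (U χ) :=
  Submodule.span k {x | ∃ (b : ι → ℤ) (l l' : List ι),
    l.length + l'.length < M ∧ b - up (cnt l') = a ∧ x = mon χ l b l'}

theorem mon_mem_UKG (l : List ι) (b : ι → ℤ) (l' : List ι) :
    mon χ l b l' ∈ UKG χ (b - up (cnt l')) := by
  have : mon χ l b l' = nE χ (wN χ l) * K χ (b - up (cnt l')) *
      (K χ (up (cnt l')) * nF χ (wN χ l')) := by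
    rw [mon, ← mul_assoc, mul_assoc (nE χ _) (K χ (b - up (cnt l'))), ← K_add, sub_add_cancel]
  rw [this]
  exact Submodule.mul_mem_mul
    (Submodule.mul_mem_mul (nE_mem_Uplus χ _) (Submodule.mem_span_singleton_self _))
    (K_mul_nF_mem_Gminus χ (wN_mem_Nwt χ l'))

theorem projW_mon (a : ι → ℤ) (l : List ι) (b : ι → ℤ) (l' : List ι) :
    projW χ a (mon χ l b l') = if b - up (cnt l') = a then mon χ l b l' else 0 :=
  projW_UKG χ a _ (mon_mem_UKG χ l b l')

theorem projW_mem_Uwt (a : ι → ℤ) {M : ℕ} {x : U χ} (hx : x ∈ Ult χ M) :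
    projW χ a x ∈ Uwt χ a M := by
  rw [Ult_eq_span] at hx
  refine span_le_of_word ((Uwt χ a M).comap (projW χ a)) ?_ hx
  rintro _ ⟨b, l, l', h, rfl⟩
  rw [Submodule.mem_comap, projW_mon]
  split_ifs with hb
  · exact Submodule.subset_span ⟨b, l, l', h, hb, rfl⟩
  · exact zero_mem _

theorem projW_of_mem_Uwt {a : ι → ℤ} {M : ℕ} {x : U χ} (hx : x ∈ Uwt χ a M) :
    projW χ a x = x := by
  have : x ∈ LinearMap.ker (projW χ a - LinearMap.id) := by
    refine span_le_of_word _ ?_ hx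
    rintro _ ⟨b, l, l', h, hb, rfl⟩
    rw [LinearMap.mem_ker, LinearMap.sub_apply, projW_mon, if_pos hb, LinearMap.id_apply, sub_self]
  rw [LinearMap.mem_ker, LinearMap.sub_apply, sub_eq_zero] at this
  exact this

theorem Uwt_le_Ult {a : ι → ℤ} {M : ℕ} : Uwt χ a M ≤ Ult χ M := by
  rw [Ult_eq_span]
  exact Submodule.span_mono fun _ ⟨b, l, l', h, _, hx⟩ => ⟨b, l, l', h, hx⟩

theorem Ult_one_le_H {x : U χ} (hx : x ∈ Ult χ 1) : x ∈ H χ := by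
  rw [Ult_eq_span] at hx
  refine span_le_of_word (H χ).toSubmodule ?_ hx
  rintro _ ⟨b, l, l', h, rfl⟩
  have h1 : l = [] := List.eq_nil_of_length_eq_zero (by omega)
  have h2 : l' = [] := List.eq_nil_of_length_eq_zero (by omega)
  subst h1 h2
  rw [mon, wN_nil, map_one, map_one, one_mul, mul_one]
  exact Algebra.subset_adjoin ⟨b, rfl⟩

theorem lamR_E_mul (φ : U χ →ₗ[k] k) (i : ι) (z : U χ) : lamR χ φ (E χ i * z) =
    E χ i * lamR χ φ z + K χ (α i) * lamR χ (φ ∘ₗ LinearMap.mulLeft k (E χ i)) z := by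
  rw [lamR_apply, map_mul, comul_E, add_mul, map_add,
    coeffR_mul_left φ φ _ _ (fun x => by rw [one_mul]),
    coeffR_mul_left φ (φ ∘ₗ LinearMap.mulLeft k (E χ i)) _ _ (fun _ => rfl)]
  rfl

theorem lamR_mul_F (φ : U χ →ₗ[k] k) (i : ι) (z : U χ) : lamR χ φ (z * F χ i) =
    lamR χ (φ ∘ₗ LinearMap.mulRight k (K χ (-α i))) z * F χ i +
      lamR χ (φ ∘ₗ LinearMap.mulRight k (F χ i)) z := by
  rw [lamR_apply, map_mul, comul_F, mul_add, map_add,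
    coeffR_mul_right φ (φ ∘ₗ LinearMap.mulRight k (K χ (-α i))) _ _ (fun _ => rfl),
    coeffR_mul_right φ (φ ∘ₗ LinearMap.mulRight k (F χ i)) _ _ (fun _ => rfl), mul_one]
  rfl

theorem mon_cons (i : ι) (l : List ι) (b : ι → ℤ) (l' : List ι) :
    mon χ (i :: l) b l' = E χ i * mon χ l b l' := by
  rw [mon, wN_cons, map_mul (nE χ), nE_x, mon]
  simp only [mul_assoc]

theorem mon_append (l : List ι) (b : ι → ℤ) (l' : List ι) (i : ι) :
    mon χ l b (l' ++ [i]) = mon χ l b l' * F χ i := by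
  rw [mon, wN_append, map_mul (nF χ), wN_cons, wN_nil, mul_one, nF_x, mon]
  simp only [mul_assoc]

theorem mon_mul_K (l : List ι) (b : ι → ℤ) (l' : List ι) (a : ι → ℤ) :
    mon χ l b l' * K χ a = χ.val a (up (cnt l')) • mon χ l (b + a) l' := by
  rw [mon, mul_assoc, nF_mul_K, S_wN, map_smul, mul_smul_comm, mul_smul_comm, ← mul_assoc,
    mul_assoc (nE χ _), ← K_add, mon]

variable {χ}

theorem vanish_mul {φ : U χ →ₗ[k] k} {M n : ℕ} (hφ : ∀ x ∈ Ult χ M, φ x = 0)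
    (f : Module.End k (U χ)) (h : ∀ b l l', l.length + l'.length < n → f (mon χ l b l') ∈ Ult χ M) :
    ∀ x ∈ Ult χ n, (φ ∘ₗ f) x = 0 := by
  intro x hx
  rw [Ult_eq_span] at hx
  refine span_le_of_word (LinearMap.ker (φ ∘ₗ f)) ?_ hx
  rintro _ ⟨b, l, l', hl, rfl⟩
  exact hφ _ (h b l l' hl)

theorem lamR_mon (l : List ι) (b : ι → ℤ) (l' : List ι) {M : ℕ} (hM : l.length + l'.length ≤ M)
    (φ : U χ →ₗ[k] k) (hφ : ∀ x ∈ Ult χ M, φ x = 0) :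
    lamR χ φ (mon χ l b l') = φ (mon χ l b l') • K χ (up (cnt l) + b) := by
  induction l generalizing M φ with
  | nil =>
    induction l' using List.reverseRecOn generalizing M φ with
    | nil =>
      have : mon χ [] b [] = K χ b := by simp [mon]
      rw [this, lamR_apply, comul_K, coeffR_tmul, cnt_nil, up_zero, zero_add]
    | append_singleton l' i ih =>
      rw [List.length_append, List.length_singleton, List.length_nil, zero_add] at hM
      rw [mon_append, lamR_mul_F, ih (M := M) (by simp; omega), ih (M := M - 1) (by simp; omega)]
      · have h0 : (φ ∘ₗ LinearMap.mulRight k (K χ (-α i))) (mon χ [] b l') = 0 := by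
          refine vanish_mul hφ _ (n := M) ?_ _ (mon_mem_Ult χ b (by simp; omega))
          intro b l l' h
          rw [LinearMap.mulRight_apply, mon_mul_K]
          exact Submodule.smul_mem _ _ (mon_mem_Ult χ _ h)
        rw [h0, zero_smul, zero_mul, zero_add]
        rfl
      · refine vanish_mul hφ _ ?_
        intro b l l' h
        rw [LinearMap.mulRight_apply, ← mon_append]
        exact mon_mem_Ult χ _ (by simp; omega)
      · refine vanish_mul hφ _ ?_
        intro b l l' h
        rw [LinearMap.mulRight_apply, mon_mul_K]
        exact Submodule.smul_mem _ _ (mon_mem_Ult χ _ h)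
  | cons i l ih =>
    rw [List.length_cons] at hM
    rw [mon_cons, lamR_E_mul, ih (by omega) φ hφ, ih (M := M - 1) (by omega),
      hφ _ (mon_mem_Ult χ b (by omega)), zero_smul, mul_zero, zero_add, mul_smul_comm, ← K_add,
      ← add_assoc, ← up_cnt_cons]
    · rfl
    · refine vanish_mul hφ _ ?_
      intro b l l' h
      rw [LinearMap.mulLeft_apply, ← mon_cons]
      exact mon_mem_Ult χ _ (by simp; omega)

theorem mem_Ult_of_vanish {M : ℕ} {z : U χ} (h : ∀ φ : U χ →ₗ[k] k, (∀ x ∈ Ult χ M, φ x = 0) → φ z = 0) :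
    z ∈ Ult χ M := by
  rw [← Subspace.forall_mem_dualAnnihilator_apply_eq_zero_iff]
  intro φ hφ
  exact h φ ((Submodule.mem_dualAnnihilator φ).1 hφ)

theorem vz_K_of_neg {b : ι → ℤ} (hb : hgt b < 0) : vz χ (K χ b) = 0 := by
  have := vz_KFE χ b 1 1
  rwa [map_one, map_one, mul_one, mul_one, if_neg hb.ne] at this

theorem vz_lamR_of_mem_Uwt {a : ι → ℤ} {M : ℕ} (ha : (M : ℤ) + hgt a < 0) {z : U χ}
    (hz : z ∈ Uwt χ a (M + 1)) (φ : U χ →ₗ[k] k) (hφ : ∀ x ∈ Ult χ M, φ x = 0) :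
    vz χ (lamR χ φ z) = 0 := by
  refine span_le_of_word (LinearMap.ker (vz χ ∘ₗ lamR χ φ)) ?_ hz
  rintro _ ⟨b, l, l', h, hb, rfl⟩
  rw [LinearMap.mem_ker, LinearMap.comp_apply, lamR_mon l b l' (M := M) (by omega) φ hφ, map_smul,
    vz_K_of_neg, smul_zero]
  have h1 := congrArg hgt hb
  rw [hgt_sub, hgt_up, size_cnt] at h1
  rw [hgt_add, hgt_up, size_cnt]
  omega

theorem counit_lamR (φ : U χ →ₗ[k] k) (z : U χ) : counit χ (lamR χ φ z) = φ z := by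
  refine EKF_induction (P := fun z => counit χ (lamR χ φ z) = φ z) (by simp) ?_ ?_ z
  · intro a u v
    conv_rhs => rw [← coeffL_counit_comul χ (nE χ u * K χ a * nF χ v)]
    rw [lamR_apply]
    induction comul χ (nE χ u * K χ a * nF χ v) with
    | zero => simp
    | tmul x y => simp [mul_comm]
    | add x y hx hy => simp only [map_add, hx, hy]
  · intro x y hx hy
    simp only [map_add, hx, hy]

end Filtration

/-! ### Injectivity of `ψ` -/

section Injectivity

variable (χ : SymBichar k ι) {τ : Equiv.Perm ι} (c : ι → k)

variable (τ) in
/-- The projection is injective on the words of length less than `m`. -/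
def InjOnFlt (m : ℕ) : Prop := ∀ x ∈ Flt χ τ c m, vz χ x = 0 → x = 0

variable {χ} {c}

theorem mul_mem_Twt {μ ν : ι → ℕ} {x y : T k ι} (hx : x ∈ Twt k μ) (hy : y ∈ Twt k ν) :
    x * y ∈ Twt k (μ + ν) := by
  refine span_le_of_word ((Twt k (μ + ν)).comap (LinearMap.mulRight k y)) ?_ hx
  rintro _ ⟨l, hl, rfl⟩
  refine span_le_of_word ((Twt k (μ + ν)).comap (LinearMap.mulLeft k (word k l))) ?_ hy
  rintro _ ⟨l', hl', rfl⟩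
  refine Submodule.subset_span ⟨l ++ l', fun i => ?_, ?_⟩
  · simp [hl, hl']
  · rw [LinearMap.mulLeft_apply, word_append]

theorem lamR_evB_of_mem (hτ : ∀ i, τ (τ i) = i) (hχτ : ∀ i j, χ.q (τ i) (τ j) = χ.q i j)
    {μ : ι → ℕ} {s : T k ι} (hs : s ∈ Twt k μ) (φ : U χ →ₗ[k] k) :
    lamR χ φ (evB χ τ c s) - φ (K χ (-up μ)) • evB χ τ c s ∈ Flt χ τ c (size μ) := by
  refine span_le_of_word ((Flt χ τ c (size μ)).comap
    (lamR χ φ ∘ₗ (evB χ τ c).toLinearMap - φ (K χ (-up μ)) • (evB χ τ c).toLinearMap)) ?_ hs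
  rintro _ ⟨l, hl, rfl⟩
  have hμ : cnt l = μ := funext hl
  have := lamR_evB (c := c) hτ hχτ l φ
  rwa [← size_cnt, hμ] at this

theorem evB_mem_Flt_of_projPi (hτ : ∀ i, τ (τ i) = i) (hχτ : ∀ i j, χ.q (τ i) (τ j) = χ.q i j)
    {μ : ι → ℕ} {s : T k ι} (hs : s ∈ Twt k μ) (hs' : s ∈ Imax χ)
    (h0 : projPi χ (0, 0) (projP χ (-up μ) (evB χ τ c s)) = 0) (hinj : InjOnFlt χ τ c (size μ)) :
    evB χ τ c s ∈ Flt χ τ c (size μ) := by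
  rw [projP_eq] at h0
  set z := projW χ (-up μ) (evB χ τ c s) with hz
  have h1 : z - evB χ τ c s ∈ Flt χ τ c (size μ) := by
    have := lamR_evB_of_mem (c := c) hτ hχτ hs (epsU χ (-up μ))
    rwa [epsU_K, if_pos rfl, one_smul] at this
  have hm : z ∈ Uwt χ (-up μ) (size μ) := projW_mem_Uwt χ _ (evB_mem_Ult χ c hτ hχτ hs hs')
  have descend : ∀ M, M + 1 < size μ → z ∈ Uwt χ (-up μ) (M + 2) → z ∈ Uwt χ (-up μ) (M + 1) := by
    intro M hM hzM
    have hzU : z ∈ Ult χ (M + 1) := by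
      refine mem_Ult_of_vanish fun φ hφ => ?_
      have hK : φ (K χ (-up μ)) = 0 := by
        have := hφ (mon χ [] (-up μ) []) (mon_mem_Ult χ _ (by simp))
        simpa [mon] using this
      have hF : lamR χ φ z ∈ Flt χ τ c (size μ) := by
        have h2 := lamR_evB_of_mem (c := c) hτ hχτ hs φ
        rw [hK, zero_smul, sub_zero] at h2
        have h3 := add_mem (lamR_mem_Flt hτ hχτ φ h1) h2
        rwa [map_sub, sub_add_cancel] at h3
      have hv : vz χ (lamR χ φ z) = 0 := by
        refine vz_lamR_of_mem_Uwt (M := M + 1) ?_ hzM φ hφ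
        rw [hgt_neg, hgt_up]
        push_cast
        omega
      rw [← counit_lamR, hinj _ hF hv, map_zero]
    have := projW_mem_Uwt χ (-up μ) hzU
    rwa [projW_of_mem_Uwt χ hzM] at this
  rcases Nat.eq_zero_or_pos (size μ) with h | hpos
  · rw [h] at hm h1 ⊢
    have hbot : z = 0 := by
      have : Uwt χ (-up μ) 0 ≤ ⊥ := Submodule.span_le.2 (by rintro _ ⟨b, l, l', h, _⟩; omega)
      exact this hm
    rw [hbot, zero_sub] at h1
    exact (Submodule.neg_mem_iff _).1 h1
  · obtain ⟨m, hm1⟩ : ∃ m, size μ = m + 1 := ⟨size μ - 1, by omega⟩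
    have key : ∀ j ≤ m, z ∈ Uwt χ (-up μ) (m - j + 1) := by
      intro j
      induction j with
      | zero => intro _; rw [Nat.sub_zero, ← hm1]; exact hm
      | succ j ih =>
        intro hj
        have := ih (by omega)
        rw [show m - j + 1 = (m - (j + 1)) + 2 by omega] at this
        exact descend _ (by omega) this
    have hH := Ult_one_le_H χ (Uwt_le_Ult χ (by simpa using key m le_rfl))
    rw [projPi_of_mem_H χ hH] at h0
    rw [h0, zero_sub] at h1
    exact (Submodule.neg_mem_iff _).1 h1

theorem evB_prT_mem_Flt (hτ : ∀ i, τ (τ i) = i) (hχτ : ∀ i j, χ.q (τ i) (τ j) = χ.q i j)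
    (hc : ParamCondition χ τ c) {r : T k ι} (hr : r ∈ Imax χ) (μ : ι → ℕ)
    (hinj : ∀ n ≤ size μ, InjOnFlt χ τ c n) : evB χ τ c (prT k μ r) ∈ Flt χ τ c (size μ) := by
  obtain ⟨S, hS, hspan⟩ := hc
  rw [← hspan, TwoSidedIdeal.mem_span_iff_mem_addSubgroup_closure] at hr
  induction hr using AddSubgroup.closure_induction with
  | mem x hx =>
    obtain ⟨_, ⟨x, -, s, hs, rfl⟩, y, -, rfl⟩ := hx
    obtain ⟨ν, hν, h0⟩ := hS s hs
    have hsI : s ∈ Imax χ := (hspan s).1 (TwoSidedIdeal.subset_span hs)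
    refine word_induction (P := fun x => evB χ τ c (prT k μ (x * s * y)) ∈ Flt χ τ c (size μ))
      ?_ ?_ ?_ x
    · intro l
      refine word_induction (P := fun y => evB χ τ c (prT k μ (word k l * s * y)) ∈
        Flt χ τ c (size μ)) ?_ ?_ ?_ y
      · intro l'
        rw [prT_of_mem (mul_mem_Twt (mul_mem_Twt (word_mem_Twt l) hν) (word_mem_Twt l'))]
        split_ifs with h
        · have hsz := congrArg size h
          rw [size_add, size_add, size_cnt, size_cnt] at hsz
          have h1 := evB_mem_Flt_of_projPi hτ hχτ hν hsI h0 (hinj _ (by omega))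
          rw [map_mul, map_mul]
          have h2 := mul_evB_mem_Flt l' (evB_mul_mem_Flt hτ hχτ l h1)
          rwa [add_comm (size ν), hsz] at h2
        · rw [map_zero]; exact zero_mem _
      · intro u v hu hv
        rw [mul_add, map_add, map_add]
        exact add_mem hu hv
      · intro a u hu
        rw [mul_smul_comm, map_smul, map_smul]
        exact Submodule.smul_mem _ _ hu
    · intro u v hu hv
      rw [add_mul, add_mul, map_add, map_add]
      exact add_mem hu hv
    · intro a u hu
      rw [smul_mul_assoc, smul_mul_assoc, map_smul, map_smul]
      exact Submodule.smul_mem _ _ hu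
  | zero => rw [map_zero, map_zero]; exact zero_mem _
  | add x y _ _ hx hy => rw [map_add, map_add]; exact add_mem hx hy
  | neg x _ hx => rw [map_neg, map_neg]; exact neg_mem hx

theorem prT_of_Tlt {m : ℕ} {r : T k ι} (hr : r ∈ Tlt k ι m) {μ : ι → ℕ} (hμ : m ≤ size μ) :
    prT k μ r = 0 := by
  refine span_le_of_word (LinearMap.ker (prT k μ)) ?_ hr
  rintro _ ⟨l, hl, rfl⟩
  rw [LinearMap.mem_ker, prT_word, if_neg]
  rintro rfl
  rw [size_cnt] at hμ
  omega

theorem evB_mem_Flt_of_Imax (hτ : ∀ i, τ (τ i) = i) (hχτ : ∀ i j, χ.q (τ i) (τ j) = χ.q i j)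
    (hc : ParamCondition χ τ c) {m : ℕ} (hinj : ∀ n ≤ m, InjOnFlt χ τ c n) {r : T k ι}
    (hr : r ∈ Imax χ) (hr' : r ∈ Tlt k ι (m + 1)) : evB χ τ c r ∈ Flt χ τ c m := by
  obtain ⟨s, hs, -⟩ := sum_prT r
  rw [hs, map_sum]
  refine Submodule.sum_mem _ fun μ _ => ?_
  by_cases hμ : m + 1 ≤ size μ
  · rw [prT_of_Tlt hr' hμ, map_zero]
    exact zero_mem _
  · exact Flt_mono χ c (by omega)
      (evB_prT_mem_Flt hτ hχτ hc hr μ fun n hn => hinj n (by omega))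

theorem vz_K_evB (hτ : ∀ i, τ (τ i) = i) {a : ι → ℤ} (ha : a ∈ Qθ τ) (l : List ι) :
    vz χ (K χ a * evB χ τ c (word k l)) - Finsupp.single a (wN χ l) ∈ Vlt χ l.length := by
  have h := kOp_mem_Vlt a (vz_evB χ c hτ l)
  rwa [map_sub, kOp_single, add_zero, ← vz_K_mul χ (hgt_of_mem_Qθ ha)] at h

theorem exists_lift_Flt (hτ : ∀ i, τ (τ i) = i) {m : ℕ} {x : U χ} (hx : x ∈ Flt χ τ c (m + 1)) :
    ∃ P : (ι → ℤ) →₀ T k ι, (∀ a, P a ∈ Tlt k ι (m + 1)) ∧ (∀ a ∈ P.support, a ∈ Qθ τ) ∧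
      (P.sum fun a p => K χ a * evB χ τ c p) = x ∧
      vz χ x - P.mapRange (mkN χ) (map_zero _) ∈ Vlt χ m := by
  refine Submodule.span_induction (p := fun x _ => ∃ P : (ι → ℤ) →₀ T k ι,
      (∀ a, P a ∈ Tlt k ι (m + 1)) ∧ (∀ a ∈ P.support, a ∈ Qθ τ) ∧
      (P.sum fun a p => K χ a * evB χ τ c p) = x ∧
      vz χ x - P.mapRange (mkN χ) (map_zero _) ∈ Vlt χ m) ?_ ?_ ?_ ?_ hx
  · rintro _ ⟨a, ha, l, hl, rfl⟩
    refine ⟨Finsupp.single a (word k l), fun b => ?_, fun b hb => ?_, ?_, ?_⟩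
    · rw [Finsupp.single_apply]
      split_ifs
      · exact word_mem_Tlt hl
      · exact zero_mem _
    · rw [Finset.mem_singleton.1 (Finsupp.support_single_subset hb)]
      exact ha
    · rw [Finsupp.sum_single_index (by simp)]
    · rw [Finsupp.mapRange_single]
      exact Vlt_mono χ (by omega) (vz_K_evB hτ ha l)
  · exact ⟨0, fun a => zero_mem _, by simp, by simp, by simp⟩
  · rintro x y - - ⟨P, h1, h2, h3, h4⟩ ⟨Q, g1, g2, g3, g4⟩
    refine ⟨P + Q, fun a => add_mem (h1 a) (g1 a), fun a ha => ?_, ?_, ?_⟩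
    · rcases Finset.mem_union.1 (Finsupp.support_add ha) with h | h
      · exact h2 a h
      · exact g2 a h
    · rw [Finsupp.sum_add_index' (by simp) (by simp [mul_add]), h3, g3]
    · rw [Finsupp.mapRange_add (by simp), map_add, add_sub_add_comm]
      exact add_mem h4 g4
  · rintro r x - ⟨P, h1, h2, h3, h4⟩
    refine ⟨r • P, fun a => Submodule.smul_mem _ _ (h1 a), fun a ha => h2 a
      (Finsupp.support_smul ha), ?_, ?_⟩
    · rw [Finsupp.sum_smul_index' (by simp), ← h3, Finsupp.smul_sum]
      simp
    · have : (r • P).mapRange (mkN χ) (map_zero _) = r • P.mapRange (mkN χ) (map_zero _) := by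
        ext a; simp
      rw [this, map_smul, ← smul_sub]
      exact Submodule.smul_mem _ _ h4

theorem injOnFlt (hτ : ∀ i, τ (τ i) = i) (hχτ : ∀ i j, χ.q (τ i) (τ j) = χ.q i j)
    (hc : ParamCondition χ τ c) (m : ℕ) : InjOnFlt χ τ c m := by
  induction m using Nat.strong_induction_on with
  | _ m ih =>
    intro x hx hv
    cases m with
    | zero =>
      have : Flt χ τ c 0 ≤ ⊥ := Submodule.span_le.2 (by rintro _ ⟨a, _, l, h, _⟩; omega)
      exact this hx
    | succ m =>
      obtain ⟨P, h1, h2, h3, h4⟩ := exists_lift_Flt hτ hx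
      refine ih m (Nat.lt_succ_self m) x ?_ hv
      rw [← h3]
      refine Submodule.sum_mem _ fun a ha => K_mul_mem_Flt (h2 a ha) ?_
      rw [hv, zero_sub, Submodule.neg_mem_iff] at h4
      have h5 := apply_mem_Nlt h4 a
      rw [Finsupp.mapRange_apply] at h5
      obtain ⟨t, ht, h6⟩ := exists_Tlt_of_Nlt h5
      have h7 : P a - t ∈ Imax χ := by
        rw [← mkN_eq_zero, map_sub, h6, sub_self]
      have h8 : P a - t ∈ Tlt k ι (m + 1) :=
        sub_mem (h1 a) (span_le_of_word _ (by rintro _ ⟨l, hl, rfl⟩; exact word_mem_Tlt (by omega)) ht)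
      have h9 := evB_mem_Flt_of_Imax hτ hχτ hc (fun n hn => ih n (by omega)) h7 h8
      have h10 : evB χ τ c t ∈ Flt χ τ c m := by
        refine span_le_of_word ((Flt χ τ c m).comap (evB χ τ c).toLinearMap) ?_ ht
        rintro _ ⟨l, hl, rfl⟩
        exact evB_mem_Flt χ c hl
      have h11 := add_mem h9 h10
      rwa [map_sub, sub_add_cancel] at h11

theorem vz_injective_Bc (hτ : ∀ i, τ (τ i) = i) (hχτ : ∀ i j, χ.q (τ i) (τ j) = χ.q i j)
    (hc : ParamCondition χ τ c) {x : U χ} (hx : x ∈ Bc χ τ c) (h : vz χ x = 0) : x = 0 := by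
  obtain ⟨m, hm⟩ := exists_mem_Flt hτ hχτ hx
  exact injOnFlt hτ hχτ hc m x hm h

theorem vz_psiB (hτ : ∀ i, τ (τ i) = i) (h : IsCompl (psiRange χ τ) (psiKer χ τ))
    (x : Bc χ τ c) : vz χ ((psiB χ τ hτ c h x : Upoly χ τ) : U χ) = vz χ x := by
  have h1 := vz_projection χ h (Subalgebra.inclusion (Bc_le_Upoly χ τ hτ c) x)
  rw [Subalgebra.coe_inclusion] at h1
  rw [← h1, psiB, LinearMap.comp_apply, AlgHom.toLinearMap_apply]

theorem psiB_bijective (hτ : ∀ i, τ (τ i) = i) (hχτ : ∀ i j, χ.q (τ i) (τ j) = χ.q i j)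
    (hc : ParamCondition χ τ c) (h : IsCompl (psiRange χ τ) (psiKer χ τ)) :
    Function.Bijective (psiB χ τ hτ c h) := by
  refine ⟨(injective_iff_map_eq_zero _).2 fun x hx => Subtype.ext ?_, ?_⟩
  · refine vz_injective_Bc hτ hχτ hc x.2 ?_
    rw [← vz_psiB hτ h x, hx]
    simp
  · rintro ⟨⟨y, hy⟩, hy'⟩
    have hy'' : y ∈ partialBos χ τ := hy'
    obtain ⟨x, hx, hxy⟩ : ∃ x ∈ Bc χ τ c, vz χ x = vz χ y := by
      refine partialBos_induction χ (P := fun y => ∃ x ∈ Bc χ τ c, vz χ x = vz χ y)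
        ⟨0, zero_mem _, by simp⟩ ?_ ?_ hy''
      · intro a ha u
        obtain ⟨m, hm⟩ := exists_mem_Nlt χ u
        obtain ⟨x, hx, hxu⟩ := exists_Bc_vz χ c hτ m u hm
        refine ⟨K χ a * x, mul_mem (K_mem_Bc χ c hτ ha) hx, ?_⟩
        rw [vz_K_mul χ (hgt_of_mem_Qθ ha), hxu, kOp_single, add_zero, vz_K_nF χ ha]
      · rintro x y ⟨x', hx, hx'⟩ ⟨y', hy, hy'⟩
        exact ⟨x' + y', add_mem hx hy, by rw [map_add, map_add, hx', hy']⟩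
    refine ⟨⟨x, hx⟩, Subtype.ext (Subtype.ext (sub_eq_zero.1 ?_))⟩
    refine vz_injective_partialBos χ (τ := τ) (sub_mem (psiB χ τ hτ c h ⟨x, hx⟩).2 hy') ?_
    rw [map_sub, vz_psiB hτ h ⟨x, hx⟩, hxy]
    exact sub_self _

theorem psiInv_mem (hτ : ∀ i, τ (τ i) = i) (h : IsCompl (psiRange χ τ) (psiKer χ τ))
    (hb : Function.Bijective (psiB χ τ hτ c h)) (μ : ι → ℕ) (f : UminusWt χ μ) :
    psiInv χ τ hτ c h hb μ f ∈ Bc χ τ c := Subtype.property _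

theorem vz_psiInv (hτ : ∀ i, τ (τ i) = i) (h : IsCompl (psiRange χ τ) (psiKer χ τ))
    (hb : Function.Bijective (psiB χ τ hτ c h)) (μ : ι → ℕ) (f : UminusWt χ μ) :
    vz χ (psiInv χ τ hτ c h hb μ f) = vz χ (f : U χ) := by
  rw [psiInv, ← vz_psiB hτ h]
  have := (LinearEquiv.ofBijective (psiB χ τ hτ c h) hb).apply_symm_apply
    ⟨⟨(f : U χ), partialBos_le_Upoly χ τ (Uminus_le_partialBos χ τ (UminusWt_le χ f.2))⟩,
      Uminus_le_partialBos χ τ (UminusWt_le χ f.2)⟩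
  rw [LinearEquiv.ofBijective_apply] at this
  rw [this]

end Injectivity

/-! ### Formal sums -/

section Formal

variable {V W A B : Type*} [AddCommGroup V] [Module k V] [AddCommGroup W] [Module k W]
  [Ring A] [Algebra k A] [Ring B] [Algebra k B]

/-- A linear map applied to the coefficients of a series. -/
def hm (f : V →ₗ[k] W) (x : HahnSeries (ι → ℤ) V) : HahnSeries (ι → ℤ) W := x.map f

@[simp] theorem hm_coeff (f : V →ₗ[k] W) (x : HahnSeries (ι → ℤ) V) (ν : ι → ℤ) :
    (hm f x).coeff ν = f (x.coeff ν) := rfl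

theorem hm_support (f : V →ₗ[k] W) (x : HahnSeries (ι → ℤ) V) : (hm f x).support ⊆ x.support :=
  fun ν hν h => hν (by rw [hm_coeff, h, map_zero])

theorem hm_add (f : V →ₗ[k] W) (x y : HahnSeries (ι → ℤ) V) : hm f (x + y) = hm f x + hm f y := by
  ext ν; simp

theorem hm_sub (f : V →ₗ[k] W) (x y : HahnSeries (ι → ℤ) V) : hm f (x - y) = hm f x - hm f y := by
  ext ν; simp

theorem hm_neg (f : V →ₗ[k] W) (x : HahnSeries (ι → ℤ) V) : hm f (-x) = - hm f x := by
  ext ν; simp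

@[simp] theorem hm_single (f : V →ₗ[k] W) (a : ι → ℤ) (v : V) :
    hm f (HahnSeries.single a v) = HahnSeries.single a (f v) := by
  ext ν
  rw [hm_coeff, HahnSeries.coeff_single, HahnSeries.coeff_single]
  split_ifs <;> simp

theorem hm_mul (f : A →ₐ[k] B) (x y : HahnSeries (ι → ℤ) A) :
    hm f.toLinearMap (x * y) = hm f.toLinearMap x * hm f.toLinearMap y :=
  HahnSeries.map_mul (f : A →ₙ+* B)

theorem coeff_mul_of_subset {x y : HahnSeries (ι → ℤ) A} {s t : Set (ι → ℤ)} (hs : s.IsPWO)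
    (ht : t.IsPWO) (hx : x.support ⊆ s) (hy : y.support ⊆ t) (ν : ι → ℤ) :
    (x * y).coeff ν = ∑ p ∈ Finset.antidiagonal hs ht ν, x.coeff p.1 * y.coeff p.2 := by
  rw [HahnSeries.coeff_mul]
  refine Finset.sum_subset (fun p hp => ?_) fun p _ hp => ?_
  · simp only [Finset.mem_antidiagonal] at hp ⊢
    exact ⟨hx hp.1, hy hp.2.1, hp.2.2⟩
  · by_contra h
    refine hp ?_
    simp only [Finset.mem_antidiagonal] at *
    exact ⟨left_ne_zero_of_mul h, right_ne_zero_of_mul h, by tauto⟩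

theorem hm_leibniz_right (D : A →ₗ[k] A) (s : A →ₐ[k] A)
    (h : ∀ x y, D (x * y) = x * D y + D x * s y) (x y : HahnSeries (ι → ℤ) A) :
    hm D (x * y) = x * hm D y + hm D x * hm s.toLinearMap y := by
  ext ν
  rw [HahnSeries.coeff_add, hm_coeff,
    coeff_mul_of_subset x.isPWO_support y.isPWO_support subset_rfl subset_rfl,
    coeff_mul_of_subset x.isPWO_support y.isPWO_support subset_rfl (hm_support D y),
    coeff_mul_of_subset x.isPWO_support y.isPWO_support (hm_support D x) (hm_support _ y),
    map_sum, ← Finset.sum_add_distrib]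
  exact Finset.sum_congr rfl fun p _ => h _ _

theorem hm_leibniz_left (D : A →ₗ[k] A) (s : A →ₐ[k] A)
    (h : ∀ x y, D (x * y) = D x * y + s x * D y) (x y : HahnSeries (ι → ℤ) A) :
    hm D (x * y) = hm D x * y + hm s.toLinearMap x * hm D y := by
  ext ν
  rw [HahnSeries.coeff_add, hm_coeff,
    coeff_mul_of_subset x.isPWO_support y.isPWO_support subset_rfl subset_rfl,
    coeff_mul_of_subset x.isPWO_support y.isPWO_support (hm_support D x) subset_rfl,
    coeff_mul_of_subset x.isPWO_support y.isPWO_support (hm_support _ x) (hm_support D y),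
    map_sum, ← Finset.sum_add_distrib]
  exact Finset.sum_congr rfl fun p _ => h _ _

/-- All exponents of the series are positive. -/
def PosSupp (x : HahnSeries (ι → ℤ) A) : Prop := ∀ ν, x.coeff ν ≠ 0 → 0 < ν

theorem PosSupp.add {x y : HahnSeries (ι → ℤ) A} (hx : PosSupp x) (hy : PosSupp y) :
    PosSupp (x + y) := fun ν h => by
  by_contra hν
  refine h ?_
  rw [HahnSeries.coeff_add, not_not.1 (mt (hx ν) hν), not_not.1 (mt (hy ν) hν), add_zero]

theorem PosSupp.single {a : ι → ℤ} (ha : 0 < a) (r : A) :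
    PosSupp (HahnSeries.single a r) := fun ν h => by
  by_contra hν
  refine h (HahnSeries.coeff_single_of_ne ?_)
  rintro rfl
  exact hν ha

theorem PosSupp.coeff_mul_right {x y : HahnSeries (ι → ℤ) A} (hy : PosSupp y) {ν : ι → ℤ}
    (h : ∀ ν' < ν, x.coeff ν' = 0) : (x * y).coeff ν = 0 := by
  rw [HahnSeries.coeff_mul]
  refine Finset.sum_eq_zero fun p hp => ?_
  by_contra hne
  simp only [Finset.mem_antidiagonal] at hp
  have h2 := hy _ (right_ne_zero_of_mul hne)
  refine left_ne_zero_of_mul hne (h _ ?_)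
  rw [← hp.2.2]
  exact lt_add_of_pos_right _ h2

theorem PosSupp.coeff_mul_left {x y : HahnSeries (ι → ℤ) A} (hy : PosSupp y) {ν : ι → ℤ}
    (h : ∀ ν' < ν, x.coeff ν' = 0) : (y * x).coeff ν = 0 := by
  rw [HahnSeries.coeff_mul]
  refine Finset.sum_eq_zero fun p hp => ?_
  by_contra hne
  simp only [Finset.mem_antidiagonal] at hp
  have h2 := hy _ (left_ne_zero_of_mul hne)
  refine right_ne_zero_of_mul hne (h _ ?_)
  rw [← hp.2.2]
  exact lt_add_of_pos_left _ h2

/-- A series vanishes if all its leading coefficients vanish. -/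
theorem eq_zero_of_leading (x : HahnSeries (ι → ℤ) V)
    (h : ∀ ν, (∀ ν' < ν, x.coeff ν' = 0) → x.coeff ν = 0) : x = 0 := by
  by_contra hx
  have hne : x.support.Nonempty := by
    rw [HahnSeries.support_nonempty_iff]; exact hx
  have hwf := x.isWF_support
  refine hwf.min_mem hne (h _ fun ν' hν' => ?_)
  by_contra h0
  exact hwf.not_lt_min hne h0 hν'

/-- Uniqueness for linear differential equations `D_i X = - X G_i`. -/
theorem ode_right (D : ι → A →ₗ[k] A) (ε : A →ₗ[k] W)
    (hD : ∀ r, (∀ i, D i r = 0) → ε r = 0 → r = 0) (G : ι → HahnSeries (ι → ℤ) A)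
    (hG : ∀ i, PosSupp (G i)) {x y : HahnSeries (ι → ℤ) A}
    (hx : ∀ i, hm (D i) x = -(x * G i)) (hy : ∀ i, hm (D i) y = -(y * G i))
    (h0 : hm ε x = hm ε y) : x = y := by
  rw [← sub_eq_zero]
  refine eq_zero_of_leading _ fun ν hν => hD _ (fun i => ?_) ?_
  · rw [← hm_coeff, hm_sub, hx, hy, neg_sub_neg, ← neg_sub, ← sub_mul, HahnSeries.coeff_neg,
      (hG i).coeff_mul_right hν, neg_zero]
  · rw [← hm_coeff, hm_sub, h0, sub_self, HahnSeries.coeff_zero]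

/-- Uniqueness for linear differential equations `D_i X = - G_i X`. -/
theorem ode_left (D : ι → A →ₗ[k] A) (ε : A →ₗ[k] W)
    (hD : ∀ r, (∀ i, D i r = 0) → ε r = 0 → r = 0) (G : ι → HahnSeries (ι → ℤ) A)
    (hG : ∀ i, PosSupp (G i)) {x y : HahnSeries (ι → ℤ) A}
    (hx : ∀ i, hm (D i) x = -(G i * x)) (hy : ∀ i, hm (D i) y = -(G i * y))
    (h0 : hm ε x = hm ε y) : x = y := by
  rw [← sub_eq_zero]
  refine eq_zero_of_leading _ fun ν hν => hD _ (fun i => ?_) ?_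
  · rw [← hm_coeff, hm_sub, hx, hy, neg_sub_neg, ← neg_sub, ← mul_sub, HahnSeries.coeff_neg,
      (hG i).coeff_mul_left hν, neg_zero]
  · rw [← hm_coeff, hm_sub, h0, sub_self, HahnSeries.coeff_zero]

/-- A degree map which does not decrease the total degree. -/
def Growing (d : (ι → ℕ) → (ι → ℕ)) : Prop := ∀ ρ, size ρ ≤ size (d ρ)

theorem Growing.finite {d : (ι → ℕ) → (ι → ℕ)} (hd : Growing d) (ν : ι → ℤ) :
    {ρ | up (d ρ) = ν}.Finite := by
  refine (Set.finite_Iic (fun _ : ι => (hgt ν).toNat)).subset fun ρ hρ i => ?_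
  have h1 : up (d ρ) = ν := hρ
  have h2 := hd ρ
  have h3 : ρ i ≤ size ρ := Finset.single_le_sum (f := ρ) (fun _ _ => Nat.zero_le _)
    (Finset.mem_univ i)
  have h4 : (size (d ρ) : ℤ) = hgt ν := by rw [← hgt_up, h1]
  show ρ i ≤ (hgt ν).toNat
  omega

theorem Growing.add {d : (ι → ℕ) → (ι → ℕ)} (hd : Growing d) (a : ι → ℕ) :
    Growing fun ρ => a + d ρ := fun ρ => by
  have := hd ρ
  rw [size_add]
  omega

theorem growing_id : Growing (id : (ι → ℕ) → (ι → ℕ)) := fun _ => le_rfl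

theorem formalSum_coeff (d : (ι → ℕ) → (ι → ℕ)) (X : (ι → ℕ) → A) (ν : ι → ℤ) :
    (formalSum d X).coeff ν = ∑ᶠ ρ ∈ {ρ | up (d ρ) = ν}, X ρ := rfl

theorem hm_formalSum {d : (ι → ℕ) → (ι → ℕ)} (hd : Growing d) (f : A →ₗ[k] B) (X : (ι → ℕ) → A) :
    hm f (formalSum d X) = formalSum d fun ρ => f (X ρ) := by
  ext ν
  rw [hm_coeff, formalSum_coeff, formalSum_coeff]
  exact AddMonoidHom.map_finsum_mem X f.toAddMonoidHom (hd.finite ν)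

theorem formalSum_add {d : (ι → ℕ) → (ι → ℕ)} (hd : Growing d) (X Y : (ι → ℕ) → A) :
    formalSum d (fun ρ => X ρ + Y ρ) = formalSum d X + formalSum d Y := by
  ext ν
  rw [HahnSeries.coeff_add, formalSum_coeff, formalSum_coeff, formalSum_coeff,
    finsum_mem_add_distrib (hd.finite ν)]

theorem formalSum_neg (d : (ι → ℕ) → (ι → ℕ)) (hd : Growing d) (X : (ι → ℕ) → A) :
    formalSum d (fun ρ => - X ρ) = - formalSum d X := by
  rw [eq_neg_iff_add_eq_zero, ← formalSum_add hd]
  ext ν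
  simp [formalSum_coeff]

theorem formalSum_mul_single {d : (ι → ℕ) → (ι → ℕ)} (hd : Growing d) (X : (ι → ℕ) → A)
    (a : ι → ℕ) (r : A) : formalSum d X * HahnSeries.single (up a) r =
      formalSum (fun ρ => a + d ρ) fun ρ => X ρ * r := by
  ext ν
  rw [HahnSeries.coeff_mul_single, formalSum_coeff, formalSum_coeff]
  refine (AddMonoidHom.map_finsum_mem X (AddMonoidHom.mulRight r) (hd.finite _)).trans ?_
  refine finsum_mem_congr ?_ fun ρ _ => rfl
  ext ρ
  simp only [Set.mem_ofPred_eq, up_add, eq_sub_iff_add_eq']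

theorem single_mul_formalSum {d : (ι → ℕ) → (ι → ℕ)} (hd : Growing d) (X : (ι → ℕ) → A)
    (a : ι → ℕ) (r : A) : HahnSeries.single (up a) r * formalSum d X =
      formalSum (fun ρ => a + d ρ) fun ρ => r * X ρ := by
  ext ν
  rw [HahnSeries.coeff_single_mul, formalSum_coeff, formalSum_coeff]
  refine (AddMonoidHom.map_finsum_mem X (AddMonoidHom.mulLeft r) (hd.finite _)).trans ?_
  refine finsum_mem_congr ?_ fun ρ _ => rfl
  ext ρ
  simp only [Set.mem_ofPred_eq, up_add, eq_sub_iff_add_eq']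

theorem formalSum_shift (d : (ι → ℕ) → (ι → ℕ)) (X : (ι → ℕ) → A) (i : ι)
    (h : ∀ ρ, ρ i = 0 → X ρ = 0) : formalSum d X =
      formalSum (fun ρ => d (Pi.single i 1 + ρ)) fun ρ => X (Pi.single i 1 + ρ) := by
  ext ν
  rw [formalSum_coeff, formalSum_coeff]
  have hinj : Function.Injective fun ρ : ι → ℕ => Pi.single i 1 + ρ := add_right_injective _
  refine Eq.trans ?_ (finsum_mem_image (s := {ρ : ι → ℕ | up (d (Pi.single i 1 + ρ)) = ν})
    (f := X) hinj.injOn)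
  refine finsum_mem_inter_support_eq' _ _ _ fun ρ hρ => ?_
  have hi : ρ i ≠ 0 := fun h0 => hρ (h ρ h0)
  constructor
  · intro hν
    have h1 : Pi.single i 1 + (ρ - Pi.single i 1) = ρ := by
      ext j
      by_cases hj : j = i
      · subst hj; simp; omega
      · simp [hj]
    exact ⟨ρ - Pi.single i 1, by rw [Set.mem_ofPred_eq, h1]; exact hν, h1⟩
  · rintro ⟨σ, hσ, rfl⟩
    exact hσ

theorem formalSum_eq_single (d : (ι → ℕ) → (ι → ℕ)) (X : (ι → ℕ) → A)
    (h : ∀ ρ, ρ ≠ 0 → X ρ = 0) : formalSum d X = HahnSeries.single (up (d 0)) (X 0) := by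
  ext ν
  rw [formalSum_coeff, HahnSeries.coeff_single]
  have h1 : ∀ ρ : ι → ℕ, X ρ = if ρ = 0 then X 0 else 0 := by
    intro ρ
    split_ifs with h0
    · rw [h0]
    · exact h ρ h0
  split_ifs with hν
  · rw [finsum_mem_inter_support_eq X _ {0} ?_, finsum_mem_singleton]
    ext ρ
    simp only [Set.mem_inter_iff, Set.mem_ofPred_eq, Set.mem_singleton_iff, Function.mem_support]
    constructor
    · rintro ⟨-, h2⟩
      exact ⟨by by_contra h0; exact h2 (h ρ h0), h2⟩
    · rintro ⟨rfl, h2⟩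
      exact ⟨hν.symm, h2⟩
  · refine finsum_mem_eq_zero_of_forall_eq_zero fun ρ hρ => h ρ ?_
    rintro rfl
    exact hν (Eq.symm hρ)

end Formal

theorem Nic_strong_induction {χ : SymBichar k ι} {P : Nic χ → Prop} (one : P 1)
    (mul : ∀ i f, P f → (∀ j, P (dL χ j f)) → P (nx χ i * f))
    (add : ∀ f g, P f → P g → P (f + g)) (smul : ∀ (r : k) f, P f → P (r • f)) (f : Nic χ) :
    P f := by
  let M : Submodule k (Nic χ) :=
    { carrier := {f | P f}
      add_mem' := fun hf hg => add _ _ hf hg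
      zero_mem' := by simpa using smul 0 1 one
      smul_mem' := fun r f hf => smul r f hf }
  have key : ∀ m, ∀ g ∈ Nlt χ m, g ∈ M := by
    intro m
    induction m with
    | zero =>
      intro g hg
      refine span_le_of_word M ?_ hg
      rintro _ ⟨l, hl, rfl⟩
      omega
    | succ m ih =>
      intro g hg
      refine span_le_of_word M ?_ hg
      rintro _ ⟨l, hl, rfl⟩
      cases l with
      | nil => exact one
      | cons i l =>
        rw [List.length_cons] at hl
        have hl' : l.length < m := by omega
        rw [wN_cons]
        exact mul i _ (ih _ (wN_mem_Nlt χ hl'))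
          fun j => ih _ (Nlt_mono χ hl'.le (dL_wN_mem_Nlt χ j l))
  obtain ⟨m, hm⟩ := exists_mem_Nlt χ f
  exact key m f hm

/-- Linear maps from the Nichols algebra to `U(χ)` which are compatible with the generators
`B_i` in the same way as the inverse of `ψ`. -/
structure PsiLift (χ : SymBichar k ι) (τ : Equiv.Perm ι) (c : ι → k) (b : Nic χ →ₗ[k] U χ) :
    Prop where
  one : b 1 = 1
  B_mul : ∀ i f, Bgen χ τ c i * b f = b (nx χ i * f) +
    (c i * χ.q i (τ i)) • (K χ (-α i + α (τ i)) * b (dL χ (τ i) f))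

namespace PsiLift

variable {χ : SymBichar k ι} {τ : Equiv.Perm ι} {c : ι → k} {b : Nic χ →ₗ[k] U χ}

theorem x_mul (hb : PsiLift χ τ c b) (i : ι) (f : Nic χ) : b (nx χ i * f) =
    Bgen χ τ c i * b f - (c i * χ.q i (τ i)) • (K χ (-α i + α (τ i)) * b (dL χ (τ i) f)) := by
  rw [hb.B_mul, add_sub_cancel_right]

theorem mul_K (hb : PsiLift χ τ c b) (hχτ : ∀ i j, χ.q (τ i) (τ j) = χ.q i j) {a : ι → ℤ}
    (ha : a ∘ τ = -a) (f : Nic χ) : b f * K χ a = K χ a * b (S χ a f) := by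
  refine Nic_strong_induction (P := fun f => b f * K χ a = K χ a * b (S χ a f)) ?_ ?_ ?_ ?_ f
  · rw [map_one (S χ a), hb.one, one_mul, mul_one]
  · intro i f hf hdf
    have h1 : Bgen χ τ c i * K χ a = χ.val a (α i) • (K χ a * Bgen χ τ c i) := by
      rw [K_mul_B χ c hχτ ha, smul_smul, mul_inv_cancel₀ (val_ne_zero _ _ _), one_smul]
    rw [hb.x_mul, map_mul (S χ a), S_x, smul_mul_assoc, map_smul, hb.x_mul, sub_mul, mul_assoc, hf,
      smul_mul_assoc, mul_assoc, hdf, ← mul_assoc, h1, dL_S, val_Qθ χ hχτ ha, map_smul,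
      ← mul_assoc (K χ (-α i + α (τ i))), K_comm χ _ a]
    simp only [smul_mul_assoc, mul_smul_comm, smul_sub, mul_sub, smul_smul, mul_assoc]
    have := val_ne_zero χ a (α i)
    congr 2
    field_simp
  · intro f g hf hg
    simp only [map_add, add_mul, mul_add, hf, hg]
  · intro r f hf
    simp only [map_smul, smul_mul_assoc, mul_smul_comm, hf]

theorem mul_B (hb : PsiLift χ τ c b) (hτ : ∀ i, τ (τ i) = i)
    (hχτ : ∀ i j, χ.q (τ i) (τ j) = χ.q i j) (i : ι) (f : Nic χ) :
    b f * Bgen χ τ c i = b (f * nx χ i) +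
      (c (τ i) * χ.q i (τ i)) • (b (dR χ (τ i) f) * K χ (α i - α (τ i))) := by
  refine Nic_strong_induction (P := fun f => b f * Bgen χ τ c i = b (f * nx χ i) +
      (c (τ i) * χ.q i (τ i)) • (b (dR χ (τ i) f) * K χ (α i - α (τ i)))) ?_ ?_ ?_ ?_ f
  · have h := hb.B_mul i 1
    rw [hb.one, mul_one, dL_one, map_zero, mul_zero, smul_zero, add_zero, mul_one] at h
    rw [hb.one, one_mul, one_mul, dR_one, map_zero, zero_mul, smul_zero, add_zero, h]
  · intro j f hf hdf
    have e1 : dR χ (τ i) (nx χ j * f) = nx χ j * dR χ (τ i) f +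
        if τ i = j then S χ (α j) f else 0 := by
      rw [dR_mul, dR_x]
      split_ifs with h
      · rw [one_mul, h]
      · rw [zero_mul]
    have e2 : dL χ (τ j) (f * nx χ i) = dL χ (τ j) f * nx χ i +
        if τ i = j then S χ (α (τ j)) f else 0 := by
      rw [dL_mul, dL_x]
      by_cases h : τ i = j
      · rw [if_pos h, if_pos (by rw [← h, hτ]), mul_one]
      · rw [if_neg h, if_neg (fun h' => h (by rw [← h', hτ])), mul_zero]
    have e3 : (c j * χ.q j (τ j)) • (K χ (-α j + α (τ j)) *
          b (if τ i = j then S χ (α (τ j)) f else 0)) =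
        (c (τ i) * χ.q i (τ i)) • (b (if τ i = j then S χ (α j) f else 0) *
          K χ (α i - α (τ i))) := by
      split_ifs with h
      · subst h
        rw [hb.mul_K hχτ (by
          funext l
          have h1 := congrFun (α_comp (τ := τ) i) l
          have h2 := congrFun (α_comp (τ := τ) (τ i)) l
          simp only [Function.comp_apply, hτ, Pi.sub_apply, Pi.neg_apply] at h1 h2 ⊢
          rw [h1, h2]; ring), ← S_add, hτ, sub_add_cancel, SymBichar.q, SymBichar.q, val_symm,
          neg_add_eq_sub]
      · simp
    have e4 := hb.x_mul j (dR χ (τ i) f)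
    rw [dL_dR] at e4
    rw [e1, map_add, e4, hb.x_mul, sub_mul, mul_assoc, hf, smul_mul_assoc, mul_assoc, hdf]
    rw [mul_add, hb.B_mul, ← mul_assoc (nx χ j), e2, map_add]
    simp only [mul_add, add_mul, sub_mul, smul_add, smul_sub, mul_smul_comm, smul_mul_assoc, e3,
      mul_assoc]
    rw [smul_comm (c j * χ.q j (τ j)) (c (τ i) * χ.q i (τ i))]
    abel
  · intro f g hf hg
    simp only [map_add, add_mul, mul_add, hf, hg, smul_add]
    abel
  · intro r f hf
    simp only [map_smul, smul_mul_assoc, hf, smul_add]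
    rw [smul_comm r]

theorem nF (χ : SymBichar k ι) (τ : Equiv.Perm ι) : PsiLift χ τ 0 (nF χ).toLinearMap := by
  refine ⟨map_one (SymPair.nF χ), fun i f => ?_⟩
  simp [Bgen]

end PsiLift

section

variable {χ : SymBichar k ι} {τ : Equiv.Perm ι} {c : ι → k}

/-- Elements of `B_c` are determined by their image under `ψ`. -/
theorem Bc_ext (hτ : ∀ i, τ (τ i) = i) (hχτ : ∀ i j, χ.q (τ i) (τ j) = χ.q i j)
    (hc : ParamCondition χ τ c) {x y : U χ} (hx : x ∈ Bc χ τ c) (hy : y ∈ Bc χ τ c)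
    (h : vz χ x = vz χ y) : x = y := by
  rw [← sub_eq_zero]
  exact vz_injective_Bc hτ hχτ hc ((Bc χ τ c).sub_mem hx hy) (by rw [map_sub, h, sub_self])

theorem exists_psiLift (hτ : ∀ i, τ (τ i) = i) (hχτ : ∀ i j, χ.q (τ i) (τ j) = χ.q i j)
    (hc : ParamCondition χ τ c) : ∃ b : Nic χ →ₗ[k] U χ, PsiLift χ τ c b ∧
      ∀ f, ∀ x ∈ Bc χ τ c, vz χ x = Finsupp.single 0 f → x = b f := by
  have hex : ∀ f : Nic χ, ∃ x ∈ Bc χ τ c, vz χ x = Finsupp.single 0 f := fun f => by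
    obtain ⟨m, hm⟩ := exists_mem_Nlt χ f
    exact exists_Bc_vz χ c hτ m f hm
  choose b hb hv using hex
  have huniq : ∀ f, ∀ x ∈ Bc χ τ c, vz χ x = Finsupp.single 0 f → x = b f := fun f x hx h =>
    Bc_ext hτ hχτ hc hx (hb f) (by rw [h, hv])
  refine ⟨{ toFun := b, map_add' := fun f g => ?_, map_smul' := fun r f => ?_ }, ⟨?_, ?_⟩, huniq⟩
  · exact (huniq _ _ ((Bc χ τ c).add_mem (hb f) (hb g))
      (by rw [map_add, hv, hv, Finsupp.single_add])).symm
  · exact (huniq _ _ ((Bc χ τ c).smul_mem (hb f) r)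
      (by rw [map_smul, hv, Finsupp.smul_single])).symm
  · exact (huniq 1 1 (Bc χ τ c).one_mem (vz_one χ)).symm
  · intro i f
    show Bgen χ τ c i * b f = b (nx χ i * f) + _ • (_ * b (dL χ (τ i) f))
    have hK : K χ (-α i + α (τ i)) * b (dL χ (τ i) f) ∈ Bc χ τ c :=
      (Bc χ τ c).mul_mem (K_mem_Bc χ c hτ (sub_mem_Qθ' τ i)) (hb _)
    rw [← sub_eq_iff_eq_add]
    refine huniq _ _ ((Bc χ τ c).sub_mem ((Bc χ τ c).mul_mem (B_mem_Bc χ τ c i) (hb f))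
      ((Bc χ τ c).smul_mem hK _)) ?_
    rw [map_sub, map_smul, vz_B_mul χ τ c i (Bc_le_Mle χ c hτ (hb f)), hv, bOp_single,
      vz_K_mul χ (hgt_of_mem_Qθ (sub_mem_Qθ' τ i)), hv, kOp_single]
    simp [val_neg_left, SymBichar.q]

/-- The algebra homomorphism with `x_i ↦ c_{τ(i)} K_i E_{τ(i)}`. -/
theorem exists_sigma (hτ : ∀ i, τ (τ i) = i) (hχτ : ∀ i j, χ.q (τ i) (τ j) = χ.q i j) (c : ι → k) :
    ∃ s : Nic χ →ₐ[k] U χ, ∀ i, s (nx χ i) = c (τ i) • (K χ (α i) * E χ (τ i)) := by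
  have hkill : ∀ p ∈ Imax χ, FreeAlgebra.lift k (fun i => E χ (τ i)) p = 0 := by
    intro p hp
    have h1 := lift_mulLeft_perm_kill χ hχτ p hp
    have h2 : ∀ p : T k ι, nE χ ((FreeAlgebra.lift k
        (fun i => (LinearMap.mulLeft k (nx χ (τ i)) : Module.End k (Nic χ))) p) 1) =
        FreeAlgebra.lift k (fun i => E χ (τ i)) p := by
      have h3 : ∀ (p : T k ι) u, nE χ ((FreeAlgebra.lift k
        (fun i => (LinearMap.mulLeft k (nx χ (τ i)) : Module.End k (Nic χ))) p) u) =
        FreeAlgebra.lift k (fun i => E χ (τ i)) p * nE χ u := by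
        intro p
        induction p using FreeAlgebra.induction with
        | grade0 r => intro u; simp [Algebra.smul_def]
        | grade1 i => intro u; simp
        | mul a b ha hb =>
          intro u
          rw [map_mul, Module.End.mul_apply, ha, hb, map_mul, mul_assoc]
        | add a b ha hb =>
          intro u
          rw [map_add, LinearMap.add_apply, map_add, ha, hb, map_add, add_mul]
      intro p
      rw [h3, map_one (nE χ), mul_one]
    rw [← h2, h1, LinearMap.zero_apply, map_zero]
  refine ⟨liftN χ (FreeAlgebra.lift k fun i => c (τ i) • (K χ (α i) * E χ (τ i)))
    (Imax_kill χ _ fun J hJ => ?_), fun i => ?_⟩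
  · refine graded_kill_twisted _ (FreeAlgebra.lift k fun i => E χ (τ i))
      (fun i => c (τ i) • K χ (α i)) (fun i j => (χ.val (α j) (α (τ i)))⁻¹) ?_ ?_ ?_ ?_ J hJ.graded
      fun p hp => hkill p (le_Imax χ hJ hp)
    · intro i j
      rw [q_perm_symm χ hτ hχτ]
    · intro i
      simp
    · intro i j
      simp only [smul_mul_assoc, mul_smul_comm]
      rw [K_comm, smul_comm]
    · intro i j
      simp only [FreeAlgebra.lift_ι_apply, smul_mul_assoc, mul_smul_comm]
      rw [K_mul_E, smul_comm, inv_smul_smul₀ (val_ne_zero _ _ _)]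
  · rw [nx, liftN_mk, FreeAlgebra.lift_ι_apply]

end

/-! ### Canonical elements -/

theorem single_add_sub {μ : ι → ℕ} {i : ι} (h : μ i ≠ 0) :
    Pi.single i 1 + (μ - Pi.single i 1) = μ := by
  ext j
  by_cases hj : j = i
  · subst hj; simp; omega
  · simp [hj]

theorem dR_mem_Nwt_aux {χ : SymBichar k ι} (i : ι) {μ : ι → ℕ} {u : Nic χ} (hu : u ∈ Nwt χ μ) :
    (μ i = 0 → dR χ i u = 0) ∧ ∀ ν, Pi.single i 1 + ν = μ → dR χ i u ∈ Nwt χ ν := by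
  refine Nwt_word_induction (P := fun μ u => (μ i = 0 → dR χ i u = 0) ∧
    ∀ ν, Pi.single i 1 + ν = μ → dR χ i u ∈ Nwt χ ν) ?_ ?_ ?_ ?_ ?_ hu
  · refine ⟨fun _ => dR_one χ i, fun ν hν => ?_⟩
    have := congrFun hν i
    simp at this
  · intro j μ u hu h
    rw [dR_mul, S_of_mem hu, dR_x]
    by_cases hij : i = j
    · subst hij
      refine ⟨fun h0 => by simp at h0, fun ν hν => ?_⟩
      obtain rfl := add_left_cancel hν
      rw [if_pos rfl, one_mul]
      refine Submodule.add_mem _ ?_ (Submodule.smul_mem _ _ hu)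
      by_cases h0 : ν i = 0
      · rw [h.1 h0, mul_zero]; exact Submodule.zero_mem _
      · have h2 := single_add_sub h0
        have := x_mul_mem_Nwt (h.2 _ h2) i
        rwa [h2] at this
    · rw [if_neg hij, zero_mul, add_zero]
      refine ⟨fun h0 => ?_, fun ν hν => ?_⟩
      · have h0' : μ i = 0 := by simpa [hij] using h0
        rw [h.1 h0', mul_zero]
      · have h0 : μ i ≠ 0 := by
          have := congrFun hν i
          simp [hij] at this
          omega
        have h2 := single_add_sub h0
        have := x_mul_mem_Nwt (h.2 _ h2) j
        rw [← h2, add_left_comm] at hν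
        rwa [add_left_cancel hν]
  · intro μ; simp
  · intro μ u v h1 h2
    refine ⟨fun h => by rw [map_add, h1.1 h, h2.1 h, add_zero], fun ν hν => ?_⟩
    rw [map_add]
    exact Submodule.add_mem _ (h1.2 ν hν) (h2.2 ν hν)
  · intro μ r u h1
    refine ⟨fun h => by rw [map_smul, h1.1 h, smul_zero], fun ν hν => ?_⟩
    rw [map_smul]
    exact Submodule.smul_mem _ _ (h1.2 ν hν)

theorem epsN_eq_prN (χ : SymBichar k ι) (u : Nic χ) :
    prN χ 0 u = algebraMap k (Nic χ) (epsN χ u) := by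
  have h : ∀ {μ : ι → ℕ} {u : Nic χ}, u ∈ Nwt χ μ → μ = 0 → u = algebraMap k (Nic χ) (epsN χ u) := by
    intro μ u hu
    refine Nwt_word_induction (P := fun μ u => μ = 0 → u = algebraMap k (Nic χ) (epsN χ u))
      ?_ ?_ ?_ ?_ ?_ hu
    · intro _; rw [map_one (epsN χ), map_one (algebraMap k (Nic χ))]
    · intro i μ u _ _ h
      have := congrFun h i
      simp at this
    · intro μ _; simp
    · intro μ u v h1 h2 h
      rw [map_add (epsN χ), map_add (algebraMap k (Nic χ)), ← h1 h, ← h2 h]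
    · intro μ r u h1 h
      conv_lhs => rw [h1 h]
      rw [map_smul (epsN χ), Algebra.smul_def, smul_eq_mul, map_mul (algebraMap k (Nic χ))]
  rw [← epsN_prN]
  exact h (prN_mem χ 0 u) rfl

section Canonical

variable {χ : SymBichar k ι}

variable (χ) in
/-- The contraction of the first tensor factor. -/
def contr (w : Nic χ) : Nic χ ⊗[k] Nic χ →ₗ[k] Nic χ :=
  (TensorProduct.lid k (Nic χ)).toLinearMap ∘ₗ LinearMap.rTensor (Nic χ) (formN χ w)

@[simp] theorem contr_tmul (w f e : Nic χ) : contr χ w (f ⊗ₜ[k] e) = formN χ w f • e := by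
  simp [contr]

theorem rTensor_formN_separating (x : Nic χ ⊗[k] Nic χ)
    (h : ∀ w, LinearMap.rTensor (Nic χ) (formN χ w) x = 0) : x = 0 :=
  rTensor_separating (M := fun _ : Nic χ => k) (fun w => formN χ w)
    (fun _ hu => formN_nondeg χ hu) _ h

theorem contr_separating (x : Nic χ ⊗[k] Nic χ) (h : ∀ w, contr χ w x = 0) : x = 0 := by
  refine rTensor_formN_separating _ fun w => ?_
  have h2 : contr χ w x =
      TensorProduct.lid k (Nic χ) (LinearMap.rTensor (Nic χ) (formN χ w) x) := by
    rw [contr, LinearMap.comp_apply, LinearEquiv.coe_coe]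
  rw [h w] at h2
  exact (LinearEquiv.map_eq_zero_iff _).1 h2.symm

theorem contr_ext {x y : Nic χ ⊗[k] Nic χ} (h : ∀ w, contr χ w x = contr χ w y) : x = y := by
  rw [← sub_eq_zero]
  refine contr_separating _ fun w => ?_
  rw [map_sub, h, sub_self]

theorem contr_lTensor (w : Nic χ) (g : Nic χ →ₗ[k] Nic χ) (x : Nic χ ⊗[k] Nic χ) :
    contr χ w (LinearMap.lTensor (Nic χ) g x) = g (contr χ w x) := by
  induction x with
  | zero => simp
  | tmul f e => simp
  | add x y hx hy => rw [map_add, map_add, hx, hy, map_add, map_add]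

theorem contr_rTensor {w w' : Nic χ} {g : Nic χ →ₗ[k] Nic χ}
    (h : ∀ f, formN χ w (g f) = formN χ w' f) (x : Nic χ ⊗[k] Nic χ) :
    contr χ w (LinearMap.rTensor (Nic χ) g x) = contr χ w' x := by
  induction x with
  | zero => simp
  | tmul f e => simp [h]
  | add x y hx hy => rw [map_add, map_add, hx, hy, map_add]

variable (χ) in
/-- Families of canonical elements of the form on the Nichols algebra. -/
structure IsCan (C : (ι → ℕ) → Nic χ ⊗[k] Nic χ) : Prop where
  mem : ∀ μ, C μ ∈ LinearMap.range (TensorProduct.map (Nwt χ μ).subtype (Nwt χ μ).subtype)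
  contr : ∀ μ w, contr χ w (C μ) = prN χ μ w

theorem prN_dR_of_mem (i : ι) (μ : ι → ℕ) {ν : ι → ℕ} {u : Nic χ} (hu : u ∈ Nwt χ ν) :
    prN χ μ (dR χ i u) = dR χ i (prN χ (Pi.single i 1 + μ) u) := by
  have h3 : prN χ (Pi.single i 1 + μ) u = if ν = Pi.single i 1 + μ then u else 0 :=
    prN_of_mem hu _
  refine Eq.trans ?_ (congrArg (dR χ i) h3).symm
  have h1 := dR_mem_Nwt_aux i hu
  by_cases hν : ν i = 0
  · rw [h1.1 hν, map_zero, if_neg, map_zero]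
    rintro rfl
    simp at hν
  · have h2 := single_add_sub hν
    rw [prN_of_mem (h1.2 _ h2) μ]
    by_cases h3 : ν - Pi.single i 1 = μ
    · rw [if_pos h3, if_pos (by rw [← h3, h2])]
    · rw [if_neg h3, if_neg, map_zero]
      intro h4
      exact h3 (add_left_cancel (h2.trans h4))

theorem prN_dR (i : ι) (μ : ι → ℕ) (u : Nic χ) :
    prN χ μ (dR χ i u) = dR χ i (prN χ (Pi.single i 1 + μ) u) := by
  induction u using Nwt_induction with
  | hw ν u hu => exact prN_dR_of_mem i μ hu
  | add u v hu hv => rw [map_add, map_add, map_add, map_add, hu, hv]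

theorem dL_of_zero {i : ι} {μ : ι → ℕ} (h : μ i = 0) {u : Nic χ} (hu : u ∈ Nwt χ μ) :
    dL χ i u = 0 := by
  refine Nwt_word_induction (P := fun μ u => μ i = 0 → dL χ i u = 0) ?_ ?_ ?_ ?_ ?_ hu h
  · exact fun _ => dL_one χ i
  · intro j μ u _ h1 h0
    have hij : i ≠ j := by
      rintro rfl
      simp at h0
    have h0' : μ i = 0 := by simpa [hij] using h0
    rw [dL_x_mul, if_neg hij, h1 h0', mul_zero, smul_zero, add_zero]
  · intro μ _; exact map_zero _
  · intro μ u v h1 h2 h; rw [map_add, h1 h, h2 h, add_zero]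
  · intro μ r u h1 h; rw [map_smul, h1 h, smul_zero]

namespace IsCan

variable {C : (ι → ℕ) → Nic χ ⊗[k] Nic χ}

theorem congr (hC : IsCan χ C) {V : Type*} [AddCommGroup V] [Module k V] {μ : ι → ℕ}
    {P Q : Nic χ ⊗[k] Nic χ →ₗ[k] V}
    (h : ∀ f ∈ Nwt χ μ, ∀ e ∈ Nwt χ μ, P (f ⊗ₜ[k] e) = Q (f ⊗ₜ[k] e)) : P (C μ) = Q (C μ) := by
  obtain ⟨z, hz⟩ := hC.mem μ
  rw [← hz]
  clear hz
  induction z with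
  | zero => simp
  | tmul f e => exact h _ f.2 _ e.2
  | add x y hx hy => rw [map_add, map_add, hx, hy, map_add]

theorem comm (hC : IsCan χ C) (μ : ι → ℕ) : TensorProduct.comm k _ _ (C μ) = C μ := by
  refine contr_ext fun w => ?_
  rw [hC.contr]
  have h1 : ∀ u x, formN χ u (SymPair.contr χ w (TensorProduct.comm k _ _ x)) =
      formN χ w (SymPair.contr χ u x) := by
    intro u x
    induction x with
    | zero => simp
    | tmul f e => simp [mul_comm]
    | add x y hx hy => simp only [map_add, hx, hy]
  rw [← sub_eq_zero]
  refine formN_nondeg χ fun u => ?_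
  have h2 := formN_prN (prN_mem χ μ w) u
  have h3 := formN_prN (prN_mem χ μ u) w
  rw [map_sub, h1, hC.contr, formN_symm χ w, h3.symm, formN_symm χ u, ← h2, formN_symm χ (prN χ μ u),
    sub_self]

theorem zero (hC : IsCan χ C) : C 0 = 1 ⊗ₜ[k] 1 := by
  refine contr_ext fun w => ?_
  rw [hC.contr, contr_tmul, formN_symm, formN_one, epsN_eq_prN, Algebra.algebraMap_eq_smul_one]

theorem lTensor_dR (hC : IsCan χ C) (i : ι) (μ : ι → ℕ) :
    LinearMap.lTensor _ (dR χ i) (C (Pi.single i 1 + μ)) =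
      LinearMap.rTensor _ (LinearMap.mulRight k (nx χ i)) (C μ) := by
  refine contr_ext fun w => ?_
  rw [contr_lTensor, hC.contr, contr_rTensor (w' := dR χ i w), hC.contr, prN_dR]
  intro f
  rw [LinearMap.mulRight_apply, formN_symm, formN_mul_x, formN_symm]

theorem lTensor_dL (hC : IsCan χ C) (i : ι) (μ : ι → ℕ) :
    LinearMap.lTensor _ (dL χ i) (C (Pi.single i 1 + μ)) =
      LinearMap.rTensor _ (LinearMap.mulLeft k (nx χ i)) (C μ) := by
  refine contr_ext fun w => ?_
  rw [contr_lTensor, hC.contr, contr_rTensor (w' := dL χ i w), hC.contr, prN_dL]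
  intro f
  rw [LinearMap.mulLeft_apply, formN_symm, formN_x_mul, formN_symm]

theorem lTensor_dR_zero (hC : IsCan χ C) {i : ι} {μ : ι → ℕ} (h : μ i = 0) :
    LinearMap.lTensor _ (dR χ i) (C μ) = 0 := by
  refine contr_ext fun w => ?_
  rw [contr_lTensor, hC.contr, (dR_mem_Nwt_aux i (prN_mem χ μ w)).1 h, map_zero]

theorem lTensor_dL_zero (hC : IsCan χ C) {i : ι} {μ : ι → ℕ} (h : μ i = 0) :
    LinearMap.lTensor _ (dL χ i) (C μ) = 0 := by
  refine contr_ext fun w => ?_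
  rw [contr_lTensor, hC.contr, dL_of_zero h (prN_mem χ μ w), map_zero]

theorem rTensor_eq (hC : IsCan χ C) (g : Nic χ →ₗ[k] Nic χ) (μ : ι → ℕ) :
    LinearMap.rTensor _ g (C μ) = TensorProduct.comm k _ _ (LinearMap.lTensor _ g (C μ)) := by
  conv_lhs => rw [← hC.comm]
  have : LinearMap.rTensor (Nic χ) g ∘ₗ (TensorProduct.comm k (Nic χ) (Nic χ)).toLinearMap =
      (TensorProduct.comm k (Nic χ) (Nic χ)).toLinearMap ∘ₗ LinearMap.lTensor (Nic χ) g := by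
    ext; simp
  exact LinearMap.congr_fun this (C μ)

theorem lTensor_eq (hC : IsCan χ C) (g : Nic χ →ₗ[k] Nic χ) (μ : ι → ℕ) :
    LinearMap.lTensor _ g (C μ) = TensorProduct.comm k _ _ (LinearMap.rTensor _ g (C μ)) := by
  rw [hC.rTensor_eq, TensorProduct.comm_comm]

theorem rTensor_dR (hC : IsCan χ C) (i : ι) (μ : ι → ℕ) :
    LinearMap.rTensor _ (dR χ i) (C (Pi.single i 1 + μ)) =
      LinearMap.lTensor _ (LinearMap.mulRight k (nx χ i)) (C μ) := by
  rw [hC.rTensor_eq, hC.lTensor_dR, hC.lTensor_eq]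

theorem rTensor_dL (hC : IsCan χ C) (i : ι) (μ : ι → ℕ) :
    LinearMap.rTensor _ (dL χ i) (C (Pi.single i 1 + μ)) =
      LinearMap.lTensor _ (LinearMap.mulLeft k (nx χ i)) (C μ) := by
  rw [hC.rTensor_eq, hC.lTensor_dL, hC.lTensor_eq]

theorem rTensor_dR_zero (hC : IsCan χ C) {i : ι} {μ : ι → ℕ} (h : μ i = 0) :
    LinearMap.rTensor _ (dR χ i) (C μ) = 0 := by
  rw [hC.rTensor_eq, hC.lTensor_dR_zero h, map_zero]

theorem rTensor_dL_zero (hC : IsCan χ C) {i : ι} {μ : ι → ℕ} (h : μ i = 0) :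
    LinearMap.rTensor _ (dL χ i) (C μ) = 0 := by
  rw [hC.rTensor_eq, hC.lTensor_dL_zero h, map_zero]

end IsCan

/-- The canonical element of a pair of dual bases. -/
def canOf (D : ∀ μ, DualBases χ (borelPairing χ) μ) (μ : ι → ℕ) : Nic χ ⊗[k] Nic χ :=
  ∑ j, ((UminusWtEquiv χ μ).symm ((D μ).Fb j) : Nic χ) ⊗ₜ[k]
    ((UplusWtEquiv χ μ).symm ((D μ).Eb j) : Nic χ)

theorem isCan_canOf (D : ∀ μ, DualBases χ (borelPairing χ) μ) : IsCan χ (canOf D) := by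
  refine ⟨fun μ => ?_, fun μ w => ?_⟩
  · refine Submodule.sum_mem _ fun j _ => ⟨(UminusWtEquiv χ μ).symm ((D μ).Fb j) ⊗ₜ[k]
      (UplusWtEquiv χ μ).symm ((D μ).Eb j), rfl⟩
  · set f := fun j => (UminusWtEquiv χ μ).symm ((D μ).Fb j) with hf
    set e := (D μ).Eb.map (UplusWtEquiv χ μ).symm with he
    have hdual : ∀ i j, formN χ (f i) (e j) = if i = j then 1 else 0 := by
      intro i j
      rw [← wtPairing_equiv, hf, he, Module.Basis.map_apply, LinearEquiv.apply_symm_apply,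
        LinearEquiv.apply_symm_apply, (D μ).dual]
    have h1 : SymPair.contr χ w (canOf D μ) = ((∑ j, formN χ w (f j) • e j : Nwt χ μ) : Nic χ) := by
      rw [canOf, map_sum]
      simp [hf, he]
    rw [h1]
    have h2 : (∑ j, formN χ w (f j) • e j : Nwt χ μ) = ⟨prN χ μ w, prN_mem χ μ w⟩ := by
      refine Eq.trans ?_ (e.sum_repr ⟨prN χ μ w, prN_mem χ μ w⟩)
      refine Finset.sum_congr rfl fun j _ => ?_
      congr 1
      have h3 : formN χ (f j) (prN χ μ w) = formN χ w (f j) := by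
        rw [formN_prN (f j).2, formN_symm]
      have h4 := congrArg (fun z : Nwt χ μ => formN χ (f j) z)
        (e.sum_repr ⟨prN χ μ w, prN_mem χ μ w⟩)
      simp only [Submodule.coe_sum, Submodule.coe_smul, map_sum, map_smul, hdual, smul_eq_mul,
        mul_ite, mul_one, mul_zero, Finset.sum_ite_eq, Finset.mem_univ, if_true] at h4
      rw [← h3, ← h4]
    rw [h2]

end Canonical

/-! ### Formal sums of canonical elements -/

section Theta

variable {χ : SymBichar k ι} {C : (ι → ℕ) → Nic χ ⊗[k] Nic χ} {A B : Type*} [Ring A] [Algebra k A]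
  [Ring B] [Algebra k B] {d d' : (ι → ℕ) → (ι → ℕ)} {P Q : (ι → ℕ) → Nic χ ⊗[k] Nic χ →ₗ[k] A}

/-- The formal sum of the images of the canonical elements with alternating signs. -/
def Th (C : (ι → ℕ) → Nic χ ⊗[k] Nic χ) (d : (ι → ℕ) → (ι → ℕ))
    (P : (ι → ℕ) → Nic χ ⊗[k] Nic χ →ₗ[k] A) : HahnSeries (ι → ℤ) A :=
  formalSum d fun μ => sgn k μ • P μ (C μ)

theorem Th_ext (hC : IsCan χ C) (hd : ∀ μ, d μ = d' μ)
    (h : ∀ μ, ∀ f ∈ Nwt χ μ, ∀ e ∈ Nwt χ μ, P μ (f ⊗ₜ[k] e) = Q μ (f ⊗ₜ[k] e)) :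
    Th C d P = Th C d' Q := by
  rw [funext hd, Th, Th]
  congr 1
  funext μ
  rw [hC.congr (h μ)]

theorem hm_Th (hd : Growing d) (g : A →ₗ[k] B) :
    hm g (Th C d P) = Th C d fun μ => g ∘ₗ P μ := by
  rw [Th, hm_formalSum hd]
  simp only [map_smul]
  rfl

theorem Th_add (hd : Growing d) : Th C d (fun μ => P μ + Q μ) = Th C d P + Th C d Q := by
  rw [Th, Th, Th, ← formalSum_add hd]
  simp only [LinearMap.add_apply, smul_add]

theorem Th_neg (hd : Growing d) : - Th C d P = Th C d fun μ => - P μ := by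
  rw [Th, Th, ← formalSum_neg d hd]
  simp only [LinearMap.neg_apply, smul_neg]

theorem Th_mul_single (hd : Growing d) (a : ι → ℕ) (r : A) :
    Th C d P * HahnSeries.single (up a) r =
      Th C (fun μ => a + d μ) fun μ => LinearMap.mulRight k r ∘ₗ P μ := by
  rw [Th, formalSum_mul_single hd, Th]
  simp only [smul_mul_assoc]
  rfl

theorem single_mul_Th (hd : Growing d) (a : ι → ℕ) (r : A) :
    HahnSeries.single (up a) r * Th C d P =
      Th C (fun μ => a + d μ) fun μ => LinearMap.mulLeft k r ∘ₗ P μ := by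
  rw [Th, single_mul_formalSum hd, Th]
  simp only [mul_smul_comm]
  rfl

theorem sgn_add (i : ι) (μ : ι → ℕ) : sgn k (Pi.single i 1 + μ) = - sgn k μ := by
  rw [sgn, sgn, size_add, size_single, pow_add, pow_one, neg_one_mul]

theorem Th_shift (hd : Growing d) (i : ι) (f g : Nic χ ⊗[k] Nic χ →ₗ[k] Nic χ ⊗[k] Nic χ)
    (h : ∀ μ, f (C (Pi.single i 1 + μ)) = g (C μ)) (h0 : ∀ μ, μ i = 0 → f (C μ) = 0) :
    Th C d (fun μ => P μ ∘ₗ f) =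
      - Th C (fun μ => d (Pi.single i 1 + μ)) fun μ => P (Pi.single i 1 + μ) ∘ₗ g := by
  rw [Th, formalSum_shift d _ i (fun μ hμ => by
    rw [LinearMap.comp_apply, h0 μ hμ, map_zero, smul_zero]), Th, ← formalSum_neg]
  · simp only [LinearMap.comp_apply, h, sgn_add, neg_smul]
  · intro μ
    refine le_trans ?_ (hd _)
    rw [size_add]
    omega

theorem Th_shift_lTensor_dR (hC : IsCan χ C) (hd : Growing d) (i : ι) :
    Th C d (fun μ => P μ ∘ₗ LinearMap.lTensor _ (dR χ i)) =
      - Th C (fun μ => d (Pi.single i 1 + μ)) fun μ => P (Pi.single i 1 + μ) ∘ₗ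
        LinearMap.rTensor _ (LinearMap.mulRight k (nx χ i)) :=
  Th_shift hd i _ _ (hC.lTensor_dR i) fun _ h => hC.lTensor_dR_zero h

theorem Th_shift_lTensor_dL (hC : IsCan χ C) (hd : Growing d) (i : ι) :
    Th C d (fun μ => P μ ∘ₗ LinearMap.lTensor _ (dL χ i)) =
      - Th C (fun μ => d (Pi.single i 1 + μ)) fun μ => P (Pi.single i 1 + μ) ∘ₗ
        LinearMap.rTensor _ (LinearMap.mulLeft k (nx χ i)) :=
  Th_shift hd i _ _ (hC.lTensor_dL i) fun _ h => hC.lTensor_dL_zero h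

theorem Th_shift_rTensor_dR (hC : IsCan χ C) (hd : Growing d) (i : ι) :
    Th C d (fun μ => P μ ∘ₗ LinearMap.rTensor _ (dR χ i)) =
      - Th C (fun μ => d (Pi.single i 1 + μ)) fun μ => P (Pi.single i 1 + μ) ∘ₗ
        LinearMap.lTensor _ (LinearMap.mulRight k (nx χ i)) :=
  Th_shift hd i _ _ (hC.rTensor_dR i) fun _ h => hC.rTensor_dR_zero h

theorem Th_shift_rTensor_dL (hC : IsCan χ C) (hd : Growing d) (i : ι) :
    Th C d (fun μ => P μ ∘ₗ LinearMap.rTensor _ (dL χ i)) =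
      - Th C (fun μ => d (Pi.single i 1 + μ)) fun μ => P (Pi.single i 1 + μ) ∘ₗ
        LinearMap.lTensor _ (LinearMap.mulLeft k (nx χ i)) :=
  Th_shift hd i _ _ (hC.rTensor_dL i) fun _ h => hC.rTensor_dL_zero h

theorem Th_eq_one (hC : IsCan χ C) (hd : d 0 = 0) (h1 : P 0 (1 ⊗ₜ[k] 1) = 1)
    (h : ∀ μ, μ ≠ 0 → ∀ f ∈ Nwt χ μ, ∀ e ∈ Nwt χ μ, P μ (f ⊗ₜ[k] e) = 0) : Th C d P = 1 := by
  rw [Th, formalSum_eq_single, hd, up_zero, hC.zero, h1, sgn]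
  · simp [size]
  · intro ρ hρ
    rw [hC.congr (Q := 0) (fun f hf e he => by rw [h ρ hρ f hf e he, LinearMap.zero_apply]),
      LinearMap.zero_apply, smul_zero]

variable {τ : Equiv.Perm ι} {c : ι → k} {b : Nic χ →ₗ[k] U χ}

theorem growing_single_add (i : ι) : Growing fun μ : ι → ℕ => Pi.single i 1 + μ := fun μ => by
  rw [size_add]; omega

theorem Th_dR (hC : IsCan χ C) (hb : PsiLift χ τ c b) (hτ : ∀ i, τ (τ i) = i)
    (hχτ : ∀ i j, χ.q (τ i) (τ j) = χ.q i j) (Φ : Nic χ →ₐ[k] A) (i : ι) :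
    Th C id (fun _ => TensorProduct.map b Φ.toLinearMap ∘ₗ LinearMap.lTensor _ (dR χ i)) =
      -(Th C id (fun _ => TensorProduct.map b Φ.toLinearMap) *
        (HahnSeries.single (up (Pi.single i 1)) (Bgen χ τ c i ⊗ₜ[k] (1 : A)) +
          HahnSeries.single (up (Pi.single i 1 + Pi.single (τ i) 1))
            ((c (τ i) * χ.q i (τ i)) • (K χ (α i - α (τ i)) ⊗ₜ[k] Φ (nx χ (τ i)))))) := by
  have h1 : Th C (fun μ => Pi.single i 1 + μ) (fun _ => TensorProduct.map b Φ.toLinearMap ∘ₗ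
      LinearMap.rTensor _ (LinearMap.mulRight k (nx χ i))) =
      Th C (fun μ => Pi.single i 1 + μ) (fun _ =>
        LinearMap.mulRight k (Bgen χ τ c i ⊗ₜ[k] (1 : A)) ∘ₗ TensorProduct.map b Φ.toLinearMap +
        (LinearMap.mulRight k (-((c (τ i) * χ.q i (τ i)) • (K χ (α i - α (τ i)) ⊗ₜ[k] (1 : A)))) ∘ₗ
          TensorProduct.map b Φ.toLinearMap) ∘ₗ LinearMap.rTensor _ (dR χ (τ i))) := by
    refine Th_ext hC (fun _ => rfl) fun μ f _ e _ => ?_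
    have h := hb.mul_B hτ hχτ i f
    simp only [LinearMap.comp_apply, LinearMap.add_apply, LinearMap.rTensor_tmul,
      TensorProduct.map_tmul, LinearMap.mulRight_apply, AlgHom.toLinearMap_apply, mul_neg,
      mul_smul_comm, Algebra.TensorProduct.tmul_mul_tmul, mul_one, h, TensorProduct.add_tmul,
      TensorProduct.smul_tmul']
    abel
  rw [Th_shift_lTensor_dR hC growing_id]
  simp only [id]
  rw [h1, Th_add (growing_single_add i), mul_add, Th_mul_single growing_id,
    Th_mul_single growing_id, Th_shift_rTensor_dR hC (growing_single_add i)]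
  congr 2
  refine (Th_neg ((growing_single_add (τ i)).add _)).trans ?_
  refine Th_ext hC (fun μ => (add_assoc _ _ _).symm) fun μ f _ e _ => ?_
  simp only [LinearMap.neg_apply, LinearMap.comp_apply, LinearMap.lTensor_tmul,
    TensorProduct.map_tmul, LinearMap.mulRight_apply, AlgHom.toLinearMap_apply, mul_neg, neg_neg,
    mul_smul_comm, Algebra.TensorProduct.tmul_mul_tmul, mul_one, map_mul]

theorem Th_dL (hC : IsCan χ C) (hb : PsiLift χ τ c b) (Φ : Nic χ →ₐ[k] A) (i : ι) :
    Th C id (fun _ => TensorProduct.map b Φ.toLinearMap ∘ₗ LinearMap.lTensor _ (dL χ i)) =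
      -((HahnSeries.single (up (Pi.single i 1)) (Bgen χ τ c i ⊗ₜ[k] (1 : A)) +
          HahnSeries.single (up (Pi.single i 1 + Pi.single (τ i) 1))
            ((c i * χ.q i (τ i)) • (K χ (-α i + α (τ i)) ⊗ₜ[k] Φ (nx χ (τ i))))) *
        Th C id (fun _ => TensorProduct.map b Φ.toLinearMap)) := by
  have h1 : Th C (fun μ => Pi.single i 1 + μ) (fun _ => TensorProduct.map b Φ.toLinearMap ∘ₗ
      LinearMap.rTensor _ (LinearMap.mulLeft k (nx χ i))) =
      Th C (fun μ => Pi.single i 1 + μ) (fun _ =>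
        LinearMap.mulLeft k (Bgen χ τ c i ⊗ₜ[k] (1 : A)) ∘ₗ TensorProduct.map b Φ.toLinearMap +
        (LinearMap.mulLeft k (-((c i * χ.q i (τ i)) • (K χ (-α i + α (τ i)) ⊗ₜ[k] (1 : A)))) ∘ₗ
          TensorProduct.map b Φ.toLinearMap) ∘ₗ LinearMap.rTensor _ (dL χ (τ i))) := by
    refine Th_ext hC (fun _ => rfl) fun μ f _ e _ => ?_
    have h := hb.B_mul i f
    simp only [LinearMap.comp_apply, LinearMap.add_apply, LinearMap.rTensor_tmul,
      TensorProduct.map_tmul, LinearMap.mulLeft_apply, AlgHom.toLinearMap_apply, neg_mul,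
      smul_mul_assoc, Algebra.TensorProduct.tmul_mul_tmul, one_mul, h, TensorProduct.add_tmul,
      TensorProduct.smul_tmul']
    abel
  rw [Th_shift_lTensor_dL hC growing_id]
  simp only [id]
  rw [h1, Th_add (growing_single_add i), add_mul, single_mul_Th growing_id,
    single_mul_Th growing_id, Th_shift_rTensor_dL hC (growing_single_add i)]
  congr 2
  refine (Th_neg ((growing_single_add (τ i)).add _)).trans ?_
  refine Th_ext hC (fun μ => (add_assoc _ _ _).symm) fun μ f _ e _ => ?_
  simp only [LinearMap.neg_apply, LinearMap.comp_apply, LinearMap.lTensor_tmul,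
    TensorProduct.map_tmul, LinearMap.mulLeft_apply, AlgHom.toLinearMap_apply, neg_mul, neg_neg,
    smul_mul_assoc, Algebra.TensorProduct.tmul_mul_tmul, one_mul, map_mul]

end Theta

/-! ### Homomorphisms out of the Nichols algebra -/

section Homs

variable (χ : SymBichar k ι)

/-- The algebra homomorphism `x_i ↦ u_i ⊗ x_i` for commuting elements `u_i`. -/
theorem exists_tensor_hom {A : Type*} [Ring A] [Algebra k A] (u : ι → A)
    (hu : ∀ i j, u i * u j = u j * u i) :
    ∃ f : Nic χ →ₐ[k] A ⊗[k] Nic χ, ∀ i, f (nx χ i) = u i ⊗ₜ[k] nx χ i := by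
  refine ⟨liftN χ (FreeAlgebra.lift k fun i => u i ⊗ₜ[k] nx χ i) (Imax_kill χ _ fun J hJ => ?_),
    fun i => ?_⟩
  · refine graded_kill _ ((Algebra.TensorProduct.includeRight :
        Nic χ →ₐ[k] A ⊗[k] Nic χ).comp (mkN χ)) (fun i => u i ⊗ₜ[k] 1) ?_ ?_ ?_ J hJ.graded ?_
    · intro i
      simp [mkN_X]
    · intro i j
      simp [hu i j]
    · intro i j
      simp
    · intro p hp
      rw [AlgHom.comp_apply, mkN_eq_zero.2 (le_Imax χ hJ hp), map_zero]
  · rw [nx, liftN_mk, FreeAlgebra.lift_ι_apply]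
    rfl

/-- The coproduct of the bosonization of the Nichols algebra. -/
theorem exists_comul_hom : ∃ f : Nic χ →ₐ[k] U χ ⊗[k] Nic χ, ∀ i, f (nx χ i) =
    E χ i ⊗ₜ[k] 1 + K χ (α i) ⊗ₜ[k] nx χ i := by
  refine ⟨liftN χ (FreeAlgebra.lift k fun i => E χ i ⊗ₜ[k] 1 + K χ (α i) ⊗ₜ[k] nx χ i) ?_,
    fun i => ?_⟩
  · obtain ⟨f, hf⟩ := exists_tensor_hom χ (fun i => K χ (α i)) fun i j => K_comm χ _ _
    refine comul_kill χ _ ((Algebra.TensorProduct.includeLeft :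
      U χ →ₐ[k] U χ ⊗[k] Nic χ).comp ((nE χ).comp (mkN χ))) (f.comp (mkN χ)) ?_ ?_ (Imax χ)
      (Imax_isGradedBiideal χ) ?_ ?_
    · intro i
      simp [mkN_X, hf]
    · intro i j
      simp [mkN_X, hf, K_mul_E, TensorProduct.smul_tmul', SymBichar.q]
    · intro p hp
      simp [mkN_eq_zero.2 hp]
    · intro p hp
      simp [mkN_eq_zero.2 hp]
  · rw [nx, liftN_mk, FreeAlgebra.lift_ι_apply]
    rfl

variable {χ} in
theorem tensor_hom_apply {v : (ι → ℤ) → U χ} (hv : v 0 = 1) (hv' : ∀ a b, v (a + b) = v a * v b)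
    {f : Nic χ →ₐ[k] U χ ⊗[k] Nic χ} (hf : ∀ i, f (nx χ i) = v (α i) ⊗ₜ[k] nx χ i) {μ : ι → ℕ}
    {u : Nic χ} (hu : u ∈ Nwt χ μ) : f u = v (up μ) ⊗ₜ[k] u := by
  refine Nwt_word_induction (P := fun μ u => f u = v (up μ) ⊗ₜ[k] u) ?_ ?_ ?_ ?_ ?_ hu
  · rw [map_one f, up_zero, hv]
    rfl
  · intro i μ u _ h
    rw [map_mul f, hf, h, Algebra.TensorProduct.tmul_mul_tmul, up_add, up_single, hv']
  · intro μ
    rw [map_zero f, TensorProduct.tmul_zero]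
  · intro μ u w h1 h2
    rw [map_add f, h1, h2, TensorProduct.tmul_add]
  · intro μ r u h
    rw [map_smul f, h, TensorProduct.tmul_smul]

/-- A homomorphism `f` into `A ⊗ Nic` with `f(x_j) = w_j ⊗ 1 + u_j ⊗ x_j` is compatible with the
right skew derivations. -/
theorem lTensor_dR_hom {A : Type*} [Ring A] [Algebra k A] {w u : ι → A}
    {f : Nic χ →ₐ[k] A ⊗[k] Nic χ} (hf : ∀ i, f (nx χ i) = w i ⊗ₜ[k] 1 + u i ⊗ₜ[k] nx χ i) (i : ι)
    (hw : ∀ j, w j * u i = (χ.q i j)⁻¹ • (u i * w j)) (hu : ∀ j, u j * u i = u i * u j)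
    (e : Nic χ) : LinearMap.lTensor A (dR χ i) (f e) = f (dR χ i e) * (u i ⊗ₜ[k] 1) := by
  have hleib : ∀ x y : A ⊗[k] Nic χ, LinearMap.lTensor A (dR χ i) (x * y) =
      x * LinearMap.lTensor A (dR χ i) y + LinearMap.lTensor A (dR χ i) x *
        LinearMap.lTensor A (S χ (α i)).toLinearMap y := by
    intro x y
    induction x with
    | zero => simp
    | add x x' hx hx' => rw [add_mul, map_add, hx, hx', map_add, add_mul, add_mul]; abel
    | tmul a v =>
      induction y with
      | zero => simp
      | add x x' hx hx' => rw [mul_add, map_add, hx, hx', map_add, map_add, mul_add, mul_add]; abel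
      | tmul a' v' => simp [dR_mul, TensorProduct.tmul_add]
  refine Nic_induction_right (P := fun e => LinearMap.lTensor A (dR χ i) (f e) =
    f (dR χ i e) * (u i ⊗ₜ[k] 1)) ?_ ?_ ?_ ?_ e
  · rw [map_one f, dR_one, map_zero f, zero_mul, Algebra.TensorProduct.one_def,
      LinearMap.lTensor_tmul, dR_one, TensorProduct.tmul_zero]
  · intro j e he
    have hq : χ.q i j * (χ.q i j)⁻¹ = 1 := mul_inv_cancel₀ (val_ne_zero _ _ _)
    have h1 : (u i ⊗ₜ[k] (1 : Nic χ)) * LinearMap.lTensor A (S χ (α i)).toLinearMap (f (nx χ j)) =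
        χ.q i j • (f (nx χ j) * (u i ⊗ₜ[k] 1)) := by
      rw [hf, map_add, LinearMap.lTensor_tmul, LinearMap.lTensor_tmul, AlgHom.toLinearMap_apply,
        AlgHom.toLinearMap_apply, S_x, map_one (S χ _)]
      simp only [mul_add, add_mul, Algebra.TensorProduct.tmul_mul_tmul, one_mul, mul_one, hw, hu,
        TensorProduct.tmul_smul, smul_add, ← TensorProduct.smul_tmul', smul_smul, hq, one_smul,
        mul_smul_comm]
      rfl
    have h2 : LinearMap.lTensor A (dR χ i) (f (nx χ j)) =
        (if i = j then 1 else 0) * (u i ⊗ₜ[k] (1 : Nic χ)) := by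
      rw [hf, map_add, LinearMap.lTensor_tmul, LinearMap.lTensor_tmul, dR_one, dR_x]
      split_ifs with h
      · simp [h]
      · simp
    rw [map_mul f, hleib, he, h2, mul_assoc, h1, dR_mul_x, map_add f, map_smul f, map_mul f]
    simp only [add_mul, mul_smul_comm, smul_mul_assoc, mul_assoc]
    congr 1
    split_ifs <;> simp
  · intro x y hx hy
    rw [map_add f, map_add, hx, hy, map_add, map_add f, add_mul]
  · intro r x hx
    rw [map_smul f, map_smul, hx, map_smul, map_smul f, smul_mul_assoc]

/-- A homomorphism `f` into `A ⊗ Nic` with `f(x_j) = u_j ⊗ x_j` is compatible with the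
left skew derivations. -/
theorem lTensor_dL_hom {A : Type*} [Ring A] [Algebra k A] {u : ι → A}
    {f : Nic χ →ₐ[k] A ⊗[k] Nic χ} (hf : ∀ i, f (nx χ i) = u i ⊗ₜ[k] nx χ i) (i : ι)
    (hu : ∀ j, u j * u i = u i * u j)
    (e : Nic χ) : LinearMap.lTensor A (dL χ i) (f e) = (u i ⊗ₜ[k] 1) * f (dL χ i e) := by
  refine Nic_induction (P := fun e => LinearMap.lTensor A (dL χ i) (f e) =
    (u i ⊗ₜ[k] 1) * f (dL χ i e)) ?_ ?_ ?_ ?_ e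
  · rw [map_one f, dL_one, map_zero f, mul_zero, Algebra.TensorProduct.one_def,
      LinearMap.lTensor_tmul, dL_one, TensorProduct.tmul_zero]
  · intro j e he
    have h1 : ∀ z : A ⊗[k] Nic χ, LinearMap.lTensor A (dL χ i) ((u j ⊗ₜ[k] nx χ j) * z) =
        (if i = j then (u i ⊗ₜ[k] 1) * z else 0) +
          χ.q i j • ((u j ⊗ₜ[k] nx χ j) * LinearMap.lTensor A (dL χ i) z) := by
      intro z
      induction z with
      | zero => simp
      | add x y hx hy =>
        rw [mul_add, map_add, hx, hy, map_add, mul_add, mul_add, smul_add]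
        split_ifs <;> abel
      | tmul a v =>
        rw [Algebra.TensorProduct.tmul_mul_tmul, LinearMap.lTensor_tmul, dL_x_mul,
          TensorProduct.tmul_add, LinearMap.lTensor_tmul, TensorProduct.tmul_smul,
          Algebra.TensorProduct.tmul_mul_tmul]
        split_ifs with h
        · simp [h]
        · simp
    rw [map_mul f, hf, h1, he, dL_x_mul, map_add f, map_smul f, map_mul f, hf, mul_add,
      mul_smul_comm, ← mul_assoc, ← mul_assoc]
    congr 1
    · split_ifs <;> simp
    · simp [hu]
  · intro x y hx hy
    rw [map_add f, map_add, hx, hy, map_add, map_add f, mul_add]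
  · intro r x hx
    rw [map_smul f, map_smul, hx, map_smul, map_smul f, mul_smul_comm]

end Homs

/-! ### Triple tensor products -/

theorem tw_add (τ : Equiv.Perm ι) (μ ν : ι → ℕ) : tw τ (μ + ν) = tw τ μ + tw τ ν := rfl

theorem tw_single {τ : Equiv.Perm ι} (hτ : ∀ i, τ (τ i) = i) (i : ι) :
    tw τ (Pi.single i 1) = Pi.single (τ i) 1 := by
  funext j
  simp only [tw, Pi.single_apply]
  congr 1
  exact propext ⟨fun h => by rw [← h, hτ], fun h => by rw [h, hτ]⟩

theorem tw_zero (τ : Equiv.Perm ι) : tw τ 0 = 0 := rfl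

theorem size_tw (τ : Equiv.Perm ι) (μ : ι → ℕ) : size (tw τ μ) = size μ :=
  Equiv.sum_comp τ μ

theorem growing_tw (τ : Equiv.Perm ι) : Growing (tw τ) := fun μ => (size_tw τ μ).ge

theorem growing_tw_add (τ : Equiv.Perm ι) : Growing fun μ => tw τ μ + μ := fun μ => by
  rw [size_add]; omega

theorem up_single_pos (i : ι) : (0 : ι → ℤ) < up (Pi.single i 1) := by
  rw [up_single, α]
  exact Pi.single_pos.2 one_pos

theorem up_nonneg (μ : ι → ℕ) : (0 : ι → ℤ) ≤ up μ := fun i => Int.natCast_nonneg (μ i)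

theorem up_single_add_pos (i : ι) (μ : ι → ℕ) : (0 : ι → ℤ) < up (Pi.single i 1 + μ) := by
  rw [up_add]
  exact add_pos_of_pos_of_nonneg (up_single_pos i) (up_nonneg μ)

section Series

variable {χ : SymBichar k ι} {C : (ι → ℕ) → Nic χ ⊗[k] Nic χ} {A B : Type*} [Ring A] [Algebra k A]
  [Ring B] [Algebra k B] {d d' : (ι → ℕ) → (ι → ℕ)} {P Q : (ι → ℕ) → Nic χ ⊗[k] Nic χ →ₗ[k] A}

theorem Th_mul_single_zero (hd : Growing d) (r : A) :
    Th C d P * HahnSeries.single 0 r = Th C d fun μ => LinearMap.mulRight k r ∘ₗ P μ := by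
  have := Th_mul_single (C := C) (P := P) hd 0 r
  simpa only [up_zero, zero_add] using this

theorem single_zero_mul_Th (hd : Growing d) (r : A) :
    HahnSeries.single 0 r * Th C d P = Th C d fun μ => LinearMap.mulLeft k r ∘ₗ P μ := by
  have := single_mul_Th (C := C) (P := P) hd 0 r
  simpa only [up_zero, zero_add] using this

end Series

section RingSeries

variable {A B W : Type*} [Ring A] [Algebra k A] [Ring B] [Algebra k B] [Ring W] [Algebra k W]

/-- A linear map between algebras applied to the coefficients of a series. -/
def hr (f : A →ₗ[k] B) (x : HahnSeries (ι → ℤ) A) : HahnSeries (ι → ℤ) B := hm f x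

theorem hr_Th {χ : SymBichar k ι} {C : (ι → ℕ) → Nic χ ⊗[k] Nic χ} {d : (ι → ℕ) → (ι → ℕ)}
    {P : (ι → ℕ) → Nic χ ⊗[k] Nic χ →ₗ[k] A} (hd : Growing d) (g : A →ₗ[k] B) :
    hr g (Th C d P) = Th C d fun μ => g ∘ₗ P μ := hm_Th hd g

theorem hr_single (f : A →ₗ[k] B) (a : ι → ℤ) (r : A) :
    hr f (HahnSeries.single a r) = HahnSeries.single a (f r) := hm_single f a r

theorem hr_add (f : A →ₗ[k] B) (x y : HahnSeries (ι → ℤ) A) : hr f (x + y) = hr f x + hr f y :=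
  hm_add f x y

theorem hr_neg (f : A →ₗ[k] B) (x : HahnSeries (ι → ℤ) A) : hr f (-x) = - hr f x := hm_neg f x

theorem hr_mul (f : A →ₐ[k] B) (x y : HahnSeries (ι → ℤ) A) :
    hr f.toLinearMap (x * y) = hr f.toLinearMap x * hr f.toLinearMap y := hm_mul f x y

theorem hr_leibniz_right (D : A →ₗ[k] A) (s : A →ₐ[k] A)
    (h : ∀ x y, D (x * y) = x * D y + D x * s y) (x y : HahnSeries (ι → ℤ) A) :
    hr D (x * y) = x * hr D y + hr D x * hr s.toLinearMap y := hm_leibniz_right D s h x y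

theorem hr_leibniz_left (D : A →ₗ[k] A) (s : A →ₐ[k] A)
    (h : ∀ x y, D (x * y) = D x * y + s x * D y) (x y : HahnSeries (ι → ℤ) A) :
    hr D (x * y) = hr D x * y + hr s.toLinearMap x * hr D y := hm_leibniz_left D s h x y

theorem hr_ode_right (D : ι → A →ₗ[k] A) (ε : A →ₗ[k] W)
    (hD : ∀ r, (∀ i, D i r = 0) → ε r = 0 → r = 0) (G : ι → HahnSeries (ι → ℤ) A)
    (hG : ∀ i, PosSupp (G i)) {x y : HahnSeries (ι → ℤ) A}
    (hx : ∀ i, hr (D i) x = -(x * G i)) (hy : ∀ i, hr (D i) y = -(y * G i))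
    (h0 : hr ε x = hr ε y) : x = y := ode_right D ε hD G hG hx hy h0

theorem hr_ode_left (D : ι → A →ₗ[k] A) (ε : A →ₗ[k] W)
    (hD : ∀ r, (∀ i, D i r = 0) → ε r = 0 → r = 0) (G : ι → HahnSeries (ι → ℤ) A)
    (hG : ∀ i, PosSupp (G i)) {x y : HahnSeries (ι → ℤ) A}
    (hx : ∀ i, hr (D i) x = -(G i * x)) (hy : ∀ i, hr (D i) y = -(G i * y))
    (h0 : hr ε x = hr ε y) : x = y := ode_left D ε hD G hG hx hy h0

end RingSeries

theorem single_one_mul_comm {A : Type*} [Ring A] (a : ι → ℤ) (x : HahnSeries (ι → ℤ) A) :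
    HahnSeries.single a 1 * x = x * HahnSeries.single a 1 := by
  ext ν
  rw [HahnSeries.coeff_single_mul, HahnSeries.coeff_mul_single, one_mul, mul_one]

theorem single_mul_of_single_zero_mul {A : Type*} [Ring A] (a : ι → ℤ) {r r' : A}
    {x y : HahnSeries (ι → ℤ) A}
    (h : HahnSeries.single 0 r * x = y * HahnSeries.single 0 r') :
    HahnSeries.single a r * x = y * HahnSeries.single a r' := by
  have h1 : HahnSeries.single a r = HahnSeries.single a 1 * HahnSeries.single 0 r := by
    rw [HahnSeries.single_mul_single, add_zero, one_mul]
  have h2 : HahnSeries.single a r' = HahnSeries.single a 1 * HahnSeries.single 0 r' := by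
    rw [HahnSeries.single_mul_single, add_zero, one_mul]
  rw [h1, h2, mul_assoc, h, ← mul_assoc, single_one_mul_comm, mul_assoc]

theorem leibniz_rearrange {R : Type*} [Ring R] {x y z g₁ g₂ g₃ m s : R} (h : m * s = z * g₃) :
    x * (y * -(z * (g₁ + g₂)) + -(y * m) * s) = -(x * (y * z) * (g₁ + (g₂ + g₃))) := by
  rw [neg_mul, mul_assoc y, h]
  simp only [mul_add, mul_neg, mul_assoc]
  abel

section Triple

variable (χ : SymBichar k ι)

/-- The triple tensor product with the Nichols algebra as third factor. -/
abbrev R3 := U χ ⊗[k] (U χ ⊗[k] Nic χ)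

/-- The left skew derivation of the third factor. -/
def D3L (i : ι) : R3 χ →ₗ[k] R3 χ :=
  LinearMap.lTensor (U χ) (LinearMap.lTensor (U χ) (dL χ i))

/-- The right skew derivation of the third factor. -/
def D3R (i : ι) : R3 χ →ₗ[k] R3 χ :=
  LinearMap.lTensor (U χ) (LinearMap.lTensor (U χ) (dR χ i))

/-- The action of `K_i` on the third factor. -/
def S3 (i : ι) : R3 χ →ₐ[k] R3 χ :=
  Algebra.TensorProduct.map (AlgHom.id k _) (Algebra.TensorProduct.map (AlgHom.id k _) (S χ (α i)))

/-- The counit of the third factor. -/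
def eps3 : R3 χ →ₐ[k] U χ ⊗[k] (U χ ⊗[k] k) :=
  Algebra.TensorProduct.map (AlgHom.id k _) (Algebra.TensorProduct.map (AlgHom.id k _) (epsN χ))

@[simp] theorem D3L_tmul (i : ι) (x y : U χ) (u : Nic χ) :
    D3L χ i (x ⊗ₜ[k] (y ⊗ₜ[k] u)) = x ⊗ₜ[k] (y ⊗ₜ[k] dL χ i u) := by
  rw [D3L, LinearMap.lTensor_tmul, LinearMap.lTensor_tmul]

@[simp] theorem D3R_tmul (i : ι) (x y : U χ) (u : Nic χ) :
    D3R χ i (x ⊗ₜ[k] (y ⊗ₜ[k] u)) = x ⊗ₜ[k] (y ⊗ₜ[k] dR χ i u) := by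
  rw [D3R, LinearMap.lTensor_tmul, LinearMap.lTensor_tmul]

theorem D3L_tmul' (i : ι) (x : U χ) (z : U χ ⊗[k] Nic χ) :
    D3L χ i (x ⊗ₜ[k] z) = x ⊗ₜ[k] LinearMap.lTensor (U χ) (dL χ i) z := by
  rw [D3L, LinearMap.lTensor_tmul]

theorem D3R_tmul' (i : ι) (x : U χ) (z : U χ ⊗[k] Nic χ) :
    D3R χ i (x ⊗ₜ[k] z) = x ⊗ₜ[k] LinearMap.lTensor (U χ) (dR χ i) z := by
  rw [D3R, LinearMap.lTensor_tmul]

@[simp] theorem S3_tmul (i : ι) (x y : U χ) (u : Nic χ) :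
    S3 χ i (x ⊗ₜ[k] (y ⊗ₜ[k] u)) = x ⊗ₜ[k] (y ⊗ₜ[k] S χ (α i) u) := by
  simp [S3]

@[simp] theorem eps3_tmul (x y : U χ) (u : Nic χ) :
    eps3 χ (x ⊗ₜ[k] (y ⊗ₜ[k] u)) = x ⊗ₜ[k] (y ⊗ₜ[k] epsN χ u) := by
  simp [eps3]

variable {χ}

theorem R3_induction {P : R3 χ → Prop} (zero : P 0) (tmul : ∀ x y u, P (x ⊗ₜ[k] (y ⊗ₜ[k] u)))
    (add : ∀ r s, P r → P s → P (r + s)) (r : R3 χ) : P r := by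
  induction r using TensorProduct.induction_on with
  | zero => exact zero
  | add r s hr hs => exact add r s hr hs
  | tmul x z =>
    induction z using TensorProduct.induction_on with
    | zero => rw [TensorProduct.tmul_zero]; exact zero
    | add r s hr hs => rw [TensorProduct.tmul_add]; exact add _ _ hr hs
    | tmul y u => exact tmul x y u

theorem D3R_mul (i : ι) (r s : R3 χ) : D3R χ i (r * s) = r * D3R χ i s + D3R χ i r * S3 χ i s := by
  induction r using R3_induction with
  | zero => simp
  | add r r' hr hr' => rw [add_mul, map_add, hr, hr', map_add, add_mul, add_mul]; abel
  | tmul x y u =>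
    induction s using R3_induction with
    | zero => simp
    | add r r' hr hr' => rw [mul_add, map_add, hr, hr', map_add, map_add, mul_add, mul_add]; abel
    | tmul x' y' u' =>
      simp only [Algebra.TensorProduct.tmul_mul_tmul, D3R_tmul, S3_tmul, dR_mul,
        TensorProduct.tmul_add]

theorem D3L_mul (i : ι) (r s : R3 χ) : D3L χ i (r * s) = D3L χ i r * s + S3 χ i r * D3L χ i s := by
  induction r using R3_induction with
  | zero => simp
  | add r r' hr hr' =>
    rw [add_mul, map_add, hr, hr', map_add (D3L χ i), map_add (S3 χ i), add_mul, add_mul]; abel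
  | tmul x y u =>
    induction s using R3_induction with
    | zero => simp
    | add r r' hr hr' => rw [mul_add, map_add, hr, hr', map_add, mul_add, mul_add]; abel
    | tmul x' y' u' =>
      simp only [Algebra.TensorProduct.tmul_mul_tmul, D3L_tmul, S3_tmul, dL_mul,
        TensorProduct.tmul_add]

theorem R3_separating (D : ι → Nic χ →ₗ[k] Nic χ)
    (hD : ∀ u, epsN χ u = 0 → (∀ i, D i u = 0) → u = 0) (r : R3 χ)
    (h : ∀ i, LinearMap.lTensor (U χ) (LinearMap.lTensor (U χ) (D i)) r = 0)
    (h0 : eps3 χ r = 0) : r = 0 := by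
  let g : Option ι → Nic χ →ₗ[k] Nic χ := fun j =>
    j.elim (Algebra.linearMap k (Nic χ) ∘ₗ (epsN χ).toLinearMap) D
  have hg : ∀ u, (∀ j, g j u = 0) → u = 0 := fun u hu => by
    refine hD u ?_ fun i => hu (some i)
    have h1 : algebraMap k (Nic χ) (epsN χ u) = 0 := hu none
    have h2 := congrArg (epsN χ) h1
    rwa [AlgHom.commutes, map_zero] at h2
  have hg' := lTensor_separating (V := U χ) (M := fun _ => Nic χ) g hg
  refine lTensor_separating (V := U χ) (M := fun _ => U χ ⊗[k] Nic χ)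
    (fun j => LinearMap.lTensor (U χ) (g j)) hg' r fun j => ?_
  cases j with
  | some i => exact h i
  | none =>
    have h1 : ∀ r, LinearMap.lTensor (U χ) (LinearMap.lTensor (U χ) (g none)) r =
        LinearMap.lTensor (U χ) (LinearMap.lTensor (U χ) (Algebra.linearMap k (Nic χ)))
          (eps3 χ r) := by
      intro r
      induction r using R3_induction with
      | zero => simp
      | add r s hr hs => rw [map_add, hr, hs, map_add (eps3 χ), map_add]
      | tmul x y u => simp [g]
    rw [h1, h0, map_zero]

theorem D3R_separating (r : R3 χ) (h : ∀ i, D3R χ i r = 0) (h0 : (eps3 χ).toLinearMap r = 0) :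
    r = 0 :=
  R3_separating (dR χ) (fun _ => eq_zero_of_dR χ) r h h0

theorem D3L_separating (r : R3 χ) (h : ∀ i, D3L χ i r = 0) (h0 : (eps3 χ).toLinearMap r = 0) :
    r = 0 :=
  R3_separating (dL χ) (fun _ => eq_zero_of_dL χ) r h h0

end Triple

/-! ### The coproduct of the second leg -/

section IdComul

variable {χ : SymBichar k ι} {C : (ι → ℕ) → Nic χ ⊗[k] Nic χ} {τ : Equiv.Perm ι} {c : ι → k}
  {b : Nic χ →ₗ[k] U χ} {s : Nic χ →ₐ[k] U χ} {Δ δ : Nic χ →ₐ[k] U χ ⊗[k] Nic χ}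

variable (τ s) in
/-- The summands of `Θ^σ̄_{K23}`. -/
def sigma23 (μ : ι → ℕ) : Nic χ ⊗[k] Nic χ →ₗ[k] R3 χ :=
  TensorProduct.mk k _ _ (K χ (up μ - up (tw τ μ))) ∘ₗ
    TensorProduct.map s.toLinearMap LinearMap.id

theorem sigma23_tmul (μ : ι → ℕ) (f e : Nic χ) : sigma23 τ s μ (f ⊗ₜ[k] e) =
    K χ (up μ - up (tw τ μ)) ⊗ₜ[k] (s f ⊗ₜ[k] e) := by
  simp [sigma23]

theorem D3R_sigma23 (hC : IsCan χ C) (hτ : ∀ i, τ (τ i) = i) (i : ι) :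
    hr (D3R χ i) (Th C (fun μ => tw τ μ + μ) (sigma23 τ s)) =
      -(Th C (fun μ => tw τ μ + μ) (sigma23 τ s) *
        HahnSeries.single (up (Pi.single i 1 + Pi.single (τ i) 1))
          (K χ (α i - α (τ i)) ⊗ₜ[k] (s (nx χ i) ⊗ₜ[k] 1))) := by
  have h1 : hr (D3R χ i) (Th C (fun μ => tw τ μ + μ) (sigma23 τ s)) =
      Th C (fun μ => tw τ μ + μ) fun μ => sigma23 τ s μ ∘ₗ LinearMap.lTensor _ (dR χ i) := by
    rw [hr_Th (growing_tw_add τ)]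
    refine Th_ext hC (fun _ => rfl) fun μ f _ e _ => ?_
    rw [LinearMap.comp_apply, LinearMap.comp_apply, LinearMap.lTensor_tmul, sigma23_tmul,
      sigma23_tmul, D3R_tmul]
  rw [h1, Th_shift_lTensor_dR hC (growing_tw_add τ), Th_mul_single (growing_tw_add τ)]
  congr 1
  refine Th_ext hC (fun μ => ?_) fun μ f _ e _ => ?_
  · rw [tw_add, tw_single hτ]
    abel
  · rw [LinearMap.comp_apply, LinearMap.comp_apply, LinearMap.rTensor_tmul, sigma23_tmul,
      sigma23_tmul, LinearMap.mulRight_apply, LinearMap.mulRight_apply,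
      Algebra.TensorProduct.tmul_mul_tmul, Algebra.TensorProduct.tmul_mul_tmul, ← K_add,
      map_mul s, mul_one, tw_add, tw_single hτ, up_add, up_add, up_single, up_single]
    congr 2
    abel

theorem E_K_commute (hb : PsiLift χ τ c b) (hτ : ∀ i, τ (τ i) = i)
    (hχτ : ∀ i j, χ.q (τ i) (τ j) = χ.q i j) {μ : ι → ℕ} {f : Nic χ} (hf : f ∈ Nwt χ μ) (i : ι) :
    b f * K χ (α i - α (τ i)) = (χ.val (α i) (up μ) * (χ.val (α (τ i)) (up μ))⁻¹) •
      (K χ (α i - α (τ i)) * b f) := by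
  rw [hb.mul_K hχτ (comp_of_mem_Qθ hτ (sub_mem_Qθ τ i)), S_of_mem hf, map_smul, mul_smul_comm,
    val_sub_left]

theorem sigma_mul_S3 (hC : IsCan χ C) (hb : PsiLift χ τ c b) (hτ : ∀ i, τ (τ i) = i)
    (hχτ : ∀ i j, χ.q (τ i) (τ j) = χ.q i j)
    (hs : ∀ i, s (nx χ i) = c (τ i) • (K χ (α i) * E χ (τ i)))
    (hδ : ∀ i, δ (nx χ i) = K χ (α i) ⊗ₜ[k] nx χ i) (i : ι) :
    HahnSeries.single 0 (K χ (α i - α (τ i)) ⊗ₜ[k] (s (nx χ i) ⊗ₜ[k] (1 : Nic χ))) *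
        hr (S3 χ i).toLinearMap (Th C id fun _ => TensorProduct.map b δ.toLinearMap) =
      (Th C id fun _ => TensorProduct.map b δ.toLinearMap) * HahnSeries.single 0
        ((c (τ i) * χ.q i (τ i)) •
          (K χ (α i - α (τ i)) ⊗ₜ[k] ((E χ (τ i) * K χ (α i)) ⊗ₜ[k] (1 : Nic χ)))) := by
  rw [hr_Th growing_id, single_zero_mul_Th growing_id, Th_mul_single_zero growing_id]
  refine Th_ext hC (fun _ => rfl) fun μ f hf e he => ?_
  have h1 : K χ (α i) * E χ (τ i) * K χ (up μ) =
      χ.q i (τ i) • (E χ (τ i) * (K χ (α i) * K χ (up μ))) := by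
    rw [K_mul_E, smul_mul_assoc, mul_assoc, SymBichar.q]
  have h2 : K χ (up μ) * (E χ (τ i) * K χ (α i)) =
      χ.val (α (τ i)) (up μ) • (E χ (τ i) * (K χ (α i) * K χ (up μ))) := by
    rw [← mul_assoc, K_mul_E, smul_mul_assoc, mul_assoc, K_comm, val_symm]
  simp only [LinearMap.comp_apply, TensorProduct.map_tmul, AlgHom.toLinearMap_apply,
    tensor_hom_apply (K_zero χ) (K_add χ) hδ he, S3_tmul, S_of_mem he, LinearMap.mulLeft_apply,
    LinearMap.mulRight_apply, Algebra.TensorProduct.tmul_mul_tmul, mul_smul_comm, one_mul, mul_one,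
    hs, smul_mul_assoc, h1, h2, E_K_commute hb hτ hχτ hf, TensorProduct.tmul_smul,
    ← TensorProduct.smul_tmul', smul_smul]
  congr 1
  have := val_ne_zero χ (α (τ i)) (up μ)
  field_simp

theorem id_comul_theta (hC : IsCan χ C) (hb : PsiLift χ τ c b) (hτ : ∀ i, τ (τ i) = i)
    (hχτ : ∀ i j, χ.q (τ i) (τ j) = χ.q i j)
    (hs : ∀ i, s (nx χ i) = c (τ i) • (K χ (α i) * E χ (τ i)))
    (hδ : ∀ i, δ (nx χ i) = K χ (α i) ⊗ₜ[k] nx χ i)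
    (hΔ : ∀ i, Δ (nx χ i) = E χ i ⊗ₜ[k] 1 + K χ (α i) ⊗ₜ[k] nx χ i) :
    (Th C id fun _ => TensorProduct.map b Δ.toLinearMap) =
      (Th C id fun _ => TensorProduct.map b ((Algebra.TensorProduct.includeLeft :
          U χ →ₐ[k] U χ ⊗[k] Nic χ).comp (nE χ)).toLinearMap) *
        Th C (fun μ => tw τ μ + μ) (sigma23 τ s) *
        Th C id fun _ => TensorProduct.map b δ.toLinearMap := by
  have hδ0 : ∀ i, δ (nx χ i) = (0 : U χ) ⊗ₜ[k] 1 + K χ (α i) ⊗ₜ[k] nx χ i := fun i => by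
    rw [hδ, TensorProduct.zero_tmul, zero_add]
  have hD : ∀ {w : ι → U χ} {Φ : Nic χ →ₐ[k] U χ ⊗[k] Nic χ}
      (_ : ∀ i, Φ (nx χ i) = w i ⊗ₜ[k] 1 + K χ (α i) ⊗ₜ[k] nx χ i) (i : ι)
      (_ : ∀ j, w j * K χ (α i) = (χ.q i j)⁻¹ • (K χ (α i) * w j)),
      hr (D3R χ i) (Th C id fun _ => TensorProduct.map b Φ.toLinearMap) =
      -((Th C id fun _ => TensorProduct.map b Φ.toLinearMap) *
        (HahnSeries.single (up (Pi.single i 1)) (Bgen χ τ c i ⊗ₜ[k] (K χ (α i) ⊗ₜ[k] (1 : Nic χ))) +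
          HahnSeries.single (up (Pi.single i 1 + Pi.single (τ i) 1))
            ((c (τ i) * χ.q i (τ i)) • (K χ (α i - α (τ i)) ⊗ₜ[k]
              (Φ (nx χ (τ i)) * (K χ (α i) ⊗ₜ[k] 1)))))) := by
    intro w Φ hΦ i hw
    have h1 : hr (D3R χ i) (Th C id fun _ => TensorProduct.map b Φ.toLinearMap) =
        Th C id (fun _ => TensorProduct.map b Φ.toLinearMap ∘ₗ LinearMap.lTensor _ (dR χ i)) *
          HahnSeries.single 0 (1 ⊗ₜ[k] (K χ (α i) ⊗ₜ[k] (1 : Nic χ))) := by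
      rw [hr_Th growing_id, Th_mul_single_zero growing_id]
      refine Th_ext hC (fun _ => rfl) fun μ f _ e _ => ?_
      rw [LinearMap.comp_apply, LinearMap.comp_apply, LinearMap.comp_apply, LinearMap.lTensor_tmul,
        TensorProduct.map_tmul, TensorProduct.map_tmul, AlgHom.toLinearMap_apply, D3R_tmul',
        lTensor_dR_hom χ hΦ i hw (fun j => K_comm χ _ _), LinearMap.mulRight_apply,
        Algebra.TensorProduct.tmul_mul_tmul, mul_one, AlgHom.toLinearMap_apply]
    rw [h1, Th_dR hC hb hτ hχτ, neg_mul, mul_assoc, add_mul, HahnSeries.single_mul_single,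
      HahnSeries.single_mul_single, add_zero, add_zero, smul_mul_assoc,
      Algebra.TensorProduct.tmul_mul_tmul, Algebra.TensorProduct.tmul_mul_tmul, mul_one, mul_one,
      one_mul]
  refine hr_ode_right (W := U χ ⊗[k] (U χ ⊗[k] k)) (D3R χ) (eps3 χ).toLinearMap
    (fun r => D3R_separating r)
    (fun i => HahnSeries.single (up (Pi.single i 1))
        (Bgen χ τ c i ⊗ₜ[k] (K χ (α i) ⊗ₜ[k] (1 : Nic χ))) +
      HahnSeries.single (up (Pi.single i 1 + Pi.single (τ i) 1))
        ((c (τ i) * χ.q i (τ i)) • (K χ (α i - α (τ i)) ⊗ₜ[k]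
          (Δ (nx χ (τ i)) * (K χ (α i) ⊗ₜ[k] 1)))))
    (fun i => (PosSupp.single (up_single_pos i) _).add (PosSupp.single (up_single_add_pos i _) _))
    (fun i => hD hΔ i fun j => ?_) (fun i => ?_) ?_
  · rw [K_mul_E, smul_smul, SymBichar.q, inv_mul_cancel₀ (val_ne_zero _ _ _), one_smul]
  · have h12 : hr (D3R χ i) (Th C id fun _ => TensorProduct.map b
        ((Algebra.TensorProduct.includeLeft : U χ →ₐ[k] U χ ⊗[k] Nic χ).comp
          (nE χ)).toLinearMap) = 0 := by
      rw [hr_Th growing_id, Th_ext (Q := fun _ => 0) (d' := id) hC (fun _ => rfl)]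
      · simp [Th, formalSum]
        rfl
      · intro μ f _ e _
        simp
    rw [mul_assoc, hr_leibniz_right _ _ (D3R_mul i), hr_leibniz_right _ _ (D3R_mul i), h12,
      zero_mul, add_zero, D3R_sigma23 hC hτ, hD hδ0 i (fun j => by simp)]
    have hcomm := sigma_mul_S3 hC hb hτ hχτ hs hδ i
    have hsum : (c (τ i) * χ.q i (τ i)) • (K χ (α i - α (τ i)) ⊗ₜ[k]
          (Δ (nx χ (τ i)) * (K χ (α i) ⊗ₜ[k] 1))) =
        (c (τ i) * χ.q i (τ i)) • (K χ (α i - α (τ i)) ⊗ₜ[k]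
          (δ (nx χ (τ i)) * (K χ (α i) ⊗ₜ[k] 1))) +
        (c (τ i) * χ.q i (τ i)) • (K χ (α i - α (τ i)) ⊗ₜ[k]
          ((E χ (τ i) * K χ (α i)) ⊗ₜ[k] (1 : Nic χ))) := by
      rw [← smul_add, ← TensorProduct.tmul_add, hΔ, hδ, add_mul,
        Algebra.TensorProduct.tmul_mul_tmul (E χ (τ i)), mul_one, add_comm]
    have hmove : HahnSeries.single (up (Pi.single i 1 + Pi.single (τ i) 1))
          (K χ (α i - α (τ i)) ⊗ₜ[k] (s (nx χ i) ⊗ₜ[k] (1 : Nic χ))) *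
        hr (S3 χ i).toLinearMap (Th C id fun _ => TensorProduct.map b δ.toLinearMap) =
      (Th C id fun _ => TensorProduct.map b δ.toLinearMap) *
        HahnSeries.single (up (Pi.single i 1 + Pi.single (τ i) 1))
          ((c (τ i) * χ.q i (τ i)) • (K χ (α i - α (τ i)) ⊗ₜ[k]
            ((E χ (τ i) * K χ (α i)) ⊗ₜ[k] (1 : Nic χ)))) := by
      exact single_mul_of_single_zero_mul _ hcomm
    rw [hsum, HahnSeries.single_add]
    exact leibniz_rearrange hmove
  · have h0 : ∀ {μ : ι → ℕ}, μ ≠ 0 → ∀ e ∈ Nwt χ μ, epsN χ e = 0 := fun h e he => epsN_of_mem he h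
    have e1 : hr (k := k) (B := U χ ⊗[k] (U χ ⊗[k] k)) (eps3 χ).toLinearMap (Th C id fun _ => TensorProduct.map b δ.toLinearMap) = 1 := by
      rw [hr_Th growing_id]
      refine Th_eq_one hC rfl ?_ fun μ hμ f _ e he => ?_
      · simp only [LinearMap.comp_apply, TensorProduct.map_tmul, hb.one, AlgHom.toLinearMap_apply]
        rw [map_one δ, Algebra.TensorProduct.one_def, eps3_tmul, map_one (epsN χ)]
        rfl
      · simp only [LinearMap.comp_apply, TensorProduct.map_tmul, AlgHom.toLinearMap_apply]
        rw [tensor_hom_apply (K_zero χ) (K_add χ) hδ he, eps3_tmul,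
          h0 hμ e he, TensorProduct.tmul_zero, TensorProduct.tmul_zero]
    have e2 : hr (k := k) (B := U χ ⊗[k] (U χ ⊗[k] k)) (eps3 χ).toLinearMap (Th C (fun μ => tw τ μ + μ) (sigma23 τ s)) = 1 := by
      rw [hr_Th (growing_tw_add τ)]
      refine Th_eq_one hC rfl ?_ fun μ hμ f _ e he => ?_
      · rw [LinearMap.comp_apply, sigma23_tmul, map_one s, tw_zero, sub_self, K_zero,
          AlgHom.toLinearMap_apply, eps3_tmul, map_one (epsN χ)]
        rfl
      · rw [LinearMap.comp_apply, sigma23_tmul, AlgHom.toLinearMap_apply, eps3_tmul,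
          h0 hμ e he, TensorProduct.tmul_zero, TensorProduct.tmul_zero]
    rw [hr_mul, hr_mul, e1, e2, mul_one, mul_one, hr_Th growing_id, hr_Th growing_id]
    refine Th_ext hC (fun _ => rfl) fun μ f _ e _ => ?_
    have h1 : (Algebra.TensorProduct.map (AlgHom.id k (U χ)) (epsN χ)).comp Δ =
        (Algebra.TensorProduct.map (AlgHom.id k (U χ)) (epsN χ)).comp
          ((Algebra.TensorProduct.includeLeft : U χ →ₐ[k] U χ ⊗[k] Nic χ).comp (nE χ)) := by
      refine Nic_algHom_ext fun i => ?_
      simp [hΔ]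
    have h2 := DFunLike.congr_fun h1 e
    rw [LinearMap.comp_apply, LinearMap.comp_apply, TensorProduct.map_tmul, TensorProduct.map_tmul,
      AlgHom.toLinearMap_apply, AlgHom.toLinearMap_apply, AlgHom.toLinearMap_apply, eps3,
      Algebra.TensorProduct.map_tmul, Algebra.TensorProduct.map_tmul]
    congr 1

end IdComul

/-! ### The coproduct of the first leg -/

section TwistedSigma

variable {χ : SymBichar k ι} {τ : Equiv.Perm ι} {c : ι → k}

variable (χ τ c) in
/-- The family of maps `u_f` with `σ̄(f) = K_μ u_f` for `f` of degree `-μ`. -/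
structure IsTwistedSigma (t : Nic χ →ₗ[k] Nic χ) : Prop where
  one : t 1 = 1
  x_mul : ∀ j f, t (nx χ j * f) = c (τ j) • (nx χ (τ j) * S χ (-α j) (t f))

theorem exists_twistedSigma (hτ : ∀ i, τ (τ i) = i) (hχτ : ∀ i j, χ.q (τ i) (τ j) = χ.q i j)
    (c : ι → k) : ∃ t, IsTwistedSigma χ τ c t := by
  have hS : ∀ i j (u : Nic χ), S χ (-α j) (nx χ (τ i) * u) =
      (χ.val (α j) (α (τ i)))⁻¹ • (nx χ (τ i) * S χ (-α j) u) := fun i j u => by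
    rw [map_mul (S χ _), S_x, val_neg_left, smul_mul_assoc]
  have hkill : ∀ p ∈ Imax χ, FreeAlgebra.lift k (fun j => (c (τ j) •
      (LinearMap.mulLeft k (nx χ (τ j)) ∘ₗ (S χ (-α j)).toLinearMap) : Module.End k (Nic χ)))
        p = 0 := by
    refine graded_kill_twisted _
      (FreeAlgebra.lift k fun i => (LinearMap.mulLeft k (nx χ (τ i)) : Module.End k (Nic χ)))
      (fun j => (c (τ j) * χ.val (α j) (α (τ j))) • (S χ (-α j)).toLinearMap)
      (fun i j => χ.val (α j) (α (τ i))) (fun i j => q_perm_symm χ hτ hχτ i j) ?_ ?_ ?_ (Imax χ)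
      (Imax_isGradedBiideal χ).graded (fun p hp => lift_mulLeft_perm_kill χ hχτ p hp)
    · intro i
      ext u
      simp only [FreeAlgebra.lift_ι_apply, Module.End.mul_apply, LinearMap.smul_apply,
        LinearMap.comp_apply, AlgHom.toLinearMap_apply, LinearMap.mulLeft_apply, hS, smul_smul,
        mul_assoc, mul_inv_cancel₀ (val_ne_zero χ (α i) (α (τ i))), mul_one]
    · intro i j
      ext u
      simp only [Module.End.mul_apply, LinearMap.smul_apply, AlgHom.toLinearMap_apply, map_smul,
        smul_smul, ← S_add]
      rw [mul_comm, add_comm]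
    · intro i j
      ext u
      simp only [FreeAlgebra.lift_ι_apply, Module.End.mul_apply, LinearMap.smul_apply,
        AlgHom.toLinearMap_apply, LinearMap.mulLeft_apply, hS, mul_smul_comm, smul_smul]
      congr 1
      have := val_ne_zero χ (α j) (α (τ i))
      field_simp
  refine ⟨LinearMap.applyₗ (1 : Nic χ) ∘ₗ (liftN χ _ hkill).toLinearMap, ?_, fun j f => ?_⟩
  · rw [LinearMap.comp_apply, AlgHom.toLinearMap_apply, map_one (liftN χ _ hkill)]
    rfl
  · rw [LinearMap.comp_apply, AlgHom.toLinearMap_apply, map_mul (liftN χ _ hkill)]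
    have : liftN χ _ hkill (nx χ j) = (c (τ j) •
      (LinearMap.mulLeft k (nx χ (τ j)) ∘ₗ (S χ (-α j)).toLinearMap) : Module.End k (Nic χ)) := by
      rw [nx, liftN_mk, FreeAlgebra.lift_ι_apply]
    rw [this]
    rfl

namespace IsTwistedSigma

variable {t : Nic χ →ₗ[k] Nic χ}

theorem mem (ht : IsTwistedSigma χ τ c t) (hτ : ∀ i, τ (τ i) = i) {μ : ι → ℕ} {f : Nic χ}
    (hf : f ∈ Nwt χ μ) : t f ∈ Nwt χ (tw τ μ) := by
  refine Nwt_word_induction (P := fun μ f => t f ∈ Nwt χ (tw τ μ)) ?_ ?_ ?_ ?_ ?_ hf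
  · rw [ht.one]; exact one_mem_Nwt χ
  · intro j μ f _ h
    rw [ht.x_mul, tw_add, tw_single hτ, S_of_mem h, mul_smul_comm]
    exact Submodule.smul_mem _ _ (Submodule.smul_mem _ _ (x_mul_mem_Nwt h _))
  · intro μ; rw [map_zero]; exact Submodule.zero_mem _
  · intro μ f g hf hg; rw [map_add]; exact Submodule.add_mem _ hf hg
  · intro μ r f hf; rw [map_smul]; exact Submodule.smul_mem _ _ hf

theorem val_tw (hτ : ∀ i, τ (τ i) = i) (hχτ : ∀ i j, χ.q (τ i) (τ j) = χ.q i j) (i : ι)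
    (μ : ι → ℕ) : χ.val (α (τ i)) (up (tw τ μ)) = χ.val (α i) (up μ) := by
  have h := val_comp_perm χ hχτ (α i) (up μ)
  rw [← h]
  congr 1
  have := α_comp (τ := τ) (τ i)
  rw [hτ] at this
  exact this.symm

theorem map_S (ht : IsTwistedSigma χ τ c t) (hτ : ∀ i, τ (τ i) = i)
    (hχτ : ∀ i j, χ.q (τ i) (τ j) = χ.q i j) (i : ι) (f : Nic χ) :
    t (S χ (-α i) f) = S χ (-α (τ i)) (t f) := by
  induction f using Nwt_induction with
  | hw μ f hf =>
    rw [S_of_mem hf, S_of_mem (ht.mem hτ hf), map_smul, val_neg_left, val_neg_left,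
      val_tw hτ hχτ]
  | add f g hf hg => simp only [map_add, hf, hg]

theorem sigma_eq (ht : IsTwistedSigma χ τ c t) (hτ : ∀ i, τ (τ i) = i)
    (hχτ : ∀ i j, χ.q (τ i) (τ j) = χ.q i j) {s : Nic χ →ₐ[k] U χ}
    (hs : ∀ i, s (nx χ i) = c (τ i) • (K χ (α i) * E χ (τ i))) {μ : ι → ℕ} {f : Nic χ}
    (hf : f ∈ Nwt χ μ) : s f = K χ (up μ) * nE χ (t f) := by
  refine (Nwt_word_induction (P := fun μ f => f ∈ Nwt χ μ ∧ s f = K χ (up μ) * nE χ (t f))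
    ?_ ?_ ?_ ?_ ?_ hf).2
  · rw [map_one s, ht.one, map_one (nE χ), up_zero, K_zero, mul_one]
    exact ⟨one_mem_Nwt χ, rfl⟩
  · rintro j μ f - ⟨hf, h⟩
    refine ⟨x_mul_mem_Nwt hf j, ?_⟩
    have h1 : E χ (τ j) * K χ (up μ) = (χ.val (up μ) (α (τ j)))⁻¹ • (K χ (up μ) * E χ (τ j)) := by
      rw [K_mul_E, smul_smul, inv_mul_cancel₀ (val_ne_zero _ _ _), one_smul]
    have h2 := val_tw hτ hχτ (τ j) μ
    rw [hτ] at h2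
    rw [map_mul s, hs, h, ht.x_mul, S_of_mem (ht.mem hτ hf), map_smul (nE χ), map_mul (nE χ),
      map_smul (nE χ), nE_x, up_add, up_single, K_add, val_neg_left, h2, val_symm]
    simp only [smul_mul_assoc, mul_smul_comm, mul_assoc]
    rw [← mul_assoc (E χ (τ j)), h1, smul_mul_assoc, mul_smul_comm, mul_assoc]
  · intro μ; simp
  · rintro μ f g ⟨hf, h1⟩ ⟨hg, h2⟩
    refine ⟨Submodule.add_mem _ hf hg, ?_⟩
    rw [map_add s, h1, h2, map_add t, map_add (nE χ), mul_add]
  · rintro μ r f ⟨hf, h1⟩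
    refine ⟨Submodule.smul_mem _ _ hf, ?_⟩
    rw [map_smul s, h1, map_smul t, map_smul (nE χ), mul_smul_comm]

theorem dL (ht : IsTwistedSigma χ τ c t) (hτ : ∀ i, τ (τ i) = i)
    (hχτ : ∀ i j, χ.q (τ i) (τ j) = χ.q i j) (i : ι) (f : Nic χ) :
    dL χ i (t f) = (c i * χ.q i (τ i)) • t (dL χ (τ i) (S χ (-α i) f)) := by
  refine Nic_induction (P := fun f => SymPair.dL χ i (t f) =
    (c i * χ.q i (τ i)) • t (SymPair.dL χ (τ i) (S χ (-α i) f))) ?_ ?_ ?_ ?_ f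
  · rw [ht.one, map_one (S χ _), dL_one, dL_one, map_zero, smul_zero]
  · intro j f hf
    have hq : χ.q i (τ j) = χ.q (τ i) j := by
      have := hχτ i (τ j)
      rwa [hτ, eq_comm] at this
    rw [ht.x_mul, map_smul, dL_x_mul, map_mul (S χ _), S_x, smul_mul_assoc, map_smul, map_smul,
      dL_x_mul, dL_S, hf, map_add, map_smul t (χ.q (τ i) j), ht.x_mul, ← hq, val_neg_left,
      val_neg_left]
    rw [smul_add, smul_add, smul_add]
    congr 1
    · by_cases h : i = τ j
      · subst h
        rw [if_pos rfl, if_pos (hτ j), ht.map_S hτ hχτ, hτ, smul_smul, SymBichar.q]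
        congr 1
        have := val_ne_zero χ (α (τ j)) (α j)
        field_simp
      · rw [if_neg h, if_neg (fun h' => h (by rw [← h', hτ])), map_zero, smul_zero, smul_zero,
          smul_zero]
    · simp only [map_smul, mul_smul_comm, smul_smul]
      congr 1
      rw [val_symm χ (α j) (α i)]
      ring
  · intro f g hf hg
    simp only [map_add, hf, hg, smul_add]
  · intro r f hf
    simp only [map_smul, hf]
    rw [smul_comm]

end IsTwistedSigma

end TwistedSigma

section ComulId

variable {χ : SymBichar k ι} {C : (ι → ℕ) → Nic χ ⊗[k] Nic χ} {τ : Equiv.Perm ι} {c : ι → k}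
  {b : Nic χ →ₗ[k] U χ} {t : Nic χ →ₗ[k] Nic χ} {γ : Nic χ →ₐ[k] U χ ⊗[k] Nic χ}

theorem E_mul_theta (hC : IsCan χ C) (a : ι) :
    (Th C id fun _ => TensorProduct.map (nF χ).toLinearMap (AlgHom.id k (Nic χ)).toLinearMap) *
        (HahnSeries.single 0 (E χ a ⊗ₜ[k] (1 : Nic χ)) +
          HahnSeries.single (up (Pi.single a 1)) (K χ (-α a) ⊗ₜ[k] nx χ a)) =
      (HahnSeries.single 0 (E χ a ⊗ₜ[k] (1 : Nic χ)) +
          HahnSeries.single (up (Pi.single a 1)) (K χ (α a) ⊗ₜ[k] nx χ a)) *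
        Th C id fun _ => TensorProduct.map (nF χ).toLinearMap (AlgHom.id k (Nic χ)).toLinearMap := by
  set M := TensorProduct.map (nF χ).toLinearMap (AlgHom.id k (Nic χ)).toLinearMap with hM
  have h1 : HahnSeries.single 0 (E χ a ⊗ₜ[k] (1 : Nic χ)) * Th C id (fun _ => M) =
      Th C id (fun _ => M) * HahnSeries.single 0 (E χ a ⊗ₜ[k] (1 : Nic χ)) +
      (Th C id (fun _ => (LinearMap.mulLeft k (K χ (α a) ⊗ₜ[k] (1 : Nic χ)) ∘ₗ M) ∘ₗ
        LinearMap.rTensor _ (dL χ a)) +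
      Th C id (fun _ => (LinearMap.mulRight k (-(K χ (-α a) ⊗ₜ[k] (1 : Nic χ))) ∘ₗ M) ∘ₗ
        LinearMap.rTensor _ (dR χ a))) := by
    rw [single_zero_mul_Th growing_id, Th_mul_single_zero growing_id, ← Th_add growing_id,
      ← Th_add growing_id]
    refine Th_ext hC (fun _ => rfl) fun μ f _ e _ => ?_
    simp only [hM, LinearMap.add_apply, LinearMap.comp_apply, TensorProduct.map_tmul,
      LinearMap.rTensor_tmul, AlgHom.toLinearMap_apply, LinearMap.mulLeft_apply,
      LinearMap.mulRight_apply, mul_neg, Algebra.TensorProduct.tmul_mul_tmul, one_mul, mul_one,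
      E_mul_nF, TensorProduct.add_tmul, TensorProduct.sub_tmul]
    abel
  have h2 : Th C id (fun _ => (LinearMap.mulLeft k (K χ (α a) ⊗ₜ[k] (1 : Nic χ)) ∘ₗ M) ∘ₗ
        LinearMap.rTensor _ (dL χ a)) =
      -(HahnSeries.single (up (Pi.single a 1)) (K χ (α a) ⊗ₜ[k] nx χ a) * Th C id fun _ => M) := by
    rw [Th_shift_rTensor_dL hC growing_id, single_mul_Th growing_id]
    congr 1
    refine Th_ext hC (fun _ => rfl) fun μ f _ e _ => ?_
    simp [hM]
  have h3 : Th C id (fun _ => (LinearMap.mulRight k (-(K χ (-α a) ⊗ₜ[k] (1 : Nic χ))) ∘ₗ M) ∘ₗ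
        LinearMap.rTensor _ (dR χ a)) =
      (Th C id fun _ => M) * HahnSeries.single (up (Pi.single a 1)) (K χ (-α a) ⊗ₜ[k] nx χ a) := by
    rw [Th_shift_rTensor_dR hC growing_id, Th_mul_single growing_id]
    refine (Th_neg (growing_single_add a)).trans ?_
    refine Th_ext hC (fun _ => rfl) fun μ f _ e _ => ?_
    simp [hM]
  rw [mul_add, add_mul, h1, h2, h3]
  abel

variable (χ) in
/-- The inclusion of the last two tensor factors. -/
def inc23 : U χ ⊗[k] Nic χ →ₐ[k] R3 χ := Algebra.TensorProduct.includeRight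

theorem inc23_apply (z : U χ ⊗[k] Nic χ) : inc23 χ z = 1 ⊗ₜ[k] z := rfl

variable (χ) in
/-- The coproduct applied to the first tensor factor. -/
def cop12 : U χ ⊗[k] Nic χ →ₐ[k] R3 χ :=
  (Algebra.TensorProduct.assoc k k k (U χ) (U χ) (Nic χ)).toAlgHom.comp
    (Algebra.TensorProduct.map (comul χ) (AlgHom.id k (Nic χ)))

theorem cop12_tmul (x : U χ) (u : Nic χ) : cop12 χ (x ⊗ₜ[k] u) =
    Algebra.TensorProduct.assoc k k k (U χ) (U χ) (Nic χ) (comul χ x ⊗ₜ[k] u) := rfl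

theorem cop12_K (a : ι → ℤ) (u : Nic χ) :
    cop12 χ (K χ a ⊗ₜ[k] u) = K χ a ⊗ₜ[k] (K χ a ⊗ₜ[k] u) := by
  rw [cop12_tmul, comul_K, Algebra.TensorProduct.assoc_tmul]

theorem cop12_B (i : ι) : cop12 χ (Bgen χ τ c i ⊗ₜ[k] (1 : Nic χ)) =
    Bgen χ τ c i ⊗ₜ[k] (K χ (-α i) ⊗ₜ[k] (1 : Nic χ)) + 1 ⊗ₜ[k] (F χ i ⊗ₜ[k] (1 : Nic χ)) +
      c i • (K χ (-α i + α (τ i)) ⊗ₜ[k] ((E χ (τ i) * K χ (-α i)) ⊗ₜ[k] (1 : Nic χ))) := by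
  rw [cop12_tmul, comul_B, TensorProduct.add_tmul, TensorProduct.add_tmul, ← TensorProduct.smul_tmul',
    map_add, map_add, map_smul, Algebra.TensorProduct.assoc_tmul, Algebra.TensorProduct.assoc_tmul,
    Algebra.TensorProduct.assoc_tmul]

theorem D3L_cop12 (i : ι) (z : U χ ⊗[k] Nic χ) :
    D3L χ i (cop12 χ z) = cop12 χ (LinearMap.lTensor _ (dL χ i) z) := by
  induction z using TensorProduct.induction_on with
  | zero => simp
  | add x y hx hy => rw [map_add (cop12 χ), map_add, hx, hy, map_add, map_add (cop12 χ)]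
  | tmul x u =>
    rw [LinearMap.lTensor_tmul, cop12_tmul, cop12_tmul]
    induction comul χ x using TensorProduct.induction_on with
    | zero => simp
    | add x y hx hy => simp only [TensorProduct.add_tmul, map_add, hx, hy]
    | tmul x y => rw [Algebra.TensorProduct.assoc_tmul, D3L_tmul, Algebra.TensorProduct.assoc_tmul]

variable (τ t) in
/-- The summands of `Θ^{σ̄K}_{K32}`. -/
def sigma32 (μ : ι → ℕ) : Nic χ ⊗[k] Nic χ →ₗ[k] R3 χ :=
  TensorProduct.mk k _ _ (K χ (up μ - up (tw τ μ))) ∘ₗ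
    TensorProduct.map (LinearMap.mulRight k (K χ (-up (tw τ μ))) ∘ₗ (nE χ).toLinearMap) t ∘ₗ
      (TensorProduct.comm k (Nic χ) (Nic χ)).toLinearMap

theorem sigma32_tmul (μ : ι → ℕ) (f e : Nic χ) : sigma32 τ t μ (f ⊗ₜ[k] e) =
    K χ (up μ - up (tw τ μ)) ⊗ₜ[k] ((nE χ e * K χ (-up (tw τ μ))) ⊗ₜ[k] t f) := by
  simp [sigma32]

theorem D3L_sigma32 (hC : IsCan χ C) (ht : IsTwistedSigma χ τ c t) (hτ : ∀ i, τ (τ i) = i)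
    (hχτ : ∀ i j, χ.q (τ i) (τ j) = χ.q i j) (i : ι) :
    hr (D3L χ i) (Th C (tw τ) (sigma32 τ t)) =
      -(HahnSeries.single (up (Pi.single i 1)) (c i • (K χ (-α i + α (τ i)) ⊗ₜ[k]
        ((E χ (τ i) * K χ (-α i)) ⊗ₜ[k] (1 : Nic χ)))) * Th C (tw τ) (sigma32 τ t)) := by
  have h1 : hr (D3L χ i) (Th C (tw τ) (sigma32 τ t)) = Th C (tw τ) fun μ =>
      ((c i * χ.q i (τ i) * (χ.val (α i) (up μ))⁻¹) • sigma32 τ t μ) ∘ₗ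
        LinearMap.rTensor _ (dL χ (τ i)) := by
    rw [hr_Th (growing_tw τ)]
    refine Th_ext hC (fun _ => rfl) fun μ f hf e _ => ?_
    rw [LinearMap.comp_apply, LinearMap.comp_apply, LinearMap.rTensor_tmul, LinearMap.smul_apply,
      sigma32_tmul, sigma32_tmul, D3L_tmul, ht.dL hτ hχτ, S_of_mem hf, map_smul, map_smul, smul_smul,
      val_neg_left, TensorProduct.tmul_smul, TensorProduct.tmul_smul]
  rw [h1, Th_shift_rTensor_dL hC (growing_tw τ), single_mul_Th (growing_tw τ)]
  congr 1
  refine Th_ext hC (fun μ => ?_) fun μ f _ e he => ?_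
  · rw [tw_add, tw_single hτ, hτ]
  · have h2 : K χ (-α i) * nE χ e = (χ.val (α i) (up μ))⁻¹ • (nE χ e * K χ (-α i)) := by
      rw [K_mul_nE, S_of_mem he, map_smul (nE χ), smul_mul_assoc, val_neg_left]
    rw [LinearMap.comp_apply, LinearMap.comp_apply, LinearMap.lTensor_tmul, LinearMap.smul_apply,
      sigma32_tmul, sigma32_tmul, LinearMap.mulLeft_apply, LinearMap.mulLeft_apply, smul_mul_assoc,
      Algebra.TensorProduct.tmul_mul_tmul, Algebra.TensorProduct.tmul_mul_tmul, one_mul, ← K_add,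
      mul_assoc (E χ (τ i)), ← mul_assoc _ (nE χ e), h2, smul_mul_assoc, mul_smul_comm,
      ← TensorProduct.smul_tmul', TensorProduct.tmul_smul, smul_smul, mul_assoc (nE χ e), ← K_add,
      map_mul (nE χ), nE_x, mul_assoc (E χ (τ i)), tw_add, tw_single hτ, hτ]
    simp only [up_add, up_single, val_add_right]
    have e1 : α (τ i) + up μ - (α i + up (tw τ μ)) =
      -α i + α (τ i) + (up μ - up (tw τ μ)) := by abel
    have e2 : -(α i + up (tw τ μ)) = -α i + -up (tw τ μ) := by abel
    rw [e1, e2]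
    congr 1
    rw [SymBichar.q]
    have h3 := val_ne_zero χ (α i) (up μ)
    have h4 := val_ne_zero χ (α i) (α (τ i))
    field_simp

end ComulId

section ComulId

variable {χ : SymBichar k ι} {C : (ι → ℕ) → Nic χ ⊗[k] Nic χ} {τ : Equiv.Perm ι} {c : ι → k}
  {b : Nic χ →ₗ[k] U χ} {t : Nic χ →ₗ[k] Nic χ} {γ : Nic χ →ₐ[k] U χ ⊗[k] Nic χ}

theorem K_neg_apply (χ : SymBichar k ι) : K χ (-(0 : ι → ℤ)) = 1 := by rw [neg_zero, K_zero]

theorem K_neg_add (χ : SymBichar k ι) (a b : ι → ℤ) :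
    K χ (-(a + b)) = K χ (-a) * K χ (-b) := by rw [neg_add, K_add]

variable (χ C) in
/-- The quasi `R`-matrix, acting on the last two tensor factors. -/
def Th23 : HahnSeries (ι → ℤ) (R3 χ) := Th C id fun _ => (inc23 χ).toLinearMap ∘ₗ
  TensorProduct.map (nF χ).toLinearMap (AlgHom.id k (Nic χ)).toLinearMap

theorem Th23_eq : Th23 χ C = hr (inc23 χ).toLinearMap (Th C id fun _ =>
    TensorProduct.map (nF χ).toLinearMap (AlgHom.id k (Nic χ)).toLinearMap) :=
  (hr_Th growing_id _).symm

theorem D3L_Th23 (hC : IsCan χ C) (i : ι) : hr (D3L χ i) (Th23 χ C) =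
    -(HahnSeries.single (up (Pi.single i 1)) (1 ⊗ₜ[k] (F χ i ⊗ₜ[k] (1 : Nic χ))) * Th23 χ C) := by
  have h1 : hr (D3L χ i) (Th23 χ C) = hr (inc23 χ).toLinearMap (Th C id fun _ =>
      TensorProduct.map (nF χ).toLinearMap (AlgHom.id k (Nic χ)).toLinearMap ∘ₗ
        LinearMap.lTensor _ (dL χ i)) := by
    rw [Th23, hr_Th growing_id, hr_Th growing_id]
    refine Th_ext hC (fun _ => rfl) fun μ f _ e _ => ?_
    simp [inc23_apply]
  have h2 : Bgen χ 1 (0 : ι → k) i = F χ i := by simp [Bgen]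
  have h3 : ((0 : ι → k) i * χ.q i ((1 : Equiv.Perm ι) i)) • (K χ (-α i + α ((1 : Equiv.Perm ι) i))
      ⊗ₜ[k] (AlgHom.id k (Nic χ)) (nx χ ((1 : Equiv.Perm ι) i))) = 0 := by simp
  rw [h1, Th_dL hC (PsiLift.nF χ 1), h2, h3, map_zero (HahnSeries.single _), add_zero, hr_neg, hr_mul,
    ← Th23_eq, hr_single]
  rfl

theorem S3_Th23_mul (hC : IsCan χ C) (i : ι) (a : ι → ℤ) (x : U χ) :
    HahnSeries.single a (x ⊗ₜ[k] (K χ (-α i) ⊗ₜ[k] (1 : Nic χ))) * Th23 χ C =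
      hr (S3 χ i).toLinearMap (Th23 χ C) *
        HahnSeries.single a (x ⊗ₜ[k] (K χ (-α i) ⊗ₜ[k] (1 : Nic χ))) := by
  refine single_mul_of_single_zero_mul a ?_
  rw [Th23, hr_Th growing_id, single_zero_mul_Th growing_id, Th_mul_single_zero growing_id]
  refine Th_ext hC (fun _ => rfl) fun μ f hf e he => ?_
  have h1 : K χ (-α i) * nF χ f = χ.val (α i) (up μ) • (nF χ f * K χ (-α i)) := by
    rw [K_mul_nF, neg_neg, S_of_mem hf, map_smul (nF χ), smul_mul_assoc]
  simp only [LinearMap.comp_apply, TensorProduct.map_tmul, AlgHom.toLinearMap_apply, inc23_apply,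
    S3_tmul, AlgHom.id_apply, S_of_mem he, LinearMap.mulLeft_apply,
    LinearMap.mulRight_apply, Algebra.TensorProduct.tmul_mul_tmul, one_mul, mul_one, h1,
    TensorProduct.tmul_smul, ← TensorProduct.smul_tmul', smul_mul_assoc]

theorem Th23_mul_inc23 (hC : IsCan χ C) (a : ι) :
    Th23 χ C * (HahnSeries.single 0 (1 ⊗ₜ[k] (E χ a ⊗ₜ[k] (1 : Nic χ))) +
          HahnSeries.single (up (Pi.single a 1)) (1 ⊗ₜ[k] (K χ (-α a) ⊗ₜ[k] nx χ a))) =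
      (HahnSeries.single 0 (1 ⊗ₜ[k] (E χ a ⊗ₜ[k] (1 : Nic χ))) +
          HahnSeries.single (up (Pi.single a 1)) (1 ⊗ₜ[k] (K χ (α a) ⊗ₜ[k] nx χ a))) *
        Th23 χ C := by
  have h := congrArg (hr (inc23 χ).toLinearMap) (E_mul_theta hC a)
  rw [hr_mul, hr_mul, ← Th23_eq, hr_add, hr_add, hr_single, hr_single, hr_single] at h
  exact h

theorem single_zero_mul_neg {A : Type*} [Ring A] (a a' : ι → ℤ) (r x y : A)
    (z : HahnSeries (ι → ℤ) A) :
    HahnSeries.single 0 r * -((HahnSeries.single a x + HahnSeries.single a' y) * z) =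
      -((HahnSeries.single a (r * x) + HahnSeries.single a' (r * y)) * z) := by
  rw [mul_neg, ← mul_assoc, mul_add, HahnSeries.single_mul_single, HahnSeries.single_mul_single,
    zero_add, zero_add]

theorem single_mul_add_single {A : Type*} [Ring A] (a a' : ι → ℤ) (r x y : A) :
    HahnSeries.single a r * (HahnSeries.single 0 x + HahnSeries.single a' y) =
      HahnSeries.single (a + a') (r * y) + HahnSeries.single a (r * x) := by
  rw [mul_add, HahnSeries.single_mul_single, HahnSeries.single_mul_single, add_zero, add_comm]

theorem mul_move {R : Type*} [Ring R] {w x y e e' : R} (h : w * x = y * w) (h' : x * e = e' * x) :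
    y * (w * e) = w * e' * x := by
  rw [← mul_assoc, ← h, mul_assoc, h', mul_assoc]

theorem D3L_Thγ (hC : IsCan χ C) (hb : PsiLift χ τ c b)
    (hγ : ∀ i, γ (nx χ i) = K χ (-α i) ⊗ₜ[k] nx χ i) (i : ι) :
    hr (D3L χ i) (Th C id fun _ => TensorProduct.map b γ.toLinearMap) =
      -((HahnSeries.single (up (Pi.single i 1)) (Bgen χ τ c i ⊗ₜ[k]
          (K χ (-α i) ⊗ₜ[k] (1 : Nic χ))) +
        HahnSeries.single (up (Pi.single i 1 + Pi.single (τ i) 1)) ((c i * χ.q i (τ i)) •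
          (K χ (-α i + α (τ i)) ⊗ₜ[k] ((K χ (-α i) * K χ (-α (τ i))) ⊗ₜ[k] nx χ (τ i))))) *
        Th C id fun _ => TensorProduct.map b γ.toLinearMap) := by
  have h1 : hr (D3L χ i) (Th C id fun _ => TensorProduct.map b γ.toLinearMap) =
      HahnSeries.single 0 (1 ⊗ₜ[k] (K χ (-α i) ⊗ₜ[k] (1 : Nic χ))) *
        Th C id (fun _ => TensorProduct.map b γ.toLinearMap ∘ₗ LinearMap.lTensor _ (dL χ i)) := by
    rw [hr_Th growing_id, single_zero_mul_Th growing_id]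
    refine Th_ext hC (fun _ => rfl) fun μ f _ e _ => ?_
    rw [LinearMap.comp_apply, LinearMap.comp_apply, LinearMap.comp_apply, LinearMap.lTensor_tmul,
      TensorProduct.map_tmul, TensorProduct.map_tmul, AlgHom.toLinearMap_apply, D3L_tmul',
      lTensor_dL_hom χ hγ i (fun j => K_comm χ _ _), LinearMap.mulLeft_apply,
      Algebra.TensorProduct.tmul_mul_tmul, one_mul, AlgHom.toLinearMap_apply]
  rw [h1, Th_dL hC hb]
  refine (single_zero_mul_neg _ _ _ _ _ _).trans ?_
  rw [mul_smul_comm, Algebra.TensorProduct.tmul_mul_tmul, Algebra.TensorProduct.tmul_mul_tmul, mul_one,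
    one_mul, one_mul, hγ, Algebra.TensorProduct.tmul_mul_tmul, one_mul]

theorem S3_Thγ_mul (hC : IsCan χ C) (hb : PsiLift χ τ c b) (hτ : ∀ i, τ (τ i) = i)
    (hχτ : ∀ i j, χ.q (τ i) (τ j) = χ.q i j)
    (hγ : ∀ i, γ (nx χ i) = K χ (-α i) ⊗ₜ[k] nx χ i) (i : ι) (a : ι → ℤ) :
    HahnSeries.single a (c i • (K χ (-α i + α (τ i)) ⊗ₜ[k]
        ((E χ (τ i) * K χ (-α i)) ⊗ₜ[k] (1 : Nic χ)))) *
        (Th C id fun _ => TensorProduct.map b γ.toLinearMap) =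
      hr (S3 χ i).toLinearMap (Th C id fun _ => TensorProduct.map b γ.toLinearMap) *
        HahnSeries.single a (c i • (K χ (-α i + α (τ i)) ⊗ₜ[k]
          ((E χ (τ i) * K χ (-α i)) ⊗ₜ[k] (1 : Nic χ)))) := by
  refine single_mul_of_single_zero_mul a ?_
  rw [hr_Th growing_id, single_zero_mul_Th growing_id, Th_mul_single_zero growing_id]
  refine Th_ext hC (fun _ => rfl) fun μ f hf e he => ?_
  have h1 : K χ (-up μ) * (E χ (τ i) * K χ (-α i)) =
      (χ.val (α (τ i)) (up μ))⁻¹ • (E χ (τ i) * K χ (-α i) * K χ (-up μ)) := by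
    rw [← mul_assoc, K_mul_E, smul_mul_assoc, mul_assoc, K_comm, ← mul_assoc, val_neg_left,
      val_symm]
  have h2 : b f * K χ (-α i + α (τ i)) = ((χ.val (α i) (up μ))⁻¹ * χ.val (α (τ i)) (up μ)) •
      (K χ (-α i + α (τ i)) * b f) := by
    have h := E_K_commute hb hτ hχτ hf (τ i)
    rw [hτ, sub_eq_neg_add] at h
    rw [h, mul_comm (χ.val _ _)]
  simp only [LinearMap.comp_apply, TensorProduct.map_tmul, AlgHom.toLinearMap_apply,
    tensor_hom_apply (v := fun a => K χ (-a)) (K_neg_apply χ) (K_neg_add χ) hγ he, S3_tmul, S_of_mem he,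
    LinearMap.mulLeft_apply, LinearMap.mulRight_apply, Algebra.TensorProduct.tmul_mul_tmul,
    mul_smul_comm, one_mul, mul_one, smul_mul_assoc, h1, h2, TensorProduct.tmul_smul,
    ← TensorProduct.smul_tmul', smul_smul]
  congr 1
  have := val_ne_zero χ (α (τ i)) (up μ)
  have := val_ne_zero χ (α i) (up μ)
  field_simp

theorem leibniz_rearrange_left {R : Type*} [Ring R] {x y z f g₁ g₂ n h₂ sx sy : R}
    (e1 : g₁ * x = sx * g₁) (e2 : n * y = sy * n) (e3 : sx * (g₂ + n) = (h₂ + n) * x) :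
    (-(f * x) * y + sx * -((g₁ + g₂) * y)) * z + sx * sy * -(n * z) =
      -((g₁ + f + n + h₂) * (x * y * z)) := by
  have h : (-(f * x) * y + sx * -((g₁ + g₂) * y)) * z + sx * sy * -(n * z) =
      -(f * x * y * z + sx * g₁ * y * z + sx * g₂ * y * z + sx * (sy * n) * z) := by noncomm_ring
  rw [h, ← e1, ← e2]
  have h' : f * x * y * z + g₁ * x * y * z + sx * g₂ * y * z + sx * (n * y) * z =
      f * x * y * z + g₁ * x * y * z + sx * (g₂ + n) * y * z := by noncomm_ring
  rw [h', e3]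
  noncomm_ring

theorem comul_id_theta (hC : IsCan χ C) (hb : PsiLift χ τ c b) (ht : IsTwistedSigma χ τ c t)
    (hτ : ∀ i, τ (τ i) = i) (hχτ : ∀ i j, χ.q (τ i) (τ j) = χ.q i j)
    (hγ : ∀ i, γ (nx χ i) = K χ (-α i) ⊗ₜ[k] nx χ i) :
    (Th C id fun _ => (cop12 χ).toLinearMap ∘ₗ
        TensorProduct.map b (AlgHom.id k (Nic χ)).toLinearMap) =
      Th23 χ C * (Th C id fun _ => TensorProduct.map b γ.toLinearMap) *
        Th C (tw τ) (sigma32 τ t) := by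
  have hG : ∀ i, hr (cop12 χ).toLinearMap
      (HahnSeries.single (up (Pi.single i 1)) (Bgen χ τ c i ⊗ₜ[k] (1 : Nic χ)) +
        HahnSeries.single (up (Pi.single i 1 + Pi.single (τ i) 1))
          ((c i * χ.q i (τ i)) • (K χ (-α i + α (τ i)) ⊗ₜ[k] AlgHom.id k (Nic χ) (nx χ (τ i))))) =
      HahnSeries.single (up (Pi.single i 1))
          (Bgen χ τ c i ⊗ₜ[k] (K χ (-α i) ⊗ₜ[k] (1 : Nic χ))) +
        HahnSeries.single (up (Pi.single i 1)) (1 ⊗ₜ[k] (F χ i ⊗ₜ[k] (1 : Nic χ))) +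
        HahnSeries.single (up (Pi.single i 1)) (c i • (K χ (-α i + α (τ i)) ⊗ₜ[k]
          ((E χ (τ i) * K χ (-α i)) ⊗ₜ[k] (1 : Nic χ)))) +
        HahnSeries.single (up (Pi.single i 1 + Pi.single (τ i) 1)) ((c i * χ.q i (τ i)) •
          (K χ (-α i + α (τ i)) ⊗ₜ[k] (K χ (-α i + α (τ i)) ⊗ₜ[k] nx χ (τ i)))) := fun i => by
    rw [hr_add, hr_single, hr_single, AlgHom.toLinearMap_apply, AlgHom.toLinearMap_apply, cop12_B,
      map_smul (cop12 χ), cop12_K, HahnSeries.single_add, HahnSeries.single_add, AlgHom.id_apply]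
  refine hr_ode_left (W := U χ ⊗[k] (U χ ⊗[k] k)) (D3L χ) (eps3 χ).toLinearMap
    (fun r => D3L_separating r) (fun i => HahnSeries.single (up (Pi.single i 1))
          (Bgen χ τ c i ⊗ₜ[k] (K χ (-α i) ⊗ₜ[k] (1 : Nic χ))) +
        HahnSeries.single (up (Pi.single i 1)) (1 ⊗ₜ[k] (F χ i ⊗ₜ[k] (1 : Nic χ))) +
        HahnSeries.single (up (Pi.single i 1)) (c i • (K χ (-α i + α (τ i)) ⊗ₜ[k]
          ((E χ (τ i) * K χ (-α i)) ⊗ₜ[k] (1 : Nic χ)))) +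
        HahnSeries.single (up (Pi.single i 1 + Pi.single (τ i) 1)) ((c i * χ.q i (τ i)) •
          (K χ (-α i + α (τ i)) ⊗ₜ[k] (K χ (-α i + α (τ i)) ⊗ₜ[k] nx χ (τ i)))))
    (fun i => (((PosSupp.single (up_single_pos i) _).add (PosSupp.single (up_single_pos i) _)).add
      (PosSupp.single (up_single_pos i) _)).add (PosSupp.single (up_single_add_pos i _) _))
    (fun i => ?_) (fun i => ?_) ?_
  · have h1 : hr (D3L χ i) (Th C id fun _ => (cop12 χ).toLinearMap ∘ₗ
          TensorProduct.map b (AlgHom.id k (Nic χ)).toLinearMap) =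
        hr (cop12 χ).toLinearMap (Th C id fun _ =>
          TensorProduct.map b (AlgHom.id k (Nic χ)).toLinearMap ∘ₗ
            LinearMap.lTensor _ (dL χ i)) := by
      rw [hr_Th growing_id, hr_Th growing_id]
      refine Th_ext hC (fun _ => rfl) fun μ f _ e _ => ?_
      simp only [LinearMap.comp_apply, TensorProduct.map_tmul, AlgHom.toLinearMap_apply, D3L_cop12,
        LinearMap.lTensor_tmul, AlgHom.id_apply]
    rw [h1, Th_dL hC hb, hr_neg, hr_mul, hG, hr_Th growing_id]
  · have hw : ∀ (ε : ι → ℤ), HahnSeries.single (up (Pi.single i 1)) ((c i * χ.q i (τ i)) •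
          (K χ (-α i + α (τ i)) ⊗ₜ[k] (K χ (-α i) ⊗ₜ[k] (1 : Nic χ)))) *
        (HahnSeries.single 0 (1 ⊗ₜ[k] (E χ (τ i) ⊗ₜ[k] (1 : Nic χ))) +
          HahnSeries.single (up (Pi.single (τ i) 1)) (1 ⊗ₜ[k] (K χ ε ⊗ₜ[k] nx χ (τ i)))) =
        HahnSeries.single (up (Pi.single i 1 + Pi.single (τ i) 1)) ((c i * χ.q i (τ i)) •
          (K χ (-α i + α (τ i)) ⊗ₜ[k] ((K χ (-α i) * K χ ε) ⊗ₜ[k] nx χ (τ i)))) +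
        HahnSeries.single (up (Pi.single i 1)) (c i • (K χ (-α i + α (τ i)) ⊗ₜ[k]
          ((E χ (τ i) * K χ (-α i)) ⊗ₜ[k] (1 : Nic χ)))) := fun ε => by
      have h := val_ne_zero χ (α i) (α (τ i))
      refine (single_mul_add_single _ _ _ _ _).trans ?_
      rw [← up_add, smul_mul_assoc, smul_mul_assoc, Algebra.TensorProduct.tmul_mul_tmul,
        Algebra.TensorProduct.tmul_mul_tmul, Algebra.TensorProduct.tmul_mul_tmul,
        Algebra.TensorProduct.tmul_mul_tmul, mul_one, mul_one, one_mul, K_mul_E, val_neg_left,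
        ← TensorProduct.smul_tmul', TensorProduct.tmul_smul, smul_smul, SymBichar.q, mul_assoc,
        mul_inv_cancel₀ h, mul_one]
    rw [hr_leibniz_left _ _ (D3L_mul i), hr_leibniz_left _ _ (D3L_mul i), hr_mul, D3L_Th23 hC,
      D3L_Thγ hC hb hγ, D3L_sigma32 hC ht hτ hχτ]
    refine leibniz_rearrange_left (S3_Th23_mul hC i _ _) (S3_Thγ_mul hC hb hτ hχτ hγ i _) ?_
    have e1 := S3_Th23_mul hC i (up (Pi.single i 1))
      ((c i * χ.q i (τ i)) • K χ (-α i + α (τ i)))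
    rw [← TensorProduct.smul_tmul'] at e1
    have e2 := hw (α (τ i))
    rw [← K_add] at e2
    rw [← e2, ← hw]
    exact mul_move e1 (Th23_mul_inc23 hC (τ i))
  · have h0 : ∀ {μ : ι → ℕ}, μ ≠ 0 → ∀ e ∈ Nwt χ μ, epsN χ e = 0 := fun h e he => epsN_of_mem he h
    have e1 : hr (k := k) (B := U χ ⊗[k] (U χ ⊗[k] k)) (eps3 χ).toLinearMap
        (Th C id fun _ => TensorProduct.map b γ.toLinearMap) = 1 := by
      rw [hr_Th growing_id]
      refine Th_eq_one hC rfl ?_ fun μ hμ f _ e he => ?_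
      · simp only [LinearMap.comp_apply, TensorProduct.map_tmul, hb.one, AlgHom.toLinearMap_apply]
        rw [map_one γ, Algebra.TensorProduct.one_def, eps3_tmul, map_one (epsN χ)]
        rfl
      · simp only [LinearMap.comp_apply, TensorProduct.map_tmul, AlgHom.toLinearMap_apply]
        rw [tensor_hom_apply (v := fun a => K χ (-a)) (K_neg_apply χ) (K_neg_add χ) hγ he, eps3_tmul,
          h0 hμ e he, TensorProduct.tmul_zero, TensorProduct.tmul_zero]
    have e2 : hr (k := k) (B := U χ ⊗[k] (U χ ⊗[k] k)) (eps3 χ).toLinearMap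
        (Th C (tw τ) (sigma32 τ t)) = 1 := by
      rw [hr_Th (growing_tw τ)]
      refine Th_eq_one hC rfl ?_ fun μ hμ f hf e _ => ?_
      · rw [LinearMap.comp_apply, sigma32_tmul, ht.one, map_one (nE χ), tw_zero, sub_self,
          up_zero, neg_zero, K_zero, AlgHom.toLinearMap_apply, eps3_tmul, map_one (epsN χ), one_mul]
        rfl
      · have hμ' : tw τ μ ≠ 0 := fun h => hμ (funext fun j => by
          have := congrFun h (τ j)
          simpa [tw, hτ] using this)
        rw [LinearMap.comp_apply, sigma32_tmul, AlgHom.toLinearMap_apply, eps3_tmul,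
          h0 hμ' _ (ht.mem hτ hf), TensorProduct.tmul_zero, TensorProduct.tmul_zero]
    have e3 : hr (k := k) (B := U χ ⊗[k] (U χ ⊗[k] k)) (eps3 χ).toLinearMap (Th23 χ C) = 1 := by
      rw [Th23, hr_Th growing_id]
      refine Th_eq_one hC rfl ?_ fun μ hμ f hf e he => ?_
      · simp only [LinearMap.comp_apply, TensorProduct.map_tmul, AlgHom.toLinearMap_apply]
        rw [map_one (nF χ), AlgHom.id_apply, inc23_apply, eps3_tmul, map_one (epsN χ)]
        rfl
      · simp only [LinearMap.comp_apply, TensorProduct.map_tmul, AlgHom.toLinearMap_apply]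
        rw [inc23_apply, eps3_tmul, AlgHom.id_apply, h0 hμ e he, TensorProduct.tmul_zero,
          TensorProduct.tmul_zero]
    rw [hr_mul, hr_mul, e1, e2, e3, mul_one, mul_one, hr_Th growing_id]
    refine Th_eq_one hC rfl ?_ fun μ hμ f hf e he => ?_
    · simp only [LinearMap.comp_apply, TensorProduct.map_tmul, AlgHom.toLinearMap_apply]
      rw [hb.one, AlgHom.id_apply, ← Algebra.TensorProduct.one_def, map_one (cop12 χ),
        Algebra.TensorProduct.one_def, Algebra.TensorProduct.one_def, eps3_tmul, map_one (epsN χ)]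
      rfl
    · simp only [LinearMap.comp_apply, TensorProduct.map_tmul, AlgHom.toLinearMap_apply]
      rw [cop12_tmul, AlgHom.id_apply]
      induction comul χ (b f) using TensorProduct.induction_on with
      | zero => simp
      | add x y hx hy => rw [TensorProduct.add_tmul, map_add, map_add, hx, hy, add_zero]
      | tmul x y => rw [Algebra.TensorProduct.assoc_tmul, eps3_tmul, h0 hμ e he,
          TensorProduct.tmul_zero, TensorProduct.tmul_zero]

end ComulId

section Intertwine

variable {χ : SymBichar k ι} {C : (ι → ℕ) → Nic χ ⊗[k] Nic χ} {τ : Equiv.Perm ι} {c : ι → k}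
  {b : Nic χ →ₗ[k] U χ}

theorem toCompletion_tmul (x y : U χ) :
    toCompletion χ (x ⊗ₜ[k] y) = HahnSeries.single 0 (x ⊗ₜ[k] 1) * rightSeries χ y := by
  rw [toCompletion, Algebra.TensorProduct.lift_tmul]
  rfl

theorem toCompletion_K (x : U χ) (a : ι → ℤ) :
    toCompletion χ (x ⊗ₜ[k] K χ a) = HahnSeries.single 0 (x ⊗ₜ[k] K χ a) := by
  rw [toCompletion_tmul, rightSeries_K, HahnSeries.single_mul_single, add_zero,
    Algebra.TensorProduct.tmul_mul_tmul, mul_one, one_mul]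

theorem toCompletion_F (x : U χ) (i : ι) :
    toCompletion χ (x ⊗ₜ[k] F χ i) = HahnSeries.single (-α i) (x ⊗ₜ[k] F χ i) := by
  rw [toCompletion_tmul, rightSeries_F, HahnSeries.single_mul_single, zero_add,
    Algebra.TensorProduct.tmul_mul_tmul, mul_one, one_mul]

theorem toCompletion_E_mul_K (x : U χ) (i : ι) (a : ι → ℤ) :
    toCompletion χ (x ⊗ₜ[k] (E χ i * K χ a)) =
      HahnSeries.single (α i) (x ⊗ₜ[k] (E χ i * K χ a)) := by
  rw [toCompletion_tmul, map_mul (rightSeries χ), rightSeries_E, rightSeries_K,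
    HahnSeries.single_mul_single, HahnSeries.single_mul_single, zero_add, add_zero,
    Algebra.TensorProduct.tmul_mul_tmul, Algebra.TensorProduct.tmul_mul_tmul, one_mul, mul_one,
    one_mul]

theorem comul_K_mul_theta (hC : IsCan χ C) (hb : PsiLift χ τ c b)
    (hχτ : ∀ i j, χ.q (τ i) (τ j) = χ.q i j) {a : ι → ℤ}
    (ha : ∀ i, a (τ i) = -a i) :
    toCompletion χ (comul χ (K χ a)) *
        (Th C id fun _ => TensorProduct.map b (nE χ).toLinearMap) =
      (Th C id fun _ => TensorProduct.map b (nE χ).toLinearMap) *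
        toCompletion χ (comul χ (K χ a)) := by
  rw [comul_K, toCompletion_K, single_zero_mul_Th growing_id, Th_mul_single_zero growing_id]
  refine Th_ext hC (fun _ => rfl) fun μ f hf e he => ?_
  have h1 : b f * K χ a = χ.val a (up μ) • (K χ a * b f) := by
    rw [hb.mul_K hχτ (funext ha), S_of_mem hf, map_smul, mul_smul_comm]
  have h2 : K χ a * nE χ e = χ.val a (up μ) • (nE χ e * K χ a) := by
    rw [K_mul_nE, S_of_mem he, map_smul (nE χ), smul_mul_assoc]
  simp only [LinearMap.comp_apply, TensorProduct.map_tmul, AlgHom.toLinearMap_apply,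
    LinearMap.mulLeft_apply, LinearMap.mulRight_apply, Algebra.TensorProduct.tmul_mul_tmul, h1, h2,
    TensorProduct.tmul_smul, ← TensorProduct.smul_tmul']

theorem mul_conj_move {R : Type*} [Ring R] {u f κ κ' G G' x : R} (hu : u * x = x * u)
    (h : f * x = x * f + (x * G' * κ' + κ * -(G * x))) :
    u * (f + κ * G) * x = x * (u * (f + G' * κ')) := by
  have h' : (f + κ * G) * x = x * (f + G' * κ') := by
    rw [add_mul, h]
    noncomm_ring
  rw [mul_assoc, h', ← mul_assoc, hu, mul_assoc]

theorem comul_B_mul_theta (hC : IsCan χ C) (hb : PsiLift χ τ c b)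
    (hτ : ∀ i, τ (τ i) = i) (hχτ : ∀ i j, χ.q (τ i) (τ j) = χ.q i j) (i : ι) :
    toCompletion χ (comul χ (Bgen χ τ c i)) *
        (Th C id fun _ => TensorProduct.map b (nE χ).toLinearMap) =
      (Th C id fun _ => TensorProduct.map b (nE χ).toLinearMap) * toCompletion χ
          (Bgen χ τ c i ⊗ₜ[k] K χ (α i) +
            (c (τ i) * χ.q i (τ i)) • ((K χ (-α (τ i)) * K χ (α i)) ⊗ₜ[k]
              (E χ (τ i) * K χ (α i))) +
            1 ⊗ₜ[k] F χ i) := by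
  set M := TensorProduct.map b (nE χ).toLinearMap with hM
  set Θ := Th C id fun _ => M with hΘ
  have hup : up (Pi.single i 1) = α i := up_single i
  have hup' : up (Pi.single i 1 + Pi.single (τ i) 1) = α i + α (τ i) := by
    rw [up_add, up_single, up_single]
  have e1 : toCompletion χ (comul χ (Bgen χ τ c i)) = HahnSeries.single (-α i) 1 *
      (HahnSeries.single 0 (1 ⊗ₜ[k] F χ i) + HahnSeries.single 0 (1 ⊗ₜ[k] K χ (-α i)) *
        (HahnSeries.single (up (Pi.single i 1)) (Bgen χ τ c i ⊗ₜ[k] (1 : U χ)) +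
          HahnSeries.single (up (Pi.single i 1 + Pi.single (τ i) 1))
            ((c i * χ.q i (τ i)) • (K χ (-α i + α (τ i)) ⊗ₜ[k] nE χ (nx χ (τ i)))))) := by
    have h : (c i * χ.q i (τ i)) • (K χ (-α i + α (τ i)) ⊗ₜ[k] (K χ (-α i) * E χ (τ i))) =
        c i • (K χ (-α i + α (τ i)) ⊗ₜ[k] (E χ (τ i) * K χ (-α i))) := by
      rw [K_mul_E, val_neg_left, TensorProduct.tmul_smul, smul_smul, SymBichar.q, mul_assoc,
        mul_inv_cancel₀ (val_ne_zero _ _ _), mul_one]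
    rw [comul_B, map_add, map_add, map_smul, toCompletion_K, toCompletion_F, toCompletion_E_mul_K,
      hup, hup', mul_add (HahnSeries.single 0 _), HahnSeries.single_mul_single,
      HahnSeries.single_mul_single, mul_add, mul_add, HahnSeries.single_mul_single,
      HahnSeries.single_mul_single, HahnSeries.single_mul_single, mul_smul_comm,
      Algebra.TensorProduct.tmul_mul_tmul, Algebra.TensorProduct.tmul_mul_tmul, nE_x]
    simp only [one_mul, mul_one, zero_add, add_zero, h, neg_add_cancel, neg_add_cancel_left,
      single_smul']
    abel
  have e2 : toCompletion χ (Bgen χ τ c i ⊗ₜ[k] K χ (α i) +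
            (c (τ i) * χ.q i (τ i)) • ((K χ (-α (τ i)) * K χ (α i)) ⊗ₜ[k]
              (E χ (τ i) * K χ (α i))) + 1 ⊗ₜ[k] F χ i) = HahnSeries.single (-α i) 1 *
      (HahnSeries.single 0 (1 ⊗ₜ[k] F χ i) +
        (HahnSeries.single (up (Pi.single i 1)) (Bgen χ τ c i ⊗ₜ[k] (1 : U χ)) +
          HahnSeries.single (up (Pi.single i 1 + Pi.single (τ i) 1))
            ((c (τ i) * χ.q i (τ i)) • (K χ (α i - α (τ i)) ⊗ₜ[k] nE χ (nx χ (τ i))))) *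
        HahnSeries.single 0 (1 ⊗ₜ[k] K χ (α i))) := by
    rw [map_add, map_add, map_smul, toCompletion_K, toCompletion_F, toCompletion_E_mul_K,
      hup, hup', add_mul (HahnSeries.single _ _), HahnSeries.single_mul_single,
      HahnSeries.single_mul_single, mul_add, mul_add, HahnSeries.single_mul_single,
      HahnSeries.single_mul_single, HahnSeries.single_mul_single, smul_mul_assoc,
      Algebra.TensorProduct.tmul_mul_tmul, Algebra.TensorProduct.tmul_mul_tmul, nE_x, one_mul,
      one_mul, mul_one, one_mul, one_mul, mul_one, add_zero, add_zero, add_zero, neg_add_cancel,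
      neg_add_cancel_left, single_smul', ← K_add, neg_add_eq_sub]
    abel
  have e3 : HahnSeries.single 0 (1 ⊗ₜ[k] F χ i) * Θ = Θ * HahnSeries.single 0 (1 ⊗ₜ[k] F χ i) +
      (-(Th C id fun _ => M ∘ₗ LinearMap.lTensor _ (dR χ i)) *
        HahnSeries.single 0 (1 ⊗ₜ[k] K χ (α i)) +
      HahnSeries.single 0 (1 ⊗ₜ[k] K χ (-α i)) *
        Th C id fun _ => M ∘ₗ LinearMap.lTensor _ (dL χ i)) := by
    rw [hΘ, Th_neg growing_id, single_zero_mul_Th growing_id, Th_mul_single_zero growing_id,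
      Th_mul_single_zero growing_id, single_zero_mul_Th growing_id, ← Th_add growing_id,
      ← Th_add growing_id]
    refine Th_ext hC (fun _ => rfl) fun μ f _ e _ => ?_
    simp only [hM, LinearMap.add_apply, LinearMap.comp_apply, TensorProduct.map_tmul,
      LinearMap.lTensor_tmul, AlgHom.toLinearMap_apply, LinearMap.mulLeft_apply,
      LinearMap.mulRight_apply, LinearMap.neg_apply, neg_mul, Algebra.TensorProduct.tmul_mul_tmul,
      one_mul, mul_one, F_mul_nE, TensorProduct.tmul_add, TensorProduct.tmul_sub]
    abel
  rw [hM, Th_dR hC hb hτ hχτ, Th_dL hC hb, neg_neg, ← hM, ← hΘ] at e3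
  rw [e1, e2]
  exact mul_conj_move (single_one_mul_comm _ _) e3

end Intertwine

section Transport

variable {χ : SymBichar k ι} {A : Type*} [Ring A] [Algebra k A]

theorem formalSum_eq_Th (D : ∀ μ, DualBases χ (borelPairing χ) μ) (d : (ι → ℕ) → (ι → ℕ))
    {X : (ι → ℕ) → A} (P : (ι → ℕ) → Nic χ ⊗[k] Nic χ →ₗ[k] A)
    (h : ∀ μ, X μ = sgn k μ • ∑ j, P μ (((UminusWtEquiv χ μ).symm ((D μ).Fb j) : Nic χ) ⊗ₜ[k]
      ((UplusWtEquiv χ μ).symm ((D μ).Eb j) : Nic χ))) :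
    formalSum d X = Th (canOf D) d P := by
  rw [Th]
  congr 1
  funext μ
  rw [h, canOf, map_sum]

theorem nF_symm {μ : ι → ℕ} (y : UminusWt χ μ) :
    nF χ ((UminusWtEquiv χ μ).symm y) = (y : U χ) := by
  rw [← UminusWtEquiv_coe, LinearEquiv.apply_symm_apply]

theorem nE_symm {μ : ι → ℕ} (y : UplusWt χ μ) :
    nE χ ((UplusWtEquiv χ μ).symm y) = (y : U χ) := by
  rw [← UplusWtEquiv_coe, LinearEquiv.apply_symm_apply]

variable (χ) in
/-- The Nichols algebra as the negative part. -/
def nicEquivUminus : Nic χ ≃ₐ[k] Uminus χ :=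
  AlgEquiv.ofBijective ((nF χ).codRestrict (Uminus χ) (nF_mem_Uminus χ))
    ⟨fun u v h => nF_injective χ (congrArg Subtype.val h), fun x => by
      have hle : Uminus χ ≤ (nF χ).range := Algebra.adjoin_le (by
        rintro _ ⟨i, rfl⟩
        exact ⟨nx χ i, nF_x χ i⟩)
      obtain ⟨u, hu⟩ := hle x.2
      exact ⟨u, Subtype.ext hu⟩⟩

theorem nicEquivUminus_symm (f : Nic χ) (h : nF χ f ∈ Uminus χ) :
    (nicEquivUminus χ).symm ⟨nF χ f, h⟩ = f := by
  rw [AlgEquiv.symm_apply_eq]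
  rfl

theorem sigWt_eq (s : Nic χ →ₐ[k] U χ) {μ : ι → ℕ} (y : UminusWt χ μ) :
    sigWt χ (s.comp (nicEquivUminus χ).symm.toAlgHom) μ y = s ((UminusWtEquiv χ μ).symm y) := by
  rw [sigWt]
  refine congrArg s ?_
  refine Eq.trans ?_ (nicEquivUminus_symm _ (nF_mem_Uminus χ _))
  refine congrArg (nicEquivUminus χ).symm (Subtype.ext ?_)
  exact (nF_symm y).symm

variable (χ) in
/-- The Nichols algebra in the third tensor factor as the positive part. -/
def thirdE : R3 χ →ₐ[k] U χ ⊗[k] (U χ ⊗[k] U χ) :=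
  Algebra.TensorProduct.map (AlgHom.id k (U χ)) (Algebra.TensorProduct.map (AlgHom.id k (U χ))
    (nE χ))

@[simp] theorem thirdE_tmul (x y : U χ) (u : Nic χ) :
    thirdE χ (x ⊗ₜ[k] (y ⊗ₜ[k] u)) = x ⊗ₜ[k] (y ⊗ₜ[k] nE χ u) := rfl

theorem thirdE_tmul' (x : U χ) (z : U χ ⊗[k] Nic χ) : thirdE χ (x ⊗ₜ[k] z) = x ⊗ₜ[k]
    Algebra.TensorProduct.map (AlgHom.id k (U χ)) (nE χ) z := rfl

theorem thirdE_cop12 (x : U χ) (u : Nic χ) : thirdE χ (cop12 χ (x ⊗ₜ[k] u)) =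
    Algebra.TensorProduct.assoc k k k (U χ) (U χ) (U χ) (comul χ x ⊗ₜ[k] nE χ u) := by
  rw [cop12_tmul]
  induction comul χ x using TensorProduct.induction_on with
  | zero => simp
  | add x y hx hy => rw [TensorProduct.add_tmul, map_add, map_add, hx, hy, TensorProduct.add_tmul,
      map_add]
  | tmul x y => rfl

theorem comul_nE {Δ : Nic χ →ₐ[k] U χ ⊗[k] Nic χ}
    (hΔ : ∀ i, Δ (nx χ i) = E χ i ⊗ₜ[k] 1 + K χ (α i) ⊗ₜ[k] nx χ i) (u : Nic χ) :
    comul χ (nE χ u) = Algebra.TensorProduct.map (AlgHom.id k (U χ)) (nE χ) (Δ u) := by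
  have h : (comul χ).comp (nE χ) =
      (Algebra.TensorProduct.map (AlgHom.id k (U χ)) (nE χ)).comp Δ := by
    refine Nic_algHom_ext fun i => ?_
    simp [hΔ, comul_E]
  exact DFunLike.congr_fun h u

variable {τ : Equiv.Perm ι} {c : ι → k} {b : Nic χ →ₗ[k] U χ}
  {psi : ∀ μ, UminusWt χ μ → U χ} (D : ∀ μ, DualBases χ (borelPairing χ) μ)

theorem thetaK_eq (hpsi : ∀ μ y, psi μ y = b ((UminusWtEquiv χ μ).symm y)) (μ : ι → ℕ) :
    thetaK χ D psi μ = sgn k μ • ∑ j, TensorProduct.map b (nE χ).toLinearMap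
      (((UminusWtEquiv χ μ).symm ((D μ).Fb j) : Nic χ) ⊗ₜ[k]
      ((UplusWtEquiv χ μ).symm ((D μ).Eb j) : Nic χ)) := by
  simp only [thetaK, hpsi, TensorProduct.map_tmul, AlgHom.toLinearMap_apply, nE_symm]

theorem ThetaK_eq (hpsi : ∀ μ y, psi μ y = b ((UminusWtEquiv χ μ).symm y)) :
    ThetaK χ D psi = Th (canOf D) id fun _ => TensorProduct.map b (nE χ).toLinearMap :=
  formalSum_eq_Th D id _ (thetaK_eq D hpsi)

theorem idComulThetaK_eq (hpsi : ∀ μ y, psi μ y = b ((UminusWtEquiv χ μ).symm y)) {s : Nic χ →ₐ[k] U χ}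
    (hb : PsiLift χ τ c b) (hτ : ∀ i, τ (τ i) = i) (hχτ : ∀ i j, χ.q (τ i) (τ j) = χ.q i j)
    (hs : ∀ i, s (nx χ i) = c (τ i) • (K χ (α i) * E χ (τ i))) :
    idComulThetaK χ D psi =
      ThetaK12 χ D psi * ThetaSigmaK23 χ τ D (s.comp (nicEquivUminus χ).symm.toAlgHom) *
        ThetaK1K3 χ D psi := by
  obtain ⟨Δ, hΔ⟩ := exists_comul_hom χ
  obtain ⟨δ, hδ⟩ := exists_tensor_hom χ (fun i => K χ (α i)) fun i j => K_comm χ _ _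
  have h := congrArg (hr (thirdE χ).toLinearMap)
    (id_comul_theta (isCan_canOf D) hb hτ hχτ hs hδ hΔ)
  rw [hr_mul, hr_mul, hr_Th growing_id, hr_Th growing_id, hr_Th growing_id,
    hr_Th (growing_tw_add τ)] at h
  have e1 : idComulThetaK χ D psi = Th (canOf D) id fun _ => (thirdE χ).toLinearMap ∘ₗ
      TensorProduct.map b Δ.toLinearMap := by
    refine formalSum_eq_Th D id _ fun μ => ?_
    simp only [thetaK, hpsi, map_smul, map_sum, LinearMap.comp_apply, TensorProduct.map_tmul,
      AlgHom.toLinearMap_apply, thirdE_tmul', Algebra.TensorProduct.map_tmul, AlgHom.id_apply,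
      ← comul_nE hΔ, nE_symm]
  have e2 : ThetaK12 χ D psi = Th (canOf D) id fun _ => (thirdE χ).toLinearMap ∘ₗ
      TensorProduct.map b ((Algebra.TensorProduct.includeLeft : U χ →ₐ[k] U χ ⊗[k] Nic χ).comp
        (nE χ)).toLinearMap := by
    refine formalSum_eq_Th D id _ fun μ => ?_
    simp only [hpsi, LinearMap.comp_apply, TensorProduct.map_tmul, AlgHom.comp_apply,
      Algebra.TensorProduct.includeLeft_apply, map_one,
      AlgHom.toLinearMap_apply, thirdE_tmul, nE_symm]
  have e3 : ThetaSigmaK23 χ τ D (s.comp (nicEquivUminus χ).symm.toAlgHom) =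
      Th (canOf D) (fun μ => tw τ μ + μ) fun μ => (thirdE χ).toLinearMap ∘ₗ sigma23 τ s μ := by
    refine formalSum_eq_Th D _ _ fun μ => ?_
    simp only [sigWt_eq, LinearMap.comp_apply, sigma23_tmul, AlgHom.toLinearMap_apply, thirdE_tmul,
      nE_symm]
  have e4 : ThetaK1K3 χ D psi = Th (canOf D) id fun _ => (thirdE χ).toLinearMap ∘ₗ
      TensorProduct.map b δ.toLinearMap := by
    refine formalSum_eq_Th D id _ fun μ => ?_
    simp only [hpsi, LinearMap.comp_apply, TensorProduct.map_tmul, AlgHom.toLinearMap_apply,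
      tensor_hom_apply (K_zero χ) (K_add χ) hδ (Subtype.property _), thirdE_tmul, nE_symm]
  rw [e1, e2, e3, e4]
  exact h

theorem comulIdThetaK_eq (hpsi : ∀ μ y, psi μ y = b ((UminusWtEquiv χ μ).symm y))
    {s : Nic χ →ₐ[k] U χ}
    (hb : PsiLift χ τ c b) (hτ : ∀ i, τ (τ i) = i) (hχτ : ∀ i j, χ.q (τ i) (τ j) = χ.q i j)
    (hs : ∀ i, s (nx χ i) = c (τ i) • (K χ (α i) * E χ (τ i))) :
    comulIdThetaK χ D psi =
      Theta23 χ D * ThetaKm1K3 χ D psi *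
        ThetaSigmaK32 χ τ D (s.comp (nicEquivUminus χ).symm.toAlgHom) := by
  obtain ⟨γ, hγ⟩ := exists_tensor_hom χ (fun i => K χ (-α i)) fun i j => K_comm χ _ _
  obtain ⟨t, ht⟩ := exists_twistedSigma (χ := χ) hτ hχτ c
  have h := congrArg (hr (thirdE χ).toLinearMap)
    (comul_id_theta (isCan_canOf D) hb ht hτ hχτ hγ)
  rw [hr_mul, hr_mul, Th23, hr_Th growing_id, hr_Th growing_id, hr_Th growing_id,
    hr_Th (growing_tw τ)] at h
  have e1 : comulIdThetaK χ D psi = Th (canOf D) id fun _ => (thirdE χ).toLinearMap ∘ₗ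
      (cop12 χ).toLinearMap ∘ₗ TensorProduct.map b (AlgHom.id k (Nic χ)).toLinearMap := by
    refine formalSum_eq_Th D id _ fun μ => ?_
    simp only [thetaK, hpsi, map_smul, map_sum, LinearMap.comp_apply, TensorProduct.map_tmul,
      AlgHom.toLinearMap_apply, Algebra.TensorProduct.map_tmul, AlgHom.id_apply,
      thirdE_cop12, nE_symm]
  have e2 : Theta23 χ D = Th (canOf D) id fun _ => (thirdE χ).toLinearMap ∘ₗ
      (inc23 χ).toLinearMap ∘ₗ
        TensorProduct.map (nF χ).toLinearMap (AlgHom.id k (Nic χ)).toLinearMap := by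
    refine formalSum_eq_Th D id _ fun μ => ?_
    simp only [LinearMap.comp_apply, TensorProduct.map_tmul, inc23_apply,
      AlgHom.toLinearMap_apply, thirdE_tmul, nE_symm, nF_symm, AlgHom.id_apply]
  have e3 : ThetaSigmaK32 χ τ D (s.comp (nicEquivUminus χ).symm.toAlgHom) =
      Th (canOf D) (tw τ) fun μ => (thirdE χ).toLinearMap ∘ₗ sigma32 τ t μ := by
    refine formalSum_eq_Th D _ _ fun μ => ?_
    simp only [sigWt_eq, LinearMap.comp_apply, sigma32_tmul, AlgHom.toLinearMap_apply, thirdE_tmul,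
      nE_symm, ht.sigma_eq hτ hχτ hs (Subtype.property _)]
    simp only [← mul_assoc, ← K_add, neg_add_cancel, K_zero, one_mul]
  have e4 : ThetaKm1K3 χ D psi = Th (canOf D) id fun _ => (thirdE χ).toLinearMap ∘ₗ
      TensorProduct.map b γ.toLinearMap := by
    refine formalSum_eq_Th D id _ fun μ => ?_
    simp only [hpsi, LinearMap.comp_apply, TensorProduct.map_tmul, AlgHom.toLinearMap_apply,
      tensor_hom_apply (v := fun a => K χ (-a)) (K_neg_apply χ) (K_neg_add χ) hγ
        (Subtype.property _), thirdE_tmul, nE_symm]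
  rw [e1, e2, e3, e4]
  exact h

end Transport

end SymPair

end

open SymPair TensorProduct

theorem proposition5p1 {k : Type*} [Field k] {n : ℕ} (χ : SymBichar k (Fin n))
    (τ : Equiv.Perm (Fin n)) (hτ : ∀ i, τ (τ i) = i)
    (hχτ : ∀ i j, χ.q (τ i) (τ j) = χ.q i j)
    (c : Fin n → k) (hc : ParamCondition χ τ c) :
    -- the direct sum decompositions of `U(χ)` behind the projections in the parameter condition
    DirectSum.IsInternal (UKG χ) ∧ DirectSum.IsInternal (UHU χ) ∧
    -- the skew Hopf pairing, which exists and is unique, and has dual bases in every degree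
    ∃ p : BorelForm χ, IsSkewHopfPairing χ p ∧ (∀ p', IsSkewHopfPairing χ p' → p' = p) ∧
      (∀ μ, Nonempty (DualBases χ p μ)) ∧
    -- the algebra homomorphism `σ̄ : U⁻ → U⁺ ⋊ H`
    ∃ s : Uminus χ →ₐ[k] U χ,
      (∀ i, s ⟨F χ i, Algebra.subset_adjoin (Set.mem_range_self i)⟩ =
        c (τ i) • (K χ (α i) * E χ (τ i))) ∧
    -- the projection `ψ` is well defined and restricts to a bijection on `B_c`
    ∃ (h : IsCompl (psiRange χ τ) (psiKer χ τ)) (hb : Function.Bijective (psiB χ τ hτ c h)),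
    -- for every choice of dual bases
    ∀ D : ∀ μ, DualBases χ p μ,
      idComulThetaK χ D (psiInv χ τ hτ c h hb) =
        ThetaK12 χ D (psiInv χ τ hτ c h hb) * ThetaSigmaK23 χ τ D s *
          ThetaK1K3 χ D (psiInv χ τ hτ c h hb) ∧
      comulIdThetaK χ D (psiInv χ τ hτ c h hb) =
        Theta23 χ D * ThetaKm1K3 χ D (psiInv χ τ hτ c h hb) * ThetaSigmaK32 χ τ D s ∧
      (∀ i, toCompletion χ (comul χ (Bgen χ τ c i)) * ThetaK χ D (psiInv χ τ hτ c h hb) =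
        ThetaK χ D (psiInv χ τ hτ c h hb) * toCompletion χ
          (Bgen χ τ c i ⊗ₜ[k] K χ (α i) +
            (c (τ i) * χ.q i (τ i)) • ((K χ (-α (τ i)) * K χ (α i)) ⊗ₜ[k]
              (E χ (τ i) * K χ (α i))) +
            1 ⊗ₜ[k] F χ i)) ∧
      (∀ a : Fin n → ℤ, (∀ i, a (τ i) = -a i) →
        toCompletion χ (comul χ (K χ a)) * ThetaK χ D (psiInv χ τ hτ c h hb) =
          ThetaK χ D (psiInv χ τ hτ c h hb) * toCompletion χ (comul χ (K χ a))) := by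
  obtain ⟨b, hb, hbu⟩ := exists_psiLift hτ hχτ hc
  obtain ⟨s, hs⟩ := exists_sigma (χ := χ) hτ hχτ c
  refine ⟨UKG_isInternal χ, UHU_isInternal χ, borelPairing χ, borelPairing_isSkewHopfPairing χ,
    fun p' hp' => IsSkewHopfPairing.unique hp' (borelPairing_isSkewHopfPairing χ),
    dualBases_nonempty χ, s.comp (nicEquivUminus χ).symm.toAlgHom, fun i => ?_,
    psi_isCompl χ hτ, psiB_bijective hτ hχτ hc _, fun D => ?_⟩
  · rw [← hs]
    refine congrArg s ?_
    exact (AlgEquiv.symm_apply_eq (nicEquivUminus χ)).2 (Subtype.ext (nF_x χ i).symm)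
  · have hpsi : ∀ μ y, psiInv χ τ hτ c (psi_isCompl χ hτ) (psiB_bijective hτ hχτ hc _) μ y =
        b ((UminusWtEquiv χ μ).symm y) := fun μ y => by
      refine hbu _ _ (psiInv_mem hτ _ _ μ y) ?_
      have h := vz_K_nF χ (τ := τ) (zero_mem (Qθ τ)) ((UminusWtEquiv χ μ).symm y : Nic χ)
      rw [K_zero, one_mul, nF_symm] at h
      rw [vz_psiInv, h]
    refine ⟨idComulThetaK_eq D hpsi hb hτ hχτ hs, comulIdThetaK_eq D hpsi hb hτ hχτ hs,
      fun i => ?_, fun a ha => ?_⟩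
    · rw [ThetaK_eq D hpsi]
      exact comul_B_mul_theta (isCan_canOf D) hb hτ hχτ i
    · rw [ThetaK_eq D hpsi]
      exact comul_K_mul_theta (isCan_canOf D) hb hχτ ha
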